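/- Let $k$ be a commutative ring. A graded $k$-quiver $\mathcal A$ has tensor powers $T^n\mathcal A(X,Y)=\bigoplus_{X_1,\dots,X_{n-1}}\mathcal A(X,X_1)\otimes\dots\otimes\mathcal A(X_{n-1},Y)$, $T\mathcal A=\bigoplus_{n\ge0}T^n\mathcal A$, $T^+\mathcal A=\bigoplus_{n\ge1}T^n\mathcal A$, with the cut comultiplication on $T\mathcal A$; $s\mathcal C=\mathcal C[1]$. An $A_\infty$-category $\mathcal C$ is a graded quiver with a coderivation $b:Ts\mathcal C\to Ts\mathcal C$ of degree $1$ with $b_0=0$, $b^2=0$; an $A_\infty$-functor $f$ is a degree $0$ cocategory homomorphism with $f_0=0$ commuting with $b$; an $A_\infty$-transformation $r:f\to g$ is an $(f,g)$-coderivation. Maps are composed from left to right, with Koszul signs. A transformation $r$ of degree $-1$ is natural if $rB_1:=[r,b]=0$, and $r\equiv p$ means $r-p=[v,b]$ for an $(f,g)$-coderivation $v$ of degree $-2$; $(r\otimes p)B_2$ denotes the coderivation with components $[(r\otimes p)B_2]_n=\sum_l(r\otimes p)\theta_{nl}b_l$, where for $r:f\to g$, $p:g\to h$ the map $(r\otimes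 p)\theta$ is $\sum f_{a_1}\otimes\dots\otimes f_{a_\alpha}\otimes r_j\otimes g_{c_1}\otimes\dots\otimes g_{c_\beta}\otimes p_t\otimes h_{e_1}\otimes\dots\otimes h_{e_\gamma}$. A unit transformation of $\mathcal C$ is a natural transformation $\mathbf i^{\mathcal C}:\mathrm{id}_{\mathcal C}\to\mathrm{id}_{\mathcal C}$ with $(\mathbf i^{\mathcal C}\otimes\mathbf i^{\mathcal C})B_2\equiv\mathbf i^{\mathcal C}$ such that, for all objects $X,Y$, the maps $({}_X\mathbf i^{\mathcal C}_0\otimes1)b_2$ and $(1\otimes{}_Y\mathbf i^{\mathcal C}_0)b_2$ of $(s\mathcal C(X,Y),b_1)$ to itself are homotopy invertible. $\mathcal C$ is unital if it has a unit transformation; an $A_\infty$-functor $i:\mathcal C\to\mathcal I$ between unital $A_\infty$-categories is unital if $i\,\mathbf i^{\mathcal I}\equiv\mathbf i^{\mathcal C}\,i$. For an $A_\infty$-category $\mathcal C$, let $\underline{\mathcal C}=(s^{-1}T^+s\mathcal C,\underline b)$, where $\underline b_1=b|_{T^+s\mathcal C}$ and $\underline b_n=0$ for $n\ne1$. For a functor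 $i:\mathcal C\to\mathcal I$ let $\underline i:\underline{\mathcal C}\to\underline{\mathcal I}$ be the strict functor with $\underline i_1=i|_{T^+s\mathcal C}$, and for a transformation $r:f\to g$ let $\underline r:\underline f\to\underline g$ have components $\underline r_0=r_0$, $\underline r_1=r|_{T^+s\mathcal C}$, $\underline r_n=0$ for $n>1$. Let $\mathbf m$ be the cocategory automorphism of $T(T^+s\mathcal C)$ whose components are the iterated multiplications $\mu^{(n)}$ of the tensor algebra, $n\ge1$, and put $\overline{\mathcal C}=(s^{-1}T^+s\mathcal C,\overline b)$, $\overline b=\mathbf m\underline b\mathbf m^{-1}$, $\overline i=\mathbf m\underline i\mathbf m^{-1}$, $\overline r=\mathbf m\underline r\mathbf m^{-1}$. For a full subcategory $\mathcal B\subseteq\mathcal C$ let $s\mathsf D(\mathcal C|\mathcal B)\subseteq T^+s\mathcal C$ be the subquiver $\bigoplus_{n\ge1}\bigoplus_{C_1,\dots,C_{n-1}\in\mathcal B}s\mathcal C(X,C_1)\otimes\dots\otimes s\mathcal C(C_{n-1},Y)$; $\mathsf D(\mathcal C|\mathcal B)$, $\mathsf D(i)$, $\mathsf D(r)$ carry the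 restrictions of $\overline b$, $\overline i$, $\overline r$. Theorem. Let $\mathcal C$ be a unital $A_\infty$-category. (1) For every full subcategory $\mathcal B$ of $\mathcal C$, $\overline b$ restricts to $\mathsf D(\mathcal C|\mathcal B)$, and $\mathsf D(\mathcal C|\mathcal B)$ is a unital $A_\infty$-category. If $\mathbf i^{\mathcal C}$ is a unit transformation of $\mathcal C$, then $\overline{\mathbf i^{\mathcal C}}$ restricts to $\mathsf D(\mathcal C|\mathcal B)$, and the restriction $\mathsf D(\mathbf i^{\mathcal C})$ is a unit transformation of $\mathsf D(\mathcal C|\mathcal B)$. (2) $\overline{\mathcal C}$ is a unital $A_\infty$-category, and $\overline{\mathbf i^{\mathcal C}}$ is a unit transformation of it for every unit transformation $\mathbf i^{\mathcal C}$ of $\mathcal C$. (3) $\underline{\mathcal C}$ is a unital $A_\infty$-category, and $\underline{\mathbf i^{\mathcal C}}$ is a unit transformation of it for every unit transformation $\mathbf i^{\mathcal C}$ of $\mathcal C$. (4) Let $i:\mathcal C\to\mathcal I$ be a unital $A_\infty$-functor (with $\mathcal I$ unital). Then $\overline i:\overline{\mathcal C}\to\overline{\mathcal I}$ and $\underline i:\underline{\mathcal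 C}\to\underline{\mathcal I}$ are unital $A_\infty$-functors. If $\mathcal B\subseteq\mathcal C$ and $\mathcal J\subseteq\mathcal I$ are full subcategories such that $i$ maps objects of $\mathcal B$ to objects of $\mathcal J$, then $\overline i$ restricts to $\mathsf D(i):\mathsf D(\mathcal C|\mathcal B)\to\mathsf D(\mathcal I|\mathcal J)$, which is a unital $A_\infty$-functor. -/

import Mathlib

universe u

noncomputable section

open scoped TensorProduct DirectSum Classical

namespace AInf

/-! ### Graded quivers and the tensor cocategory `TA`

Composition of maps is written in the usual (left operator) order of Lean. The sign rule is the
Koszul rule for right operators: `(x ⊗ y)(f ⊗ g) = (-1)^(deg y * deg f) (x)f ⊗ (y)g`. -/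

/-- A graded `k`-linear quiver with set of objects `S`: a `ℤ`-graded `k`-module for each pair of
objects, given by its homogeneous pieces. -/
abbrev GradedQuiver (k : Type u) [CommRing k] (S : Type u) : Type (u + 1) :=
  S → S → ℤ → ModuleCat.{u} k

/-- A sequence of objects `X = X₀, X₁, …, Xₙ = Y` (`n ≥ 0`) together with integers `d₁, …, dₙ`.
It indexes the summand `A(X₀,X₁)^{d₁} ⊗ ⋯ ⊗ A(Xₙ₋₁,Xₙ)^{dₙ}` of `TA(X,Y)`. -/
inductive Word (S : Type u) : S → S → Type u
  | nil (X : S) : Word S X X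
  | cons {Z Y : S} (X : S) (d : ℤ) (w : Word S Z Y) : Word S X Y

namespace Word

/-- The number `n` of tensor factors. -/
def length {S : Type u} : {X Y : S} → Word S X Y → ℕ
  | _, _, nil _ => 0
  | _, _, cons _ _ w => w.length + 1

/-- The total degree `d₁ + ⋯ + dₙ`. -/
def degree {S : Type u} : {X Y : S} → Word S X Y → ℤ
  | _, _, nil _ => 0
  | _, _, cons _ d w => d + w.degree

/-- The list `X₁, …, Xₙ₋₁` of intermediate objects. -/
def inner {S : Type u} : {X Y : S} → Word S X Y → List S
  | _, _, nil _ => []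
  | _, _, cons _ _ (nil _) => []
  | _, _, cons _ _ (cons Z d w) => Z :: (cons Z d w).inner

end Word

variable {k : Type u} [CommRing k] {S S' : Type u}

/-- The tensor product `A(X₀,X₁)^{d₁} ⊗ ⋯ ⊗ A(Xₙ₋₁,Xₙ)^{dₙ}` (with a final factor `k`, which is
the whole product for `n = 0`). -/
def Tens (A : GradedQuiver k S) : {X Y : S} → Word S X Y → ModuleCat.{u} k
  | _, _, .nil _ => ModuleCat.of k k
  | _, _, .cons (Z := Z) X d w => ModuleCat.of k (A X Z d ⊗[k] Tens A w)

/-- `Tens A (nil X)` is `k`. -/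
def tnil (A : GradedQuiver k S) (X : S) : k ≃ₗ[k] Tens A (.nil X) :=
  LinearEquiv.refl k k

/-- `Tens A (cons X d w)` is `A(X,Z)^d ⊗ Tens A w`. -/
def tcons (A : GradedQuiver k S) {Z Y : S} (X : S) (d : ℤ) (w : Word S Z Y) :
    A X Z d ⊗[k] Tens A w ≃ₗ[k] Tens A (.cons X d w) :=
  LinearEquiv.refl k (A X Z d ⊗[k] Tens A w)

/-- One tensor factor: `A(X,Y)^d = A(X,Y)^d ⊗ k`. -/
def tsingle (A : GradedQuiver k S) (X Y : S) (d : ℤ) :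
    A X Y d ≃ₗ[k] Tens A (.cons X d (.nil Y)) :=
  (TensorProduct.rid k (A X Y d)).symm ≪≫ₗ
    TensorProduct.congr (LinearEquiv.refl k (A X Y d)) (tnil A Y) ≪≫ₗ tcons A X d (.nil Y)

/-- `TA(X,Y) = ⨁ₙ TⁿA(X,Y)`, where `TⁿA(X,Y)` is the sum over all `X₁, …, Xₙ₋₁` of
`A(X,X₁) ⊗ A(X₁,X₂) ⊗ ⋯ ⊗ A(Xₙ₋₁,Y)`. -/
abbrev T (A : GradedQuiver k S) (X Y : S) : Type u := ⨁ w : Word S X Y, Tens A w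

/-- The embedding of a summand into `TA`. -/
abbrev inT (A : GradedQuiver k S) {X Y : S} (w : Word S X Y) : Tens A w →ₗ[k] T A X Y :=
  DirectSum.lof k (Word S X Y) (fun w => Tens A w) w

/-- The whole graded module `A(X,Y) = ⨁_d A(X,Y)^d`. -/
abbrev Tot (A : GradedQuiver k S) (X Y : S) : Type u := ⨁ d : ℤ, A X Y d

/-- The embedding of a homogeneous piece `A(X,Y)^d → A(X,Y)`. -/
abbrev inTot (A : GradedQuiver k S) (X Y : S) (d : ℤ) : A X Y d →ₗ[k] Tot A X Y :=
  DirectSum.lof k ℤ (fun e => (A X Y e : Type u)) d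

/-- Families of `k`-linear maps `TA(X,Y) → TB(Xf,Yg)`. -/
abbrev TMap (A : GradedQuiver k S) (B : GradedQuiver k S') (f g : S → S') : Type u :=
  ∀ X Y : S, T A X Y →ₗ[k] T B (f X) (g Y)

/-- Families of `k`-linear maps `TA(X,Y) → B(Xf,Yg)`. -/
abbrev Comps (A : GradedQuiver k S) (B : GradedQuiver k S') (f g : S → S') : Type u :=
  ∀ X Y : S, T A X Y →ₗ[k] Tot B (f X) (g Y)

/-- The unit `1_X ∈ k = T⁰A(X,X)`. -/
def one (A : GradedQuiver k S) (X : S) : T A X X := inT A (.nil X) (tnil A X 1)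

/-- The identity of `TA`. -/
def idT (A : GradedQuiver k S) : TMap A A (fun X => X) (fun X => X) :=
  fun _ _ => LinearMap.id

/-- The embedding `A = T¹A → TA`. -/
def in1 (A : GradedQuiver k S) (X Y : S) : Tot A X Y →ₗ[k] T A X Y :=
  DirectSum.toModule k ℤ (T A X Y) fun d =>
    inT A (.cons X d (.nil Y)) ∘ₗ (tsingle A X Y d).toLinearMap

/-- The projection `TA → T¹A = A` on one summand. -/
def pr1Tens (A : GradedQuiver k S) : {X Y : S} → (w : Word S X Y) → Tens A w →ₗ[k] Tot A X Y
  | _, _, .nil _ => 0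
  | _, _, .cons X d (.nil Y) => inTot A X Y d ∘ₗ (tsingle A X Y d).symm.toLinearMap
  | _, _, .cons _ _ (.cons _ _ _) => 0

/-- The projection `pr₁ : TA → T¹A = A`. -/
def pr1 (A : GradedQuiver k S) (X Y : S) : T A X Y →ₗ[k] Tot A X Y :=
  DirectSum.toModule k (Word S X Y) (Tot A X Y) fun w => pr1Tens A w

/-- The counit `ε = pr₀` on one summand. -/
def counitTens (A : GradedQuiver k S) : {X Y : S} → (w : Word S X Y) → Tens A w →ₗ[k] k
  | _, _, .nil X => (tnil A X).symm.toLinearMap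
  | _, _, .cons _ _ _ => 0

/-- The counit `ε = pr₀ : TA(X,Y) → T⁰A(X,Y) ⊆ k`. -/
def counit (A : GradedQuiver k S) (X Y : S) : T A X Y →ₗ[k] k :=
  DirectSum.toModule k (Word S X Y) k fun w => counitTens A w

/-- Left multiplication `A(X,Z)^d ⊗ TA(Z,Y) → TA(X,Y)`. -/
def consT (A : GradedQuiver k S) (X Z Y : S) (d : ℤ) : A X Z d ⊗[k] T A Z Y →ₗ[k] T A X Y :=
  (DirectSum.toModule k (Word S Z Y) (T A X Y) fun w =>
      inT A (.cons X d w) ∘ₗ (tcons A X d w).toLinearMap) ∘ₗ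
    (TensorProduct.directSumRight k k (A X Z d) (fun w : Word S Z Y => Tens A w)).toLinearMap

/-- Concatenation of tensors, with the first factor in one summand:
`(h₁ ⊗ x) · y = h₁ ⊗ (x · y)`. -/
def mulTens (A : GradedQuiver k S) (Z : S) :
    {X Y : S} → (w : Word S X Y) → Tens A w →ₗ[k] T A Y Z →ₗ[k] T A X Z
  | _, _, .nil X => LinearMap.lsmul k (T A X Z) ∘ₗ (tnil A X).symm.toLinearMap
  | _, _, .cons (Z := V) (Y := Y) X d w =>
      TensorProduct.curry
          (consT A X V Z d ∘ₗ
            LinearMap.lTensor (A X V d) (TensorProduct.lift (mulTens A Z w)) ∘ₗ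
              (TensorProduct.assoc k (A X V d) (Tens A w) (T A Y Z)).toLinearMap) ∘ₗ
        (tcons A X d w).symm.toLinearMap

/-- The multiplication `μ : TA(X,Y) ⊗ TA(Y,Z) → TA(X,Z)` of the tensor algebra. -/
def mul (A : GradedQuiver k S) (X Y Z : S) : T A X Y ⊗[k] T A Y Z →ₗ[k] T A X Z :=
  TensorProduct.lift <|
    DirectSum.toModule k (Word S X Y) (T A Y Z →ₗ[k] T A X Z) fun w => mulTens A Z w

/-- `(TA ⊗ TA)(X,Y) = ⨁_Z TA(X,Z) ⊗ TA(Z,Y)`. -/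
abbrev TT (A : GradedQuiver k S) (X Y : S) : Type u := ⨁ Z : S, T A X Z ⊗[k] T A Z Y

/-- The embedding `TA(X,Z) ⊗ TA(Z,Y) → (TA ⊗ TA)(X,Y)`. -/
abbrev inTT (A : GradedQuiver k S) (X Z Y : S) : T A X Z ⊗[k] T A Z Y →ₗ[k] TT A X Y :=
  DirectSum.lof k S (fun Z => T A X Z ⊗[k] T A Z Y) Z

/-- Left multiplication `A(X,V)^d ⊗ (TA ⊗ TA)(V,Y) → (TA ⊗ TA)(X,Y)`. -/
def consTT (A : GradedQuiver k S) (X V Y : S) (d : ℤ) : A X V d ⊗[k] TT A V Y →ₗ[k] TT A X Y :=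
  (DirectSum.toModule k S (TT A X Y) fun Z =>
      inTT A X Z Y ∘ₗ LinearMap.rTensor (T A Z Y) (consT A X V Z d) ∘ₗ
        (TensorProduct.assoc k (A X V d) (T A V Z) (T A Z Y)).symm.toLinearMap) ∘ₗ
    (TensorProduct.directSumRight k k (A X V d)
      (fun Z : S => T A V Z ⊗[k] T A Z Y)).toLinearMap

/-- The cut comultiplication on one summand, by recursion:
`(h₁ ⊗ x)Δ = 1 ⊗ (h₁ ⊗ x) + h₁ · (x)Δ`. -/
def cutTens (A : GradedQuiver k S) : {X Y : S} → (w : Word S X Y) → Tens A w →ₗ[k] TT A X Y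
  | _, _, .nil X =>
      LinearMap.toSpanSingleton k (TT A X X) (inTT A X X X (one A X ⊗ₜ[k] one A X)) ∘ₗ
        (tnil A X).symm.toLinearMap
  | _, _, .cons (Z := V) (Y := Y) X d w =>
      inTT A X X Y ∘ₗ TensorProduct.mk k (T A X X) (T A X Y) (one A X) ∘ₗ inT A (.cons X d w) +
        consTT A X V Y d ∘ₗ LinearMap.lTensor (A X V d) (cutTens A w) ∘ₗ
          (tcons A X d w).symm.toLinearMap

/-- The cut comultiplication `Δ : TA → TA ⊗ TA`,
`(h₁ ⊗ ⋯ ⊗ hₙ)Δ = ∑_{j=0}^{n} h₁ ⊗ ⋯ ⊗ h_j ⨂ h_{j+1} ⊗ ⋯ ⊗ hₙ`. -/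
def cut (A : GradedQuiver k S) (X Y : S) : T A X Y →ₗ[k] TT A X Y :=
  DirectSum.toModule k (Word S X Y) (TT A X Y) fun w => cutTens A w

/-- The operator `x ↦ (-1)^(p * deg x) x` on `TA`. -/
def sgn (A : GradedQuiver k S) (p : ℤ) (X Y : S) : T A X Y →ₗ[k] T A X Y :=
  DirectSum.lmap fun w : Word S X Y =>
    ((p * w.degree).negOnePow : ℤ) • (LinearMap.id : Tens A w →ₗ[k] Tens A w)

/-- The operator `x ↦ (-1)^(p * deg x) x` on `A`. -/
def sgnTot (A : GradedQuiver k S) (p : ℤ) (X Y : S) : Tot A X Y →ₗ[k] Tot A X Y :=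
  DirectSum.lmap fun d : ℤ =>
    ((p * d).negOnePow : ℤ) • (LinearMap.id : A X Y d →ₗ[k] A X Y d)

/-- The map `φ ⊗ ψ : TA ⊗ TA → TB ⊗ TB`, where `φ` has degree `p`, with the Koszul sign. -/
def tensMap {A : GradedQuiver k S} {B : GradedQuiver k S'} {f g h : S → S'} (p : ℤ)
    (φ : TMap A B f g) (ψ : TMap A B g h) (X Y : S) : TT A X Y →ₗ[k] TT B (f X) (h Y) :=
  DirectSum.toModule k S (TT B (f X) (h Y)) fun Z =>
    inTT B (f X) (g Z) (h Y) ∘ₗ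
      TensorProduct.map (φ X Z) (ψ Z Y ∘ₗ sgn A p Z Y)

/-- The convolution `Δ (φ ⊗ ψ) μ : TA → TB`, where `φ` has degree `p`. -/
def conv {A : GradedQuiver k S} {B : GradedQuiver k S'} {f g h : S → S'} (p : ℤ)
    (φ : TMap A B f g) (ψ : TMap A B g h) : TMap A B f h := fun X Y =>
  (DirectSum.toModule k S' (T B (f X) (h Y)) fun V => mul B (f X) V (h Y)) ∘ₗ
    tensMap p φ ψ X Y ∘ₗ cut A X Y

/-- Components, viewed as maps into `T¹B ⊆ TB`. -/
def inc {A : GradedQuiver k S} {B : GradedQuiver k S'} {f g : S → S'} (φ : Comps A B f g) :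
    TMap A B f g := fun X Y => in1 B (f X) (g Y) ∘ₗ φ X Y

/-- The components `r pr₁` of a map `r : TA → TB`. -/
def comps {A : GradedQuiver k S} {B : GradedQuiver k S'} {f g : S → S'} (R : TMap A B f g) :
    Comps A B f g := fun X Y => pr1 B (f X) (g Y) ∘ₗ R X Y

/-- `R : TA → TB` is homogeneous of degree `p`. -/
def IsHomogeneous {A : GradedQuiver k S} {B : GradedQuiver k S'} {f g : S → S'} (p : ℤ)
    (R : TMap A B f g) : Prop :=
  ∀ (X Y : S) (w : Word S X Y) (x : Tens A w) (w' : Word S' (f X) (g Y)),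
    w'.degree ≠ w.degree + p →
      R X Y (inT A w x) w' = 0

/-! ### Cocategory homomorphisms and coderivations -/

/-- `F : TA → TB` is a homomorphism of graded cocategories with `f₀ = 0`. -/
structure IsCocatHom {A : GradedQuiver k S} {B : GradedQuiver k S'} {f : S → S'}
    (F : TMap A B f f) : Prop where
  homogeneous : IsHomogeneous 0 F
  comul : ∀ X Y, cut B (f X) (f Y) ∘ₗ F X Y = tensMap 0 F F X Y ∘ₗ cut A X Y
  counit : ∀ X Y, counit B (f X) (f Y) ∘ₗ F X Y = counit A X Y
  map_one : ∀ X, F X X (one A X) = one B (f X)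

/-- `R : TA → TB` is an `(F,G)`-coderivation of degree `p`: `R Δ = Δ (F ⊗ R + R ⊗ G)`. -/
structure IsCoderivation {A : GradedQuiver k S} {B : GradedQuiver k S'} {f g : S → S'} (p : ℤ)
    (F : TMap A B f f) (G : TMap A B g g) (R : TMap A B f g) : Prop where
  homogeneous : IsHomogeneous p R
  comul : ∀ X Y, cut B (f X) (g Y) ∘ₗ R X Y =
    (tensMap 0 F R X Y + tensMap p R G X Y) ∘ₗ cut A X Y

/-- The `(F,G)`-coderivation of degree `p` with components `φ`:
`∑ f_{a₁} ⊗ ⋯ ⊗ f_{a_α} ⊗ φ_j ⊗ g_{c₁} ⊗ ⋯ ⊗ g_{c_β}`. -/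
def coderivation {A : GradedQuiver k S} {B : GradedQuiver k S'} {f g : S → S'} (p : ℤ)
    (F : TMap A B f f) (φ : Comps A B f g) (G : TMap A B g g) : TMap A B f g :=
  conv 0 F (conv p (inc φ) G)

/-- The map `TA → TB` with `1_X ↦ 1_{Xf}`, vanishing on `T⁺A`: one summand. -/
def etaEpsTens (A : GradedQuiver k S) (B : GradedQuiver k S') (f : S → S') :
    {X Y : S} → (w : Word S X Y) → Tens A w →ₗ[k] T B (f X) (f Y)
  | _, _, .nil X => LinearMap.toSpanSingleton k (T B (f X) (f X)) (one B (f X)) ∘ₗ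
      (tnil A X).symm.toLinearMap
  | _, _, .cons _ _ _ => 0

/-- The map `TA → TB` with `1_X ↦ 1_{Xf}`, vanishing on `T⁺A`. -/
def etaEps (A : GradedQuiver k S) (B : GradedQuiver k S') (f : S → S') : TMap A B f f :=
  fun X Y => DirectSum.toModule k (Word S X Y) (T B (f X) (f Y)) fun w => etaEpsTens A B f w

/-- The map `∑ φ_{i₁} ⊗ ⋯ ⊗ φ_{iₙ} : TA → TⁿB`. -/
def convPow {A : GradedQuiver k S} {B : GradedQuiver k S'} {f : S → S'} (φ : Comps A B f f) :
    ℕ → TMap A B f f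
  | 0 => etaEps A B f
  | n + 1 => conv 0 (inc φ) (convPow φ n)

/-- The cocategory homomorphism with components `φ` (of degree `0`, with `φ₀ = 0`):
`∑_{n} ∑ φ_{i₁} ⊗ ⋯ ⊗ φ_{iₙ}`. On `TˡA` only the terms with `n ≤ l` do not vanish. -/
def cocatHom {A : GradedQuiver k S} {B : GradedQuiver k S'} {f : S → S'} (φ : Comps A B f f) :
    TMap A B f f := fun X Y =>
  DirectSum.toModule k (Word S X Y) (T B (f X) (f Y)) fun w =>
    (∑ n ∈ Finset.range (w.length + 1), convPow φ n X Y) ∘ₗ inT A w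

/-! ### `A∞`-categories, functors and transformations

An `A∞`-category `𝒞` is described by the suspended quiver `s𝒞 = 𝒞[1]` and the codifferential
`b : Ts𝒞 → Ts𝒞`. So every graded quiver `A` below is the suspension of the quiver of an
`A∞`-category. -/

/-- `(A, b)` is an `A∞`-category: `b` is a `(1,1)`-coderivation of degree `1` with `b₀ = 0` and
`b² = 0`. -/
structure IsAInfCategory (A : GradedQuiver k S) (b : TMap A A (fun X => X) (fun X => X)) :
    Prop where
  coderivation : IsCoderivation 1 (idT A) (idT A) b
  map_one : ∀ X, b X X (one A X) = 0
  sq_zero : ∀ X Y, b X Y ∘ₗ b X Y = 0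

/-- `F` is an `A∞`-functor `(A, b) → (A', b')`. -/
structure IsAInfFunctor {A : GradedQuiver k S} {A' : GradedQuiver k S'}
    (b : TMap A A (fun X => X) (fun X => X)) (b' : TMap A' A' (fun X => X) (fun X => X))
    {f : S → S'} (F : TMap A A' f f) : Prop where
  cocatHom : IsCocatHom F
  comm : ∀ X Y, b' (f X) (f Y) ∘ₗ F X Y = F X Y ∘ₗ b X Y

/-- The differential `r ↦ r B₁ = [r, b] = r b - (-1)^p b r` on coderivations of degree `p`. -/
def B1 {A : GradedQuiver k S} {A' : GradedQuiver k S'} {f g : S → S'}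
    (b : TMap A A (fun X => X) (fun X => X)) (b' : TMap A' A' (fun X => X) (fun X => X))
    (p : ℤ) (R : TMap A A' f g) : TMap A A' f g := fun X Y =>
  b' (f X) (g Y) ∘ₗ R X Y - (p.negOnePow : ℤ) • (R X Y ∘ₗ b X Y)

/-- The map `(r ⊗ p)θ = ∑ f_{a₁} ⊗ ⋯ ⊗ f_{a_α} ⊗ r_j ⊗ g_{c₁} ⊗ ⋯ ⊗ g_{c_β} ⊗ p_t ⊗ h_{e₁} ⊗ ⋯
⊗ h_{e_γ}` for coderivations `r : f → g`, `p : g → h` of degrees `m` and `n`. -/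
def theta {A : GradedQuiver k S} {A' : GradedQuiver k S'} {f g h : S → S'} (m n : ℤ)
    (F : TMap A A' f f) (R : TMap A A' f g) (G : TMap A A' g g) (P : TMap A A' g h)
    (H : TMap A A' h h) : TMap A A' f h :=
  conv 0 F (conv m (inc (comps R)) (conv 0 G (conv n (inc (comps P)) H)))

/-- The composition `(r ⊗ p)B₂`: the `(f,h)`-coderivation of degree `m + n + 1` whose components
are `∑_l (r ⊗ p)θ_{jl} b_l`. -/
def B2 {A : GradedQuiver k S} {A' : GradedQuiver k S'} {f g h : S → S'}
    (b' : TMap A' A' (fun X => X) (fun X => X)) (m n : ℤ)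
    (F : TMap A A' f f) (R : TMap A A' f g) (G : TMap A A' g g) (P : TMap A A' g h)
    (H : TMap A A' h h) : TMap A A' f h :=
  coderivation (m + n + 1) F
    (fun X Y => pr1 A' (f X) (h Y) ∘ₗ b' (f X) (h Y) ∘ₗ theta m n F R G P H X Y) H

/-- `R : F → G` is a natural `A∞`-transformation: an `(F,G)`-coderivation of degree `-1` with
`r B₁ = 0`. -/
structure IsNatural {A : GradedQuiver k S} {A' : GradedQuiver k S'} {f g : S → S'}
    (b : TMap A A (fun X => X) (fun X => X)) (b' : TMap A' A' (fun X => X) (fun X => X))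
    (F : TMap A A' f f) (G : TMap A A' g g) (R : TMap A A' f g) : Prop where
  coderivation : IsCoderivation (-1) F G R
  closed : B1 b b' (-1) R = 0

/-- Equivalence `R ≡ P` of natural `A∞`-transformations `F → G`: there is an
`(F,G)`-coderivation `v` of degree `-2` with `R - P = v B₁`. -/
def Equivalent {A : GradedQuiver k S} {A' : GradedQuiver k S'} {f g : S → S'}
    (b : TMap A A (fun X => X) (fun X => X)) (b' : TMap A' A' (fun X => X) (fun X => X))
    (F : TMap A A' f f) (G : TMap A A' g g) (R P : TMap A A' f g) : Prop :=
  ∃ V : TMap A A' f g, IsCoderivation (-2) F G V ∧ R - P = B1 b b' (-2) V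

/-! ### Unitality -/

/-- A linear endomorphism of `A(X,Y)` homogeneous of degree `p`. -/
def IsHomogeneousTot {A : GradedQuiver k S} {X Y : S} (p : ℤ)
    (φ : Tot A X Y →ₗ[k] Tot A X Y) : Prop :=
  ∀ (d : ℤ) (x : A X Y d) (e : ℤ), e ≠ d + p →
    φ (inTot A X Y d x) e = 0

/-- The differential `b₁` of `A(X,Y)`. -/
def diff {A : GradedQuiver k S} (b : TMap A A (fun X => X) (fun X => X)) (X Y : S) :
    Tot A X Y →ₗ[k] Tot A X Y :=
  pr1 A X Y ∘ₗ b X Y ∘ₗ in1 A X Y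

/-- `φ` is homotopy invertible with respect to the differential `δ` (of degree `1`). -/
def IsHomotopyInvertible {A : GradedQuiver k S} {X Y : S} (δ φ : Tot A X Y →ₗ[k] Tot A X Y) :
    Prop :=
  IsHomogeneousTot 0 φ ∧ φ ∘ₗ δ = δ ∘ₗ φ ∧
    ∃ ψ h h' : Tot A X Y →ₗ[k] Tot A X Y,
      IsHomogeneousTot 0 ψ ∧ ψ ∘ₗ δ = δ ∘ₗ ψ ∧
      IsHomogeneousTot (-1) h ∧ IsHomogeneousTot (-1) h' ∧
      ψ ∘ₗ φ = LinearMap.id + h ∘ₗ δ + δ ∘ₗ h ∧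
      φ ∘ₗ ψ = LinearMap.id + h' ∘ₗ δ + δ ∘ₗ h'

/-- The map `(_X i₀ ⊗ 1)b₂ : A(X,Y) → A(X,Y)` for a coderivation `i` of degree `-1`. -/
def leftUnit {A : GradedQuiver k S} (b i : TMap A A (fun X => X) (fun X => X)) (X Y : S) :
    Tot A X Y →ₗ[k] Tot A X Y :=
  pr1 A X Y ∘ₗ b X Y ∘ₗ mul A X X Y ∘ₗ
    TensorProduct.mk k (T A X X) (T A X Y) (in1 A X X (pr1 A X X (i X X (one A X)))) ∘ₗ
      in1 A X Y ∘ₗ sgnTot A (-1) X Y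

/-- The map `(1 ⊗ _Y i₀)b₂ : A(X,Y) → A(X,Y)`. -/
def rightUnit {A : GradedQuiver k S} (b i : TMap A A (fun X => X) (fun X => X)) (X Y : S) :
    Tot A X Y →ₗ[k] Tot A X Y :=
  pr1 A X Y ∘ₗ b X Y ∘ₗ mul A X Y Y ∘ₗ
    (TensorProduct.mk k (T A X Y) (T A Y Y)).flip
        (in1 A Y Y (pr1 A Y Y (i Y Y (one A Y)))) ∘ₗ
      in1 A X Y

/-- `i` is a unit transformation of the `A∞`-category `(A, b)`: a natural `A∞`-transformation
`id → id` with `(i ⊗ i)B₂ ≡ i`, such that all maps `(_X i₀ ⊗ 1)b₂` and `(1 ⊗ _Y i₀)b₂` are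
homotopy invertible. -/
structure IsUnitTransformation {A : GradedQuiver k S}
    (b i : TMap A A (fun X => X) (fun X => X)) : Prop where
  natural : IsNatural b b (idT A) (idT A) i
  idempotent : Equivalent b b (idT A) (idT A)
    (B2 b (-1) (-1) (idT A) i (idT A) i (idT A)) i
  left : ∀ X Y, IsHomotopyInvertible (diff b X Y) (leftUnit b i X Y)
  right : ∀ X Y, IsHomotopyInvertible (diff b X Y) (rightUnit b i X Y)

/-- `(A, b)` is a unital `A∞`-category. -/
def IsUnital (A : GradedQuiver k S) (b : TMap A A (fun X => X) (fun X => X)) : Prop :=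
  IsAInfCategory A b ∧ ∃ i, IsUnitTransformation b i

/-- `F` is a unital `A∞`-functor between unital `A∞`-categories: `i F ≡ F i'` for unit
transformations `i`, `i'` of the source and of the target. -/
def IsUnitalFunctor {A : GradedQuiver k S} {A' : GradedQuiver k S'}
    (b : TMap A A (fun X => X) (fun X => X)) (b' : TMap A' A' (fun X => X) (fun X => X))
    {f : S → S'} (F : TMap A A' f f) : Prop :=
  IsAInfCategory A b ∧ IsAInfCategory A' b' ∧ IsAInfFunctor b b' F ∧
    ∃ (i : TMap A A (fun X => X) (fun X => X)) (i' : TMap A' A' (fun X => X) (fun X => X)),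
      IsUnitTransformation b i ∧ IsUnitTransformation b' i' ∧
        Equivalent b b' F F (fun X Y => F X Y ∘ₗ i X Y) (fun X Y => i' (f X) (f Y) ∘ₗ F X Y)

/-! ### The quivers `T⁺A` and `sD(C|B)` -/

/-- The set of all sequences `X, C₁, …, Cₙ₋₁, Y` with `n ≥ 1`, intermediate objects in `B`, and
degrees of sum `d`. -/
abbrev PlusWord (B : Set S) (X Y : S) (d : ℤ) : Type u :=
  {w : Word S X Y // 0 < w.length ∧ (∀ Z ∈ w.inner, Z ∈ B) ∧ w.degree = d}

/-- The graded quiver with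
`⨁_{n ≥ 1} ⨁_{C₁,…,Cₙ₋₁ ∈ B} A(X,C₁) ⊗ A(C₁,C₂) ⊗ ⋯ ⊗ A(Cₙ₋₁,Y)` as module of morphisms from `X`
to `Y`. For `A = s𝒞` it is `sD(𝒞|ℬ)`, where `ℬ ⊆ 𝒞` is the full subcategory with the set of
objects `B`. -/
def plusOver (A : GradedQuiver k S) (B : Set S) : GradedQuiver k S := fun X Y d =>
  ModuleCat.of k (⨁ w : PlusWord B X Y d, Tens A w.1)

/-- The embedding of a summand into `sD(C|B)`. -/
def inPlus (A : GradedQuiver k S) (B : Set S) {X Y : S} {d : ℤ} (w : PlusWord B X Y d) :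
    Tens A w.1 →ₗ[k] plusOver A B X Y d :=
  DirectSum.lof k (PlusWord B X Y d) (fun w => Tens A w.1) w

/-- The linear map from `sD(C|B)` with given restrictions to the summands. -/
def plusLift (A : GradedQuiver k S) (B : Set S) {X Y : S} {d : ℤ} {M : Type u}
    [AddCommGroup M] [Module k M] (φ : ∀ w : PlusWord B X Y d, Tens A w.1 →ₗ[k] M) :
    plusOver A B X Y d →ₗ[k] M :=
  DirectSum.toModule k (PlusWord B X Y d) M φ

/-- The graded quiver `T⁺A`. -/
abbrev plus (A : GradedQuiver k S) : GradedQuiver k S := plusOver A Set.univ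

/-- The embedding `T⁺A → TA`. -/
def plusIncl (A : GradedQuiver k S) (X Y : S) (d : ℤ) : plus A X Y d →ₗ[k] T A X Y :=
  plusLift A Set.univ fun w => inT A w.1

/-- The projection `TA → T⁺A`. -/
def plusProj (A : GradedQuiver k S) (X Y : S) : T A X Y →ₗ[k] Tot (plus A) X Y :=
  DirectSum.toModule k (Word S X Y) (Tot (plus A) X Y) fun w =>
    if hw : 0 < w.length then
      inTot (plus A) X Y w.degree ∘ₗ
        inPlus A Set.univ ⟨w, hw, fun _ _ => Set.mem_univ _, rfl⟩
    else 0

/-! ### The construction `𝒞 ↦ underline 𝒞` -/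

/-- The map `T(T⁺A) → TA`, equal to the identity on `T⁰` and on `T¹(T⁺A) = T⁺A` and to zero on
the other summands: one summand. -/
def lowTens (A : GradedQuiver k S) :
    {X Y : S} → (W : Word S X Y) → Tens (plus A) W →ₗ[k] T A X Y
  | _, _, .nil X => LinearMap.toSpanSingleton k (T A X X) (one A X) ∘ₗ
      (tnil (plus A) X).symm.toLinearMap
  | _, _, .cons X d (.nil Y) => plusIncl A X Y d ∘ₗ (tsingle (plus A) X Y d).symm.toLinearMap
  | _, _, .cons _ _ (.cons _ _ _) => 0

/-- The map `T(T⁺A) → TA`, equal to the identity on `T⁰` and on `T¹(T⁺A) = T⁺A` and to zero on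
the other summands. -/
def low (A : GradedQuiver k S) (X Y : S) : T (plus A) X Y →ₗ[k] T A X Y :=
  DirectSum.toModule k (Word S X Y) (T A X Y) fun W => lowTens A W

/-- For `Φ : TA → TB`: the components `Φ₀`, `Φ₁ = Φ|_{T⁺A}`, `Φₙ = 0` for `n > 1` of a map on
`T(T⁺A)` with values in `T⁺B`. -/
def underComps {A : GradedQuiver k S} {B : GradedQuiver k S'} {f g : S → S'}
    (Φ : TMap A B f g) : Comps (plus A) (plus B) f g := fun X Y =>
  plusProj B (f X) (g Y) ∘ₗ Φ X Y ∘ₗ low A X Y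

/-- The `A∞`-functor `underline F`, strict, with first component `F : T⁺A → T⁺B`. -/
def underFunctor {A : GradedQuiver k S} {B : GradedQuiver k S'} {f : S → S'}
    (F : TMap A B f f) : TMap (plus A) (plus B) f f :=
  cocatHom (underComps F)

/-- For an `(F,G)`-coderivation `R` of degree `p`: the
`(underline F, underline G)`-coderivation `underline R` with components `r₀`,
`R|_{T⁺A} : T⁺A → T⁺B`, `0`, `0`, …. -/
def underTransf {A : GradedQuiver k S} {B : GradedQuiver k S'} {f g : S → S'} (p : ℤ)
    (F : TMap A B f f) (R : TMap A B f g) (G : TMap A B g g) : TMap (plus A) (plus B) f g :=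
  coderivation p (underFunctor F) (underComps R) (underFunctor G)

/-- The codifferential `underline b` on `T(T⁺A)`: the coderivation with the only non-vanishing
component `b : T⁺A → T⁺A`. -/
def underDiff {A : GradedQuiver k S} (b : TMap A A (fun X => X) (fun X => X)) :
    TMap (plus A) (plus A) (fun X => X) (fun X => X) :=
  coderivation 1 (idT (plus A)) (underComps b) (idT (plus A))

/-! ### The construction `𝒞 ↦ overline 𝒞` -/

/-- Multiplication of all factors, `T(T⁺A) → TA`: one summand. -/
def flatTens (A : GradedQuiver k S) :
    {X Y : S} → (W : Word S X Y) → Tens (plus A) W →ₗ[k] T A X Y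
  | _, _, .nil X => LinearMap.toSpanSingleton k (T A X X) (one A X) ∘ₗ
      (tnil (plus A) X).symm.toLinearMap
  | _, _, .cons (Z := Z) (Y := Y) X d W =>
      mul A X Z Y ∘ₗ TensorProduct.map (plusIncl A X Z d) (flatTens A W) ∘ₗ
        (tcons (plus A) X d W).symm.toLinearMap

/-- Multiplication of all factors in the tensor algebra, `T(T⁺A) → TA`. -/
def flat (A : GradedQuiver k S) (X Y : S) : T (plus A) X Y →ₗ[k] T A X Y :=
  DirectSum.toModule k (Word S X Y) (T A X Y) fun W => flatTens A W

/-- The cocategory automorphism `𝐦` of `T(T⁺A)` with components `μ⁽ⁿ⁾`, `n ≥ 1`. -/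
def mm (A : GradedQuiver k S) : TMap (plus A) (plus A) (fun X => X) (fun X => X) :=
  cocatHom fun X Y => plusProj A X Y ∘ₗ flat A X Y

/-- The inverse automorphism `𝐦⁻¹`, with components `(-1)^(n-1) μ⁽ⁿ⁾`, `n ≥ 1`. -/
def mmInv (A : GradedQuiver k S) : TMap (plus A) (plus A) (fun X => X) (fun X => X) :=
  cocatHom fun X Y => plusProj A X Y ∘ₗ flat A X Y ∘ₗ
    DirectSum.lmap fun W : Word S X Y =>
      (((W.length : ℤ) - 1).negOnePow : ℤ) •
        (LinearMap.id : Tens (plus A) W →ₗ[k] Tens (plus A) W)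

/-- The conjugate `𝐦 Φ 𝐦⁻¹` (right operators). -/
def conj {A : GradedQuiver k S} {B : GradedQuiver k S'} {f g : S → S'}
    (Φ : TMap (plus A) (plus B) f g) : TMap (plus A) (plus B) f g := fun X Y =>
  mmInv B (f X) (g Y) ∘ₗ Φ X Y ∘ₗ mm A X Y

/-- The codifferential `overline b = 𝐦 (underline b) 𝐦⁻¹` on `T(T⁺A)`. -/
def overDiff {A : GradedQuiver k S} (b : TMap A A (fun X => X) (fun X => X)) :
    TMap (plus A) (plus A) (fun X => X) (fun X => X) :=
  conj (underDiff b)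

/-- The `A∞`-functor `overline F = 𝐦 (underline F) 𝐦⁻¹`. -/
def overFunctor {A : GradedQuiver k S} {B : GradedQuiver k S'} {f : S → S'}
    (F : TMap A B f f) : TMap (plus A) (plus B) f f :=
  conj (underFunctor F)

/-- The `A∞`-transformation `overline R = 𝐦 (underline R) 𝐦⁻¹`. -/
def overTransf {A : GradedQuiver k S} {B : GradedQuiver k S'} {f g : S → S'} (p : ℤ)
    (F : TMap A B f f) (R : TMap A B f g) (G : TMap A B g g) : TMap (plus A) (plus B) f g :=
  conj (underTransf p F R G)

/-! ### The construction `(𝒞, ℬ) ↦ D(𝒞|ℬ)` -/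

/-- The map `Q(X,X₁)^{d₁} ⊗ ⋯ → Q'(X,X₁)^{d₁} ⊗ ⋯` induced by a morphism of quivers. -/
def tensFunctor {Q Q' : GradedQuiver k S} (φ : ∀ X Y d, Q X Y d →ₗ[k] Q' X Y d) :
    {X Y : S} → (w : Word S X Y) → Tens Q w →ₗ[k] Tens Q' w
  | _, _, .nil X => (tnil Q' X).toLinearMap ∘ₗ (tnil Q X).symm.toLinearMap
  | _, _, .cons X d w => (tcons Q' X d w).toLinearMap ∘ₗ
      TensorProduct.map (φ X _ d) (tensFunctor φ w) ∘ₗ (tcons Q X d w).symm.toLinearMap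

/-- The embedding `sD(C|B) → T⁺sC`. -/
def subIncl (A : GradedQuiver k S) (B : Set S) (X Y : S) (d : ℤ) :
    plusOver A B X Y d →ₗ[k] plus A X Y d :=
  plusLift A B fun w =>
    inPlus A Set.univ ⟨w.1, w.2.1, fun _ _ => Set.mem_univ _, w.2.2.2⟩

/-- The projection of `T⁺sC` to its direct summand `sD(C|B)`. -/
def subProj (A : GradedQuiver k S) (B : Set S) (X Y : S) (d : ℤ) :
    plus A X Y d →ₗ[k] plusOver A B X Y d :=
  plusLift A Set.univ fun w =>
    if hw : ∀ Z ∈ w.1.inner, Z ∈ B then inPlus A B ⟨w.1, w.2.1, hw, w.2.2.2⟩ else 0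

/-- The embedding `TsD(C|B) → T(T⁺sC)`. -/
def subInclT (A : GradedQuiver k S) (B : Set S) (X Y : S) :
    T (plusOver A B) X Y →ₗ[k] T (plus A) X Y :=
  DirectSum.lmap fun w : Word S X Y => tensFunctor (subIncl A B) w

/-- The projection `T(T⁺sC) → TsD(C|B)`. -/
def subProjT (A : GradedQuiver k S) (B : Set S) (X Y : S) :
    T (plus A) X Y →ₗ[k] T (plusOver A B) X Y :=
  DirectSum.lmap fun w : Word S X Y => tensFunctor (subProj A B) w

/-- `Φ : T(T⁺A) → T(T⁺A')` maps `TsD(A|B)` into `TsD(A'|J)`. -/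
def Restricts {A : GradedQuiver k S} {A' : GradedQuiver k S'} (B : Set S) (J : Set S')
    {f g : S → S'} (Φ : TMap (plus A) (plus A') f g) : Prop :=
  ∀ X Y, LinearMap.range (Φ X Y ∘ₗ subInclT A B X Y) ≤
    LinearMap.range (subInclT A' J (f X) (g Y))

/-- The restriction of `Φ : T(T⁺A) → T(T⁺A')` to a map `TsD(A|B) → TsD(A'|J)`. -/
def restrict {A : GradedQuiver k S} {A' : GradedQuiver k S'} (B : Set S) (J : Set S')
    {f g : S → S'} (Φ : TMap (plus A) (plus A') f g) :
    TMap (plusOver A B) (plusOver A' J) f g := fun X Y =>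
  subProjT A' J (f X) (g Y) ∘ₗ Φ X Y ∘ₗ subInclT A B X Y

/-- The codifferential of `D(C|B)`, the restriction of `overline b`. -/
def DDiff {A : GradedQuiver k S} (B : Set S) (b : TMap A A (fun X => X) (fun X => X)) :
    TMap (plusOver A B) (plusOver A B) (fun X => X) (fun X => X) :=
  restrict B B (overDiff b)

/-- The `A∞`-functor `D(F) : D(C|B) → D(I|J)`, the restriction of `overline F`. -/
def DFunctor {A : GradedQuiver k S} {A' : GradedQuiver k S'} (B : Set S) (J : Set S')
    {f : S → S'} (F : TMap A A' f f) : TMap (plusOver A B) (plusOver A' J) f f :=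
  restrict B J (overFunctor F)

/-- The `A∞`-transformation `D(R) : D(F) → D(G)`, the restriction of `overline R`. -/
def DTransf {A : GradedQuiver k S} {A' : GradedQuiver k S'} (B : Set S) (J : Set S')
    {f g : S → S'} (p : ℤ) (F : TMap A A' f f) (R : TMap A A' f g) (G : TMap A A' g g) :
    TMap (plusOver A B) (plusOver A' J) f g :=
  restrict B J (overTransf p F R G)

end AInf

end

/-! A homomorphism or a coderivation with values in a tensor cocategory is determined by its
components (`IsCocatHom.ext`, `IsCoderivation.ext`), and suitable components can be prescribed
(`isCocatHom_cocatHom`, `isCoderivation_coderivation`). Hence transformations are never compared by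
formulas, only by their images under one map that separates coderivations.

For `T(T⁺A)` there are two such maps to `TA`: `low`, the identity on `T⁰` and `T¹` and zero beyond,
and `flat`, the multiplication of all factors, with `low ∘ 𝐦 = flat` (`low_mm`). The underlined maps
are those intertwined by `low` with the original ones, the overlined maps those intertwined by
`flat`. So `b² = 0`, naturality, functoriality and equivalences pass from `𝒞` to both constructions.

For `D(𝒞|ℬ)`, a tensor of letters `u₁ | ⋯ | uₙ` is read as one word of `A` whose objects carry
marks: objects inside a letter are marked and must lie in `ℬ`, objects at the bars are unmarked.
This identifies `TsD(𝒞|ℬ)` with tensors between unmarked objects (`unbar_bars`, `bars_unbar`), and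
its cuts with the cuts at unmarked objects (`sumCut_atBot_bars`). Coderivations of `TA` lift to
marked words, and by uniqueness the lift is the restriction of the overlined map
(`overTransf_subInclT`).

The condition `(i ⊗ i)B₂ ≡ i` is rephrased as `i = [Θ, b]` for some `Θ` with `ΘΔ = Δ(1 ⊗ Θ + i ⊗ i +
Θ ⊗ 1)` (`IsAInfCategory.equivalent_B2_iff`). In this form it is transported like the other
identities.

It remains to see that the unit maps of `D(𝒞|ℬ)` are homotopy invertible. Viewed in `TA`, they are
commutators `N` of `b` with left or right multiplication by `i₀`. These are coderivations of degree
`0` relative to the identity and the projection to `T⁰A`. Idempotency of `i` and invertibility in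
`𝒞` make `N₁` homotopic to `-1` (left) or `+1` (right) (`IsOneSided.exists_homotopy`). Extending the
homotopy to a coderivation changes `N` into `±1` plus a part that shortens words, which is an
automorphism (`IsOneSided.exists_automorphism`).

For `underline 𝒞` the second component of the codifferential vanishes, so the unit maps are zero and
the complexes must be contractible. They are: on `T⁺` the map `N` is null-homotopic, being a
commutator with multiplication by `i₀`, and also homotopic to an automorphism. Idempotency becomes
`underline i ≡ 0`, witnessed by `-underline Θ`. -/

noncomputable section

open scoped TensorProduct DirectSum Classical

namespace AInf

variable {k : Type u} [CommRing k] {S S' S'' : Type u}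

/-! ### Calculus of tensors: induction, multiplication and sums over cuts. -/

section
variable {A : GradedQuiver k S} {X Y Z W : S} {d : ℤ} {P Q : Type u}
  [AddCommGroup P] [Module k P] [AddCommGroup Q] [Module k Q]

/-! ### Elements of the tensor quiver -/

/-- Left multiplication by a homogeneous morphism. -/
def cns (a : A X Z d) : T A Z Y →ₗ[k] T A X Y :=
  consT A X Z Y d ∘ₗ TensorProduct.mk k (A X Z d) (T A Z Y) a

lemma consT_tmul (a : A X Z d) (y : T A Z Y) : consT A X Z Y d (a ⊗ₜ y) = cns a y := rfl

lemma cns_inT (a : A X Z d) (w : Word S Z Y) (x : Tens A w) :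
    cns a (inT A w x) = inT A (.cons X d w) (tcons A X d w (a ⊗ₜ[k] x)) := by
  simp only [cns, consT, LinearMap.comp_apply, TensorProduct.mk_apply, LinearEquiv.coe_coe]
  erw [TensorProduct.directSumRight_tmul_lof]
  simp

/-- Left multiplication as a bilinear map. -/
def cnsHom (A : GradedQuiver k S) (X Z Y : S) (d : ℤ) :
    A X Z d →ₗ[k] T A Z Y →ₗ[k] T A X Y :=
  TensorProduct.curry (consT A X Z Y d)

lemma cnsHom_apply (a : A X Z d) (y : T A Z Y) : cnsHom A X Z Y d a y = cns a y := rfl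

lemma inT_nil (c : k) : inT A (.nil X) (tnil A X c) = c • one A X := by
  rw [one, ← map_smul, ← map_smul, smul_eq_mul, mul_one]

lemma Tens.cons_induction {w : Word S Z Y} {p : Tens A (.cons X d w) → Prop} (h0 : p 0)
    (hadd : ∀ x y, p x → p y → p (x + y)) (ht : ∀ a x, p (tcons A X d w (a ⊗ₜ[k] x))) (x) :
    p x := by
  obtain ⟨x, rfl⟩ := (tcons A X d w).surjective x
  induction x using TensorProduct.induction_on with
  | zero => simpa using h0
  | add x y hx hy => rw [map_add]; exact hadd _ _ hx hy
  | tmul a x => exact ht a x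

/-- Words are built from empty words by prepending letters. The motive ranges over all pairs of
objects because prepending changes the source; the scalar clause is needed because `T⁰` is spanned
by the unit. -/
theorem T.induction {p : ∀ {X Y : S}, T A X Y → Prop} (h0 : ∀ X Y, p (0 : T A X Y))
    (hadd : ∀ {X Y} (x y : T A X Y), p x → p y → p (x + y))
    (hsmul : ∀ {X Y} (c : k) (x : T A X Y), p x → p (c • x)) (hone : ∀ X, p (one A X))
    (hcns : ∀ {X Z Y d} (a : A X Z d) (y : T A Z Y), p y → p (cns a y)) {X Y : S}
    (x : T A X Y) : p x := by
  induction x using DirectSum.induction_on with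
  | zero => exact h0 _ _
  | add x y hx hy => exact hadd _ _ hx hy
  | of w x =>
    change p (inT A w x)
    induction w with
    | nil X =>
      obtain ⟨c, rfl⟩ := (tnil A X).surjective x
      rw [inT_nil]
      exact hsmul _ _ (hone X)
    | cons X d w ih =>
      induction x using Tens.cons_induction with
      | h0 => rw [map_zero]; exact h0 _ _
      | hadd x y hx hy => rw [map_add]; exact hadd _ _ hx hy
      | ht a x => rw [← cns_inT]; exact hcns _ _ (ih x)

/-- Linear families on the tensor quiver that agree on units and, inductively, on products. -/
theorem T.family_ext {M : S → S → Type u} [∀ X Y, AddCommGroup (M X Y)] [∀ X Y, Module k (M X Y)]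
    {φ ψ : ∀ X Y, T A X Y →ₗ[k] M X Y} (hone : ∀ X, φ X X (one A X) = ψ X X (one A X))
    (hcns : ∀ {X Z Y d} (a : A X Z d) (y : T A Z Y), φ Z Y y = ψ Z Y y →
      φ X Y (cns a y) = ψ X Y (cns a y)) : φ = ψ := by
  funext X Y
  refine LinearMap.ext fun x => ?_
  induction x using T.induction with
  | h0 X Y => simp
  | hadd x y hx hy => simp [hx, hy]
  | hsmul c x hx => simp [hx]
  | hone X => exact hone X
  | hcns a y ih => exact hcns a y ih

/-! ### Multiplication -/

/-- Multiplication as a bilinear map. -/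
def mulL (A : GradedQuiver k S) (X Y Z : S) : T A X Y →ₗ[k] T A Y Z →ₗ[k] T A X Z :=
  TensorProduct.curry (mul A X Y Z)

local infixl:70 " ⋆ " => mulL _ _ _ _

lemma mul_tmul (x : T A X Y) (y : T A Y Z) : mul A X Y Z (x ⊗ₜ y) = x ⋆ y := rfl

lemma inT_mulL (w : Word S X Y) (x : Tens A w) (y : T A Y Z) :
    inT A w x ⋆ y = mulTens A Z w x y := by
  rw [← mul_tmul, mul, TensorProduct.lift.tmul, DirectSum.toModule_lof]

@[simp] lemma one_mulL (y : T A X Y) : one A X ⋆ y = y := by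
  rw [← mul_tmul, mul, TensorProduct.lift.tmul, one, DirectSum.toModule_lof]
  simp [mulTens]

@[simp] lemma cns_mulL (a : A X Z d) (x : T A Z Y) (y : T A Y W) :
    cns a x ⋆ y = cns a (x ⋆ y) := by
  induction x using DirectSum.induction_on with
  | zero => simp
  | add x x' hx hy => simp [hx, hy]
  | of w x =>
    change cns a (inT A w x) ⋆ y = cns a (inT A w x ⋆ y)
    rw [cns_inT, inT_mulL, inT_mulL]
    simp only [mulTens, LinearMap.comp_apply, LinearEquiv.coe_coe, LinearEquiv.symm_apply_apply,
      TensorProduct.curry_apply, TensorProduct.assoc_tmul, LinearMap.lTensor_tmul,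
      consT_tmul]
    rfl

@[simp] lemma mulL_one (x : T A X Y) : x ⋆ one A Y = x := by
  induction x using T.induction with
  | h0 X Y => simp
  | hadd x y hx hy => simp [hx, hy]
  | hsmul c x hx => simp [hx]
  | hone X => simp
  | hcns a y ih => simp [ih]

lemma mulL_assoc (x : T A X Y) (y : T A Y Z) (z : T A Z W) : x ⋆ y ⋆ z = x ⋆ (y ⋆ z) := by
  induction x using T.induction with
  | h0 X Y => simp
  | hadd x y hx hy => simp [hx, hy]
  | hsmul c x hx => simp [hx]
  | hone X => simp
  | hcns a y ih => simp [ih]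

/-! ### Sums over all cuts -/

/-- The sum `∑ β(x', x'')` over all cuts `x = x' ⊗ x''`. -/
def sumCut (β : ∀ Z, T A X Z →ₗ[k] T A Z Y →ₗ[k] P) : T A X Y →ₗ[k] P :=
  DirectSum.toModule k S P (fun Z => TensorProduct.lift (β Z)) ∘ₗ cut A X Y

lemma sumCut_one (β : ∀ Z, T A X Z →ₗ[k] T A Z X →ₗ[k] P) :
    sumCut β (one A X) = β X (one A X) (one A X) := by
  simp [sumCut, cut, one, cutTens]

/-- A cut lies in front of the first letter, or that letter belongs to the left part. With
`sumCut_one` this recursion is the only access to the definition of the cut needed for inductions.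
-/
lemma sumCut_cns {V : S} (β : ∀ Z, T A X Z →ₗ[k] T A Z Y →ₗ[k] P) (a : A X V d) (y : T A V Y) :
    sumCut β (cns a y) =
      β X (one A X) (cns a y) + sumCut (fun Z => β Z ∘ₗ cns a) y := by
  induction y using DirectSum.induction_on with
  | zero => simp
  | add x y hx hy => simp only [map_add, hx, hy]; abel
  | of w x =>
    change sumCut β (cns a (inT A w x)) = β X (one A X) (cns a (inT A w x)) +
      sumCut (fun Z => β Z ∘ₗ cns a) (inT A w x)
    simp only [cns_inT, sumCut, LinearMap.comp_apply, cut, DirectSum.toModule_lof, cutTens,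
      LinearMap.add_apply, map_add, LinearEquiv.coe_coe, LinearEquiv.symm_apply_apply,
      TensorProduct.mk_apply, TensorProduct.lift.tmul, LinearMap.lTensor_tmul]
    congr 1
    generalize cutTens A w x = z
    induction z using DirectSum.induction_on with
    | zero => simp
    | add x y hx hy => simp only [TensorProduct.tmul_add, map_add, hx, hy]
    | of Z z =>
      change _ = DirectSum.toModule k S P _ (inTT A V Z Y z)
      rw [DirectSum.toModule_lof]
      change DirectSum.toModule k S P _ (consTT A X V Y d (a ⊗ₜ inTT A V Z Y z)) = _
      rw [consTT, LinearMap.comp_apply, LinearEquiv.coe_coe]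
      erw [TensorProduct.directSumRight_tmul_lof]
      rw [DirectSum.toModule_lof]
      simp only [LinearMap.comp_apply, DirectSum.toModule_lof]
      induction z using TensorProduct.induction_on with
      | zero => simp
      | add x y hx hy => simp only [TensorProduct.tmul_add, map_add, hx, hy]
      | tmul x y => simp [consT_tmul]

/-- `sumCut` as a linear function of the bilinear maps. -/
def sumCutHom (A : GradedQuiver k S) (X Y : S) (P : Type u) [AddCommGroup P] [Module k P] :
    (∀ Z, T A X Z →ₗ[k] T A Z Y →ₗ[k] P) →ₗ[k] T A X Y →ₗ[k] P where
  toFun := sumCut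
  map_add' β γ := by
    ext1 w
    refine LinearMap.ext fun x => ?_
    simp only [LinearMap.comp_apply, LinearMap.add_apply, sumCut]
    generalize cut A X Y _ = z
    induction z using DirectSum.induction_on with
    | zero => simp
    | add x y hx hy => simp only [map_add, hx, hy]; abel
    | of Z z =>
      change DirectSum.toModule k S P _ (inTT A X Z Y z) =
        DirectSum.toModule k S P _ (inTT A X Z Y z) + DirectSum.toModule k S P _ (inTT A X Z Y z)
      simp only [DirectSum.toModule_lof]
      induction z using TensorProduct.induction_on with
      | zero => simp
      | add x y hx hy => simp only [map_add, hx, hy]; abel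
      | tmul x y => simp
  map_smul' c β := by
    ext1 w
    refine LinearMap.ext fun x => ?_
    simp only [LinearMap.comp_apply, LinearMap.smul_apply, sumCut, RingHom.id_apply]
    generalize cut A X Y _ = z
    induction z using DirectSum.induction_on with
    | zero => simp
    | add x y hx hy => simp only [map_add, hx, hy, smul_add]
    | of Z z =>
      change DirectSum.toModule k S P _ (inTT A X Z Y z) =
        c • DirectSum.toModule k S P _ (inTT A X Z Y z)
      simp only [DirectSum.toModule_lof]
      induction z using TensorProduct.induction_on with
      | zero => simp
      | add x y hx hy => simp only [map_add, hx, hy, smul_add]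
      | tmul x y => simp

lemma sumCut_add (β γ : ∀ Z, T A X Z →ₗ[k] T A Z Y →ₗ[k] P) (x : T A X Y) :
    sumCut (fun Z => β Z + γ Z) x = sumCut β x + sumCut γ x :=
  LinearMap.congr_fun ((sumCutHom A X Y P).map_add β γ) x

lemma sumCut_sub (β γ : ∀ Z, T A X Z →ₗ[k] T A Z Y →ₗ[k] P) (x : T A X Y) :
    sumCut (fun Z => β Z - γ Z) x = sumCut β x - sumCut γ x :=
  LinearMap.congr_fun ((sumCutHom A X Y P).map_sub β γ) x

lemma sumCut_smul (c : k) (β : ∀ Z, T A X Z →ₗ[k] T A Z Y →ₗ[k] P) (x : T A X Y) :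
    sumCut (fun Z => c • β Z) x = c • sumCut β x :=
  LinearMap.congr_fun ((sumCutHom A X Y P).map_smul c β) x

lemma sumCut_zsmul (c : ℤ) (β : ∀ Z, T A X Z →ₗ[k] T A Z Y →ₗ[k] P) (x : T A X Y) :
    sumCut (fun Z => c • β Z) x = c • sumCut β x :=
  LinearMap.congr_fun (map_zsmul (sumCutHom A X Y P) c β) x

lemma sumCut_congr {β γ : ∀ Z, T A X Z →ₗ[k] T A Z Y →ₗ[k] P}
    (h : ∀ Z x y, β Z x y = γ Z x y) (x : T A X Y) : sumCut β x = sumCut γ x := by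
  have : β = γ := funext fun Z => LinearMap.ext₂ (h Z)
  rw [this]

lemma map_sumCut (l : P →ₗ[k] Q) (β : ∀ Z, T A X Z →ₗ[k] T A Z Y →ₗ[k] P) (x : T A X Y) :
    l (sumCut β x) = sumCut (fun Z => (β Z).compr₂ l) x := by
  rw [sumCut, sumCut, LinearMap.comp_apply, LinearMap.comp_apply]
  generalize cut A X Y x = z
  induction z using DirectSum.induction_on with
  | zero => simp
  | add x y hx hy => simp only [map_add, hx, hy]
  | of Z z =>
    change l (DirectSum.toModule k S _ _ (inTT A X Z Y z)) =
      DirectSum.toModule k S _ _ (inTT A X Z Y z)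
    simp only [DirectSum.toModule_lof]
    induction z using TensorProduct.induction_on with
    | zero => simp
    | add x y hx hy => simp only [map_add, hx, hy]
    | tmul x y => simp

/-- Coassociativity of the cut comultiplication. -/
lemma sumCut_coassoc (γ : ∀ Z W, T A X Z →ₗ[k] T A Z W →ₗ[k] T A W Y →ₗ[k] P) (x : T A X Y) :
    sumCut (fun Z => sumCutHom A Z Y P ∘ₗ LinearMap.pi fun W => γ Z W) x =
      sumCut (fun W => sumCut fun Z => γ Z W) x := by
  induction x using T.induction with
  | h0 X Y => simp
  | hadd x y hx hy => simp [hx, hy]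
  | hsmul c x hx => simp [hx]
  | hone X =>
    simp only [sumCut_one, LinearMap.comp_apply]
    exact sumCut_one _
  | hcns a y ih =>
    rename_i X Z Y d
    simp only [sumCut_cns, LinearMap.comp_apply, sumCut_one]
    -- Pairs of cuts of `a · y` have both cuts in front of `a`, exactly one there, or none. Only the
    -- last kind needs the induction hypothesis, applied to `γ ∘ cns a`.
    have h1 : sumCutHom A X Y P (LinearMap.pi (fun W => γ X W) (one A X)) (cns a y) = _ :=
      sumCut_cns (fun W => γ X W (one A X)) a y
    have h2 := ih fun V W => γ V W ∘ₗ cns a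
    have h3 : sumCut (fun W => sumCut (fun Z => γ Z W) ∘ₗ cns a) y =
        sumCut (fun W => γ X W (one A X) ∘ₗ cns a + sumCut fun Z => γ Z W ∘ₗ cns a) y := by
      refine sumCut_congr (fun W x y => ?_) y
      simp [sumCut_cns]
    have h4 := sumCut_add (fun W => γ X W (one A X) ∘ₗ cns a)
      (fun W => sumCut fun Z => γ Z W ∘ₗ cns a) y
    rw [h1, h3, h4, ← h2, add_assoc]
    rfl

end

/-! ### Words, degrees, Koszul signs and convolution. -/

section
variable {A : GradedQuiver k S} {B : GradedQuiver k S'} {X Y Z W : S} {d : ℤ} {P Q : Type u}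
  [AddCommGroup P] [Module k P] [AddCommGroup Q] [Module k Q]

local infixl:70 " ⋆ " => mulL _ _ _ _

/-! ### Cuts of words -/

/-- Concatenation of words. -/
def Word.append : {X Y Z : S} → Word S X Y → Word S Y Z → Word S X Z
  | _, _, _, .nil _, w' => w'
  | _, _, _, .cons X d w, w' => .cons X d (w.append w')

lemma Word.length_append : ∀ {X Y Z : S} (w : Word S X Y) (w' : Word S Y Z),
    (w.append w').length = w.length + w'.length
  | _, _, _, .nil _, w' => by simp [append, length]
  | _, _, _, .cons X d w, w' => by simp [append, length, length_append w w']; omega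

lemma Word.degree_append : ∀ {X Y Z : S} (w : Word S X Y) (w' : Word S Y Z),
    (w.append w').degree = w.degree + w'.degree
  | _, _, _, .nil _, w' => by simp [append, degree]
  | _, _, _, .cons X d w, w' => by simp [append, degree, degree_append w w']; omega

/-- The parts of a cut of a word `w` are words with concatenation `w`. This gives control of lengths
and degrees of both parts, on which the later inductions on length rely. -/
lemma sumCut_mem (N : Submodule k P) {w : Word S X Y} (x : Tens A w)
    {β : ∀ Z, T A X Z →ₗ[k] T A Z Y →ₗ[k] P}
    (h : ∀ Z (w₁ : Word S X Z) (w₂ : Word S Z Y), w₁.append w₂ = w →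
      ∀ x₁ x₂, β Z (inT A w₁ x₁) (inT A w₂ x₂) ∈ N) : sumCut β (inT A w x) ∈ N := by
  induction w with
  | nil X =>
    obtain ⟨c, rfl⟩ := (tnil A X).surjective x
    rw [inT_nil, map_smul, sumCut_one]
    exact N.smul_mem _ (h X (.nil X) (.nil X) rfl _ _)
  | cons X d w ih =>
    induction x using Tens.cons_induction with
    | h0 => simp
    | hadd x y hx hy => rw [map_add, map_add]; exact N.add_mem hx hy
    | ht a x =>
      rw [← cns_inT, sumCut_cns]
      refine N.add_mem ?_ (ih x fun Z w₁ w₂ e x₁ x₂ => ?_)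
      · rw [cns_inT]
        exact h X (.nil X) _ rfl _ _
      · rw [LinearMap.comp_apply, cns_inT]
        exact h Z (.cons X d w₁) w₂ (by rw [Word.append, e]) _ _

lemma sumCut_congr_word {w : Word S X Y} (x : Tens A w)
    {β γ : ∀ Z, T A X Z →ₗ[k] T A Z Y →ₗ[k] P}
    (h : ∀ Z (w₁ : Word S X Z) (w₂ : Word S Z Y), w₁.append w₂ = w →
      ∀ x₁ x₂, β Z (inT A w₁ x₁) (inT A w₂ x₂) = γ Z (inT A w₁ x₁) (inT A w₂ x₂)) :
    sumCut β (inT A w x) = sumCut γ (inT A w x) := by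
  rw [← sub_eq_zero, ← sumCut_sub, ← Submodule.mem_bot k]
  refine sumCut_mem ⊥ x fun Z w₁ w₂ e x₁ x₂ => ?_
  simp [h Z w₁ w₂ e x₁ x₂]

theorem T.word_induction {p : T A X Y → Prop} (h0 : p 0) (hadd : ∀ x y, p x → p y → p (x + y))
    (h : ∀ w x, p (inT A w x)) (x : T A X Y) : p x := by
  induction x using DirectSum.induction_on with
  | zero => exact h0
  | add x y hx hy => exact hadd _ _ hx hy
  | of w x => exact h w x

lemma sumCut_zero (x : T A X Y) :
    sumCut (fun Z => (0 : T A X Z →ₗ[k] T A Z Y →ₗ[k] P)) x = 0 :=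
  LinearMap.congr_fun (sumCutHom A X Y P).map_zero x

/-- A cut of a product is a cut of one of the factors. The cut between the two factors is counted in
both sums, hence subtracted once. -/
lemma sumCut_mulL (β : ∀ V, T A X V →ₗ[k] T A V Z →ₗ[k] P) (x : T A X Y) (y : T A Y Z) :
    sumCut β (x ⋆ y) = sumCut (fun V => (β V).compl₂ ((mulL A V Y Z).flip y)) x +
      sumCut (fun V => β V ∘ₗ mulL A X Y V x) y - β Y x y := by
  induction x using T.induction with
  | h0 X Y =>
    have : sumCut (fun V => β V ∘ₗ mulL A X Y V 0) y = 0 := by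
      rw [sumCut_congr (γ := fun _ => 0) (by simp) y, sumCut_zero]
    rw [this]
    simp only [map_zero, LinearMap.zero_apply, add_zero, sub_zero]
  | hadd x x' hx hx' =>
    rename_i X Y
    have : sumCut (fun V => β V ∘ₗ mulL A X Y V (x + x')) y =
        sumCut (fun V => β V ∘ₗ mulL A X Y V x) y +
          sumCut (fun V => β V ∘ₗ mulL A X Y V x') y := by
      rw [← sumCut_add]; exact sumCut_congr (by simp) y
    simp only [map_add, LinearMap.add_apply] at this ⊢
    rw [this, hx, hx']; abel
  | hsmul c x hx =>
    rename_i X Y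
    have : sumCut (fun V => β V ∘ₗ mulL A X Y V (c • x)) y =
        c • sumCut (fun V => β V ∘ₗ mulL A X Y V x) y := by
      rw [← sumCut_smul]; exact sumCut_congr (by simp) y
    simp only [map_smul, LinearMap.smul_apply] at this ⊢
    rw [this, hx, smul_sub, smul_add]
  | hone X =>
    have : sumCut (fun V => β V ∘ₗ mulL A X X V (one A X)) y = sumCut β y :=
      sumCut_congr (by simp) y
    rw [sumCut_one, one_mulL, this]; simp
  | hcns a x ih =>
    rename_i X V Y d
    have h1 := ih (fun V => β V ∘ₗ cns a) y
    have h2 : sumCut (fun W => (β W ∘ₗ cns a) ∘ₗ mulL A V Y W x) y =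
        sumCut (fun W => β W ∘ₗ mulL A X Y W (cns a x)) y := sumCut_congr (by simp) y
    have h3 : sumCut (fun W => (β W ∘ₗ cns a).compl₂ ((mulL A W Y Z).flip y)) x =
        sumCut (fun W => (β W).compl₂ ((mulL A W Y Z).flip y) ∘ₗ cns a) x :=
      sumCut_congr (by simp) x
    rw [cns_mulL, sumCut_cns, sumCut_cns, h1, h2, h3]
    simp only [LinearMap.comp_apply, LinearMap.compl₂_apply, LinearMap.flip_apply, cns_mulL]
    abel

/-! ### Degrees and signs -/

/-- The homogeneous elements of degree `n`. -/
def Deg (A : GradedQuiver k S) (n : ℤ) (X Y : S) : Submodule k (T A X Y) where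
  carrier := {z | ∀ w : Word S X Y, w.degree ≠ n → z w = 0}
  add_mem' hx hy w hw := by rw [DirectSum.add_apply, hx w hw, hy w hw, add_zero]
  zero_mem' w hw := rfl
  smul_mem' c x hx w hw := by rw [DirectSum.smul_apply, hx w hw, smul_zero]

lemma inT_apply_of_ne {w w' : Word S X Y} (h : w ≠ w') (x : Tens A w) : inT A w x w' = 0 :=
  DirectSum.of_eq_of_ne _ _ _ h.symm

lemma inT_mem_Deg (w : Word S X Y) (x : Tens A w) {n : ℤ} (h : w.degree = n) :
    inT A w x ∈ Deg A n X Y := fun w' hw' =>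
  inT_apply_of_ne (by rintro rfl; exact hw' h) x

lemma Deg.le_of_word {n : ℤ} {N : Submodule k (T A X Y)}
    (h : ∀ w : Word S X Y, w.degree = n → ∀ x, inT A w x ∈ N) : Deg A n X Y ≤ N := by
  intro z hz
  rw [← DirectSum.sum_support_of z]
  refine N.sum_mem fun w _ => ?_
  by_cases hw : w.degree = n
  · exact h w hw _
  · rw [hz w hw, map_zero]; exact N.zero_mem

lemma isHomogeneous_iff {f g : S → S'} {p : ℤ} {R : TMap A B f g} :
    IsHomogeneous p R ↔ ∀ X Y n, Deg A n X Y ≤ (Deg B (n + p) (f X) (g Y)).comap (R X Y) := by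
  constructor
  · rintro h X Y n
    refine Deg.le_of_word fun w hw x w' hw' => h X Y w x w' (by rwa [hw])
  · intro h X Y w x w' hw'
    exact h X Y _ (inT_mem_Deg w x rfl) w' hw'

lemma one_mem_Deg (X : S) : one A X ∈ Deg A 0 X X := inT_mem_Deg _ _ rfl

lemma cns_mem_Deg {n m : ℤ} (a : A X Z d) {y : T A Z Y} (hy : y ∈ Deg A n Z Y) (h : d + n = m) :
    cns a y ∈ Deg A m X Y := by
  have : Deg A n Z Y ≤ (Deg A m X Y).comap (cns a) := Deg.le_of_word fun w hw x => by
    rw [Submodule.mem_comap, cns_inT]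
    exact inT_mem_Deg _ _ (by rw [Word.degree, hw, h])
  exact this hy

lemma mulL_mem_Deg {n m l : ℤ} {x : T A X Y} {y : T A Y Z} (hx : x ∈ Deg A n X Y)
    (hy : y ∈ Deg A m Y Z) (h : n + m = l) : x ⋆ y ∈ Deg A l X Z := by
  have : Deg A n X Y ≤ (Deg A l X Z).comap ((mulL A X Y Z).flip y) := by
    refine Deg.le_of_word fun w hw x => ?_
    rw [Submodule.mem_comap, LinearMap.flip_apply]
    clear hx
    rename_i x₀
    clear x₀
    induction w generalizing n l with
    | nil X =>
      obtain ⟨c, rfl⟩ := (tnil A X).surjective x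
      rw [inT_nil, map_smul, LinearMap.smul_apply, one_mulL]
      refine Submodule.smul_mem _ _ ?_
      obtain rfl : m = l := by rw [← h, ← hw]; simp [Word.degree]
      exact hy
    | cons X e w ih =>
      induction x using Tens.cons_induction with
      | h0 => simp
      | hadd x x' hx hx' => simpa using Submodule.add_mem _ hx hx'
      | ht a x =>
        rw [← cns_inT, cns_mulL]
        refine cns_mem_Deg a (ih hy rfl rfl x) ?_
        rw [← h, ← hw, Word.degree]; ring
  exact this hx

lemma sgn_inT (p : ℤ) (w : Word S X Y) (x : Tens A w) :
    sgn A p X Y (inT A w x) = ((p * w.degree).negOnePow : ℤ) • inT A w x := by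
  rw [sgn, DirectSum.lmap_lof]
  simp only [LinearMap.smul_apply, LinearMap.id_apply]
  exact map_zsmul (inT A w) _ x

lemma sgn_one (p : ℤ) (X : S) : sgn A p X X (one A X) = one A X := by
  rw [one, sgn_inT]; simp [Word.degree]

lemma sgn_cns (p : ℤ) (a : A X Z d) (y : T A Z Y) :
    sgn A p X Y (cns a y) = ((p * d).negOnePow : ℤ) • cns a (sgn A p Z Y y) := by
  induction y using T.word_induction with
  | h0 => simp
  | hadd x y hx hy => simp only [map_add, hx, hy, smul_add]
  | h w x =>
    rw [cns_inT, sgn_inT, sgn_inT, map_zsmul, cns_inT, smul_smul, Word.degree, mul_add,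
      Int.negOnePow_add, Units.val_mul]

lemma sgn_of_mem {n : ℤ} (p : ℤ) {x : T A X Y} (hx : x ∈ Deg A n X Y) :
    sgn A p X Y x = ((p * n).negOnePow : ℤ) • x := by
  have : Deg A n X Y ≤ LinearMap.ker (sgn A p X Y - ((p * n).negOnePow : ℤ) • LinearMap.id) :=
    Deg.le_of_word fun w hw x => by
      rw [LinearMap.mem_ker, LinearMap.sub_apply, sgn_inT, hw, sub_eq_zero]; rfl
  have h := this hx
  rw [LinearMap.mem_ker, LinearMap.sub_apply, sub_eq_zero] at h
  exact h

@[simp] lemma sgn_zero : sgn A 0 X Y = LinearMap.id := by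
  refine LinearMap.ext fun x => ?_
  induction x using T.word_induction with
  | h0 => simp
  | hadd x y hx hy => simp only [map_add, hx, hy]
  | h w x => rw [sgn_inT]; simp

lemma sgn_sgn (p q : ℤ) (x : T A X Y) : sgn A p X Y (sgn A q X Y x) = sgn A (p + q) X Y x := by
  induction x using T.word_induction with
  | h0 => simp
  | hadd x y hx hy => simp only [map_add, hx, hy]
  | h w x =>
    rw [sgn_inT, map_zsmul, sgn_inT, sgn_inT, smul_smul, add_mul, Int.negOnePow_add, Units.val_mul,
      mul_comm]

/-- Degrees add along a cut, so the sign operator is multiplicative for the comultiplication. -/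
lemma sumCut_sgn (p : ℤ) (β : ∀ Z, T A X Z →ₗ[k] T A Z Y →ₗ[k] P) (x : T A X Y) :
    sumCut β (sgn A p X Y x) =
      sumCut (fun Z => (β Z).compl₁₂ (sgn A p X Z) (sgn A p Z Y)) x := by
  induction x using T.induction with
  | h0 => simp
  | hadd x y hx hy => simp only [map_add, hx, hy]
  | hsmul c x hx => simp only [map_smul, hx]
  | hone X => simp [sgn_one, sumCut_one]
  | hcns a y ih =>
    rename_i X V Y d
    rw [sgn_cns, map_zsmul, sumCut_cns, sumCut_cns, ih, smul_add]
    congr 1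
    · simp [sgn_one, sgn_cns, map_zsmul]
    · rw [← sumCut_zsmul]
      refine sumCut_congr (fun Z x y => ?_) y
      simp [sgn_cns, map_zsmul]

/-- Koszul signs are carried by the operators `sgn`; this commutation rule accounts for all sign
changes in the computations with commutators. -/
lemma IsHomogeneous.sgn {f g : S → S'} {p : ℤ} {R : TMap A B f g} (h : IsHomogeneous p R)
    (q : ℤ) (x : T A X Y) :
    sgn B q (f X) (g Y) (R X Y x) = ((q * p).negOnePow : ℤ) • R X Y (sgn A q X Y x) := by
  induction x using T.word_induction with
  | h0 => simp
  | hadd x y hx hy => simp only [map_add, hx, hy, smul_add]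
  | h w x =>
    rw [sgn_inT, sgn_of_mem q (isHomogeneous_iff.1 h X Y _ (inT_mem_Deg w x rfl)), map_zsmul,
      smul_smul, mul_add, Int.negOnePow_add, Units.val_mul, mul_comm]

/-! ### Convolution -/

section
variable {f g h : S → S'}

/-- Translates the comultiplication identities of the definitions into sums over cuts: the sign for
moving `φ` past the right part becomes `sgn` applied to that part. -/
lemma sumCut_tensMap (p : ℤ) (φ : TMap A B f g) (ψ : TMap A B g h)
    (β : ∀ V, T B (f X) V →ₗ[k] T B V (h Y) →ₗ[k] P) (x : T A X Y) :
    DirectSum.toModule k S' P (fun V => TensorProduct.lift (β V))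
        (tensMap p φ ψ X Y (cut A X Y x)) =
      sumCut (fun Z => (β (g Z)).compl₁₂ (φ X Z) (ψ Z Y ∘ₗ sgn A p Z Y)) x := by
  rw [sumCut, LinearMap.comp_apply]
  generalize cut A X Y x = z
  induction z using DirectSum.induction_on with
  | zero => simp
  | add x y hx hy => simp only [map_add, hx, hy]
  | of Z z =>
    change DirectSum.toModule k S' P _ (tensMap p φ ψ X Y (inTT A X Z Y z)) =
      DirectSum.toModule k S P _ (inTT A X Z Y z)
    rw [tensMap, DirectSum.toModule_lof, DirectSum.toModule_lof, LinearMap.comp_apply,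
      DirectSum.toModule_lof]
    induction z using TensorProduct.induction_on with
    | zero => simp
    | add x y hx hy => simp only [map_add, hx, hy]
    | tmul x y => simp

lemma conv_apply (p : ℤ) (φ : TMap A B f g) (ψ : TMap A B g h) (x : T A X Y) :
    conv p φ ψ X Y x =
      sumCut (fun Z => (mulL B (f X) (g Z) (h Y)).compl₁₂ (φ X Z) (ψ Z Y ∘ₗ sgn A p Z Y)) x := by
  rw [← sumCut_tensMap p φ ψ fun V => mulL B (f X) V (h Y), conv]
  simp only [LinearMap.comp_apply]
  congr

lemma conv_zero_apply (φ : TMap A B f g) (ψ : TMap A B g h) (x : T A X Y) :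
    conv 0 φ ψ X Y x =
      sumCut (fun Z => (mulL B (f X) (g Z) (h Y)).compl₁₂ (φ X Z) (ψ Z Y)) x := by
  rw [conv_apply]; simp

lemma conv_one (p : ℤ) (φ : TMap A B f g) (ψ : TMap A B g h) (X : S) :
    conv p φ ψ X X (one A X) = φ X X (one A X) ⋆ ψ X X (one A X) := by
  rw [conv_apply, sumCut_one]; simp [sgn_one]

lemma IsHomogeneous.conv {φ : TMap A B f g} {ψ : TMap A B g h} {p q r : ℤ}
    (hφ : IsHomogeneous p φ) (hψ : IsHomogeneous q ψ) (hr : p + q = r) :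
    IsHomogeneous r (conv p φ ψ) := by
  rw [isHomogeneous_iff] at *
  refine fun X Y n => Deg.le_of_word fun w hw x => ?_
  rw [Submodule.mem_comap, conv_apply]
  refine sumCut_mem _ x fun Z w₁ w₂ e x₁ x₂ => ?_
  simp only [LinearMap.compl₁₂_apply, LinearMap.comp_apply, sgn_inT, map_zsmul]
  refine zsmul_mem ?_ _
  refine mulL_mem_Deg (hφ _ _ _ (inT_mem_Deg w₁ x₁ rfl)) (hψ _ _ _ (inT_mem_Deg w₂ x₂ rfl)) ?_
  rw [← hw, ← e, Word.degree_append, ← hr]; ring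

end

end

/-! ### Components and uniqueness of cocategory homomorphisms and coderivations. -/

section
variable {A : GradedQuiver k S} {B : GradedQuiver k S'} {C : GradedQuiver k S''}
  {X Y Z W : S} {d : ℤ} {P Q : Type u}
  [AddCommGroup P] [Module k P] [AddCommGroup Q] [Module k Q]

local infixl:70 " ⋆ " => mulL _ _ _ _

/-! ### Counit and first letters -/

/-- The projection of `TA` to `T⁰A`. -/
abbrev e0 (A : GradedQuiver k S) : TMap A A (fun X => X) (fun X => X) := etaEps A A fun X => X

lemma etaEps_one (f : S → S') (X : S) : etaEps A B f X X (one A X) = one B (f X) := by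
  simp [etaEps, one, etaEpsTens]

lemma etaEps_cns (f : S → S') (a : A X Z d) (y : T A Z Y) :
    etaEps A B f X Y (cns a y) = 0 := by
  induction y using T.word_induction with
  | h0 => simp
  | hadd x y hx hy => simp only [map_add, hx, hy, add_zero]
  | h w x => rw [cns_inT]; simp [etaEps, etaEpsTens]

lemma counit_one (X : S) : counit A X X (one A X) = 1 := by
  simp [counit, one, counitTens]

lemma counit_cns (a : A X Z d) (y : T A Z Y) : counit A X Y (cns a y) = 0 := by
  induction y using T.word_induction with
  | h0 => simp
  | hadd x y hx hy => simp only [map_add, hx, hy, add_zero]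
  | h w x => rw [cns_inT]; simp [counit, counitTens]

lemma etaEps_self (f : S → S') (x : T A X X) :
    etaEps A B f X X x = counit A X X x • one B (f X) := by
  induction x using T.word_induction with
  | h0 => simp
  | hadd x y hx hy => simp only [map_add, hx, hy, add_smul]
  | h w x =>
    cases w with
    | nil =>
      obtain ⟨c, rfl⟩ := (tnil A X).surjective x
      rw [inT_nil]; simp [etaEps_one, counit_one]
    | cons X d w =>
      induction x using Tens.cons_induction with
      | h0 => simp
      | hadd x y hx hy => simp only [map_add, hx, hy, add_smul]
      | ht a x => rw [← cns_inT, etaEps_cns, counit_cns, zero_smul]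

lemma etaEps_of_counit (f : S → S') {x : T A X Y} (h : counit A X Y x = 0) :
    etaEps A B f X Y x = 0 := by
  by_cases hXY : X = Y
  · subst hXY; rw [etaEps_self, h, zero_smul]
  · clear h
    induction x using T.word_induction with
    | h0 => simp
    | hadd x y hx hy => simp only [map_add, hx, hy, add_zero]
    | h w x =>
      cases w with
      | nil => exact absurd rfl hXY
      | cons X d w =>
        induction x using Tens.cons_induction with
        | h0 => simp
        | hadd x y hx hy => simp only [map_add, hx, hy, add_zero]
        | ht a x => rw [← cns_inT, etaEps_cns]

/-- Counit axiom: the left part of a cut lies in `T⁰` only for the cut in front of everything. -/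
lemma sumCut_e0_left (β : ∀ Z, T A X Z →ₗ[k] T A Z Y →ₗ[k] P) (x : T A X Y) :
    sumCut (fun Z => β Z ∘ₗ e0 A X Z) x = β X (one A X) x := by
  induction x using T.induction with
  | h0 => simp
  | hadd x y hx hy => simp only [map_add, hx, hy]
  | hsmul c x hx => simp only [map_smul, hx]
  | hone X => simp [sumCut_one, etaEps_one]
  | hcns a y _ =>
    rw [sumCut_cns, LinearMap.comp_apply, etaEps_one,
      sumCut_congr (γ := fun _ => 0) (by simp [etaEps_cns]), sumCut_zero, add_zero]

lemma sumCut_e0_right (β : ∀ Z, T A X Z →ₗ[k] T A Z Y →ₗ[k] P) (x : T A X Y) :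
    sumCut (fun Z => (β Z).compl₂ (e0 A Z Y)) x = β Y x (one A Y) := by
  induction x using T.induction with
  | h0 => simp
  | hadd x y hx hy => simp only [map_add, hx, hy, LinearMap.add_apply]
  | hsmul c x hx => simp only [map_smul, hx, LinearMap.smul_apply]
  | hone X => simp [sumCut_one, etaEps_one]
  | hcns a y ih =>
    rw [sumCut_cns, LinearMap.compl₂_apply, etaEps_cns, map_zero, zero_add]
    exact ih fun Z => β Z ∘ₗ cns a

lemma e0_mulL (x : T A X Y) (y : T A Y Z) :
    e0 A X Z (x ⋆ y) = e0 A X Y x ⋆ e0 A Y Z y := by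
  induction x using T.induction with
  | h0 => simp
  | hadd x y hx hy => simp [hx, hy]
  | hsmul c x hx => simp [hx]
  | hone X => simp [etaEps_one]
  | hcns a y ih => simp [etaEps_cns]

lemma e0_sgn (p : ℤ) (x : T A X Y) : e0 A X Y (sgn A p X Y x) = e0 A X Y x := by
  induction x using T.induction with
  | h0 => simp
  | hadd x y hx hy => simp [hx, hy]
  | hsmul c x hx => simp [hx]
  | hone X => simp [sgn_one]
  | hcns a y ih => rw [sgn_cns, map_zsmul, etaEps_cns, etaEps_cns, smul_zero]

/-- The projection of `TA` to `T¹A ⊆ TA`. -/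
def iota (A : GradedQuiver k S) : TMap A A (fun X => X) (fun X => X) :=
  fun X Y => in1 A X Y ∘ₗ pr1 A X Y

lemma in1_inTot (a : A X Y d) : in1 A X Y (inTot A X Y d a) = cns a (one A Y) := by
  rw [in1, DirectSum.toModule_lof, one, cns_inT]
  simp [tsingle]

lemma pr1_one (X : S) : pr1 A X X (one A X) = 0 := by
  simp [pr1, one, pr1Tens]

lemma pr1_in1 (x : Tot A X Y) : pr1 A X Y (in1 A X Y x) = x := by
  induction x using DirectSum.induction_on with
  | zero => simp
  | add x y hx hy => simp only [map_add, hx, hy]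
  | of d a =>
    change pr1 A X Y (in1 A X Y (inTot A X Y d a)) = inTot A X Y d a
    rw [in1, DirectSum.toModule_lof, LinearMap.comp_apply, pr1, DirectSum.toModule_lof]
    simp [pr1Tens]

lemma in1_injective : Function.Injective (in1 A X Y) :=
  Function.LeftInverse.injective pr1_in1

lemma iota_one (X : S) : iota A X X (one A X) = 0 := by
  rw [iota, LinearMap.comp_apply, pr1_one, map_zero]

lemma pr1_cns_cns {V : S} {e : ℤ} (a : A X Z d) (b : A Z V e) (y : T A V Y) :
    pr1 A X Y (cns a (cns b y)) = 0 := by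
  induction y using T.word_induction with
  | h0 => simp
  | hadd x y hx hy => simp only [map_add, hx, hy, add_zero]
  | h w x => rw [cns_inT, cns_inT]; simp [pr1, pr1Tens]

lemma iota_cns (a : A X Z d) (y : T A Z Y) : iota A X Y (cns a y) = cns a (e0 A Z Y y) := by
  induction y using T.induction with
  | h0 => simp
  | hadd x y hx hy => simp [hx, hy]
  | hsmul c x hx => simp [hx]
  | hone X =>
    rw [etaEps_one, ← in1_inTot, iota, LinearMap.comp_apply, pr1_in1]
  | hcns b y ih =>
    rw [etaEps_cns, iota, LinearMap.comp_apply, pr1_cns_cns, map_zero, map_zero]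

lemma iota_in1 (x : Tot A X Y) : iota A X Y (in1 A X Y x) = in1 A X Y x := by
  rw [iota, LinearMap.comp_apply, pr1_in1]

lemma iota_eq_zero_iff {x : T A X Y} : iota A X Y x = 0 ↔ pr1 A X Y x = 0 := by
  rw [iota, LinearMap.comp_apply]
  exact ⟨fun h => in1_injective (by rw [h, map_zero]), fun h => by rw [h, map_zero]⟩

lemma e0_in1 (x : Tot A X Y) : e0 A X Y (in1 A X Y x) = 0 := by
  induction x using DirectSum.induction_on with
  | zero => simp
  | add x y hx hy => simp only [map_add, hx, hy, add_zero]
  | of d a => exact (congrArg _ (in1_inTot a)).trans (etaEps_cns _ a _)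

lemma iota_mulL (x : T A X Y) (y : T A Y Z) :
    iota A X Z (x ⋆ y) = e0 A X Y x ⋆ iota A Y Z y + iota A X Y x ⋆ e0 A Y Z y := by
  induction x using T.induction with
  | h0 => simp
  | hadd x y hx hy => simp only [map_add, hx, hy, LinearMap.add_apply]; abel
  | hsmul c x hx => simp [hx]
  | hone X => simp [etaEps_one, iota_one]
  | hcns a y ih => simp [etaEps_cns, iota_cns, e0_mulL]

/-- A tensor of positive length is its first letter times the rest, and `iota` on the left part
selects exactly the cut after the first letter. Applied to the value of a homomorphism or
coderivation, it expresses this value by components and by values on right parts of cuts. -/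
lemma split_left (x : T A X Y) :
    x = e0 A X Y x + sumCut (fun Z => mulL A X Z Y ∘ₗ iota A X Z) x := by
  induction x using T.induction with
  | h0 => simp
  | hadd x y hx hy => 
    conv_lhs => rw [hx, hy]
    simp only [map_add]; abel
  | hsmul c x hx => 
    conv_lhs => rw [hx]
    simp only [map_smul, smul_add]
  | hone X => simp [etaEps_one, iota_one, sumCut_one]
  | hcns a y ih =>
    rename_i X Z Y d
    have h : sumCut (fun V => (mulL A X V Y ∘ₗ iota A X V) ∘ₗ cns a) y =
        sumCut (fun V => (mulL A X V Y ∘ₗ cns a) ∘ₗ e0 A Z V) y :=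
      sumCut_congr (by simp [iota_cns]) y
    rw [etaEps_cns, sumCut_cns, LinearMap.comp_apply, iota_one, map_zero, LinearMap.zero_apply,
      zero_add, zero_add, h, sumCut_e0_left]
    simp

lemma sumCut_in1_mulL (β : ∀ Z, T A X Z →ₗ[k] T A Z Y →ₗ[k] P) (a : Tot A X W) (y : T A W Y) :
    sumCut β (in1 A X W a ⋆ y) = β X (one A X) (in1 A X W a ⋆ y) +
      sumCut (fun Z => β Z ∘ₗ mulL A X W Z (in1 A X W a)) y := by
  induction a using DirectSum.induction_on with
  | zero =>
    rw [sumCut_congr (β := fun Z => β Z ∘ₗ mulL A X W Z (in1 A X W 0)) (γ := fun _ => 0)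
      (by simp), sumCut_zero]
    simp
  | add a b ha hb =>
    have : sumCut (fun Z => β Z ∘ₗ mulL A X W Z (in1 A X W (a + b))) y =
        sumCut (fun Z => β Z ∘ₗ mulL A X W Z (in1 A X W a)) y +
          sumCut (fun Z => β Z ∘ₗ mulL A X W Z (in1 A X W b)) y := by
      rw [← sumCut_add]; exact sumCut_congr (by simp) y
    rw [this]
    simp only [map_add, LinearMap.add_apply, ha, hb]; abel
  | of d a =>
    have h : in1 A X W (DirectSum.of _ d a) = cns a (one A W) := in1_inTot a
    have h' : sumCut (fun Z => β Z ∘ₗ mulL A X W Z (cns a (one A W))) y =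
      sumCut (fun Z => β Z ∘ₗ cns a) y := sumCut_congr (by simp) y
    rw [h, h', cns_mulL, one_mulL, sumCut_cns]

lemma sumCut_in1 (β : ∀ Z, T A X Z →ₗ[k] T A Z Y →ₗ[k] P) (a : Tot A X Y) :
    sumCut β (in1 A X Y a) =
      β X (one A X) (in1 A X Y a) + β Y (in1 A X Y a) (one A Y) := by
  have := sumCut_in1_mulL β a (one A Y)
  simpa [sumCut_one] using this

/-- Coassociativity for bilinear maps that are sums over cuts. -/
lemma sumCut_assoc {β γ : ∀ Z, T A X Z →ₗ[k] T A Z Y →ₗ[k] P}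
    (τ : ∀ Z W, T A X Z →ₗ[k] T A Z W →ₗ[k] T A W Y →ₗ[k] P)
    (hβ : ∀ Z x y, β Z x y = sumCut (fun W => τ Z W x) y)
    (hγ : ∀ W x y, γ W x y = sumCut (fun Z => (τ Z W).compr₂ (LinearMap.applyₗ y)) x)
    (x : T A X Y) : sumCut β x = sumCut γ x := by
  rw [sumCut_congr (β := β) (γ := fun Z => sumCutHom A Z Y P ∘ₗ LinearMap.pi fun W => τ Z W)
    (fun Z x y => hβ Z x y), sumCut_coassoc, sumCut_congr (γ := γ)]
  intro W x y
  rw [hγ, ← map_sumCut]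
  rfl

/-! ### Cocategory homomorphisms and coderivations -/

section
variable {f g h : S → S'}

lemma sumCut_tensMap_zero (φ : TMap A B f g) (ψ : TMap A B g h)
    (β : ∀ V, T B (f X) V →ₗ[k] T B V (h Y) →ₗ[k] P) (x : T A X Y) :
    DirectSum.toModule k S' P (fun V => TensorProduct.lift (β V))
        (tensMap 0 φ ψ X Y (cut A X Y x)) =
      sumCut (fun Z => (β (g Z)).compl₁₂ (φ X Z) (ψ Z Y)) x := by
  rw [sumCut_tensMap]; simp

lemma IsCocatHom.sumCut {F : TMap A B f f} (hF : IsCocatHom F)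
    (β : ∀ V, T B (f X) V →ₗ[k] T B V (f Y) →ₗ[k] P) (x : T A X Y) :
    sumCut β (F X Y x) = sumCut (fun Z => (β (f Z)).compl₁₂ (F X Z) (F Z Y)) x := by
  rw [← sumCut_tensMap_zero, ← LinearMap.comp_apply (tensMap 0 F F X Y), ← hF.comul]
  rfl

lemma toModule_lift_inTT {X Y : S'} (z : TT B X Y) :
    DirectSum.toModule k S' (TT B X Y)
      (fun V => TensorProduct.lift (TensorProduct.curry (inTT B X V Y))) z = z := by
  induction z using DirectSum.induction_on with
  | zero => simp
  | add x y hx hy => simp only [map_add, hx, hy]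
  | of Z z =>
    change DirectSum.toModule k S' _ _ (inTT B X Z Y z) = inTT B X Z Y z
    rw [DirectSum.toModule_lof]
    exact (LinearMap.congr_fun (TensorProduct.lift_mk_compr₂ _) z)

/-- One of the test families is the tautological one with values in `TB ⊗ TB`, and it returns the
element itself. Hence comultiplication identities may be checked on bilinear forms. -/
lemma TT_ext {X Y : S'} {z z' : TT B X Y}
    (h : ∀ (P : Type u) [AddCommGroup P] [Module k P]
      (β : ∀ V, T B X V →ₗ[k] T B V Y →ₗ[k] P),
      DirectSum.toModule k S' P (fun V => TensorProduct.lift (β V)) z =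
        DirectSum.toModule k S' P (fun V => TensorProduct.lift (β V)) z') : z = z' := by
  have := h (TT B X Y) (fun V => TensorProduct.curry (inTT B X V Y))
  rw [← toModule_lift_inTT z, ← toModule_lift_inTT z']
  exact this

lemma isCocatHom_of_sumCut {F : TMap A B f f} (hom : IsHomogeneous 0 F)
    (comul : ∀ X Y x, ∀ (P : Type u) [AddCommGroup P] [Module k P],
      ∀ β : ∀ V, T B (f X) V →ₗ[k] T B V (f Y) →ₗ[k] P,
      AInf.sumCut β (F X Y x) = AInf.sumCut (fun Z => (β (f Z)).compl₁₂ (F X Z) (F Z Y)) x)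
    (counit : ∀ X Y, counit B (f X) (f Y) ∘ₗ F X Y = counit A X Y)
    (map_one : ∀ X, F X X (one A X) = one B (f X)) : IsCocatHom F where
  homogeneous := hom
  counit := counit
  map_one := map_one
  comul X Y := LinearMap.ext fun x => by
    refine TT_ext fun P _ _ β => ?_
    rw [LinearMap.comp_apply, LinearMap.comp_apply, sumCut_tensMap_zero]
    exact comul X Y x P β

lemma IsCoderivation.sumCut {p : ℤ} {F : TMap A B f f} {G : TMap A B g g} {R : TMap A B f g}
    (hR : IsCoderivation p F G R)
    (β : ∀ V, T B (f X) V →ₗ[k] T B V (g Y) →ₗ[k] P) (x : T A X Y) :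
    sumCut β (R X Y x) = sumCut (fun Z => (β (f Z)).compl₁₂ (F X Z) (R Z Y)) x +
      sumCut (fun Z => (β (g Z)).compl₁₂ (R X Z) (G Z Y ∘ₗ sgn A p Z Y)) x := by
  rw [← sumCut_tensMap_zero, ← sumCut_tensMap, ← map_add, ← LinearMap.add_apply,
    ← LinearMap.comp_apply (tensMap 0 F R X Y + tensMap p R G X Y), ← hR.comul]
  rfl

lemma isCoderivation_of_sumCut {p : ℤ} {F : TMap A B f f} {G : TMap A B g g} {R : TMap A B f g}
    (hom : IsHomogeneous p R)
    (comul : ∀ X Y x, ∀ (P : Type u) [AddCommGroup P] [Module k P],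
      ∀ β : ∀ V, T B (f X) V →ₗ[k] T B V (g Y) →ₗ[k] P,
      AInf.sumCut β (R X Y x) = AInf.sumCut (fun Z => (β (f Z)).compl₁₂ (F X Z) (R Z Y)) x +
        AInf.sumCut (fun Z => (β (g Z)).compl₁₂ (R X Z) (G Z Y ∘ₗ sgn A p Z Y)) x) :
    IsCoderivation p F G R where
  homogeneous := hom
  comul X Y := LinearMap.ext fun x => by
    refine TT_ext fun P _ _ β => ?_
    rw [LinearMap.comp_apply, LinearMap.comp_apply, LinearMap.add_apply, map_add,
      sumCut_tensMap_zero, sumCut_tensMap]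
    exact comul X Y x P β

/-- Double coderivations `Θ` of degree `m + n`, defined by the relation
`Θ Δ = Δ (F ⊗ Θ + R ⊗ P + Θ ⊗ H)`. -/
abbrev IsDoubleCoderivation (m n : ℤ) (F : TMap A B f f) (R : TMap A B f g) (P : TMap A B g h)
    (H : TMap A B h h) (Θ : TMap A B f h) : Prop :=
  IsHomogeneous (m + n) Θ ∧ ∀ {X Y : S} {Q : Type u} [AddCommGroup Q] [Module k Q]
    (β : ∀ V, T B (f X) V →ₗ[k] T B V (h Y) →ₗ[k] Q) (x : T A X Y),
      sumCut β (Θ X Y x) = sumCut (fun Z => (β (f Z)).compl₁₂ (F X Z) (Θ Z Y)) x +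
        sumCut (fun Z => (β (g Z)).compl₁₂ (R X Z) (P Z Y ∘ₗ sgn A m Z Y)) x +
        sumCut (fun Z => (β (h Z)).compl₁₂ (Θ X Z) (H Z Y ∘ₗ sgn A (m + n) Z Y)) x

lemma IsDoubleCoderivation.homogeneous {m n : ℤ} {F : TMap A B f f} {R : TMap A B f g}
    {P : TMap A B g h} {H : TMap A B h h} {Θ : TMap A B f h}
    (hΘ : IsDoubleCoderivation m n F R P H Θ) : IsHomogeneous (m + n) Θ := hΘ.1

lemma IsDoubleCoderivation.sumCut {m n : ℤ} {F : TMap A B f f} {R : TMap A B f g}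
    {P : TMap A B g h} {H : TMap A B h h} {Θ : TMap A B f h}
    (hΘ : IsDoubleCoderivation m n F R P H Θ) {Q : Type u} [AddCommGroup Q] [Module k Q]
    (β : ∀ V, T B (f X) V →ₗ[k] T B V (h Y) →ₗ[k] Q) (x : T A X Y) :
    AInf.sumCut β (Θ X Y x) = AInf.sumCut (fun Z => (β (f Z)).compl₁₂ (F X Z) (Θ Z Y)) x +
        AInf.sumCut (fun Z => (β (g Z)).compl₁₂ (R X Z) (P Z Y ∘ₗ sgn A m Z Y)) x +
        AInf.sumCut (fun Z => (β (h Z)).compl₁₂ (Θ X Z) (H Z Y ∘ₗ sgn A (m + n) Z Y)) x :=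
  hΘ.2 β x

lemma IsCocatHom.map_e0 {F : TMap A B f f} (hF : IsCocatHom F) (x : T A X Y) :
    F X Y (e0 A X Y x) = etaEps A B f X Y x := by
  induction x using T.induction with
  | h0 => simp
  | hadd x y hx hy => simp only [map_add, hx, hy]
  | hsmul c x hx => simp only [map_smul, hx]
  | hone X => rw [etaEps_one, etaEps_one, hF.map_one]
  | hcns a y _ => rw [etaEps_cns, etaEps_cns, map_zero]

lemma IsCocatHom.e0_map {F : TMap A B f f} (hF : IsCocatHom F) (x : T A X Y) :
    e0 B (f X) (f Y) (F X Y x) = etaEps A B f X Y x := by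
  induction x using T.induction with
  | h0 => simp
  | hadd x y hx hy => simp only [map_add, hx, hy]
  | hsmul c x hx => simp only [map_smul, hx]
  | hone X => rw [hF.map_one, etaEps_one, etaEps_one]
  | hcns a y _ =>
    rw [etaEps_cns]
    refine etaEps_of_counit _ ?_
    rw [← LinearMap.comp_apply, hF.counit, counit_cns]

lemma sumCut_e0_mulL_e0 (x : T A X Y) :
    sumCut (fun Z => (mulL A X Z Y).compl₁₂ (e0 A X Z) (e0 A Z Y)) x = e0 A X Y x := by
  rw [sumCut_congr (γ := fun Z => (mulL A X Z Y).compl₂ (e0 A Z Y) ∘ₗ e0 A X Z) (by simp),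
    sumCut_e0_left]
  simp

/-- Since `(ε ⊗ ε)Δ = ε`, projecting both parts of the coderivation identity to `T⁰` gives `r = r +
r` for the `T⁰` part `r` of `R`, so `r = 0`. -/
lemma IsCoderivation.e0_apply {p : ℤ} {F : TMap A B f f} {G : TMap A B g g} {R : TMap A B f g}
    (hF : IsCocatHom F) (hG : IsCocatHom G) (hR : IsCoderivation p F G R) (x : T A X Y) :
    e0 B (f X) (g Y) (R X Y x) = 0 := by
  have h := hR.sumCut (fun Z => (mulL B (f X) Z (g Y)).compl₁₂ (e0 B (f X) Z) (e0 B Z (g Y))) x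
  rw [sumCut_e0_mulL_e0, sumCut_congr
    (γ := fun Z => (mulL B (f X) (f Z) (g Y)).compl₁₂ (F X Z) (e0 B (f Z) (g Y) ∘ₗ R Z Y) ∘ₗ
      e0 A X Z) (by simp [hF.e0_map, hF.map_e0]), sumCut_e0_left, sumCut_congr
    (γ := fun Z => ((mulL B (f X) (g Z) (g Y)).compl₁₂ (e0 B (f X) (g Z) ∘ₗ R X Z)
      (G Z Y)).compl₂ (e0 A Z Y)) (by
        intro Z x y
        simp only [LinearMap.compl₁₂_apply, LinearMap.comp_apply, LinearMap.compl₂_apply,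
          hG.e0_map, hG.map_e0]
        rw [← hG.map_e0, e0_sgn, hG.map_e0]), sumCut_e0_right] at h
  simp only [LinearMap.compl₁₂_apply, LinearMap.comp_apply, hF.map_one, hG.map_one, one_mulL,
    mulL_one] at h
  simpa using h

lemma IsCoderivation.eq_left {p : ℤ} {F : TMap A B f f} {G : TMap A B g g} {R : TMap A B f g}
    (hF : IsCocatHom F) (hG : IsCocatHom G) (hR : IsCoderivation p F G R) (x : T A X Y) :
    R X Y x = AInf.sumCut (fun Z => (mulL B (f X) (f Z) (g Y)).compl₁₂
        (iota B (f X) (f Z) ∘ₗ F X Z) (R Z Y)) x +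
      AInf.sumCut (fun Z => (mulL B (f X) (g Z) (g Y)).compl₁₂
        (iota B (f X) (g Z) ∘ₗ R X Z) (G Z Y ∘ₗ sgn A p Z Y)) x := by
  conv_lhs => rw [split_left (R X Y x), hR.e0_apply hF hG, zero_add, hR.sumCut]
  rfl

lemma IsCocatHom.eq_left {F : TMap A B f f} (hF : IsCocatHom F) (x : T A X Y) :
    F X Y x = etaEps A B f X Y x + AInf.sumCut (fun Z => (mulL B (f X) (f Z) (f Y)).compl₁₂
        (iota B (f X) (f Z) ∘ₗ F X Z) (F Z Y)) x := by
  conv_lhs => rw [split_left (F X Y x), hF.e0_map, hF.sumCut]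
  rfl

/-- Induction on the length of words. -/
theorem T.length_induction {p : ∀ {X Y : S} (w : Word S X Y), Tens A w → Prop}
    (h : ∀ {X Y} (w : Word S X Y) (x : Tens A w),
      (∀ {X' Y'} (w' : Word S X' Y') (x' : Tens A w'), w'.length < w.length → p w' x') → p w x)
    {X Y : S} (w : Word S X Y) (x : Tens A w) : p w x := by
  induction hn : w.length using Nat.strong_induction_on generalizing X Y with
  | _ n ih => exact h w x fun w' x' hw' => ih _ (hn ▸ hw') w' x' rfl

lemma IsCocatHom.iota_map_nil {F : TMap A B f f} (hF : IsCocatHom F) (w : Word S X Y)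
    (hw : w.length = 0) (x : Tens A w) : iota B (f X) (f Y) (F X Y (inT A w x)) = 0 := by
  cases w with
  | nil =>
    obtain ⟨c, rfl⟩ := (tnil A X).surjective x
    rw [inT_nil, map_smul, map_smul, hF.map_one, iota_one, smul_zero]
  | cons => simp [Word.length] at hw

/-- Induction on the length of words by `IsCoderivation.eq_left`. Terms starting with a letter of
`R` vanish by hypothesis. In the other terms `F` must consume at least one letter, so `R` acts on a
shorter word. -/
theorem IsCoderivation.eq_zero {p : ℤ} {F : TMap A B f f} {G : TMap A B g g} {R : TMap A B f g}
    (hF : IsCocatHom F) (hG : IsCocatHom G) (hR : IsCoderivation p F G R)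
    (h : ∀ X Y x, pr1 B (f X) (g Y) (R X Y x) = 0) : R = 0 := by
  funext X Y
  refine LinearMap.ext fun x => ?_
  induction x using T.word_induction with
  | h0 => simp
  | hadd x y hx hy => rw [map_add, hx, hy]; simp
  | h w x =>
    change R X Y (inT A w x) = 0
    induction w, x using T.length_induction with
    | h w x ih =>
      rename_i X Y
      rw [hR.eq_left hF hG, sumCut_congr_word (γ := fun _ => 0) x, sumCut_zero, zero_add,
        sumCut_congr (γ := fun _ => 0), sumCut_zero]
      · intro Z x y
        simp [iota_eq_zero_iff.2 (h X Z x)]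
      · intro Z w₁ w₂ e x₁ x₂
        simp only [LinearMap.compl₁₂_apply, LinearMap.comp_apply, LinearMap.zero_apply]
        rcases Nat.eq_zero_or_pos w₁.length with h0 | h0
        · rw [hF.iota_map_nil w₁ h0, map_zero, LinearMap.zero_apply]
        · rw [ih w₂ x₂ (by rw [← e, Word.length_append]; omega), map_zero]

theorem IsCocatHom.ext {F G : TMap A B f f} (hF : IsCocatHom F) (hG : IsCocatHom G)
    (h : ∀ X Y x, pr1 B (f X) (f Y) (F X Y x) = pr1 B (f X) (f Y) (G X Y x)) : F = G := by
  funext X Y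
  refine LinearMap.ext fun x => ?_
  induction x using T.word_induction with
  | h0 => simp
  | hadd x y hx hy => rw [map_add, hx, hy, map_add]
  | h w x =>
    induction w, x using T.length_induction with
    | h w x ih =>
      rename_i X Y
      rw [hF.eq_left, hG.eq_left]
      refine congrArg (_ + ·) ?_
      refine sumCut_congr_word x fun Z w₁ w₂ e x₁ x₂ => ?_
      simp only [LinearMap.compl₁₂_apply, LinearMap.comp_apply]
      rcases Nat.eq_zero_or_pos w₁.length with h0 | h0
      · rw [hF.iota_map_nil w₁ h0, hG.iota_map_nil w₁ h0, map_zero, LinearMap.zero_apply,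
          LinearMap.zero_apply]
      · rw [ih w₂ x₂ (by rw [← e, Word.length_append]; omega), iota, LinearMap.comp_apply,
          LinearMap.comp_apply, h]

end

end

/-! ### Existence of coderivations, double coderivations and cocategory homomorphisms. -/

section
variable {A : GradedQuiver k S} {B : GradedQuiver k S'} {C : GradedQuiver k S''}
  {X Y Z W : S} {d : ℤ} {P Q : Type u}
  [AddCommGroup P] [Module k P] [AddCommGroup Q] [Module k Q]

local infixl:70 " ⋆ " => mulL _ _ _ _

/-! ### Cuts of convolutions -/

/-- Composition with a bilinear map, as a linear function of the outer map. -/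
def postcomp {M N U V : Type u} [AddCommGroup M] [Module k M] [AddCommGroup N] [Module k N]
    [AddCommGroup U] [Module k U] [AddCommGroup V] [Module k V] (m : M →ₗ[k] N →ₗ[k] U) :
    (U →ₗ[k] V) →ₗ[k] M →ₗ[k] N →ₗ[k] V where
  toFun l := m.compr₂ l
  map_add' _ _ := rfl
  map_smul' _ _ := rfl

lemma postcomp_apply {M N U V : Type u} [AddCommGroup M] [Module k M] [AddCommGroup N]
    [Module k N] [AddCommGroup U] [Module k U] [AddCommGroup V] [Module k V]
    (m : M →ₗ[k] N →ₗ[k] U) (l : U →ₗ[k] V) (x : M) (y : N) : postcomp m l x y = l (m x y) := rfl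

/-- The bilinear map `(u, v) ↦ ∑ γ(u v', v'')`. -/
def shift (γ : ∀ V, T A X V →ₗ[k] T A V Y →ₗ[k] P) (Z : S) : T A X Z →ₗ[k] T A Z Y →ₗ[k] P :=
  sumCutHom A Z Y P ∘ₗ LinearMap.pi fun V => (mulL A X Z V).compr₂ (γ V)

lemma shift_apply (γ : ∀ V, T A X V →ₗ[k] T A V Y →ₗ[k] P) (u : T A X Z) (v : T A Z Y) :
    shift γ Z u v = sumCut (fun V => γ V ∘ₗ mulL A X Z V u) v := rfl

section
variable {f g h l : S → S'}

lemma sgn_comp_sgn (p q : ℤ) : sgn A p X Y ∘ₗ sgn A q X Y = sgn A (p + q) X Y :=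
  LinearMap.ext fun x => sgn_sgn p q x

/-- The first factor is a single letter, so a cut lies in front of everything or behind this letter;
in the second case `shift` keeps the letter in the left part. -/
lemma sumCut_conv_inc (p : ℤ) (φ : Comps A B f g) (Ψ : TMap A B g h)
    (γ : ∀ V, T B (f X) V →ₗ[k] T B V (h Y) →ₗ[k] P) (x : T A X Y) :
    sumCut γ (conv p (inc φ) Ψ X Y x) = γ (f X) (one B (f X)) (conv p (inc φ) Ψ X Y x) +
      sumCut (fun Z => (shift γ (g Z)).compl₁₂ (inc φ X Z) (Ψ Z Y ∘ₗ sgn A p Z Y)) x := by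
  rw [conv_apply, map_sumCut, map_sumCut, ← sumCut_add]
  refine sumCut_congr (fun Z x y => ?_) x
  simp only [LinearMap.compr₂_apply, LinearMap.compl₁₂_apply, LinearMap.add_apply,
    LinearMap.comp_apply, shift_apply, inc]
  exact sumCut_in1_mulL _ _ _

/-- Associativity of convolution, for bilinear maps on the last two factors. -/
lemma sumCut_conv_assoc (p : ℤ) (φ : TMap A B f g) (a : TMap A B g h) (c : TMap A B h l)
    (γ : ∀ V, T B (f X) V →ₗ[k] T B V (l Y) →ₗ[k] P)
    (β : ∀ Z, T A X Z →ₗ[k] T A Z Y →ₗ[k] P)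
    (hβ : ∀ Z x y, β Z x y = sumCut (fun W => (γ (h W)).compl₁₂
      (mulL B (f X) (g Z) (h W) (φ X Z x) ∘ₗ a Z W) (c W Y)) (sgn A p Z Y y)) (x : T A X Y) :
    sumCut β x =
      sumCut (fun W => (γ (h W)).compl₁₂ (conv p φ a X W) (c W Y ∘ₗ sgn A p W Y)) x := by
  refine sumCut_assoc (fun Z W => ((mulL B (f X) (g Z) (h W)).compl₁₂ (φ X Z)
    (a Z W ∘ₗ sgn A p Z W)).compr₂ ((γ (h W)).compl₂ (c W Y ∘ₗ sgn A p W Y))) ?_ ?_ x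
  · intro Z x y
    rw [hβ, sumCut_sgn]
    exact sumCut_congr (by simp) y
  · intro W x y
    simp only [LinearMap.compl₁₂_apply]
    rw [conv_apply, ← LinearMap.flip_apply, map_sumCut]
    exact sumCut_congr (by simp) x

/-- The bilinear map `(x, y) ↦ ∑ γ(φ(x) a(y'), c(y''))`, with the sign of a map `φ` of degree
`p`. -/
def convTail (p : ℤ) (φ : TMap A B f g) (a : TMap A B g h) (c : TMap A B h l)
    (γ : ∀ V, T B (f X) V →ₗ[k] T B V (l Y) →ₗ[k] P) (Z : S) :
    T A X Z →ₗ[k] T A Z Y →ₗ[k] P :=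
  (sumCutHom A Z Y P ∘ₗ LinearMap.pi fun W =>
    ((mulL B (f X) (g Z) (h W)).compl₁₂ (φ X Z) (a Z W)).compr₂
      ((γ (h W)).compl₂ (c W Y))).compl₂ (sgn A p Z Y)

lemma convTail_apply (p : ℤ) (φ : TMap A B f g) (a : TMap A B g h) (c : TMap A B h l)
    (γ : ∀ V, T B (f X) V →ₗ[k] T B V (l Y) →ₗ[k] P) (x : T A X Z) (y : T A Z Y) :
    convTail p φ a c γ Z x y = sumCut (fun W => (γ (h W)).compl₁₂
      (mulL B (f X) (g Z) (h W) (φ X Z x) ∘ₗ a Z W) (c W Y)) (sgn A p Z Y y) := rfl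

lemma sumCut_convTail (p : ℤ) (φ : TMap A B f g) (a : TMap A B g h) (c : TMap A B h l)
    (γ : ∀ V, T B (f X) V →ₗ[k] T B V (l Y) →ₗ[k] P) (x : T A X Y) :
    sumCut (convTail p φ a c γ) x =
      sumCut (fun W => (γ (h W)).compl₁₂ (conv p φ a X W) (c W Y ∘ₗ sgn A p W Y)) x :=
  sumCut_conv_assoc p φ a c γ _ (fun _ _ _ => rfl) x

/-- By `sumCut_mulL` a cut of `F(x') ψ(x'')` lies in `F(x')` or in `ψ(x'')`, with the middle cut
counted twice. A cut inside `F(x')` comes from a cut of `x'`, and by coassociativity what remains to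
its right is again a convolution of `F` and `ψ`. -/
lemma sumCut_conv_hom {F : TMap A B f f} (hF : IsCocatHom F) (ψ : TMap A B f h)
    (β : ∀ V, T B (f X) V →ₗ[k] T B V (h Y) →ₗ[k] P) (x : T A X Y) :
    sumCut β (conv 0 F ψ X Y x) =
      sumCut (fun Z => (β (f Z)).compl₁₂ (F X Z) (conv 0 F ψ Z Y)) x +
      sumCut (fun Z => (shift β (f Z)).compl₁₂ (F X Z) (ψ Z Y)) x -
      sumCut (fun Z => (β (f Z)).compl₁₂ (F X Z) (ψ Z Y)) x := by
  have h1 : sumCut (fun Z => (β (f Z)).compl₁₂ (F X Z) (conv 0 F ψ Z Y)) x =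
      sumCut (fun Z => ((mulL B (f X) (f Z) (h Y)).compl₁₂ (F X Z) (ψ Z Y)).compr₂ (sumCut β) -
        (shift β (f Z)).compl₁₂ (F X Z) (ψ Z Y) + (β (f Z)).compl₁₂ (F X Z) (ψ Z Y)) x := by
    refine sumCut_assoc (fun Z W => postcomp ((mulL B (f Z) (f W) (h Y)).compl₁₂ (F Z W) (ψ W Y)) ∘ₗ
      β (f Z) ∘ₗ F X Z) ?_ ?_ x
    · intro Z x y
      rw [LinearMap.compl₁₂_apply, conv_zero_apply, map_sumCut]
      exact sumCut_congr (by simp [postcomp_apply]) y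
    · intro Z x y
      simp only [LinearMap.add_apply, LinearMap.sub_apply, LinearMap.compl₁₂_apply,
        LinearMap.compr₂_apply, shift_apply]
      rw [sumCut_mulL, hF.sumCut, add_sub_right_comm, add_sub_cancel_right, sub_add_cancel]
      exact sumCut_congr (by simp [postcomp_apply]) x
  rw [h1, sumCut_add, sumCut_sub, conv_zero_apply, map_sumCut]
  abel

lemma IsHomogeneous.etaEps (f : S → S') : IsHomogeneous 0 (etaEps A B f) := by
  rw [isHomogeneous_iff]
  refine fun X Y n => Deg.le_of_word fun w hw x => ?_
  rw [Submodule.mem_comap]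
  cases w with
  | nil =>
    obtain ⟨c, rfl⟩ := (tnil A X).surjective x
    rw [inT_nil, map_smul, etaEps_one]
    exact Submodule.smul_mem _ _ (by rw [← hw]; exact one_mem_Deg _)
  | cons X d w =>
    induction x using Tens.cons_induction with
    | h0 => simp
    | hadd x y hx hy => simpa using Submodule.add_mem _ hx hy
    | ht a x => rw [← cns_inT, etaEps_cns]; exact Submodule.zero_mem _

lemma sumCut_etaEps (f : S → S') (β : ∀ V, T B (f X) V →ₗ[k] T B V (f Y) →ₗ[k] P) (x : T A X Y) :
    sumCut β (etaEps A B f X Y x) = β (f X) (one B (f X)) (etaEps A B f X Y x) := by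
  induction x using T.induction with
  | h0 => simp
  | hadd x y hx hy => simp only [map_add, hx, hy]
  | hsmul c x hx => simp only [map_smul, hx]
  | hone X => rw [etaEps_one, sumCut_one]
  | hcns a y _ => simp [etaEps_cns]

lemma etaEps_e0 (f : S → S') (x : T A X Y) :
    etaEps A B f X Y (e0 A X Y x) = etaEps A B f X Y x := by
  induction x using T.induction with
  | h0 => simp
  | hadd x y hx hy => simp only [map_add, hx, hy]
  | hsmul c x hx => simp only [map_smul, hx]
  | hone X => rw [etaEps_one]
  | hcns a y _ => simp [etaEps_cns]

lemma e0_etaEps (f : S → S') (x : T A X Y) :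
    e0 B (f X) (f Y) (etaEps A B f X Y x) = etaEps A B f X Y x := by
  induction x using T.induction with
  | h0 => simp
  | hadd x y hx hy => simp only [map_add, hx, hy]
  | hsmul c x hx => simp only [map_smul, hx]
  | hone X => rw [etaEps_one, etaEps_one]
  | hcns a y _ => simp [etaEps_cns]

lemma iota_etaEps (f : S → S') (x : T A X Y) :
    iota B (f X) (f Y) (etaEps A B f X Y x) = 0 := by
  induction x using T.induction with
  | h0 => simp
  | hadd x y hx hy => simp only [map_add, hx, hy, add_zero]
  | hsmul c x hx => simp only [map_smul, hx, smul_zero]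
  | hone X => rw [etaEps_one, iota_one]
  | hcns a y _ => simp [etaEps_cns]

lemma sumCut_etaEps_left (f : S → S') (β : ∀ Z, T B (f X) (f Z) →ₗ[k] T A Z Y →ₗ[k] P)
    (x : T A X Y) :
    sumCut (fun Z => β Z ∘ₗ etaEps A B f X Z) x = β X (one B (f X)) x := by
  rw [← etaEps_one (A := A), ← LinearMap.comp_apply,
    ← sumCut_e0_left (fun Z => β Z ∘ₗ etaEps A B f X Z)]
  exact sumCut_congr (by simp [etaEps_e0]) x

lemma sumCut_etaEps_right (f : S → S') (β : ∀ Z, T A X Z →ₗ[k] T B (f Z) (f Y) →ₗ[k] P)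
    (x : T A X Y) :
    sumCut (fun Z => (β Z).compl₂ (etaEps A B f Z Y)) x = β Y x (one B (f Y)) := by
  rw [← etaEps_one (A := A), ← LinearMap.compl₂_apply (β Y),
    ← sumCut_e0_right (fun Z => (β Z).compl₂ (etaEps A B f Z Y))]
  exact sumCut_congr (by simp [etaEps_e0]) x

/-! ### Existence of coderivations -/

lemma iota_inc (φ : Comps A B f g) (x : T A X Y) :
    iota B (f X) (g Y) (inc φ X Y x) = inc φ X Y x := iota_in1 _

lemma e0_inc (φ : Comps A B f g) (x : T A X Y) :
    e0 B (f X) (g Y) (inc φ X Y x) = 0 := e0_in1 _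

lemma e0_conv_inc (p : ℤ) (φ : Comps A B f g) (Ψ : TMap A B g h) (x : T A X Y) :
    e0 B (f X) (h Y) (conv p (inc φ) Ψ X Y x) = 0 := by
  rw [conv_apply, map_sumCut, sumCut_congr (γ := fun _ => 0), sumCut_zero]
  intro Z x y
  simp [e0_mulL, e0_inc]

lemma iota_conv_inc {G : TMap A B g g} (hG : IsCocatHom G) (p : ℤ) (φ : Comps A B f g)
    (x : T A X Y) :
    iota B (f X) (g Y) (conv p (inc φ) G X Y x) = inc φ X Y x := by
  rw [conv_apply, map_sumCut, sumCut_congr (γ := fun Z =>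
    (((mulL B (f X) (g Z) (g Y)) ∘ₗ inc φ X Z).compl₂ (etaEps A B g Z Y))),
    sumCut_etaEps_right g (fun Z => mulL B (f X) (g Z) (g Y) ∘ₗ inc φ X Z)]
  · simp
  · intro Z x y
    simp only [LinearMap.compr₂_apply, LinearMap.compl₁₂_apply, LinearMap.comp_apply, iota_mulL,
      e0_inc, iota_inc, map_zero, LinearMap.zero_apply, zero_add, LinearMap.compl₂_apply, hG.e0_map]
    rw [← etaEps_e0, e0_sgn, etaEps_e0]

/-- As `ψ` has no part in `T⁰`, a product `F(x') ψ(x'')` reaches `T¹` only through the `T⁰` part of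
`F(x')`, that is, for `x'` in `T⁰`. -/
lemma iota_conv_hom {F : TMap A B f f} (hF : IsCocatHom F) (ψ : TMap A B f h)
    (hψ : ∀ X Y x, e0 B (f X) (h Y) (ψ X Y x) = 0) (x : T A X Y) :
    iota B (f X) (h Y) (conv 0 F ψ X Y x) = iota B (f X) (h Y) (ψ X Y x) := by
  rw [conv_zero_apply, map_sumCut, sumCut_congr (γ := fun Z =>
    (((mulL B (f X) (f Z) (h Y)).compl₂ (iota B (f Z) (h Y) ∘ₗ ψ Z Y)) ∘ₗ etaEps A B f X Z)),
    sumCut_etaEps_left f (fun Z => (mulL B (f X) (f Z) (h Y)).compl₂ (iota B (f Z) (h Y) ∘ₗ ψ Z Y))]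
  · simp
  · intro Z x y
    simp [iota_mulL, hF.e0_map, hψ]

lemma e0_conv_hom {F : TMap A B f f} (ψ : TMap A B f h)
    (hψ : ∀ X Y x, e0 B (f X) (h Y) (ψ X Y x) = 0) (x : T A X Y) :
    e0 B (f X) (h Y) (conv 0 F ψ X Y x) = 0 := by
  rw [conv_zero_apply, map_sumCut, sumCut_congr (γ := fun _ => 0), sumCut_zero]
  intro Z x y
  simp [e0_mulL, hψ]

lemma sumCut_conv_inc_hom {G : TMap A B g g} (hG : IsCocatHom G) (p : ℤ) (φ : Comps A B f g)
    (γ : ∀ V, T B (f X) V →ₗ[k] T B V (g Y) →ₗ[k] P) (x : T A X Y) :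
    sumCut γ (conv p (inc φ) G X Y x) = γ (f X) (one B (f X)) (conv p (inc φ) G X Y x) +
      sumCut (fun Z => (γ (g Z)).compl₁₂ (conv p (inc φ) G X Z) (G Z Y ∘ₗ sgn A p Z Y)) x := by
  rw [sumCut_conv_inc]
  congr 1
  refine sumCut_conv_assoc p (inc φ) G G γ _ (fun Z x y => ?_) x
  rw [LinearMap.compl₁₂_apply, shift_apply, LinearMap.comp_apply, hG.sumCut]
  rfl

/-- In `f ⊗ ⋯ ⊗ f ⊗ φ ⊗ g ⊗ ⋯ ⊗ g`, cuts left of `φ` give `F ⊗ R` and cuts right of `φ` give `R ⊗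
G`. `sumCut_conv_hom` separates the two kinds and `sumCut_conv_inc_hom` evaluates the second. -/
theorem isCoderivation_coderivation {p : ℤ} {F : TMap A B f f} {G : TMap A B g g}
    (hF : IsCocatHom F) (hG : IsCocatHom G) {φ : Comps A B f g} (hφ : IsHomogeneous p (inc φ)) :
    IsCoderivation p F G (coderivation p F φ G) := by
  refine isCoderivation_of_sumCut
    (hF.homogeneous.conv (hφ.conv hG.homogeneous (add_zero p)) (zero_add p)) ?_
  intro X Y x P _ _ β
  rw [coderivation, sumCut_conv_hom hF, add_sub_assoc, ← sumCut_sub]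
  congr 1
  rw [sumCut_conv_assoc 0 F (conv p (inc φ) G) (fun Z Y => G Z Y ∘ₗ sgn A p Z Y) β]
  · simp
  · intro Z x y
    simp only [LinearMap.sub_apply, LinearMap.compl₁₂_apply, shift_apply, sgn_zero,
      LinearMap.id_apply]
    rw [sumCut_conv_inc_hom hG, LinearMap.comp_apply, mulL_one, add_sub_cancel_left]
    rfl

theorem pr1_coderivation {p : ℤ} {F : TMap A B f f} {G : TMap A B g g}
    (hF : IsCocatHom F) (hG : IsCocatHom G) (φ : Comps A B f g) (x : T A X Y) :
    pr1 B (f X) (g Y) (coderivation p F φ G X Y x) = φ X Y x := by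
  refine in1_injective ?_
  change iota B (f X) (g Y) (coderivation p F φ G X Y x) = inc φ X Y x
  rw [coderivation, iota_conv_hom hF _ (fun X Y x => e0_conv_inc p φ G x), iota_conv_inc hG]

lemma IsCoderivation.sub {p : ℤ} {F : TMap A B f f} {G : TMap A B g g} {R R' : TMap A B f g}
    (hR : IsCoderivation p F G R) (hR' : IsCoderivation p F G R') :
    IsCoderivation p F G (R - R') := by
  refine isCoderivation_of_sumCut ?_ ?_
  · rw [isHomogeneous_iff]
    exact fun X Y n x hx => (Deg B (n + p) (f X) (g Y)).sub_mem
      (isHomogeneous_iff.1 hR.homogeneous X Y n hx) (isHomogeneous_iff.1 hR'.homogeneous X Y n hx)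
  · intro X Y x P _ _ β
    change AInf.sumCut β (R X Y x - R' X Y x) = _
    rw [map_sub, hR.sumCut, hR'.sumCut, add_sub_add_comm, ← sumCut_sub, ← sumCut_sub]
    congr 1
    · exact sumCut_congr (by simp) x
    · exact sumCut_congr (by simp) x

theorem IsCoderivation.ext {p : ℤ} {F : TMap A B f f} {G : TMap A B g g} {R R' : TMap A B f g}
    (hF : IsCocatHom F) (hG : IsCocatHom G) (hR : IsCoderivation p F G R)
    (hR' : IsCoderivation p F G R')
    (h : ∀ X Y x, pr1 B (f X) (g Y) (R X Y x) = pr1 B (f X) (g Y) (R' X Y x)) : R = R' := by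
  refine sub_eq_zero.1 ((hR.sub hR').eq_zero hF hG fun X Y x => ?_)
  change pr1 B (f X) (g Y) (R X Y x - R' X Y x) = 0
  rw [map_sub, h, sub_self]

lemma isHomogeneous_iota : IsHomogeneous 0 (iota A) := by
  rw [isHomogeneous_iff]
  refine fun X Y n => Deg.le_of_word fun w hw x => ?_
  rw [Submodule.mem_comap]
  cases w with
  | nil =>
    obtain ⟨c, rfl⟩ := (tnil A X).surjective x
    rw [inT_nil, map_smul, iota_one, smul_zero]
    exact Submodule.zero_mem _
  | cons X d w =>
    induction x using Tens.cons_induction with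
    | h0 => simp
    | hadd x y hx hy => simpa using Submodule.add_mem _ hx hy
    | ht a x =>
      rw [← cns_inT, iota_cns]
      exact cns_mem_Deg a (isHomogeneous_iff.1 (IsHomogeneous.etaEps fun X => X) _ _ _
        (inT_mem_Deg w x rfl)) (by rw [← hw, Word.degree]; ring)

lemma IsHomogeneous.comp {f' : S' → S''} {g' : S' → S''} {p q r : ℤ} {R : TMap A B f g}
    {R' : TMap B C f' g'} (hR' : IsHomogeneous q R') (hR : IsHomogeneous p R) (hr : p + q = r) :
    IsHomogeneous (f := fun X => f' (f X)) (g := fun X => g' (g X)) r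
      (fun X Y => R' (f X) (g Y) ∘ₗ R X Y) := by
  rw [isHomogeneous_iff] at *
  intro X Y n x hx
  have := hR' _ _ _ (hR _ _ _ hx)
  rw [add_assoc, hr] at this
  exact this

lemma IsHomogeneous.inc_comps {p : ℤ} {R : TMap A B f g} (hR : IsHomogeneous p R) :
    IsHomogeneous p (inc (comps R)) := isHomogeneous_iota.comp hR (add_zero p)

theorem IsCoderivation.eq_coderivation {p : ℤ} {F : TMap A B f f} {G : TMap A B g g}
    {R : TMap A B f g} (hF : IsCocatHom F) (hG : IsCocatHom G) (hR : IsCoderivation p F G R) :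
    R = coderivation p F (comps R) G := by
  refine hR.ext hF hG (isCoderivation_coderivation hF hG hR.homogeneous.inc_comps) ?_
  intro X Y x
  rw [pr1_coderivation hF hG]
  rfl

/-! ### Double coderivations -/

/-- A cut of `f ⋯ f r g ⋯ g p h ⋯ h` lies left of `r`, between `r` and `p`, or right of `p`; these
give the three terms of the defining relation. -/
theorem isDoubleCoderivation_theta {m n : ℤ} {F : TMap A B f f} {R : TMap A B f g}
    {G : TMap A B g g} {P : TMap A B g h} {H : TMap A B h h} (hF : IsCocatHom F)
    (hG : IsCocatHom G) (hH : IsCocatHom H) (hR : IsCoderivation m F G R)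
    (hP : IsCoderivation n G H P) :
    IsDoubleCoderivation m n F R P H (theta m n F R G P H) := by
  -- The block `g ⋯ g p h ⋯ h` is the expansion of `P` by its components, and `f ⋯ f r g ⋯ g` that
  -- of `R`, so these convolutions collapse.
  have hP' : conv 0 G (conv n (inc (comps P)) H) = P := (hP.eq_coderivation hG hH).symm
  have hR' : conv 0 F (conv m (inc (comps R)) G) = R := (hR.eq_coderivation hF hG).symm
  rw [theta, hP']
  refine ⟨hF.homogeneous.conv (hR.homogeneous.inc_comps.conv hP.homogeneous rfl) (zero_add _), ?_⟩
  intro X Y Q _ _ β x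
  have key : ∀ {X Y : S} (γ : ∀ V, T B (f X) V →ₗ[k] T B V (h Y) →ₗ[k] Q) (y : T A X Y),
      sumCut γ (conv m (inc (comps R)) P X Y y) =
        γ (f X) (one B (f X)) (conv m (inc (comps R)) P X Y y) +
        (sumCut (fun Z => (γ (g Z)).compl₁₂ (conv m (inc (comps R)) G X Z)
          (P Z Y ∘ₗ sgn A m Z Y)) y +
        sumCut (fun Z => (γ (h Z)).compl₁₂ (conv m (inc (comps R)) P X Z)
          (H Z Y ∘ₗ sgn A (m + n) Z Y)) y) := by
    intro X Y γ y
    rw [sumCut_conv_inc]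
    congr 1
    have h1 := sumCut_convTail m (inc (comps R)) P (fun Z Y => H Z Y ∘ₗ sgn A n Z Y) γ y
    simp only [LinearMap.comp_assoc, sgn_comp_sgn, add_comm n m] at h1
    rw [← h1, ← sumCut_convTail, ← sumCut_add]
    refine sumCut_congr (fun Z x y => ?_) y
    rw [LinearMap.add_apply, LinearMap.add_apply, convTail_apply, convTail_apply,
      LinearMap.compl₁₂_apply, shift_apply, LinearMap.comp_apply, hP.sumCut]
    rfl
  have h1 := sumCut_convTail 0 F (conv m (inc (comps R)) G) (fun Z Y => P Z Y ∘ₗ sgn A m Z Y) β x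
  have h2 := sumCut_convTail 0 F (conv m (inc (comps R)) P)
    (fun Z Y => H Z Y ∘ₗ sgn A (m + n) Z Y) β x
  simp only [sgn_zero, LinearMap.comp_id, hR'] at h1 h2
  rw [sumCut_conv_hom hF, add_sub_assoc, ← sumCut_sub, add_assoc, ← h1, ← h2]
  congr 1
  rw [← sumCut_add]
  refine sumCut_congr (fun Z x y => ?_) x
  simp only [LinearMap.sub_apply, LinearMap.compl₁₂_apply, LinearMap.add_apply, convTail_apply,
    shift_apply, sgn_zero, LinearMap.id_apply]
  have h3 := key (fun V => β V ∘ₗ mulL B (f X) (f Z) V (F X Z x)) y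
  rw [LinearMap.comp_apply, mulL_one] at h3
  rw [h3, add_sub_cancel_left]
  rfl

/-- Every term contains the two letters `r` and `p`, so none lies in `T¹`. -/
lemma pr1_theta {m n : ℤ} {F : TMap A B f f} {R : TMap A B f g}
    {G : TMap A B g g} {P : TMap A B g h} {H : TMap A B h h} (hF : IsCocatHom F)
    (x : T A X Y) :
    pr1 B (f X) (h Y) (theta m n F R G P H X Y x) = 0 := by
  rw [← iota_eq_zero_iff, theta, iota_conv_hom hF _ (fun X Y x => e0_conv_inc _ _ _ x), conv_apply,
    map_sumCut, sumCut_congr (γ := fun _ => 0), sumCut_zero]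
  intro Z x y
  simp only [LinearMap.compr₂_apply, LinearMap.compl₁₂_apply, LinearMap.comp_apply, iota_mulL,
    e0_inc, map_zero, LinearMap.zero_apply, zero_add]
  rw [e0_conv_hom _ fun X Y x => e0_conv_inc _ _ _ x, map_zero]

/-- The term `R ⊗ P` does not involve `Θ` and cancels. Thus the double coderivations for fixed data
form a torsor under coderivations, which makes it possible to reduce statements about them to
`theta`. -/
lemma IsDoubleCoderivation.sub {m n : ℤ} {F : TMap A B f f} {R : TMap A B f g}
    {P : TMap A B g h} {H : TMap A B h h} {Θ Θ' : TMap A B f h}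
    (hΘ : IsDoubleCoderivation m n F R P H Θ) (hΘ' : IsDoubleCoderivation m n F R P H Θ') :
    IsCoderivation (m + n) F H (Θ - Θ') := by
  refine isCoderivation_of_sumCut ?_ ?_
  · rw [isHomogeneous_iff]
    exact fun X Y l x hx => (Deg B (l + (m + n)) (f X) (h Y)).sub_mem
      (isHomogeneous_iff.1 hΘ.homogeneous X Y l hx) (isHomogeneous_iff.1 hΘ'.homogeneous X Y l hx)
  · intro X Y x P _ _ β
    change AInf.sumCut β (Θ X Y x - Θ' X Y x) = _
    rw [map_sub, hΘ.sumCut, hΘ'.sumCut, add_sub_add_comm, add_sub_add_comm, sub_self, add_zero,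
      ← sumCut_sub, ← sumCut_sub]
    congr 1
    · exact sumCut_congr (by simp) x
    · exact sumCut_congr (by simp) x

lemma IsDoubleCoderivation.sub_coderivation {m n q : ℤ} {F : TMap A B f f} {R : TMap A B f g}
    {P : TMap A B g h} {H : TMap A B h h} {Θ V : TMap A B f h}
    (hΘ : IsDoubleCoderivation m n F R P H Θ) (hV : IsCoderivation q F H V) (hq : m + n = q) :
    IsDoubleCoderivation m n F R P H (Θ - V) := by
  subst hq
  refine ⟨?_, ?_⟩
  · rw [isHomogeneous_iff]
    exact fun X Y l x hx => (Deg B (l + (m + n)) (f X) (h Y)).sub_mem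
      (isHomogeneous_iff.1 hΘ.homogeneous X Y l hx) (isHomogeneous_iff.1 hV.homogeneous X Y l hx)
  · intro X Y P _ _ β x
    change AInf.sumCut β (Θ X Y x - V X Y x) = _
    rw [map_sub, hΘ.sumCut, hV.sumCut, add_sub_add_comm, add_sub_right_comm, ← sumCut_sub,
      ← sumCut_sub]
    congr 1
    · congr 1
      exact sumCut_congr (by simp) x
    · exact sumCut_congr (by simp) x

/-! ### Existence of cocategory homomorphisms -/

section
variable {φ : Comps A B f f}

lemma inc_nil (h1 : ∀ X, φ X X (one A X) = 0) (w : Word S X Y) (hw : w.length = 0)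
    (x : Tens A w) : inc φ X Y (inT A w x) = 0 := by
  cases w with
  | nil =>
    obtain ⟨c, rfl⟩ := (tnil A X).surjective x
    rw [inT_nil, map_smul, inc, LinearMap.comp_apply, h1, map_zero, smul_zero]
  | cons => simp [Word.length] at hw

/-- Each factor `φ` vanishes on `T⁰` and so uses up at least one letter. Consequently the bound in
the sum defining `cocatHom` can be raised at will. -/
lemma convPow_of_length_lt (h1 : ∀ X, φ X X (one A X) = 0) (n : ℕ) (w : Word S X Y) (x : Tens A w)
    (hw : w.length < n) : convPow φ n X Y (inT A w x) = 0 := by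
  induction n generalizing X Y with
  | zero => omega
  | succ n ih =>
    rw [convPow, conv_zero_apply, sumCut_congr_word (γ := fun _ => 0) x, sumCut_zero]
    intro Z w₁ w₂ e x₁ x₂
    rw [LinearMap.compl₁₂_apply]
    rcases Nat.eq_zero_or_pos w₁.length with h0 | h0
    · rw [inc_nil h1 w₁ h0]; simp
    · rw [ih w₂ x₂ (by rw [← e, Word.length_append] at hw; omega)]; simp

lemma cocatHom_inT (h1 : ∀ X, φ X X (one A X) = 0) (w : Word S X Y) (x : Tens A w) {N : ℕ}
    (hN : w.length < N) :
    cocatHom φ X Y (inT A w x) = ∑ n ∈ Finset.range N, convPow φ n X Y (inT A w x) := by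
  rw [cocatHom, DirectSum.toModule_lof, LinearMap.comp_apply, LinearMap.sum_apply]
  refine Finset.sum_subset (by intro n; simp only [Finset.mem_range]; omega) fun n _ hn => ?_
  exact convPow_of_length_lt h1 n w x (by simp only [Finset.mem_range] at hn; omega)

lemma cocatHom_eq (h1 : ∀ X, φ X X (one A X) = 0) (x : T A X Y) :
    cocatHom φ X Y x = etaEps A B f X Y x + conv 0 (inc φ) (cocatHom φ) X Y x := by
  induction x using T.word_induction with
  | h0 => simp
  | hadd x y hx hy => simp only [map_add, hx, hy]; abel
  | h w x =>
    -- With the bound `w.length + 2`, removal of the zeroth power leaves `w.length + 1` terms, still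
    -- enough for the right part of any cut of `w`.
    rw [cocatHom_inT h1 w x (N := w.length + 1 + 1) (by omega), Finset.sum_range_succ', add_comm]
    congr 1
    simp only [convPow, conv_zero_apply]
    have : ∑ n ∈ Finset.range (w.length + 1), sumCut (fun Z =>
        (mulL B (f X) (f Z) (f Y)).compl₁₂ (inc φ X Z) (convPow φ n Z Y)) (inT A w x) =
        sumCut (fun Z => ∑ n ∈ Finset.range (w.length + 1),
          (mulL B (f X) (f Z) (f Y)).compl₁₂ (inc φ X Z) (convPow φ n Z Y)) (inT A w x) := by
      have := LinearMap.congr_fun (map_sum (sumCutHom A X Y (T B (f X) (f Y))) (fun n Z =>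
        (mulL B (f X) (f Z) (f Y)).compl₁₂ (inc φ X Z) (convPow φ n Z Y))
          (Finset.range (w.length + 1))) (inT A w x)
      rw [LinearMap.sum_apply] at this
      refine this.symm.trans ?_
      rw [Finset.sum_fn]
      rfl
    rw [this]
    refine sumCut_congr_word x fun Z w₁ w₂ e x₁ x₂ => ?_
    simp only [LinearMap.sum_apply, LinearMap.compl₁₂_apply]
    rw [← map_sum, cocatHom_inT h1 w₂ x₂]
    rw [← e, Word.length_append]; omega

/-- Induction on length by the recursion `F = ηε + φ * F` of `cocatHom_eq`: a cut of `φ(x') F(x'')`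
lies in front of the letter `φ(x')` or inside `F(x'')`, where the induction hypothesis applies. -/
theorem isCocatHom_cocatHom (hφ : IsHomogeneous 0 (inc φ)) (h1 : ∀ X, φ X X (one A X) = 0) :
    IsCocatHom (cocatHom φ) := by
  have hone : ∀ X, cocatHom φ X X (one A X) = one B (f X) := fun X => by
    rw [cocatHom_eq h1, etaEps_one, conv_one, inc, LinearMap.comp_apply, h1]; simp
  refine isCocatHom_of_sumCut ?_ ?_ ?_ hone
  · have hp : ∀ n, IsHomogeneous 0 (convPow φ n) := by
      intro n
      induction n with
      | zero => exact IsHomogeneous.etaEps f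
      | succ n ih => exact hφ.conv ih (add_zero 0)
    rw [isHomogeneous_iff]
    refine fun X Y n => Deg.le_of_word fun w hw x => ?_
    rw [Submodule.mem_comap, cocatHom_inT h1 w x (Nat.lt_succ_self _)]
    exact Submodule.sum_mem _ fun i _ => isHomogeneous_iff.1 (hp i) X Y n (inT_mem_Deg w x hw)
  · intro X Y x P _ _ β
    induction x using T.word_induction with
    | h0 => simp
    | hadd x y hx hy => simp only [map_add, hx, hy]
    | h w x =>
      induction w, x using T.length_induction with
      | h w x ih =>
        rename_i X Y
        have h2 : sumCut (fun Z => (β (f Z)).compl₁₂ (cocatHom φ X Z) (cocatHom φ Z Y))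
            (inT A w x) = sumCut (fun Z => ((β (f Z)).compl₂ (cocatHom φ Z Y)) ∘ₗ etaEps A B f X Z)
              (inT A w x) + sumCut (fun Z => (β (f Z)).compl₁₂
                (conv 0 (inc φ) (cocatHom φ) X Z) (cocatHom φ Z Y)) (inT A w x) := by
          rw [← sumCut_add]
          refine sumCut_congr (fun Z x y => ?_) _
          simp [cocatHom_eq h1 x]
        have h3 := sumCut_convTail 0 (inc φ) (cocatHom φ) (cocatHom φ) β (inT A w x)
        simp only [sgn_zero, LinearMap.comp_id] at h3
        rw [h2, sumCut_etaEps_left f (fun Z => (β (f Z)).compl₂ (cocatHom φ Z Y)), ← h3]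
        conv_lhs => rw [cocatHom_eq h1]
        rw [map_add, sumCut_etaEps, sumCut_conv_inc, ← add_assoc, ← map_add, ← cocatHom_eq h1,
          LinearMap.compl₂_apply]
        refine congrArg (_ + ·) ?_
        refine sumCut_congr_word x fun Z w₁ w₂ e x₁ x₂ => ?_
        rw [LinearMap.compl₁₂_apply]
        simp only [convTail_apply, sgn_zero, LinearMap.comp_id, LinearMap.id_apply]
        -- Since `φ` vanishes on `T⁰`, only a nonempty left part contributes, and then the right
        -- part is shorter.
        rcases Nat.eq_zero_or_pos w₁.length with h0 | h0
        · rw [inc_nil h1 w₁ h0, map_zero, LinearMap.zero_apply,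
            sumCut_congr (γ := fun _ => 0) (by simp), sumCut_zero]
        · rw [shift_apply, ih w₂ x₂ (by rw [← e, Word.length_append]; omega)]
          rfl
  · intro X Y
    refine LinearMap.ext fun x => ?_
    rw [LinearMap.comp_apply]
    induction x using T.induction with
    | h0 => simp
    | hadd x y hx hy => simp only [map_add, hx, hy]
    | hsmul c x hx => simp only [map_smul, hx]
    | hone X => rw [hone, counit_one, counit_one]
    | hcns a y _ =>
      rw [cocatHom_eq h1, etaEps_cns, zero_add, counit_cns, conv_zero_apply, map_sumCut,
        sumCut_congr (γ := fun _ => 0), sumCut_zero]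
      intro Z x y
      rw [LinearMap.compr₂_apply, LinearMap.compl₁₂_apply, inc, LinearMap.comp_apply]
      generalize φ _ Z x = u
      induction u using DirectSum.induction_on with
      | zero => simp
      | add u v hu hv => simp only [map_add, LinearMap.add_apply, hu, hv]; simp
      | of d a =>
        have h : in1 B _ _ (DirectSum.of _ d a) = cns a (one B _) := in1_inTot a
        rw [h, cns_mulL, counit_cns]; rfl

theorem pr1_cocatHom (hφ : IsHomogeneous 0 (inc φ)) (h1 : ∀ X, φ X X (one A X) = 0)
    (x : T A X Y) : pr1 B (f X) (f Y) (cocatHom φ X Y x) = φ X Y x := by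
  refine in1_injective ?_
  change iota B (f X) (f Y) (cocatHom φ X Y x) = inc φ X Y x
  rw [cocatHom_eq h1, map_add, iota_etaEps, zero_add, iota_conv_inc (isCocatHom_cocatHom hφ h1)]

end

end

end

/-! ### Compositions, commutators with the codifferential, and idempotency. -/

section
variable {A : GradedQuiver k S} {B : GradedQuiver k S'} {C : GradedQuiver k S''}
  {X Y Z W : S} {d : ℤ} {P Q : Type u}
  [AddCommGroup P] [Module k P] [AddCommGroup Q] [Module k Q]

local infixl:70 " ⋆ " => mulL _ _ _ _

/-! ### Composition of homomorphisms and coderivations -/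

lemma isCocatHom_idT : IsCocatHom (idT A) :=
  isCocatHom_of_sumCut
    (fun X Y w x w' hw' => inT_apply_of_ne (by rintro rfl; simp at hw') x)
    (fun X Y x P _ _ β => sumCut_congr (fun Z x y => rfl) x) (fun X Y => rfl) (fun X => rfl)

lemma counit_etaEps (f : S → S') (x : T A X Y) :
    counit B (f X) (f Y) (etaEps A B f X Y x) = counit A X Y x := by
  induction x using T.induction with
  | h0 => simp
  | hadd x y hx hy => simp only [map_add, hx, hy]
  | hsmul c x hx => simp only [map_smul, hx]
  | hone X => rw [etaEps_one, counit_one, counit_one]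
  | hcns a y _ => rw [etaEps_cns, counit_cns, map_zero]

lemma isCocatHom_etaEps (f : S → S') : IsCocatHom (etaEps A B f) := by
  refine isCocatHom_of_sumCut (IsHomogeneous.etaEps f) ?_
    (fun X Y => LinearMap.ext fun x => counit_etaEps f x) (fun X => etaEps_one f X)
  intro X Y x P _ _ β
  have h := sumCut_etaEps_left f (fun Z => (β (f Z)).compl₂ (etaEps A B f Z Y)) x
  rw [sumCut_etaEps]
  exact h.symm

section
variable {f g h : S → S'} {f' g' h' : S' → S''}

lemma IsCocatHom.comp {F : TMap A B f f} {F' : TMap B C f' f'} (hF' : IsCocatHom F')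
    (hF : IsCocatHom F) :
    IsCocatHom (f := fun X => f' (f X)) (fun X Y => F' (f X) (f Y) ∘ₗ F X Y) := by
  refine isCocatHom_of_sumCut (hF'.homogeneous.comp hF.homogeneous (add_zero 0)) ?_ ?_ ?_
  · intro X Y x P _ _ β
    rw [LinearMap.comp_apply, hF'.sumCut, hF.sumCut]
    rfl
  · intro X Y
    rw [← LinearMap.comp_assoc, hF'.counit, hF.counit]
  · intro X
    rw [LinearMap.comp_apply, hF.map_one, hF'.map_one]

lemma IsCoderivation.comp_hom {p : ℤ} {E : TMap A B f f} {F : TMap B C f' f'}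
    {G : TMap B C g' g'} {R : TMap B C f' g'} (hR : IsCoderivation p F G R) (hE : IsCocatHom E) :
    IsCoderivation (f := fun X => f' (f X)) (g := fun X => g' (f X)) p
      (fun X Y => F (f X) (f Y) ∘ₗ E X Y) (fun X Y => G (f X) (f Y) ∘ₗ E X Y)
      (fun X Y => R (f X) (f Y) ∘ₗ E X Y) := by
  refine isCoderivation_of_sumCut (hR.homogeneous.comp hE.homogeneous (zero_add p)) ?_
  intro X Y x P _ _ β
  rw [LinearMap.comp_apply, hR.sumCut, hE.sumCut, hE.sumCut]
  congr 1
  refine sumCut_congr (fun Z x y => ?_) x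
  simp only [LinearMap.compl₁₂_apply, LinearMap.comp_apply, hE.homogeneous.sgn]
  simp

lemma IsCoderivation.hom_comp {p : ℤ} {E : TMap B C f' f'} {F : TMap A B f f}
    {G : TMap A B g g} {R : TMap A B f g} (hE : IsCocatHom E) (hR : IsCoderivation p F G R) :
    IsCoderivation (f := fun X => f' (f X)) (g := fun X => f' (g X)) p
      (fun X Y => E (f X) (f Y) ∘ₗ F X Y) (fun X Y => E (g X) (g Y) ∘ₗ G X Y)
      (fun X Y => E (f X) (g Y) ∘ₗ R X Y) := by
  refine isCoderivation_of_sumCut (hE.homogeneous.comp hR.homogeneous (add_zero p)) ?_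
  intro X Y x P _ _ β
  rw [LinearMap.comp_apply, hE.sumCut, hR.sumCut]
  rfl

lemma IsDoubleCoderivation.comp_hom {m n : ℤ} {E : TMap A B f f} {F : TMap B C f' f'}
    {H : TMap B C h' h'} {R : TMap B C f' g'} {P : TMap B C g' h'} {Θ : TMap B C f' h'}
    (hΘ : IsDoubleCoderivation m n F R P H Θ) (hE : IsCocatHom E) :
    IsDoubleCoderivation (f := fun X => f' (f X)) (g := fun X => g' (f X))
      (h := fun X => h' (f X)) m n
      (fun X Y => F (f X) (f Y) ∘ₗ E X Y) (fun X Y => R (f X) (f Y) ∘ₗ E X Y)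
      (fun X Y => P (f X) (f Y) ∘ₗ E X Y) (fun X Y => H (f X) (f Y) ∘ₗ E X Y)
      (fun X Y => Θ (f X) (f Y) ∘ₗ E X Y) := by
  refine ⟨hΘ.homogeneous.comp hE.homogeneous (zero_add _), ?_⟩
  intro X Y Q _ _ β x
  rw [LinearMap.comp_apply, hΘ.sumCut, hE.sumCut, hE.sumCut, hE.sumCut]
  congr 1
  · congr 1
    refine sumCut_congr (fun Z x y => ?_) x
    simp only [LinearMap.compl₁₂_apply, LinearMap.comp_apply, hE.homogeneous.sgn]
    simp
  · refine sumCut_congr (fun Z x y => ?_) x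
    simp only [LinearMap.compl₁₂_apply, LinearMap.comp_apply, hE.homogeneous.sgn]
    simp

lemma IsDoubleCoderivation.hom_comp {m n : ℤ} {E : TMap B C f' f'} {F : TMap A B f f}
    {H : TMap A B h h} {R : TMap A B f g} {P : TMap A B g h} {Θ : TMap A B f h}
    (hE : IsCocatHom E) (hΘ : IsDoubleCoderivation m n F R P H Θ) :
    IsDoubleCoderivation (f := fun X => f' (f X)) (g := fun X => f' (g X))
      (h := fun X => f' (h X)) m n
      (fun X Y => E (f X) (f Y) ∘ₗ F X Y) (fun X Y => E (f X) (g Y) ∘ₗ R X Y)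
      (fun X Y => E (g X) (h Y) ∘ₗ P X Y) (fun X Y => E (h X) (h Y) ∘ₗ H X Y)
      (fun X Y => E (f X) (h Y) ∘ₗ Θ X Y) := by
  refine ⟨hE.homogeneous.comp hΘ.homogeneous (add_zero _), ?_⟩
  intro X Y Q _ _ β x
  rw [LinearMap.comp_apply, hE.sumCut, hΘ.sumCut]
  rfl

/-! ### Commutators with the codifferential -/

section
variable {b : TMap A A (fun X => X) (fun X => X)} {b' : TMap B B (fun X => X) (fun X => X)}

lemma B1_apply (p : ℤ) (R : TMap A B f g) (x : T A X Y) :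
    B1 b b' p R X Y x = b' (f X) (g Y) (R X Y x) - (p.negOnePow : ℤ) • R X Y (b X Y x) := rfl

lemma IsHomogeneous.sub {p : ℤ} {R R' : TMap A B f g} (hR : IsHomogeneous p R)
    (hR' : IsHomogeneous p R') : IsHomogeneous p (R - R') := by
  rw [isHomogeneous_iff] at *
  exact fun X Y l x hx => (Deg B (l + p) (f X) (g Y)).sub_mem (hR X Y l hx) (hR' X Y l hx)

lemma IsHomogeneous.zsmul {p : ℤ} {R : TMap A B f g} (hR : IsHomogeneous p R) (c : ℤ) :
    IsHomogeneous p (fun X Y => c • R X Y) := by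
  rw [isHomogeneous_iff] at *
  exact fun X Y l x hx => (Deg B (l + p) (f X) (g Y)).toAddSubgroup.zsmul_mem (hR X Y l hx) c

lemma IsHomogeneous.B1 {p q : ℤ} {R : TMap A B f g} (hb : IsHomogeneous 1 b)
    (hb' : IsHomogeneous 1 b') (hR : IsHomogeneous p R) (hq : p + 1 = q) :
    IsHomogeneous q (B1 b b' p R) :=
  (hb'.comp hR hq).sub ((hR.comp hb ((add_comm 1 p).trans hq)).zsmul _)

/-- In the expansion of the commutator, the terms with the codifferential acting beside `R`, on the
`F` or the `G` part, occur twice with opposite signs, because `F` and `G` commute with the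
codifferentials. The remaining terms are `F ⊗ [R, b]` and `[R, b] ⊗ G`. -/
theorem IsCoderivation.B1 {p q : ℤ} {F : TMap A B f f} {G : TMap A B g g} {R : TMap A B f g}
    (hb : IsCoderivation 1 (idT A) (idT A) b) (hb' : IsCoderivation 1 (idT B) (idT B) b')
    (hF : ∀ X Y x, b' (f X) (f Y) (F X Y x) = F X Y (b X Y x))
    (hG : ∀ X Y x, b' (g X) (g Y) (G X Y x) = G X Y (b X Y x))
    (hR : IsCoderivation p F G R) (hGh : IsHomogeneous 0 G) (hq : p + 1 = q) :
    IsCoderivation q F G (B1 b b' p R) := by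
  refine isCoderivation_of_sumCut (hb.homogeneous.B1 hb'.homogeneous hR.homogeneous hq) ?_
  intro X Y x P _ _ β
  rw [B1_apply, map_sub, map_zsmul, hb'.sumCut, hR.sumCut, hR.sumCut, hR.sumCut, hb.sumCut,
    hb.sumCut]
  simp only [← sumCut_add, ← sumCut_zsmul, ← sumCut_sub]
  refine sumCut_congr (fun Z x y => ?_) x
  have h1 : sgn A p Z Y (b Z Y y) = (p.negOnePow : ℤ) • b Z Y (sgn A p Z Y y) := by
    rw [hb.homogeneous.sgn, mul_one]
  have h2 : sgn B 1 (f Z) (g Y) (R Z Y y) = (p.negOnePow : ℤ) • R Z Y (sgn A 1 Z Y y) := by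
    rw [hR.homogeneous.sgn, one_mul]
  have h3 : sgn B 1 (g Z) (g Y) (G Z Y (sgn A p Z Y y)) = G Z Y (sgn A q Z Y y) := by
    rw [hGh.sgn, sgn_sgn, add_comm, hq]; simp
  have h4 : sgn A p Z Y (sgn A 1 Z Y y) = sgn A q Z Y y := by rw [sgn_sgn, hq]
  have h5 : (p.negOnePow : ℤ) * (p.negOnePow : ℤ) = 1 := by
    rw [← Units.val_mul, Int.units_mul_self, Units.val_one]
  simp only [LinearMap.add_apply, LinearMap.sub_apply, LinearMap.smul_apply,
    LinearMap.compl₁₂_apply, LinearMap.comp_apply, idT, LinearMap.id_apply, B1_apply, map_sub,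
    map_zsmul, h1, h2, h3, h4, hF, hG, smul_add, smul_smul, h5]
  abel

/-- The mixed terms `b ⊗ b` cancel because `b` is odd. With it, `b² = 0` for a constructed
codifferential need only be checked after a map separating coderivations. -/
theorem IsCoderivation.sq (hb : IsCoderivation 1 (idT A) (idT A) b) :
    IsCoderivation 2 (idT A) (idT A) (fun X Y => b X Y ∘ₗ b X Y) := by
  refine isCoderivation_of_sumCut (hb.homogeneous.comp hb.homogeneous rfl) ?_
  intro X Y x P _ _ β
  rw [LinearMap.comp_apply, hb.sumCut, hb.sumCut, hb.sumCut]
  simp only [← sumCut_add]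
  refine sumCut_congr (fun Z x y => ?_) x
  have h1 : sgn A 1 Z Y (b Z Y y) = -b Z Y (sgn A 1 Z Y y) := by
    rw [hb.homogeneous.sgn]; simp
  have h2 : sgn A 1 Z Y (sgn A 1 Z Y y) = sgn A 2 Z Y y := by rw [sgn_sgn]; norm_num
  simp only [LinearMap.add_apply,
    LinearMap.compl₁₂_apply, LinearMap.comp_apply, idT, LinearMap.id_apply, h1, h2, map_neg]
  abel

-- Besides the terms already cancelling for a coderivation, the commutator contains the commutators
-- of `R` and of `P` with the codifferential, tensored with `P` and `R`. They vanish by naturality,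
-- and the `R ⊗ P` term disappears.
set_option maxHeartbeats 1000000 in
theorem IsDoubleCoderivation.B1 {F : TMap A B f f} {R : TMap A B f g} {G : TMap A B g g}
    {P : TMap A B g h} {H : TMap A B h h} {Θ : TMap A B f h}
    (hb : IsCoderivation 1 (idT A) (idT A) b) (hb' : IsCoderivation 1 (idT B) (idT B) b')
    (hF : ∀ X Y x, b' (f X) (f Y) (F X Y x) = F X Y (b X Y x))
    (hH : ∀ X Y x, b' (h X) (h Y) (H X Y x) = H X Y (b X Y x))
    (hHh : IsHomogeneous 0 H) (hR : IsNatural b b' F G R) (hP : IsNatural b b' G H P)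
    (hΘ : IsDoubleCoderivation (-1) (-1) F R P H Θ) :
    IsCoderivation (-1) F H (B1 b b' (-2) Θ) := by
  refine isCoderivation_of_sumCut (hb.homogeneous.B1 hb'.homogeneous hΘ.homogeneous rfl) ?_
  intro X Y x Q _ _ β
  have e1 : ((-1 : ℤ).negOnePow : ℤ) = -1 := rfl
  have e2 : ((-2 : ℤ).negOnePow : ℤ) = 1 := rfl
  have e3 : ((2 : ℤ).negOnePow : ℤ) = 1 := rfl
  -- In degree `-1`, naturality says that the transformation anticommutes with the codifferentials.
  have hR' : ∀ X Y x, b' (f X) (g Y) (R X Y x) = -R X Y (b X Y x) := fun X Y x => by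
    have := LinearMap.congr_fun (congrFun (congrFun hR.closed X) Y) x
    rw [B1_apply, e1, neg_one_zsmul, sub_neg_eq_add] at this
    exact eq_neg_of_add_eq_zero_left this
  have hP' : ∀ X Y x, b' (g X) (h Y) (P X Y x) = -P X Y (b X Y x) := fun X Y x => by
    have := LinearMap.congr_fun (congrFun (congrFun hP.closed X) Y) x
    rw [B1_apply, e1, neg_one_zsmul, sub_neg_eq_add] at this
    exact eq_neg_of_add_eq_zero_left this
  rw [B1_apply, e2, one_smul, map_sub, hb'.sumCut, hΘ.sumCut, hΘ.sumCut, hΘ.sumCut, hb.sumCut,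
    hb.sumCut, hb.sumCut]
  simp only [← sumCut_add, ← sumCut_sub]
  refine sumCut_congr (fun Z x y => ?_) x
  have h1 : ∀ y, sgn A (-1) Z Y (b Z Y y) = -b Z Y (sgn A (-1) Z Y y) := fun y => by
    rw [hb.homogeneous.sgn]; simp
  have h2 : sgn B 1 (f Z) (h Y) (Θ Z Y y) = Θ Z Y (sgn A 1 Z Y y) := by
    rw [hΘ.homogeneous.sgn]; simp [e3]
  have h3 : ∀ y, sgn B 1 (g Z) (h Y) (P Z Y y) = -P Z Y (sgn A 1 Z Y y) := fun y => by
    rw [hP.coderivation.homogeneous.sgn]; simp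
  have h4 : ∀ y, sgn B 1 (h Z) (h Y) (H Z Y y) = H Z Y (sgn A 1 Z Y y) := fun y => by
    rw [hHh.sgn]; simp
  have h5 : ∀ y, sgn A (-1 + -1) Z Y (b Z Y y) = b Z Y (sgn A (-1 + -1) Z Y y) := fun y => by
    rw [hb.homogeneous.sgn]; simp [e3]
  have h6 : ∀ p q, sgn A p Z Y (sgn A q Z Y y) = sgn A (p + q) Z Y y := fun p q => sgn_sgn p q y
  simp only [LinearMap.add_apply, LinearMap.sub_apply, 
    LinearMap.compl₁₂_apply, LinearMap.comp_apply, idT, LinearMap.id_apply, B1_apply, map_sub,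
    map_neg, LinearMap.neg_apply, h1, h2, h3, h4, h5, h6, hF, hH, hR', hP', e2, one_smul]
  norm_num
  abel

end

end

/-! ### Idempotents up to homotopy -/

/-- Both sides are coderivations, so components suffice. In the commutator of `theta` with `b`, the
term with `theta` applied last has no component by `pr1_theta`, and the other term is the definition
of `B2`. -/
lemma IsAInfCategory.B2_eq_B1_theta {b : TMap A A (fun X => X) (fun X => X)} (hA : IsAInfCategory A b)
    {i : TMap A A (fun X => X) (fun X => X)} (hi : IsNatural b b (idT A) (idT A) i) :
    B2 b (-1) (-1) (idT A) i (idT A) i (idT A) =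
      B1 b b (-2) (theta (-1) (-1) (idT A) i (idT A) i (idT A)) := by
  have hid := isCocatHom_idT (A := A)
  have hΘ := isDoubleCoderivation_theta hid hid hid hi.coderivation hi.coderivation
  have hc := hΘ.B1 (F := idT A) (G := idT A) (H := idT A) hA.coderivation hA.coderivation (fun _ _ _ => rfl)
    (fun _ _ _ => rfl) hid.homogeneous hi hi
  have e : comps (B1 b b (-2) (theta (-1) (-1) (idT A) i (idT A) i (idT A))) = fun X Y =>
      pr1 A X Y ∘ₗ b X Y ∘ₗ theta (-1) (-1) (idT A) i (idT A) i (idT A) X Y := by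
    funext X Y
    refine LinearMap.ext fun x => ?_
    have h : pr1 A X Y (theta (-1) (-1) (idT A) i (idT A) i (idT A) X Y (b X Y x)) = 0 :=
      pr1_theta (f := fun X => X) (g := fun X => X) (h := fun X => X) (X := X) (Y := Y) hid _
    rw [comps, LinearMap.comp_apply, B1_apply, map_sub, map_zsmul, h, smul_zero, sub_zero]
    rfl
  rw [hc.eq_coderivation hid hid, e]
  rfl

/-- A natural transformation `i : id → id` is idempotent up to equivalence if and only if it is the
commutator with `b` of a double coderivation. -/
theorem IsAInfCategory.equivalent_B2_iff {b : TMap A A (fun X => X) (fun X => X)}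
    (hA : IsAInfCategory A b) {i : TMap A A (fun X => X) (fun X => X)}
    (hi : IsNatural b b (idT A) (idT A) i) :
    Equivalent b b (idT A) (idT A) (B2 b (-1) (-1) (idT A) i (idT A) i (idT A)) i ↔
      ∃ Θ, IsDoubleCoderivation (-1) (-1) (idT A) i i (idT A) Θ ∧ B1 b b (-2) Θ = i := by
  have hid := isCocatHom_idT (A := A)
  have hΘ := isDoubleCoderivation_theta hid hid hid hi.coderivation hi.coderivation
  have hsub : ∀ Θ V : TMap A A (fun X => X) (fun X => X),
      B1 b b (-2) (Θ - V) = B1 b b (-2) Θ - B1 b b (-2) V := by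
    intro Θ V
    funext X Y
    refine LinearMap.ext fun x => ?_
    change b X Y (Θ X Y x - V X Y x) - ((-2 : ℤ).negOnePow : ℤ) •
      (Θ X Y (b X Y x) - V X Y (b X Y x)) = B1 b b (-2) Θ X Y x - B1 b b (-2) V X Y x
    rw [map_sub, smul_sub, B1_apply, B1_apply]
    abel
  -- The witnesses on the two sides correspond by `V = theta - Θ`, since double coderivations for
  -- the same data differ by coderivations.
  rw [Equivalent, hA.B2_eq_B1_theta hi]
  constructor
  · rintro ⟨V, hV, h⟩
    exact ⟨_, hΘ.sub_coderivation hV rfl, by rw [hsub, ← h, sub_sub_cancel]⟩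
  · rintro ⟨Θ, hΘ', h⟩
    exact ⟨_, hΘ.sub hΘ', by rw [hsub, h]⟩

end

/-! ### The automorphism `𝐦` and the maps `low` and `flat`. -/

section
variable {A : GradedQuiver k S} {B : GradedQuiver k S'} {C : GradedQuiver k S''}
  {X Y Z W : S} {d : ℤ} {P Q : Type u}
  [AddCommGroup P] [Module k P] [AddCommGroup Q] [Module k Q]

local infixl:70 " ⋆ " => mulL _ _ _ _

/-! ### Multiplicative maps -/

/-- The multiplicative map with given values on letters: one summand. -/
def mextTens (q : S → S') (l : ∀ X Z d, A X Z d →ₗ[k] T B (q X) (q Z)) :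
    {X Y : S} → (w : Word S X Y) → Tens A w →ₗ[k] T B (q X) (q Y)
  | _, _, .nil X => LinearMap.toSpanSingleton k (T B (q X) (q X)) (one B (q X)) ∘ₗ
      (tnil A X).symm.toLinearMap
  | _, _, .cons (Z := Z) (Y := Y) X d w =>
      mul B (q X) (q Z) (q Y) ∘ₗ TensorProduct.map (l X Z d) (mextTens q l w) ∘ₗ
        (tcons A X d w).symm.toLinearMap

/-- The multiplicative map `TA → TB` with given values on letters. -/
def mext (q : S → S') (l : ∀ X Z d, A X Z d →ₗ[k] T B (q X) (q Z)) : TMap A B q q :=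
  fun X Y => DirectSum.toModule k (Word S X Y) (T B (q X) (q Y)) fun w => mextTens q l w

section
variable {q : S → S'} {l : ∀ X Z d, A X Z d →ₗ[k] T B (q X) (q Z)}

lemma mext_one (X : S) : mext q l X X (one A X) = one B (q X) := by
  simp [mext, one, mextTens]

lemma mext_cns (a : A X Z d) (y : T A Z Y) :
    mext q l X Y (cns a y) = l X Z d a ⋆ mext q l Z Y y := by
  induction y using T.word_induction with
  | h0 => simp
  | hadd x y hx hy => simp only [map_add, hx, hy]
  | h w x =>
    rw [cns_inT, mext, DirectSum.toModule_lof, mext, DirectSum.toModule_lof, ← mul_tmul]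
    simp [mextTens]

lemma mext_mulL (x : T A X Y) (y : T A Y Z) :
    mext q l X Z (x ⋆ y) = mext q l X Y x ⋆ mext q l Y Z y := by
  induction x using T.induction with
  | h0 => simp
  | hadd x y hx hy => simp [hx, hy]
  | hsmul c x hx => simp [hx]
  | hone X => simp [mext_one]
  | hcns a x ih => simp [mext_cns, ih, mulL_assoc]

lemma IsHomogeneous.mext (hl : ∀ X Z d a, l X Z d a ∈ Deg B d (q X) (q Z)) :
    IsHomogeneous 0 (mext q l) := by
  rw [isHomogeneous_iff]
  refine fun X Y n => Deg.le_of_word fun w hw x => ?_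
  rw [Submodule.mem_comap, add_zero]
  induction w generalizing n with
  | nil X =>
    obtain ⟨c, rfl⟩ := (tnil A X).surjective x
    rw [inT_nil, map_smul, mext_one]
    exact Submodule.smul_mem _ _ (by rw [← hw]; exact one_mem_Deg _)
  | cons X d w ih =>
    induction x using Tens.cons_induction with
    | h0 => simp
    | hadd x y hx hy => simpa using Submodule.add_mem _ hx hy
    | ht a x =>
      rw [← cns_inT, mext_cns]
      exact mulL_mem_Deg (hl _ _ _ a) (ih _ rfl x) (by rw [← hw, Word.degree])

lemma mext_eq {Φ : TMap A B q q} (h1 : ∀ X, Φ X X (one A X) = one B (q X))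
    (hc : ∀ {X Z Y d} (a : A X Z d) (y : T A Z Y),
      Φ X Y (cns a y) = l X Z d a ⋆ Φ Z Y y) : Φ = mext q l := by
  refine T.family_ext (fun X => ?_) fun {X Z Y d} a y ih => ?_
  · rw [h1, mext_one]
  · rw [hc, mext_cns, ih]

/-- Convolution of a multiplicative map with a map `ψ`. -/
lemma e0_mext (hl : ∀ X Z d a, e0 B (q X) (q Z) (l X Z d a) = 0) (x : T A X Y) :
    e0 B (q X) (q Y) (mext q l X Y x) = etaEps A B q X Y x := by
  induction x using T.induction with
  | h0 => simp
  | hadd x y hx hy => simp only [map_add, hx, hy]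
  | hsmul c x hx => simp only [map_smul, hx]
  | hone X => rw [mext_one, etaEps_one, etaEps_one]
  | hcns a y _ => rw [mext_cns, e0_mulL, hl, etaEps_cns, map_zero, LinearMap.zero_apply]

end

/-- The strict functor given by a morphism of quivers. -/
def strict (q : S → S') (φ : ∀ X Z d, A X Z d →ₗ[k] B (q X) (q Z) d) : TMap A B q q :=
  mext q fun X Z d => (cnsHom B (q X) (q Z) (q Z) d).flip (one B (q Z)) ∘ₗ φ X Z d

section
variable {q : S → S'} {φ : ∀ X Z d, A X Z d →ₗ[k] B (q X) (q Z) d}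

lemma strict_one (X : S) : strict q φ X X (one A X) = one B (q X) := mext_one X

lemma strict_cns (a : A X Z d) (y : T A Z Y) :
    strict q φ X Y (cns a y) = cns (φ X Z d a) (strict q φ Z Y y) := by
  rw [strict, mext_cns, LinearMap.comp_apply, LinearMap.flip_apply, cnsHom_apply, cns_mulL,
    one_mulL]

lemma strict_eq {Φ : TMap A B q q} (h1 : ∀ X, Φ X X (one A X) = one B (q X))
    (hc : ∀ {X Z Y d} (a : A X Z d) (y : T A Z Y),
      Φ X Y (cns a y) = cns (φ X Z d a) (Φ Z Y y)) : Φ = strict q φ := by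
  refine T.family_ext (fun X => ?_) fun {X Z Y d} a y ih => ?_
  · rw [h1, strict_one]
  · rw [hc, strict_cns, ih]

lemma isCocatHom_strict : IsCocatHom (strict q φ) := by
  refine isCocatHom_of_sumCut (IsHomogeneous.mext fun X Z d a => ?_) ?_ ?_ strict_one
  · exact cns_mem_Deg _ (one_mem_Deg _) (add_zero d)
  · intro X Y x P _ _ β
    induction x using T.induction with
    | h0 => simp
    | hadd x y hx hy => simp only [map_add, hx, hy]
    | hsmul c x hx => simp only [map_smul, hx]
    | hone X => simp only [strict_one, sumCut_one, LinearMap.compl₁₂_apply]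
    | hcns a y ih =>
      rw [strict_cns, sumCut_cns, sumCut_cns, ih, LinearMap.compl₁₂_apply, strict_one, strict_cns]
      refine congrArg (_ + ·) ?_
      refine sumCut_congr (fun Z x y => ?_) y
      simp [strict_cns]
  · intro X Y
    refine LinearMap.ext fun x => ?_
    rw [LinearMap.comp_apply]
    induction x using T.induction with
    | h0 => simp
    | hadd x y hx hy => simp only [map_add, hx, hy]
    | hsmul c x hx => simp only [map_smul, hx]
    | hone X => rw [strict_one, counit_one, counit_one]
    | hcns a y _ => rw [strict_cns, counit_cns, counit_cns]

end

/-! ### The quivers `T⁺A` and `sD(C|B)` inside `TA` -/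

/-- The embedding of the total module of `sD(C|B)` into `TA`. -/
def overIn (A : GradedQuiver k S) (D : Set S) (X Y : S) : Tot (plusOver A D) X Y →ₗ[k] T A X Y :=
  DirectSum.toModule k ℤ (T A X Y) fun _ => plusLift A D fun w => inT A w.1

section
variable {D : Set S}

lemma plusLift_inPlus {M : Type u} [AddCommGroup M] [Module k M]
    (φ : ∀ w : PlusWord D X Y d, Tens A w.1 →ₗ[k] M) (w : PlusWord D X Y d) (x : Tens A w.1) :
    plusLift A D φ (inPlus A D w x) = φ w x :=
  DirectSum.toModule_lof _ _ _

lemma overIn_inTot_inPlus (w : PlusWord D X Y d) (x : Tens A w.1) :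
    overIn A D X Y (inTot (plusOver A D) X Y d (inPlus A D w x)) = inT A w.1 x := by
  rw [overIn, DirectSum.toModule_lof, plusLift_inPlus]

theorem plusOver_induction {p : plusOver A D X Y d → Prop} (h0 : p 0)
    (hadd : ∀ x y, p x → p y → p (x + y)) (h : ∀ w x, p (inPlus A D w x)) (x) : p x := by
  induction x using DirectSum.induction_on with
  | zero => exact h0
  | add x y hx hy => exact hadd _ _ hx hy
  | of w x => exact h w x

theorem Tot_induction {p : Tot A X Y → Prop} (h0 : p 0)
    (hadd : ∀ x y, p x → p y → p (x + y)) (h : ∀ d x, p (inTot A X Y d x)) (x) : p x := by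
  induction x using DirectSum.induction_on with
  | zero => exact h0
  | add x y hx hy => exact hadd _ _ hx hy
  | of w x => exact h w x

lemma overIn_mem_Deg (x : plusOver A D X Y d) :
    overIn A D X Y (inTot (plusOver A D) X Y d x) ∈ Deg A d X Y := by
  induction x using plusOver_induction with
  | h0 => simp
  | hadd x y hx hy => simpa using Submodule.add_mem _ hx hy
  | h w x => rw [overIn_inTot_inPlus]; exact inT_mem_Deg _ _ w.2.2.2

lemma e0_inT_of_pos {w : Word S X Y} (hw : 0 < w.length) (x : Tens A w) :
    e0 A X Y (inT A w x) = 0 := by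
  cases w with
  | nil => simp [Word.length] at hw
  | cons X d w =>
    induction x using Tens.cons_induction with
    | h0 => simp
    | hadd x y hx hy => simp only [map_add, hx, hy, add_zero]
    | ht a x => rw [← cns_inT, etaEps_cns]

lemma e0_overIn (x : Tot (plusOver A D) X Y) : e0 A X Y (overIn A D X Y x) = 0 := by
  induction x using Tot_induction with
  | h0 => simp
  | hadd x y hx hy => simp only [map_add, hx, hy, add_zero]
  | h d x =>
    induction x using plusOver_induction with
    | h0 => simp
    | hadd x y hx hy => simp only [map_add, hx, hy, add_zero]
    | h w x => rw [overIn_inTot_inPlus, e0_inT_of_pos w.2.1]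

end

lemma plusIncl_eq (x : plus A X Y d) :
    plusIncl A X Y d x = overIn A Set.univ X Y (inTot (plus A) X Y d x) := by
  rw [overIn, DirectSum.toModule_lof]; rfl

lemma overIn_plusProj (x : T A X Y) :
    overIn A Set.univ X Y (plusProj A X Y x) = x - e0 A X Y x := by
  induction x using T.word_induction with
  | h0 => simp
  | hadd x y hx hy => simp only [map_add, hx, hy]; abel
  | h w x =>
    rw [plusProj, DirectSum.toModule_lof]
    by_cases hw : 0 < w.length
    · rw [dif_pos hw, LinearMap.comp_apply, overIn_inTot_inPlus, e0_inT_of_pos hw, sub_zero]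
    · rw [dif_neg hw]
      cases w with
      | nil =>
        obtain ⟨c, rfl⟩ := (tnil A X).surjective x
        rw [inT_nil, map_smul, etaEps_one]; simp
      | cons => simp [Word.length] at hw

lemma plusProj_one (X : S) : plusProj A X X (one A X) = 0 := by
  rw [plusProj, one, DirectSum.toModule_lof, dif_neg (by simp [Word.length])]; rfl

lemma plusProj_overIn (x : Tot (plus A) X Y) : plusProj A X Y (overIn A Set.univ X Y x) = x := by
  induction x using Tot_induction with
  | h0 => simp
  | hadd x y hx hy => simp only [map_add, hx, hy]
  | h d x =>
    induction x using plusOver_induction with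
    | h0 => simp
    | hadd x y hx hy => simp only [map_add, hx, hy]
    | h w x =>
      obtain ⟨w, hw, hB, rfl⟩ := w
      rw [overIn_inTot_inPlus, plusProj, DirectSum.toModule_lof, dif_pos hw]
      rfl

lemma plusProj_etaEps {f : S → S'} (x : T A X Y) :
    plusProj B (f X) (f Y) (etaEps A B f X Y x) = 0 := by
  induction x using T.induction with
  | h0 => simp
  | hadd x y hx hy => simp only [map_add, hx, hy, add_zero]
  | hsmul c x hx => simp only [map_smul, hx, smul_zero]
  | hone X => rw [etaEps_one, plusProj_one]
  | hcns a y _ => simp [etaEps_cns]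

lemma in1_plusProj_mem_Deg {n : ℤ} {x : T A X Y} (hx : x ∈ Deg A n X Y) :
    in1 (plus A) X Y (plusProj A X Y x) ∈ Deg (plus A) n X Y := by
  have : Deg A n X Y ≤ (Deg (plus A) n X Y).comap (in1 (plus A) X Y ∘ₗ plusProj A X Y) := by
    refine Deg.le_of_word fun w hw x => ?_
    rw [Submodule.mem_comap, LinearMap.comp_apply, plusProj, DirectSum.toModule_lof]
    by_cases h : 0 < w.length
    · rw [dif_pos h, LinearMap.comp_apply, in1_inTot]
      exact cns_mem_Deg _ (one_mem_Deg _) (by rw [hw, add_zero])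
    · rw [dif_neg h]; simp
  exact this hx

/-! ### The automorphism `𝐦` -/

/-- Multiplication of all factors, with the sign `t^n` on `Tⁿ`. -/
def flatS (A : GradedQuiver k S) (t : ℤ) : TMap (plus A) A (fun X => X) (fun X => X) :=
  mext (fun X => X) fun X Z d => t • plusIncl A X Z d

lemma flat_one (X : S) : flat A X X (one (plus A) X) = one A X := by
  simp [flat, one, flatTens]

lemma flat_cns (a : plus A X Z d) (y : T (plus A) Z Y) :
    flat A X Y (cns a y) = plusIncl A X Z d a ⋆ flat A Z Y y := by
  induction y using T.word_induction with
  | h0 => simp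
  | hadd x y hx hy => simp only [map_add, hx, hy]
  | h w x =>
    rw [cns_inT, flat, DirectSum.toModule_lof, flat, DirectSum.toModule_lof, ← mul_tmul]
    simp [flatTens]

lemma flat_eq_mext : flat A = mext (fun X => X) (plusIncl A) :=
  mext_eq flat_one flat_cns

lemma flat_eq_flatS : flat A = flatS A 1 := by
  rw [flat_eq_mext, flatS]; simp

/-- The sign `(-1)^(n-1)` is `-1` times one sign for every factor. So `𝐦` and `𝐦⁻¹` are the cases `t
= 1` and `t = -1` of one construction with a multiplicative `flatS`. -/
lemma flat_sign_eq (x : T (plus A) X Y) :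
    flat A X Y (DirectSum.lmap (fun W : Word S X Y =>
      (((W.length : ℤ) - 1).negOnePow : ℤ) •
        (LinearMap.id : Tens (plus A) W →ₗ[k] Tens (plus A) W)) x) = (-1 : ℤ) • flatS A (-1) X Y x := by
  induction x using T.word_induction with
  | h0 => simp
  | hadd x y hx hy => simp only [map_add, hx, hy, smul_add]
  | h w x =>
    rw [DirectSum.lmap_lof]
    simp only [LinearMap.smul_apply, LinearMap.id_apply]
    have e : inT (plus A) w ((((w.length : ℤ) - 1).negOnePow : ℤ) • x) =
      (((w.length : ℤ) - 1).negOnePow : ℤ) • inT (plus A) w x := map_zsmul _ _ _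
    rw [e, map_zsmul]
    induction w with
    | nil =>
      obtain ⟨c, rfl⟩ := (tnil (plus A) _).surjective x
      rw [inT_nil, map_smul, map_smul, flat_one, flatS, mext_one]
      rfl
    | cons X d w ih =>
      induction x using Tens.cons_induction with
      | h0 => simp
      | hadd x y hx hy =>
        simp only [map_add, smul_add] at hx hy ⊢
        rw [hx (map_zsmul _ _ _), hy (map_zsmul _ _ _)]
      | ht a x =>
        have ih' := ih x (map_zsmul _ _ _)
        have h : flatS A (-1) _ _ (inT (plus A) w x) =
            -((((w.length : ℤ) - 1).negOnePow : ℤ) • flat A _ _ (inT (plus A) w x)) := by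
          rw [ih']; simp
        have h' : ((((Word.cons X d w).length : ℤ) - 1).negOnePow : ℤ) =
            -(((w.length : ℤ) - 1).negOnePow : ℤ) := by
          rw [Word.length, show (((w.length + 1 : ℕ) : ℤ) - 1) = (w.length - 1 : ℤ) + 1 by
            push_cast; ring, Int.negOnePow_succ, Units.val_neg]
        rw [← cns_inT, flat_cns, flatS, mext_cns, ← flatS, h, h', LinearMap.smul_apply]
        simp only [neg_smul, one_smul, map_neg, LinearMap.neg_apply, neg_neg, map_zsmul, smul_neg]

lemma plusIncl_mem_Deg (a : plus A X Z d) : plusIncl A X Z d a ∈ Deg A d X Z := by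
  rw [plusIncl_eq]; exact overIn_mem_Deg a

section
variable {t : ℤ}

lemma flatS_one (X : S) : flatS A t X X (one (plus A) X) = one A X := mext_one X

lemma flatS_cns (a : plus A X Z d) (y : T (plus A) Z Y) :
    flatS A t X Y (cns a y) = t • (plusIncl A X Z d a ⋆ flatS A t Z Y y) := by
  rw [flatS, mext_cns, LinearMap.smul_apply, map_zsmul, LinearMap.smul_apply]

lemma flatS_in1 (v : Tot (plus A) X Y) :
    flatS A t X Y (in1 (plus A) X Y v) = t • overIn A Set.univ X Y v := by
  induction v using Tot_induction with
  | h0 => simp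
  | hadd x y hx hy => simp only [map_add, hx, hy, smul_add]
  | h d x => rw [in1_inTot, flatS_cns, flatS_one, mulL_one, plusIncl_eq]

lemma e0_flatS (x : T (plus A) X Y) :
    e0 A X Y (flatS A t X Y x) = etaEps (plus A) A (fun X => X) X Y x := by
  refine e0_mext (q := fun X => X) (fun X Z d a => ?_) x
  rw [LinearMap.smul_apply, map_zsmul, plusIncl_eq]
  exact (congrArg _ (e0_overIn _)).trans (smul_zero t)

lemma isHomogeneous_flatS : IsHomogeneous 0 (flatS A t) := by
  refine IsHomogeneous.mext (q := fun X => X) fun X Z d a => ?_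
  exact (Deg A d X Z).toAddSubgroup.zsmul_mem (plusIncl_mem_Deg a) t

lemma flatS_mulL (x : T (plus A) X Y) (y : T (plus A) Y Z) :
    flatS A t X Z (x ⋆ y) = flatS A t X Y x ⋆ flatS A t Y Z y := mext_mulL x y

/-- Components of `𝐦` for `t = 1` and of its inverse for `t = -1`. -/
def mCompsS (A : GradedQuiver k S) (t : ℤ) : Comps (plus A) (plus A) (fun X => X) (fun X => X) :=
  fun X Y => t • plusProj A X Y ∘ₗ flatS A t X Y

lemma mCompsS_one (X : S) : mCompsS A t X X (one (plus A) X) = 0 := by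
  rw [mCompsS, LinearMap.smul_apply, LinearMap.comp_apply, flatS_one, plusProj_one, smul_zero]

lemma isHomogeneous_mCompsS : IsHomogeneous 0 (inc (mCompsS A t)) := by
  rw [isHomogeneous_iff]
  intro X Y n x hx
  rw [Submodule.mem_comap, inc, LinearMap.comp_apply, mCompsS, LinearMap.smul_apply, map_zsmul]
  refine (Deg (plus A) (n + 0) X Y).toAddSubgroup.zsmul_mem (in1_plusProj_mem_Deg ?_) t
  exact isHomogeneous_iff.1 isHomogeneous_flatS X Y n hx

lemma isCocatHom_mS : IsCocatHom (cocatHom (mCompsS A t)) :=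
  isCocatHom_cocatHom isHomogeneous_mCompsS mCompsS_one

/-- The map `T(T⁺A) → TA` that is the identity on `T⁰`, multiplication by `t` on `T¹(T⁺A)`. -/
def lowS (A : GradedQuiver k S) (t : ℤ) : TMap (plus A) A (fun X => X) (fun X => X) := fun X Y =>
  etaEps (plus A) A (fun X => X) X Y + t • overIn A Set.univ X Y ∘ₗ pr1 (plus A) X Y

lemma overIn_pr1_cns (a : plus A X Z d) (y : T (plus A) Z Y) :
    overIn A Set.univ X Y (pr1 (plus A) X Y (cns a y)) =
      plusIncl A X Z d a ⋆ etaEps (plus A) A (fun X => X) Z Y y := by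
  induction y using T.induction with
  | h0 => simp
  | hadd x y hx hy => simp only [map_add, hx, hy]
  | hsmul c x hx => simp only [map_smul, hx]
  | hone X => rw [← in1_inTot, pr1_in1, etaEps_one, mulL_one, plusIncl_eq]
  | hcns b y _ => rw [pr1_cns_cns, etaEps_cns, map_zero, map_zero]

/-- A convolution identity: `lowS` retains only the cuts after the last letter and just before it.
On these the last letter is multiplied by `-t` and by `t`, so the two contributions cancel on `T⁺`.
-/
lemma sumCut_flatS_lowS (x : T (plus A) X Y) :
    sumCut (fun Z => (mulL A X Z Y).compl₁₂ (flatS A (-t) X Z) (lowS A t Z Y)) x =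
      etaEps (plus A) A (fun X => X) X Y x := by
  induction x using T.induction with
  | h0 => simp
  | hadd x y hx hy => simp only [map_add, hx, hy]
  | hsmul c x hx => simp only [map_smul, hx]
  | hone X =>
    rw [sumCut_one, LinearMap.compl₁₂_apply, flatS_one, one_mulL, lowS, LinearMap.add_apply,
      LinearMap.smul_apply, LinearMap.comp_apply, pr1_one, map_zero, smul_zero, add_zero]
  | hcns a y ih =>
    rename_i X Z Y d
    have h : sumCut (fun V => (mulL A X V Y).compl₁₂ (flatS A (-t) X V) (lowS A t V Y) ∘ₗ cns a) y =
        (-t) • (plusIncl A X Z d a ⋆ sumCut (fun V =>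
          (mulL A Z V Y).compl₁₂ (flatS A (-t) Z V) (lowS A t V Y)) y) := by
      rw [map_sumCut, ← sumCut_zsmul]
      exact sumCut_congr (by simp [flatS_cns, mulL_assoc]) y
    rw [sumCut_cns, h, ih, LinearMap.compl₁₂_apply, flatS_one, one_mulL, etaEps_cns, lowS,
      LinearMap.add_apply, LinearMap.smul_apply, LinearMap.comp_apply, etaEps_cns, zero_add,
      overIn_pr1_cns, neg_smul, add_neg_cancel]

/-- For `t² = 1`, `flatS t` sends the components of the homomorphism to `ηε - flatS (-t)`. Since
`flatS t` is multiplicative, the recursion `cocatHom_eq` becomes `Φ = ηε + (ηε - flatS (-t)) * Φ`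
for the composite `Φ`, that is, `flatS (-t) * Φ = ηε`. -/
lemma sumCut_flatS_flatS_m (ht : t * t = 1) (x : T (plus A) X Y) :
    sumCut (fun Z => (mulL A X Z Y).compl₁₂ (flatS A (-t) X Z)
      (flatS A t Z Y ∘ₗ cocatHom (mCompsS A (-t)) Z Y)) x =
      etaEps (plus A) A (fun X => X) X Y x := by
  have h1 : ∀ {X Y} (x : T (plus A) X Y), flatS A t X Y (inc (mCompsS A (-t)) X Y x) =
      etaEps (plus A) A (fun X => X) X Y x - flatS A (-t) X Y x := by
    intro X Y x
    rw [inc, LinearMap.comp_apply, flatS_in1, mCompsS, LinearMap.smul_apply, map_zsmul, smul_smul,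
      LinearMap.comp_apply, overIn_plusProj, e0_flatS, mul_neg, ht, neg_one_zsmul, neg_sub]
  have h2 : flatS A t X Y (cocatHom (mCompsS A (-t)) X Y x) =
      etaEps (plus A) A (fun X => X) X Y x + sumCut (fun Z =>
        ((mulL A X Z Y).compl₂ (flatS A t Z Y ∘ₗ cocatHom (mCompsS A (-t)) Z Y) ∘ₗ
          etaEps (plus A) A (fun X => X) X Z) -
        (mulL A X Z Y).compl₁₂ (flatS A (-t) X Z)
          (flatS A t Z Y ∘ₗ cocatHom (mCompsS A (-t)) Z Y)) x := by
    conv_lhs => rw [cocatHom_eq mCompsS_one]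
    rw [map_add, conv_zero_apply, map_sumCut]
    refine congrArg₂ (· + ·) ?_ ?_
    · induction x using T.induction with
      | h0 => simp
      | hadd x y hx hy => simp only [map_add, hx, hy]
      | hsmul c x hx => simp only [map_smul, hx]
      | hone X => rw [etaEps_one, etaEps_one, flatS_one]
      | hcns b y _ => rw [etaEps_cns, etaEps_cns, map_zero]
    · refine sumCut_congr (fun Z x y => ?_) x
      rw [LinearMap.compr₂_apply, LinearMap.compl₁₂_apply]
      erw [flatS_mulL, h1]
      simp
  rw [sumCut_sub, sumCut_etaEps_left (fun X => X) (fun Z =>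
    (mulL A X Z Y).compl₂ (flatS A t Z Y ∘ₗ cocatHom (mCompsS A (-t)) Z Y)),
    LinearMap.compl₂_apply, one_mulL, LinearMap.comp_apply] at h2
  rw [eq_comm, ← sub_eq_zero]
  rw [← add_sub_assoc, add_sub_right_comm, right_eq_add] at h2
  exact h2

/-- As `flatS` maps units to units, the cut in front of everything returns `ψ(x)`, while all other
cuts involve `ψ` on shorter words. So left convolution with `flatS` is injective. -/
lemma eq_of_sumCut_flatS {t : ℤ} {ψ ψ' : TMap (plus A) A (fun X => X) (fun X => X)}
    (h : ∀ X Y x, sumCut (fun Z => (mulL A X Z Y).compl₁₂ (flatS A t X Z) (ψ Z Y)) x =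
      sumCut (fun Z => (mulL A X Z Y).compl₁₂ (flatS A t X Z) (ψ' Z Y)) x) : ψ = ψ' := by
  funext X Y
  refine LinearMap.ext fun x => ?_
  induction x using T.word_induction with
  | h0 => simp
  | hadd x y hx hy => simp only [map_add, hx, hy]
  | h w x =>
    induction w, x using T.length_induction with
    | h w x ih =>
      rename_i X Y
      have h1 : sumCut (fun Z => (mulL A X Z Y).compl₁₂ (flatS A t X Z) (ψ Z Y) -
          (mulL A X Z Y).compl₁₂ (flatS A t X Z) (ψ' Z Y)) (inT (plus A) w x) = 0 := by
        rw [sumCut_sub, h, sub_self]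
      have h2 : sumCut (fun Z => (mulL A X Z Y).compl₁₂ (flatS A t X Z) (ψ Z Y) -
          (mulL A X Z Y).compl₁₂ (flatS A t X Z) (ψ' Z Y)) (inT (plus A) w x) =
          sumCut (fun Z => (mulL A X Z Y).compl₂ (ψ Z Y - ψ' Z Y) ∘ₗ
            etaEps (plus A) A (fun X => X) X Z) (inT (plus A) w x) := by
        refine sumCut_congr_word x fun Z w₁ w₂ e x₁ x₂ => ?_
        cases w₁ with
        | nil =>
          obtain ⟨c, rfl⟩ := (tnil (plus A) _).surjective x₁
          simp [inT_nil, flatS_one, etaEps_one]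
        | cons X d w₁ =>
          have := ih w₂ x₂ (by rw [← e, Word.length_append, Word.length]; omega)
          simp [this]
      rw [h2, sumCut_etaEps_left (fun X => X) (fun Z => (mulL A X Z Y).compl₂ (ψ Z Y - ψ' Z Y)),
        LinearMap.compl₂_apply, one_mulL, LinearMap.sub_apply, sub_eq_zero] at h1
      exact h1

/-- Both maps are right inverse to `flatS (-t)` for convolution. For `t = 1` this says that `𝐦⁻¹`
followed by `flat` is `low`. -/
lemma flatS_m (ht : t * t = 1) (x : T (plus A) X Y) :
    flatS A t X Y (cocatHom (mCompsS A (-t)) X Y x) = lowS A t X Y x := by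
  have : (fun X Y => flatS A t X Y ∘ₗ cocatHom (mCompsS A (-t)) X Y) = lowS A t := by
    refine eq_of_sumCut_flatS (t := -t) fun X Y x => ?_
    rw [sumCut_flatS_lowS, ← sumCut_flatS_flatS_m ht]
  exact LinearMap.congr_fun (congrFun (congrFun this X) Y) x

/-- By `flatS_m` the components of the composite are `t² pr₁ = pr₁`, those of the identity. -/
lemma m_m (ht : t * t = 1) (x : T (plus A) X Y) :
    cocatHom (mCompsS A t) X Y (cocatHom (mCompsS A (-t)) X Y x) = x := by
  have h := (isCocatHom_mS (A := A) (t := t)).comp (isCocatHom_mS (A := A) (t := -t))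
  have : (fun X Y => cocatHom (mCompsS A t) X Y ∘ₗ cocatHom (mCompsS A (-t)) X Y) =
      idT (plus A) := by
    refine h.ext isCocatHom_idT fun X Y x => ?_
    rw [LinearMap.comp_apply]
    refine (pr1_cocatHom isHomogeneous_mCompsS mCompsS_one _).trans ?_
    rw [mCompsS, LinearMap.smul_apply, LinearMap.comp_apply, flatS_m ht, lowS, LinearMap.add_apply,
      LinearMap.smul_apply, LinearMap.comp_apply, map_add, map_zsmul, plusProj_overIn, smul_add,
      smul_smul, ht, one_smul]
    have := plusProj_etaEps (A := plus A) (B := A) (f := fun X => X) x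
    rw [this, smul_zero, zero_add]
    rfl
  exact LinearMap.congr_fun (congrFun (congrFun this X) Y) x

end

lemma mm_eq : mm A = cocatHom (mCompsS A 1) := by
  rw [mm]
  congr 1
  funext X Y
  rw [mCompsS, one_smul, flat_eq_flatS]

lemma mmInv_eq : mmInv A = cocatHom (mCompsS A (-1)) := by
  rw [mmInv]
  congr 1
  funext X Y
  refine LinearMap.ext fun x => ?_
  rw [LinearMap.comp_apply, LinearMap.comp_apply, flat_sign_eq, map_zsmul]
  rfl

lemma isCocatHom_mm : IsCocatHom (mm A) := mm_eq (A := A) ▸ isCocatHom_mS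

lemma isCocatHom_mmInv : IsCocatHom (mmInv A) := mmInv_eq (A := A) ▸ isCocatHom_mS

lemma mmInv_mm (x : T (plus A) X Y) : mmInv A X Y (mm A X Y x) = x := by
  rw [mm_eq, mmInv_eq]; exact m_m (t := -1) (by norm_num) x

lemma low_one (X : S) : low A X X (one (plus A) X) = one A X := by
  simp [low, one, lowTens]

lemma low_cns (a : plus A X Z d) (y : T (plus A) Z Y) :
    low A X Y (cns a y) = plusIncl A X Z d a ⋆ etaEps (plus A) A (fun X => X) Z Y y := by
  induction y using T.induction with
  | h0 => simp
  | hadd x y hx hy => simp only [map_add, hx, hy]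
  | hsmul c x hx => simp only [map_smul, hx]
  | hone X =>
    rw [etaEps_one, mulL_one, one, cns_inT, low, DirectSum.toModule_lof]
    have := tsingle (plus A) _ X d |>.symm_apply_apply a
    simp only [lowTens, LinearMap.comp_apply, LinearEquiv.coe_coe]
    congr 1
  | hcns b y _ =>
    rw [etaEps_cns, map_zero]
    clear * -
    induction y using T.word_induction with
    | h0 => simp
    | hadd x y hx hy => simp only [map_add, hx, hy, add_zero]
    | h w x => rw [cns_inT, cns_inT, low, DirectSum.toModule_lof]; rfl

lemma low_eq_lowS : low A = lowS A 1 := by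
  refine T.family_ext (fun X => ?_) fun {X Z Y d} a y _ => ?_
  · rw [low_one, lowS, LinearMap.add_apply, etaEps_one, LinearMap.smul_apply, LinearMap.comp_apply,
      pr1_one, map_zero, smul_zero, add_zero]
  · rw [low_cns, lowS, LinearMap.add_apply, etaEps_cns, LinearMap.smul_apply, LinearMap.comp_apply,
      overIn_pr1_cns, zero_add, one_smul]

lemma low_apply (x : T (plus A) X Y) :
    low A X Y x = etaEps (plus A) A (fun X => X) X Y x +
      overIn A Set.univ X Y (pr1 (plus A) X Y x) := by
  rw [low_eq_lowS, lowS, one_smul]; rfl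

lemma flat_mmInv (x : T (plus A) X Y) : flat A X Y (mmInv A X Y x) = low A X Y x := by
  rw [flat_eq_flatS, mmInv_eq, low_eq_lowS]; exact flatS_m (by norm_num) x

lemma low_mm (x : T (plus A) X Y) : low A X Y (mm A X Y x) = flat A X Y x := by
  rw [← flat_mmInv, mmInv_mm]

end

/-! ### The underlined and overlined maps, characterised by `low` and `flat`. -/

section
variable {A : GradedQuiver k S} {B : GradedQuiver k S'} {C : GradedQuiver k S''}
  {X Y Z W : S} {d : ℤ} {P Q : Type u}
  [AddCommGroup P] [Module k P] [AddCommGroup Q] [Module k Q]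

local infixl:70 " ⋆ " => mulL _ _ _ _

/-! ### The functor `underline` -/

section
variable {f g h : S → S'}

lemma isHomogeneous_low : IsHomogeneous 0 (low A) := by
  have h1 : low A = fun X Y => flat A X Y ∘ₗ mmInv A X Y :=
    funext fun X => funext fun Y => LinearMap.ext fun x => (flat_mmInv x).symm
  rw [h1, flat_eq_flatS]
  exact isHomogeneous_flatS.comp isCocatHom_mmInv.homogeneous (add_zero 0)

lemma plusProj_low (x : T (plus A) X Y) : plusProj A X Y (low A X Y x) = pr1 (plus A) X Y x := by
  rw [low_apply, map_add, plusProj_overIn]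
  erw [plusProj_etaEps (f := fun X => X)]
  rw [zero_add]

/-- Thus the components of a composite with `𝐦` are computed by `flat`; this is why `flat`, though
not injective, separates coderivations. -/
lemma plusProj_flat (x : T (plus A) X Y) :
    plusProj A X Y (flat A X Y x) = pr1 (plus A) X Y (mm A X Y x) := by
  rw [← low_mm, plusProj_low]

lemma etaEps_etaEps (f : S → S') (f' : S' → S'') (x : T A X Y) :
    etaEps B C f' (f X) (f Y) (etaEps A B f X Y x) = etaEps A C (fun X => f' (f X)) X Y x := by
  induction x using T.induction with
  | h0 => simp
  | hadd x y hx hy => simp only [map_add, hx, hy]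
  | hsmul c x hx => simp only [map_smul, hx]
  | hone X => rw [etaEps_one, etaEps_one, etaEps_one]
  | hcns a y _ => rw [etaEps_cns, etaEps_cns, map_zero]

lemma IsCocatHom.etaEps_map {F : TMap A B f f} (hF : IsCocatHom F) (f' : S' → S'') (x : T A X Y) :
    etaEps B C f' (f X) (f Y) (F X Y x) = etaEps A C (fun X => f' (f X)) X Y x := by
  rw [← etaEps_e0, hF.e0_map, etaEps_etaEps]

lemma e0_low (x : T (plus A) X Y) :
    e0 A X Y (low A X Y x) = etaEps (plus A) A (fun X => X) X Y x := by
  rw [low_apply, map_add, e0_overIn, add_zero]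
  exact e0_etaEps (fun X => X) x

lemma etaEps_low (f : S → S') (x : T (plus A) X Y) :
    etaEps A B f X Y (low A X Y x) = etaEps (plus A) B f X Y x := by
  rw [← etaEps_e0, e0_low]
  exact etaEps_etaEps (fun X => X) f x

lemma IsHomogeneous.inc_underComps {p : ℤ} {Φ : TMap A B f g} (hΦ : IsHomogeneous p Φ) :
    IsHomogeneous p (inc (underComps Φ)) := by
  rw [isHomogeneous_iff]
  intro X Y n x hx
  have h1 := isHomogeneous_iff.1 isHomogeneous_low X Y n hx
  rw [add_zero] at h1
  exact in1_plusProj_mem_Deg (isHomogeneous_iff.1 hΦ X Y n h1)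

lemma underComps_one {F : TMap A B f f} (hF : IsCocatHom F) (X : S) :
    underComps F X X (one (plus A) X) = 0 := by
  rw [underComps, LinearMap.comp_apply, LinearMap.comp_apply, low_one, hF.map_one, plusProj_one]

lemma isCocatHom_underFunctor {F : TMap A B f f} (hF : IsCocatHom F) :
    IsCocatHom (underFunctor F) :=
  isCocatHom_cocatHom hF.homogeneous.inc_underComps (underComps_one hF)

lemma low_eq_of_pr1 {x : T (plus A) X Y} {y : T A X Y}
    (h : pr1 (plus A) X Y x = plusProj A X Y y)
    (h0 : etaEps (plus A) A (fun X => X) X Y x = e0 A X Y y) : low A X Y x = y := by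
  rw [low_apply, h, overIn_plusProj, h0, add_sub_cancel]

/-- Strictness of the underlined functor in usable form: on `T¹` it is `F` itself, and on longer
tensors both sides vanish, because every letter gives at least one letter. -/
lemma low_underFunctor {F : TMap A B f f} (hF : IsCocatHom F) (x : T (plus A) X Y) :
    low B (f X) (f Y) (underFunctor F X Y x) = F X Y (low A X Y x) := by
  refine low_eq_of_pr1 (pr1_cocatHom hF.homogeneous.inc_underComps (underComps_one hF) x) ?_
  rw [hF.e0_map, etaEps_low]
  exact (isCocatHom_underFunctor hF).etaEps_map (fun X => X) x

lemma underFunctor_idT : underFunctor (idT A) = idT (plus A) := by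
  refine IsCocatHom.ext (isCocatHom_underFunctor isCocatHom_idT) isCocatHom_idT fun X Y x => ?_
  rw [underFunctor, pr1_cocatHom isCocatHom_idT.homogeneous.inc_underComps
    (underComps_one isCocatHom_idT)]
  exact plusProj_low x

lemma isCoderivation_underTransf {p : ℤ} {F : TMap A B f f} {G : TMap A B g g} {R : TMap A B f g}
    (hF : IsCocatHom F) (hG : IsCocatHom G) (hR : IsHomogeneous p R) :
    IsCoderivation p (underFunctor F) (underFunctor G) (underTransf p F R G) :=
  isCoderivation_coderivation (isCocatHom_underFunctor hF) (isCocatHom_underFunctor hG)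
    hR.inc_underComps

lemma low_underTransf {p : ℤ} {F : TMap A B f f} {G : TMap A B g g} {R : TMap A B f g}
    (hF : IsCocatHom F) (hG : IsCocatHom G) (hR : IsHomogeneous p R)
    (h0 : ∀ X Y x, e0 B (f X) (g Y) (R X Y x) = 0) (x : T (plus A) X Y) :
    low B (f X) (g Y) (underTransf p F R G X Y x) = R X Y (low A X Y x) := by
  refine low_eq_of_pr1 (pr1_coderivation (isCocatHom_underFunctor hF)
    (isCocatHom_underFunctor hG) _ x) ?_
  rw [h0, ← etaEps_e0, (isCoderivation_underTransf hF hG hR).e0_apply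
    (isCocatHom_underFunctor hF) (isCocatHom_underFunctor hG), map_zero]

lemma IsCoderivation.low_underTransf {p : ℤ} {F : TMap A B f f} {G : TMap A B g g}
    {R : TMap A B f g} (hF : IsCocatHom F) (hG : IsCocatHom G) (hR : IsCoderivation p F G R)
    (x : T (plus A) X Y) :
    low B (f X) (g Y) (underTransf p F R G X Y x) = R X Y (low A X Y x) :=
  AInf.low_underTransf hF hG hR.homogeneous (fun _ _ => hR.e0_apply hF hG) x

lemma underDiff_eq (b : TMap A A (fun X => X) (fun X => X)) :
    underDiff b = underTransf 1 (idT A) b (idT A) := by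
  rw [underTransf, underFunctor_idT, underDiff]

theorem IsCoderivation.ext_low {p : ℤ} {F : TMap A (plus B) f f} {G : TMap A (plus B) g g}
    {R R' : TMap A (plus B) f g} (hF : IsCocatHom F) (hG : IsCocatHom G)
    (hR : IsCoderivation p F G R) (hR' : IsCoderivation p F G R')
    (h : ∀ X Y x, low B (f X) (g Y) (R X Y x) = low B (f X) (g Y) (R' X Y x)) : R = R' :=
  hR.ext hF hG hR' fun X Y x => by rw [← plusProj_low, h, plusProj_low]

lemma isCoderivation_zero {p : ℤ} {F : TMap A B f f} {G : TMap A B g g} :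
    IsCoderivation p F G (0 : TMap A B f g) :=
  isCoderivation_of_sumCut (fun X Y w x w' _ => rfl) fun X Y x P _ _ β => by
    refine (map_zero (sumCut β)).trans ?_
    rw [sumCut_congr (γ := fun Z => 0) (fun Z x _ => map_zero (β (f Z) (F X Z x))),
      sumCut_congr (β := fun Z => (β (g Z)).compl₁₂ ((0 : TMap A B f g) X Z)
        (G Z Y ∘ₗ sgn A p Z Y)) (γ := fun Z => 0) (fun Z x y => LinearMap.congr_fun
          (map_zero (β (g Z))) _), sumCut_zero, add_zero]

lemma IsCoderivation.apply_one {p : ℤ} {F : TMap A B f f} {G : TMap A B g g} {R : TMap A B f g}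
    (hF : IsCocatHom F) (hG : IsCocatHom G) (hR : IsCoderivation p F G R) (X : S) :
    R X X (one A X) = iota B (f X) (g X) (R X X (one A X)) := by
  conv_lhs => rw [hR.eq_left hF hG]
  rw [sumCut_one, sumCut_one]
  simp only [LinearMap.compl₁₂_apply, LinearMap.comp_apply, sgn_one, hF.map_one, hG.map_one,
    iota_one, map_zero, LinearMap.zero_apply, zero_add, mulL_one]

variable {b : TMap A A (fun X => X) (fun X => X)} {b' : TMap B B (fun X => X) (fun X => X)}

lemma isCoderivation_underDiff (hb : IsHomogeneous 1 b) :
    IsCoderivation 1 (idT (plus A)) (idT (plus A)) (underDiff b) :=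
  isCoderivation_coderivation isCocatHom_idT isCocatHom_idT hb.inc_underComps

lemma low_underDiff (hb : IsCoderivation 1 (idT A) (idT A) b) (x : T (plus A) X Y) :
    low A X Y (underDiff b X Y x) = b X Y (low A X Y x) := by
  rw [underDiff_eq]
  exact hb.low_underTransf isCocatHom_idT isCocatHom_idT x

/-- The square of the underlined codifferential is a coderivation of degree `2`, and `low` carries
it to `b² = 0`; since `low` determines coderivations, it vanishes. -/
theorem IsAInfCategory.under (hA : IsAInfCategory A b) : IsAInfCategory (plus A) (underDiff b) := by
  have hb := isCoderivation_underDiff hA.coderivation.homogeneous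
  refine ⟨hb, fun X => ?_, fun X Y => LinearMap.ext fun x => ?_⟩
  · rw [hb.apply_one isCocatHom_idT isCocatHom_idT, iota_eq_zero_iff, ← plusProj_low,
      low_underDiff hA.coderivation, low_one, hA.map_one, map_zero]
  · exact LinearMap.congr_fun (congr_fun (congr_fun (hb.sq.ext_low isCocatHom_idT isCocatHom_idT
      isCoderivation_zero fun X Y x => by
        rw [LinearMap.comp_apply, low_underDiff hA.coderivation, low_underDiff hA.coderivation,
          ← LinearMap.comp_apply, hA.sq_zero]
        exact (map_zero _).symm) X) Y) x

lemma IsAInfFunctor.comm_apply {F : TMap A B f f} (hF : IsAInfFunctor b b' F) (X Y : S)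
    (x : T A X Y) : b' (f X) (f Y) (F X Y x) = F X Y (b X Y x) :=
  LinearMap.congr_fun (hF.comm X Y) x

theorem IsAInfFunctor.under {F : TMap A B f f} (hA : IsAInfCategory A b) (hB : IsAInfCategory B b')
    (hF : IsAInfFunctor b b' F) :
    IsAInfFunctor (underDiff b) (underDiff b') (underFunctor F) := by
  have hF' := isCocatHom_underFunctor hF.cocatHom
  refine ⟨hF', fun X Y => ?_⟩
  have h1 := (isCoderivation_underDiff hB.coderivation.homogeneous).comp_hom hF'
  have h2 := (isCoderivation_underDiff hA.coderivation.homogeneous).hom_comp hF'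
  refine congr_fun (congr_fun (IsCoderivation.ext_low hF' hF' h1 h2 fun X Y x => ?_) X) Y
  rw [LinearMap.comp_apply, LinearMap.comp_apply, low_underDiff hB.coderivation,
    low_underFunctor hF.cocatHom, low_underFunctor hF.cocatHom, low_underDiff hA.coderivation,
    hF.comm_apply]

lemma low_B1 (hA : IsAInfCategory A b) (hB : IsAInfCategory B b') {p : ℤ} {R : TMap A B f g}
    {R' : TMap (plus A) (plus B) f g}
    (h : ∀ X Y x, low B (f X) (g Y) (R' X Y x) = R X Y (low A X Y x)) (x : T (plus A) X Y) :
    low B (f X) (g Y) (B1 (underDiff b) (underDiff b') p R' X Y x) =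
      B1 b b' p R X Y (low A X Y x) := by
  rw [B1_apply, B1_apply, map_sub, map_zsmul, h, low_underDiff hB.coderivation, h,
    low_underDiff hA.coderivation]

theorem IsNatural.under {F : TMap A B f f} {G : TMap A B g g} {R : TMap A B f g}
    (hA : IsAInfCategory A b) (hB : IsAInfCategory B b') (hF : IsAInfFunctor b b' F)
    (hG : IsAInfFunctor b b' G) (hR : IsNatural b b' F G R) :
    IsNatural (underDiff b) (underDiff b') (underFunctor F) (underFunctor G)
      (underTransf (-1) F R G) := by
  have hF' := hF.under hA hB
  have hG' := hG.under hA hB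
  have hR' := isCoderivation_underTransf hF.cocatHom hG.cocatHom hR.coderivation.homogeneous
  refine ⟨hR', ?_⟩
  refine IsCoderivation.ext_low hF'.cocatHom hG'.cocatHom (IsCoderivation.B1 hA.under.coderivation
    hB.under.coderivation hF'.comm_apply hG'.comm_apply hR' hG'.cocatHom.homogeneous
    (q := 0) rfl) isCoderivation_zero fun X Y x => ?_
  rw [low_B1 hA hB (R := R) (fun X Y x => hR.coderivation.low_underTransf hF.cocatHom hG.cocatHom x),
    hR.closed]
  exact (map_zero _).symm

theorem Equivalent.under {F : TMap A B f f} {G : TMap A B g g} {R P : TMap A B f g}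
    {R' P' : TMap (plus A) (plus B) f g}
    (hA : IsAInfCategory A b) (hB : IsAInfCategory B b') (hF : IsAInfFunctor b b' F)
    (hG : IsAInfFunctor b b' G) (hR : IsCoderivation (-1) (underFunctor F) (underFunctor G) R')
    (hP : IsCoderivation (-1) (underFunctor F) (underFunctor G) P')
    (hR' : ∀ X Y x, low B (f X) (g Y) (R' X Y x) = R X Y (low A X Y x))
    (hP' : ∀ X Y x, low B (f X) (g Y) (P' X Y x) = P X Y (low A X Y x))
    (h : Equivalent b b' F G R P) :
    Equivalent (underDiff b) (underDiff b') (underFunctor F) (underFunctor G) R' P' := by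
  obtain ⟨V, hV, e⟩ := h
  have hF' := hF.under hA hB
  have hG' := hG.under hA hB
  have hV' := isCoderivation_underTransf hF.cocatHom hG.cocatHom hV.homogeneous
  refine ⟨_, hV', IsCoderivation.ext_low hF'.cocatHom hG'.cocatHom (hR.sub hP)
    (IsCoderivation.B1 hA.under.coderivation hB.under.coderivation hF'.comm_apply hG'.comm_apply
      hV' hG'.cocatHom.homogeneous (q := -1) rfl) fun X Y x => ?_⟩
  rw [low_B1 hA hB (R := V) (fun X Y x => hV.low_underTransf hF.cocatHom hG.cocatHom x), ← e]
  change low B (f X) (g Y) (_ - _) = R X Y _ - P X Y _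
  rw [map_sub, hR', hP']

/-- `Θ` differs from `theta` by a coderivation, and neither of these has a part in `T⁰`. -/
lemma IsDoubleCoderivation.e0_apply {m n : ℤ} {F : TMap A B f f} {R : TMap A B f g}
    {G : TMap A B g g} {P : TMap A B g h} {H : TMap A B h h} {Θ : TMap A B f h}
    (hF : IsCocatHom F) (hG : IsCocatHom G) (hH : IsCocatHom H) (hR : IsCoderivation m F G R)
    (hP : IsCoderivation n G H P) (hΘ : IsDoubleCoderivation m n F R P H Θ) (x : T A X Y) :
    e0 B (f X) (h Y) (Θ X Y x) = 0 := by
  rw [← sub_add_cancel Θ (theta m n F R G P H)]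
  change e0 B (f X) (h Y) ((Θ - theta m n F R G P H) X Y x + theta m n F R G P H X Y x) = 0
  rw [map_add, (hΘ.sub (isDoubleCoderivation_theta hF hG hH hR hP)).e0_apply hF hH, zero_add]
  exact e0_conv_hom (F := F) _ (fun _ _ x => e0_conv_inc m (comps R) _ x) x

/-! ### The functor `overline` -/

/-- The relation for `low` becomes the relation for `flat` because `flat` is `𝐦` followed by `low`.
-/
lemma flat_conj {Φ : TMap (plus A) (plus B) f g} {R : TMap A B f g}
    (h : ∀ X Y x, low B (f X) (g Y) (Φ X Y x) = R X Y (low A X Y x)) (x : T (plus A) X Y) :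
    flat B (f X) (g Y) (conj Φ X Y x) = R X Y (flat A X Y x) := by
  rw [conj, LinearMap.comp_apply, LinearMap.comp_apply, flat_mmInv, h, low_mm]

lemma IsCocatHom.conj {F : TMap (plus A) (plus B) f f} (hF : IsCocatHom F) : IsCocatHom (conj F) :=
  isCocatHom_mmInv.comp (f := fun X => f X) (f' := fun X => X) (hF.comp isCocatHom_mm)

lemma IsCoderivation.conj {p : ℤ} {F : TMap (plus A) (plus B) f f} {G : TMap (plus A) (plus B) g g}
    {R : TMap (plus A) (plus B) f g} (hR : IsCoderivation p F G R) :
    IsCoderivation p (conj F) (conj G) (conj R) :=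
  IsCoderivation.hom_comp (f := fun X => f X) (f' := fun X => X) isCocatHom_mmInv
    (hR.comp_hom (f := fun X => X) isCocatHom_mm)

lemma conj_idT : conj (idT (plus A)) = idT (plus A) :=
  funext fun _ => funext fun _ => LinearMap.ext fun x => mmInv_mm x

/-- After composition with `𝐦` the projections of the `flat` values are the components, which
determine coderivations; `𝐦` is then cancelled by its left inverse. -/
theorem IsCoderivation.ext_flat {p : ℤ} {C : GradedQuiver k S''} {f g : S'' → S}
    {F : TMap C (plus A) f f} {G : TMap C (plus A) g g}
    {R R' : TMap C (plus A) f g} (hF : IsCocatHom F) (hG : IsCocatHom G)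
    (hR : IsCoderivation p F G R) (hR' : IsCoderivation p F G R')
    (h : ∀ X Y x, flat A (f X) (g Y) (R X Y x) = flat A (f X) (g Y) (R' X Y x)) : R = R' := by
  have h1 := IsCoderivation.ext (isCocatHom_mm.comp hF) (isCocatHom_mm.comp hG)
    (hR.hom_comp isCocatHom_mm) (hR'.hom_comp isCocatHom_mm) fun X Y x => by
      rw [LinearMap.comp_apply, LinearMap.comp_apply, ← plusProj_flat, h, plusProj_flat]
  refine funext fun X => funext fun Y => LinearMap.ext fun x => ?_
  have := LinearMap.congr_fun (congr_fun (congr_fun h1 X) Y) x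
  rw [LinearMap.comp_apply, LinearMap.comp_apply] at this
  rw [← mmInv_mm (R X Y x), this, mmInv_mm]

theorem IsCocatHom.ext_flat {C : GradedQuiver k S''} {f : S'' → S}
    {F G : TMap C (plus A) f f} (hF : IsCocatHom F) (hG : IsCocatHom G)
    (h : ∀ X Y x, flat A (f X) (f Y) (F X Y x) = flat A (f X) (f Y) (G X Y x)) : F = G := by
  have h1 := IsCocatHom.ext (isCocatHom_mm.comp hF) (isCocatHom_mm.comp hG) fun X Y x => by
      rw [LinearMap.comp_apply, LinearMap.comp_apply, ← plusProj_flat, h, plusProj_flat]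
  refine funext fun X => funext fun Y => LinearMap.ext fun x => ?_
  have := LinearMap.congr_fun (congr_fun (congr_fun h1 X) Y) x
  rw [LinearMap.comp_apply, LinearMap.comp_apply] at this
  rw [← mmInv_mm (F X Y x), this, mmInv_mm]

lemma isCocatHom_overFunctor {F : TMap A B f f} (hF : IsCocatHom F) :
    IsCocatHom (overFunctor F) := (isCocatHom_underFunctor hF).conj

lemma flat_overFunctor {F : TMap A B f f} (hF : IsCocatHom F) (x : T (plus A) X Y) :
    flat B (f X) (f Y) (overFunctor F X Y x) = F X Y (flat A X Y x) :=
  flat_conj (R := F) (Φ := underFunctor F) (fun _ _ x => low_underFunctor hF x) x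

lemma overFunctor_idT : overFunctor (idT A) = idT (plus A) := by
  rw [overFunctor, underFunctor_idT, conj_idT]

lemma IsCoderivation.overTransf {p : ℤ} {F : TMap A B f f} {G : TMap A B g g} {R : TMap A B f g}
    (hF : IsCocatHom F) (hG : IsCocatHom G) (hR : IsCoderivation p F G R) :
    IsCoderivation p (overFunctor F) (overFunctor G) (overTransf p F R G) :=
  (isCoderivation_underTransf hF hG hR.homogeneous).conj

lemma IsCoderivation.flat_overTransf {p : ℤ} {F : TMap A B f f} {G : TMap A B g g}
    {R : TMap A B f g} (hF : IsCocatHom F) (hG : IsCocatHom G) (hR : IsCoderivation p F G R)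
    (x : T (plus A) X Y) :
    flat B (f X) (g Y) (AInf.overTransf p F R G X Y x) = R X Y (flat A X Y x) :=
  flat_conj (R := R) (Φ := underTransf p F R G) (fun _ _ x => hR.low_underTransf hF hG x) x

lemma overDiff_eq (b : TMap A A (fun X => X) (fun X => X)) :
    overDiff b = overTransf 1 (idT A) b (idT A) := by
  rw [overTransf, ← underDiff_eq, overDiff]

end

end

/-! ### Lifting maps to tensors with marked objects. -/

section
variable {A : GradedQuiver k S} {A' : GradedQuiver k S'} {D : Set S} {E : Set S'}
  {X Y Z W : S} {d : ℤ} {P Q : Type u}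
  [AddCommGroup P] [Module k P] [AddCommGroup Q] [Module k Q]

local infixl:70 " ⋆ " => mulL _ _ _ _

/-! ### Marked objects -/

/-- Objects of `S`, possibly marked, where only the elements of `D` can be marked. -/
structure Marked (D : Set S) : Type u where
  obj : S
  mark : Bool
  mem : mark = true → obj ∈ D

namespace Marked

/-- An object, unmarked. -/
abbrev bot (D : Set S) (X : S) : Marked D := ⟨X, false, fun h => nomatch h⟩

/-- An object of `D`, marked. -/
abbrev top {D : Set S} {X : S} (h : X ∈ D) : Marked D := ⟨X, true, fun _ => h⟩

/-- The map induced by `f`, preserving marks. -/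
abbrev map (f : S → S') (hf : ∀ X ∈ D, f X ∈ E) (z : Marked D) : Marked E :=
  ⟨f z.obj, z.mark, fun h => hf _ (z.mem h)⟩

end Marked

/-- The quiver `A` with objects marked in all possible ways. -/
abbrev dbl (A : GradedQuiver k S) (D : Set S) : GradedQuiver k (Marked D) :=
  fun z w => A z.obj w.obj

/-- The map forgetting the marks. -/
def forget (A : GradedQuiver k S) (D : Set S) : TMap (dbl A D) A Marked.obj Marked.obj :=
  strict (A := dbl A D) (B := A) Marked.obj fun _ _ _ => LinearMap.id

section
variable {z w m : Marked D}

lemma forget_one (z : Marked D) : forget A D z z (one (dbl A D) z) = one A z.obj := strict_one z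

lemma forget_cns (a : dbl A D z m d) (y : T (dbl A D) m w) :
    forget A D z w (cns a y) = cns (A := A) (X := z.obj) a (forget A D m w y) := strict_cns a y

lemma isCocatHom_forget : IsCocatHom (forget A D) := isCocatHom_strict

lemma pr1_cns_one (a : A X Z d) : pr1 A X Z (cns a (one A Z)) = inTot A X Z d a := by
  rw [← in1_inTot, pr1_in1]

lemma pr1_forget (x : T (dbl A D) z w) :
    pr1 A z.obj w.obj (forget A D z w x) = pr1 (dbl A D) z w x := by
  induction x using T.induction with
  | h0 => simp
  | hadd x y hx hy => simp only [map_add, hx, hy]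
  | hsmul c x hx => simp only [map_smul, hx]
  | hone z => rw [forget_one, pr1_one, pr1_one]
  | hcns a y ih =>
    rw [forget_cns]
    clear ih
    induction y using T.induction with
    | h0 => simp
    | hadd x y hx hy => simp only [map_add, hx, hy]
    | hsmul c x hx => simp only [map_smul, hx]
    | hone z => rw [forget_one, pr1_cns_one, pr1_cns_one]
    | hcns a y _ => rw [forget_cns, pr1_cns_cns, pr1_cns_cns]

lemma pr1_apply_of_mem_Deg {n : ℤ} {x : T A X Y} (hx : x ∈ Deg A n X Y) {e : ℤ} (he : e ≠ n) :
    pr1 A X Y x e = 0 := by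
  have : Deg A n X Y ≤ LinearMap.ker (DirectSum.component k ℤ (fun e => (A X Y e : Type u)) e ∘ₗ
      pr1 A X Y) := by
    refine Deg.le_of_word fun w hw x => ?_
    rw [LinearMap.mem_ker, LinearMap.comp_apply, pr1, DirectSum.toModule_lof]
    match w, hw, x with
    | .nil _, _, _ => exact map_zero _
    | .cons _ _ (.cons _ _ _), _, _ => exact map_zero _
    | .cons X d (.nil _), hw, x =>
      refine DirectSum.of_eq_of_ne (β := fun e => (A X Y e : Type u)) d e _ ?_
      rintro rfl
      simp [Word.degree] at hw
      exact he hw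
  exact this hx

lemma in1_mem_Deg {n : ℤ} {v : Tot A X Y} (h : ∀ e, e ≠ n → v e = 0) :
    in1 A X Y v ∈ Deg A n X Y := by
  rw [show v = inTot A X Y n (v n) from DFinsupp.ext fun e => by
    rcases eq_or_ne e n with rfl | he
    · exact (DirectSum.of_eq_same (β := fun e => (A X Y e : Type u)) e _).symm
    · rw [h e he]
      exact (DirectSum.of_eq_of_ne (β := fun e => (A X Y e : Type u)) n e _ he).symm, in1_inTot]
  exact cns_mem_Deg _ (one_mem_Deg Y) (add_zero n)

/-- Components on marked objects. -/
def liftComps {f g : S → S'} (hf : ∀ X ∈ D, f X ∈ E) (hg : ∀ X ∈ D, g X ∈ E)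
    (φ : Comps A A' f g) : Comps (dbl A D) (dbl A' E) (Marked.map f hf) (Marked.map g hg) :=
  fun z w => φ z.obj w.obj ∘ₗ forget A D z w

variable {f g h : S → S'} (hf : ∀ X ∈ D, f X ∈ E) (hg : ∀ X ∈ D, g X ∈ E)
  (hh : ∀ X ∈ D, h X ∈ E)

lemma IsHomogeneous.liftComps {p : ℤ} {R : TMap A A' f g} (hR : IsHomogeneous p R) :
    IsHomogeneous p (inc (liftComps hf hg (comps R))) := by
  rw [isHomogeneous_iff]
  intro z w n x hx
  have h1 := isHomogeneous_iff.1 (isCocatHom_forget (A := A)).homogeneous z w n hx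
  rw [add_zero] at h1
  exact in1_mem_Deg fun e he => pr1_apply_of_mem_Deg (isHomogeneous_iff.1 hR _ _ n h1) he

/-- A cocategory homomorphism on marked objects. -/
def liftHom (F : TMap A A' f f) :
    TMap (dbl A D) (dbl A' E) (Marked.map f hf) (Marked.map f hf) :=
  cocatHom (liftComps hf hf (comps F))

lemma liftComps_one {F : TMap A A' f f} (hF : IsCocatHom F) (z : Marked D) :
    liftComps hf hf (comps F) z z (one (dbl A D) z) = 0 := by
  change pr1 A' _ _ (F z.obj z.obj (forget A D z z (one (dbl A D) z))) = 0
  rw [forget_one, hF.map_one, pr1_one]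

lemma isCocatHom_liftHom {F : TMap A A' f f} (hF : IsCocatHom F) : IsCocatHom (liftHom hf F) :=
  isCocatHom_cocatHom (hF.homogeneous.liftComps hf hf) (liftComps_one hf hF)

/-- Both sides are cocategory homomorphisms from marked words to `TA'`. Their components agree
because forgetting marks acts letter by letter. -/
lemma forget_liftHom {F : TMap A A' f f} (hF : IsCocatHom F) :
    (fun z w => forget A' E (Marked.map f hf z) (Marked.map f hf w) ∘ₗ liftHom hf F z w) =
      fun z w => F z.obj w.obj ∘ₗ forget A D z w := by
  refine IsCocatHom.ext (f := fun z => f (Marked.obj z))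
    (isCocatHom_forget.comp (isCocatHom_liftHom hf hF)) (hF.comp isCocatHom_forget)
    fun z w x => ?_
  refine (pr1_forget (A := A') (z := Marked.map f hf z) (w := Marked.map f hf w)
    (liftHom hf F z w x)).trans ?_
  exact pr1_cocatHom (hF.homogeneous.liftComps hf hf) (liftComps_one hf hF) x

/-- A coderivation on marked objects. -/
def liftCoder (p : ℤ) (F : TMap A A' f f) (R : TMap A A' f g) (G : TMap A A' g g) :
    TMap (dbl A D) (dbl A' E) (Marked.map f hf) (Marked.map g hg) :=
  coderivation p (liftHom hf F) (liftComps hf hg (comps R)) (liftHom hg G)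

section
variable {F : TMap A A' f f} {G : TMap A A' g g} {H : TMap A A' h h}

lemma isCoderivation_liftCoder {p : ℤ}  {R : TMap A A' f g}
    (hF : IsCocatHom F) (hG : IsCocatHom G) (hR : IsHomogeneous p R) :
    IsCoderivation p (liftHom hf F) (liftHom hg G) (liftCoder hf hg p F R G) :=
  isCoderivation_coderivation (isCocatHom_liftHom hf hF) (isCocatHom_liftHom hg hG)
    (hR.liftComps hf hg)

lemma forget_liftCoder {p : ℤ} {R : TMap A A' f g}
    (hF : IsCocatHom F) (hG : IsCocatHom G) (hR : IsCoderivation p F G R)  :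
    (fun z w => forget A' E (Marked.map f hf z) (Marked.map g hg w) ∘ₗ
      liftCoder hf hg p F R G z w) = fun z w => R z.obj w.obj ∘ₗ forget A D z w := by
  have h1 := (isCoderivation_liftCoder hf hg hF hG hR.homogeneous).hom_comp isCocatHom_forget
  rw [forget_liftHom hf hF, forget_liftHom hg hG] at h1
  refine IsCoderivation.ext (f := fun z => f (Marked.obj z)) (g := fun z => g (Marked.obj z))
    (hF.comp isCocatHom_forget) (hG.comp isCocatHom_forget) h1
    (hR.comp_hom isCocatHom_forget) fun z w x => ?_
  refine (pr1_forget (A := A') (z := Marked.map f hf z) (w := Marked.map g hg w)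
    (liftCoder hf hg p F R G z w x)).trans ?_
  exact pr1_coderivation (isCocatHom_liftHom hf hF) (isCocatHom_liftHom hg hG) _ x

/-- The lift is `theta` of the lifted data corrected by a coderivation with the components of `Θ`.
Since `theta` has no components, this correction fixes the components, and double coderivations for
the same data with equal components are equal. -/
lemma IsDoubleCoderivation.exists_lift {m n : ℤ} {R : TMap A A' f g} {P : TMap A A' g h}
    {Θ : TMap A A' f h} (hF : IsCocatHom F) (hG : IsCocatHom G) (hH : IsCocatHom H)
    (hR : IsCoderivation m F G R) (hP : IsCoderivation n G H P)
    (hΘ : IsDoubleCoderivation m n F R P H Θ) :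
    ∃ Θ' : TMap (dbl A D) (dbl A' E) (Marked.map f hf) (Marked.map h hh),
      IsDoubleCoderivation m n (liftHom hf F) (liftCoder hf hg m F R G)
        (liftCoder hg hh n G P H) (liftHom hh H) Θ' ∧
      (fun z w => forget A' E (Marked.map f hf z) (Marked.map h hh w) ∘ₗ Θ' z w) =
        fun z w => Θ z.obj w.obj ∘ₗ forget A D z w := by
  have hF' := isCocatHom_liftHom hf hF
  have hG' := isCocatHom_liftHom hg hG
  have hH' := isCocatHom_liftHom hh hH
  have hR' := isCoderivation_liftCoder hf hg hF hG hR.homogeneous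
  have hP' := isCoderivation_liftCoder hg hh hG hH hP.homogeneous
  have h0 := isDoubleCoderivation_theta hF' hG' hH' hR' hP'
  set Θ₀ := theta m n (liftHom hf F) (liftCoder hf hg m F R G) (liftHom hg G)
    (liftCoder hg hh n G P H) (liftHom hh H) with hΘ₀
  -- The components are negated because the correction will be subtracted from `theta`.
  have hV : IsCoderivation (m + n) (liftHom hf F) (liftHom hh H)
      (coderivation (m + n) (liftHom hf F) (-liftComps hf hh (comps Θ)) (liftHom hh H)) := by
    refine isCoderivation_coderivation hF' hH' ?_
    intro z w v x v' hv'
    have := hΘ.homogeneous.liftComps hf hh z w v x v' hv'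
    rw [inc, LinearMap.comp_apply] at this ⊢
    change in1 (dbl A' E) _ _ (-_) v' = 0
    rw [map_neg]
    exact neg_eq_zero.2 this
  refine ⟨_, h0.sub_coderivation hV rfl, ?_⟩
  have h1 := (h0.sub_coderivation hV rfl).hom_comp isCocatHom_forget
  have h2 := hΘ.comp_hom (isCocatHom_forget (A := A) (D := D))
  rw [forget_liftHom hf hF, forget_liftHom hh hH, forget_liftCoder hf hg hF hG hR,
    forget_liftCoder hg hh hG hH hP] at h1
  -- After forgetting marks, both maps are double coderivations for the same data, so their
  -- difference is a coderivation and is zero once its components are.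
  refine sub_eq_zero.1 (IsCoderivation.eq_zero (f := fun z => f (Marked.obj z))
    (g := fun z => h (Marked.obj z)) (hF.comp isCocatHom_forget) (hH.comp isCocatHom_forget)
    (h1.sub h2) fun z w x => ?_)
  refine (map_sub (pr1 A' (f z.obj) (h w.obj)) _ _).trans (sub_eq_zero.2 ?_)
  refine (pr1_forget (A := A') (z := Marked.map f hf z) (w := Marked.map h hh w)
    ((Θ₀ - coderivation (m + n) (liftHom hf F) (-liftComps hf hh (comps Θ)) (liftHom hh H)) z w x)).trans ?_
  change pr1 (dbl A' E) _ _ (Θ₀ z w x - _) = _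
  rw [map_sub, pr1_coderivation hF' hH', hΘ₀, pr1_theta hF', zero_sub]
  exact neg_neg _

end
end

end

/-! ### The bijection between tensors over `sD(C|B)` and marked tensors. -/

section
variable {A : GradedQuiver k S} {A' : GradedQuiver k S'} {D : Set S} {E : Set S'}
  {X Y Z W : S} {d : ℤ} {P Q : Type u}
  [AddCommGroup P] [Module k P] [AddCommGroup Q] [Module k Q]

local infixl:70 " ⋆ " => mulL _ _ _ _

/-! ### The projection to `sD(C|B)` -/

/-- The projection `TA → sD(C|B)`. -/
def overProj (A : GradedQuiver k S) (D : Set S) (X Y : S) : T A X Y →ₗ[k] Tot (plusOver A D) X Y :=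
  DirectSum.toModule k (Word S X Y) (Tot (plusOver A D) X Y) fun w =>
    if hw : 0 < w.length ∧ ∀ Z ∈ w.inner, Z ∈ D then
      inTot (plusOver A D) X Y w.degree ∘ₗ inPlus A D ⟨w, hw.1, hw.2, rfl⟩
    else 0

lemma Word.length_cons_pos (X : S) (d : ℤ) (w : Word S Z Y) : 0 < (Word.cons X d w).length :=
  Nat.succ_pos _

lemma overProj_inT {w : Word S X Y} (hw : 0 < w.length) (hD : ∀ Z ∈ w.inner, Z ∈ D) (x : Tens A w) :
    overProj A D X Y (inT A w x) =
      inTot (plusOver A D) X Y w.degree (inPlus A D ⟨w, hw, hD, rfl⟩ x) := by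
  rw [overProj, DirectSum.toModule_lof, dif_pos ⟨hw, hD⟩, LinearMap.comp_apply]

lemma overProj_inT_of_not {w : Word S X Y} (hw : ¬(0 < w.length ∧ ∀ Z ∈ w.inner, Z ∈ D))
    (x : Tens A w) : overProj A D X Y (inT A w x) = 0 := by
  rw [overProj, DirectSum.toModule_lof, dif_neg hw, LinearMap.zero_apply]

lemma overIn_overProj_inT {w : Word S X Y} (hw : 0 < w.length) (hD : ∀ Z ∈ w.inner, Z ∈ D)
    (x : Tens A w) : overIn A D X Y (overProj A D X Y (inT A w x)) = inT A w x := by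
  rw [overProj_inT hw hD, overIn_inTot_inPlus]

lemma overProj_one (X : S) : overProj A D X X (one A X) = 0 :=
  overProj_inT_of_not (fun h => absurd h.1 (lt_irrefl 0)) _

theorem overIn_induction {p : Tot (plusOver A D) X Y → Prop} (h0 : p 0)
    (hadd : ∀ x y, p x → p y → p (x + y))
    (h : ∀ d (w : PlusWord D X Y d) x, p (inTot (plusOver A D) X Y d (inPlus A D w x))) (x) :
    p x := by
  refine Tot_induction h0 hadd (fun d x => ?_) x
  refine plusOver_induction (p := fun x => p (inTot (plusOver A D) X Y d x)) ?_ ?_ (h d) x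
  · rw [map_zero]; exact h0
  · intro x y hx hy
    rw [map_add]; exact hadd _ _ hx hy

lemma overProj_overIn (x : Tot (plusOver A D) X Y) :
    overProj A D X Y (overIn A D X Y x) = x := by
  induction x using overIn_induction with
  | h0 => simp
  | hadd x y hx hy => simp only [map_add, hx, hy]
  | h d w x =>
    obtain ⟨w, hw, hD, rfl⟩ := w
    rw [overIn_inTot_inPlus, overProj_inT hw hD]

lemma etaEps_overIn (f : S → S') {B : GradedQuiver k S'} (x : Tot (plusOver A D) X Y) :
    etaEps A B f X Y (overIn A D X Y x) = 0 := by
  rw [← etaEps_e0, e0_overIn, map_zero]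

lemma overIn_overProj_cns_one (a : A X Z d) :
    overIn A D X Z (overProj A D X Z (cns a (one A Z))) = cns a (one A Z) := by
  rw [one, cns_inT]
  exact overIn_overProj_inT (Word.length_cons_pos _ _ _) (fun V hV => by simp [Word.inner] at hV) _

lemma Word.inner_cons (X : S) (d : ℤ) {w : Word S Z Y} (hw : 0 < w.length) :
    (Word.cons X d w).inner = Z :: w.inner := by
  cases w with
  | nil => exact absurd hw (lt_irrefl 0)
  | cons => rfl

lemma overIn_overProj_cns_overIn (hZ : Z ∈ D) (a : A X Z d) (x : Tot (plusOver A D) Z Y) :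
    overIn A D X Y (overProj A D X Y (cns a (overIn A D Z Y x))) = cns a (overIn A D Z Y x) := by
  induction x using overIn_induction with
  | h0 => simp
  | hadd x y hx hy => simp only [map_add, hx, hy]
  | h d w x =>
    rw [overIn_inTot_inPlus, cns_inT]
    refine overIn_overProj_inT (Word.length_cons_pos _ _ _) (fun V hV => ?_) _
    rw [Word.inner_cons _ _ w.2.1, List.mem_cons] at hV
    rcases hV with rfl | hV
    · exact hZ
    · exact w.2.2.1 V hV

/-- If `x` lies in `T⁰`, prepending `a` creates no inner object. Otherwise `Z` becomes inner, so the
product survives only for `Z` in `D` and only on the part of `x` that survives. -/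
lemma overProj_cns (a : A X Z d) (x : T A Z Y) :
    overProj A D X Y (cns a x) = overProj A D X Y (cns a (e0 A Z Y x)) +
      if Z ∈ D then overProj A D X Y (cns a (overIn A D Z Y (overProj A D Z Y x))) else 0 := by
  induction x using T.word_induction with
  | h0 => simp
  | hadd x y hx hy =>
    rw [map_add, map_add, hx, hy]
    split_ifs <;> simp only [map_add] <;> abel
  | h w x =>
    rcases Nat.eq_zero_or_pos w.length with hw | hw
    · cases w with
      | nil =>
        obtain ⟨c, rfl⟩ := (tnil A _).surjective x
        rw [inT_nil, map_smul (e0 A _ _), etaEps_one, map_smul (overProj A D _ _) c (one A _),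
          overProj_one]
        simp
      | cons => simp [Word.length] at hw
    · rw [e0_inT_of_pos hw, map_zero, map_zero, zero_add]
      by_cases hD : ∀ V ∈ w.inner, V ∈ D
      · rw [overIn_overProj_inT hw hD]
        split_ifs with hZ
        · rfl
        · rw [cns_inT]
          refine overProj_inT_of_not (fun h => hZ (h.2 _ ?_)) _
          rw [Word.inner_cons _ _ hw]
          exact List.mem_cons_self
      · rw [overProj_inT_of_not (fun h => hD h.2), map_zero, map_zero, map_zero, ite_self, cns_inT]
        refine overProj_inT_of_not (fun h => hD fun V hV => h.2 _ ?_) _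
        rw [Word.inner_cons _ _ hw]
        exact List.mem_cons_of_mem _ hV

/-! ### Tensors over `sD(C|B)` as tensors with marked objects -/

/-- The element of `TA` with all inner objects marked, zero on `T⁰A` and if some inner object is
not in `D`: one summand. -/
def markTens (A : GradedQuiver k S) (D : Set S) :
    {X Y : S} → (w : Word S X Y) → (c : Bool) → (hc : c = true → X ∈ D) →
      Tens A w →ₗ[k] T (dbl A D) ⟨X, c, hc⟩ (Marked.bot D Y)
  | _, _, .nil _, _, _ => 0
  | _, _, .cons (Z := Z) (Y := Y) X d w, c, hc =>
      (consT (dbl A D) ⟨X, c, hc⟩ (Marked.bot D Z) (Marked.bot D Y) d ∘ₗ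
          LinearMap.lTensor (A X Z d) (etaEps A (dbl A D) (Marked.bot D) Z Y ∘ₗ inT A w) ∘ₗ
            (tcons A X d w).symm.toLinearMap +
        if hZ : Z ∈ D then
          consT (dbl A D) ⟨X, c, hc⟩ (Marked.top hZ) (Marked.bot D Y) d ∘ₗ
            LinearMap.lTensor (A X Z d) (markTens A D w true fun _ => hZ) ∘ₗ
              (tcons A X d w).symm.toLinearMap
        else 0)

/-- The element of `TA` with all inner objects marked, zero on `T⁰A` and if some inner object is
not in `D`. -/
def marked (A : GradedQuiver k S) (D : Set S) (c : Bool) (X Y : S) (hc : c = true → X ∈ D) :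
    T A X Y →ₗ[k] T (dbl A D) ⟨X, c, hc⟩ (Marked.bot D Y) :=
  DirectSum.toModule k (Word S X Y) _ fun w => markTens A D w c hc

section
variable {c : Bool} {hc : c = true → X ∈ D}

lemma marked_one {hc : c = true → X ∈ D} : marked A D c X X hc (one A X) = 0 := by
  rw [marked, one, DirectSum.toModule_lof]; rfl

lemma marked_cns (a : A X Z d) (x : T A Z Y) :
    marked A D c X Y hc (cns a x) =
      cns (A := dbl A D) (X := ⟨X, c, hc⟩) (Z := Marked.bot D Z) a
        (etaEps A (dbl A D) (Marked.bot D) Z Y x) +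
      if hZ : Z ∈ D then cns (A := dbl A D) (X := ⟨X, c, hc⟩) (Z := Marked.top hZ) a
        (marked A D true Z Y (fun _ => hZ) x) else 0 := by
  induction x using T.word_induction with
  | h0 => simp
  | hadd x y hx hy =>
    rw [map_add, map_add, hx, hy, map_add, map_add]
    split_ifs
    · rw [map_add, map_add]; abel
    · abel
  | h w x =>
    rw [cns_inT, marked, DirectSum.toModule_lof]
    split_ifs with hZ
    · rw [marked, DirectSum.toModule_lof, markTens, dif_pos hZ]; rfl
    · rw [markTens, dif_neg hZ]; rfl

lemma marked_cns_one (a : A X Z d) :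
    marked A D c X Z hc (cns a (one A Z)) =
      cns (A := dbl A D) (X := ⟨X, c, hc⟩) (Z := Marked.bot D Z) a
        (one (dbl A D) (Marked.bot D Z)) := by
  rw [marked_cns, etaEps_one]
  split_ifs with h
  · rw [marked_one, map_zero, add_zero]
  · rw [add_zero]

/-- All inner objects are marked, so a form that vanishes at marked objects sees only the two
trivial cuts. -/
lemma sumCut_marked (γ : ∀ m, T (dbl A D) ⟨X, c, hc⟩ m →ₗ[k] T (dbl A D) m (Marked.bot D Y) →ₗ[k] P)
    (hγ : ∀ m, m.mark = true → γ m = 0) (x : T A X Y) :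
    sumCut γ (marked A D c X Y hc x) =
      γ _ (one (dbl A D) _) (marked A D c X Y hc x) +
        γ _ (marked A D c X Y hc x) (one (dbl A D) _) := by
  induction x using T.induction generalizing c with
  | h0 => simp
  | hadd x y hx hy => simp only [map_add, LinearMap.add_apply, hx γ hγ, hy γ hγ]; abel
  | hsmul r x hx => simp only [map_smul, LinearMap.smul_apply, hx γ hγ, smul_add]
  | hone X => rw [marked_one]; simp
  | @hcns X Z Y d a x ih =>
    have h1 : sumCut γ (cns (A := dbl A D) (X := ⟨X, c, hc⟩) (Z := Marked.bot D Z) a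
        (etaEps A (dbl A D) (Marked.bot D) Z Y x)) =
        γ _ (one (dbl A D) _) (cns (A := dbl A D) (X := ⟨X, c, hc⟩) (Z := Marked.bot D Z) a
          (etaEps A (dbl A D) (Marked.bot D) Z Y x)) +
        γ _ (cns (A := dbl A D) (X := ⟨X, c, hc⟩) (Z := Marked.bot D Z) a
          (etaEps A (dbl A D) (Marked.bot D) Z Y x)) (one (dbl A D) _) := by
      clear ih hγ
      induction x using T.induction with
      | h0 => simp
      | hadd x y hx hy => simp only [map_add, LinearMap.add_apply, hx a γ, hy a γ]; abel
      | hsmul r x hx => simp only [map_smul, LinearMap.smul_apply, hx a γ, smul_add]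
      | hone Z => rw [etaEps_one, sumCut_cns, sumCut_one]; rfl
      | hcns b x _ => rw [etaEps_cns]; simp
    rw [marked_cns, map_add, h1]
    split_ifs with hZ
    · rw [sumCut_cns, ih (fun m => γ m ∘ₗ cns (A := dbl A D) (X := ⟨X, c, hc⟩)
        (Z := Marked.top hZ) a) (fun m hm => by rw [hγ m hm]; rfl)]
      -- The cut behind the first letter lies at the marked object `Z` and contributes nothing.
      rw [hγ ⟨Z, true, _⟩ rfl]
      simp only [map_add, LinearMap.add_apply, LinearMap.comp_apply, LinearMap.zero_apply]
      abel
    · simp only [map_zero, add_zero]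

end

/-- Letters of `sD(C|B)` become tensors with all inner objects marked. -/
def bars (A : GradedQuiver k S) (D : Set S) :
    TMap (plusOver A D) (dbl A D) (Marked.bot D) (Marked.bot D) :=
  mext (Marked.bot D) fun X Z d =>
    marked A D false X Z (fun h => nomatch h) ∘ₗ overIn A D X Z ∘ₗ inTot (plusOver A D) X Z d

lemma bars_one (X : S) : bars A D X X (one (plusOver A D) X) = one (dbl A D) (Marked.bot D X) :=
  mext_one X

lemma bars_cns (u : plusOver A D X Z d) (y : T (plusOver A D) Z Y) :
    bars A D X Y (cns u y) = marked A D false X Z (fun h => nomatch h)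
      (overIn A D X Z (inTot (plusOver A D) X Z d u)) ⋆ bars A D Z Y y := mext_cns u y

/-- Extension by zero to the marked objects. -/
def atBot {x y : Marked D} (β : ∀ Z, T (dbl A D) x (Marked.bot D Z) →ₗ[k]
    T (dbl A D) (Marked.bot D Z) y →ₗ[k] P) :
    ∀ m, T (dbl A D) x m →ₗ[k] T (dbl A D) m y →ₗ[k] P
  | ⟨Z, false, _⟩ => β Z
  | ⟨_, true, _⟩ => 0

/-- Unmarked objects of the marked word are the positions between letters of `sD(C|B)`. Cuts at
marked objects would split a letter; `atBot` removes them. The coalgebra structures on the two sides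
are compared through this identity. -/
lemma sumCut_atBot_bars (β : ∀ Z, T (dbl A D) (Marked.bot D X) (Marked.bot D Z) →ₗ[k]
    T (dbl A D) (Marked.bot D Z) (Marked.bot D Y) →ₗ[k] P) (x : T (plusOver A D) X Y) :
    sumCut (atBot β) (bars A D X Y x) =
      sumCut (fun Z => (β Z).compl₁₂ (bars A D X Z) (bars A D Z Y)) x := by
  have hb : ∀ {x y : Marked D} (β : ∀ Z, T (dbl A D) x (Marked.bot D Z) →ₗ[k]
      T (dbl A D) (Marked.bot D Z) y →ₗ[k] P) m, m.mark = true → atBot β m = 0 := by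
    rintro x y β ⟨Z, c, hc⟩ rfl
    rfl
  induction x using T.induction with
  | h0 => simp
  | hadd x y hx hy => simp only [map_add, hx β, hy β]
  | hsmul r x hx => simp only [map_smul, hx β]
  | hone X => rw [bars_one, sumCut_one, sumCut_one]; simp [bars_one]; rfl
  | @hcns X Z Y d u y ih =>
    rw [bars_cns, sumCut_mulL, sumCut_cns]
    set m := marked A D false X Z (fun h => nomatch h)
      (overIn A D X Z (inTot (plusOver A D) X Z d u)) with hm
    have h1 := ih fun V => β V ∘ₗ mulL (dbl A D) (Marked.bot D X) (Marked.bot D Z)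
      (Marked.bot D V) m
    have h2 : (fun V => atBot β V ∘ₗ mulL (dbl A D) (Marked.bot D X) (Marked.bot D Z) V m) =
        atBot (fun V => β V ∘ₗ mulL (dbl A D) (Marked.bot D X) (Marked.bot D Z)
      (Marked.bot D V) m) := by
      funext V
      rcases V with ⟨V, c | c, hc⟩
      · rfl
      · exact LinearMap.zero_comp _
    have h3 := sumCut_marked (fun V => (atBot β V).compl₂
      ((mulL (dbl A D) V (Marked.bot D Z) (Marked.bot D Y)).flip (bars A D Z Y y)))
      (fun V hV => by rw [hb β V hV]; rfl) (overIn A D X Z (inTot (plusOver A D) X Z d u))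
    erw [h3, h2, h1]
    simp only [LinearMap.compl₂_apply, LinearMap.flip_apply, LinearMap.compl₁₂_apply, one_mulL,
      bars_one, bars_cns]
    -- The cut behind the first letter is counted for both factors of the product and cancels the
    -- correction term of `sumCut_mulL`.
    rw [add_right_comm, add_sub_assoc, sub_eq_zero.2, add_zero]
    · refine congrArg₂ (· + ·) rfl (sumCut_congr (fun V v v' => ?_) y)
      simp only [LinearMap.comp_apply, LinearMap.compl₁₂_apply, bars_cns]
      rfl
    · rfl

/-- Only the cut behind the first letter has its left part in `T¹`, so such sums read off the first
letter. -/
lemma sumCut_pr1_in1_mulL (β : ∀ Z, Tot A X Z →ₗ[k] T A Z Y →ₗ[k] P) (u : Tot A X W)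
    (y : T A W Y) : sumCut (fun Z => β Z ∘ₗ pr1 A X Z) (in1 A X W u ⋆ y) = β W u y := by
  rw [sumCut_in1_mulL]
  have h : ∀ V (y' : T A W V), pr1 A X V (in1 A X W u ⋆ y') =
      pr1 A X V (in1 A X W u ⋆ e0 A W V y') := fun V y' => by
    apply in1_injective
    change iota _ _ _ _ = iota _ _ _ _
    rw [iota_mulL, iota_mulL, e0_in1]
    simp only [LinearMap.map_zero, LinearMap.zero_apply, zero_add]
    congr 1
    exact (etaEps_e0 (fun X => X) y').symm
  rw [sumCut_congr (γ := fun V => (β V ∘ₗ pr1 A X V ∘ₗ mulL A X W V (in1 A X W u)) ∘ₗ e0 A W V)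
    (fun V x y => by simp only [LinearMap.comp_apply, h V x]), sumCut_e0_left]
  simp only [LinearMap.comp_apply, pr1_one, map_zero, LinearMap.zero_apply, zero_add, mulL_one,
    pr1_in1]

/-- Prepending `a` to the first letter. -/
def merge (A : GradedQuiver k S) (D : Set S) (X Z Y : S) (d : ℤ) :
    A X Z d →ₗ[k] T (plusOver A D) Z Y →ₗ[k] T (plusOver A D) X Y where
  toFun a := sumCut fun V => mulL (plusOver A D) X V Y ∘ₗ in1 (plusOver A D) X V ∘ₗ
    overProj A D X V ∘ₗ cns a ∘ₗ overIn A D Z V ∘ₗ pr1 (plusOver A D) Z V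
  map_add' a b := LinearMap.ext fun x => by
    rw [LinearMap.add_apply, ← sumCut_add]
    refine sumCut_congr (fun V x y => ?_) x
    change mulL _ _ _ _ (in1 _ _ _ (overProj A D X V (cnsHom A X Z V d (a + b) _))) y = _
    rw [map_add, LinearMap.add_apply, map_add, map_add, map_add]
    rfl
  map_smul' r a := LinearMap.ext fun x => by
    rw [LinearMap.smul_apply, RingHom.id_apply, ← sumCut_smul]
    refine sumCut_congr (fun V x y => ?_) x
    change mulL _ _ _ _ (in1 _ _ _ (overProj A D X V (cnsHom A X Z V d (r • a) _))) y = _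
    rw [map_smul, LinearMap.smul_apply, map_smul, map_smul, map_smul]
    rfl

/-- On `T⁰` there is no first letter to extend and the value is `0`; `barsFrom_top_one` makes the
same choice for marked sources. -/
lemma merge_one (a : A X Z d) : merge A D X Z Z d a (one (plusOver A D) Z) = 0 := by
  change sumCut _ _ = 0
  rw [sumCut_one]
  simp only [LinearMap.comp_apply, pr1_one, map_zero, LinearMap.zero_apply]

lemma merge_in1_mulL (a : A X Z d) (u : Tot (plusOver A D) Z W) (y : T (plusOver A D) W Y) :
    merge A D X Z Y d a (in1 (plusOver A D) Z W u ⋆ y) =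
      in1 (plusOver A D) X W (overProj A D X W (cns a (overIn A D Z W u))) ⋆ y :=
  sumCut_pr1_in1_mulL (fun V => mulL (plusOver A D) X V Y ∘ₗ in1 (plusOver A D) X V ∘ₗ
    overProj A D X V ∘ₗ cns a ∘ₗ overIn A D Z V) u y

lemma in1_inTot_mulL (u : A X Z d) (y : T A Z Y) :
    in1 A X Z (inTot A X Z d u) ⋆ y = cns u y := by
  rw [in1_inTot, cns_mulL, one_mulL]

/-- The map inverse to `bars`: one factor. -/
def unbarCons (A : GradedQuiver k S) (D : Set S) (z m w : Marked D) (d : ℤ) :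
    dbl A D z m d →ₗ[k] T (plusOver A D) m.obj w.obj →ₗ[k] T (plusOver A D) z.obj w.obj :=
  -- A letter arriving at a marked object continues the first letter of what follows; one arriving
  -- at an unmarked object is a letter of its own.
  if m.mark = true then merge A D z.obj m.obj w.obj d
  else mulL (plusOver A D) z.obj m.obj w.obj ∘ₗ in1 (plusOver A D) z.obj m.obj ∘ₗ
    overProj A D z.obj m.obj ∘ₗ (cnsHom A z.obj m.obj m.obj d).flip (one A m.obj)

/-- The map inverse to `bars`: one summand. -/
def unbarTens (A : GradedQuiver k S) (D : Set S) :
    {z w : Marked D} → (u : Word (Marked D) z w) → Tens (dbl A D) u →ₗ[k]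
      T (plusOver A D) z.obj w.obj
  | _, _, .nil z => LinearMap.toSpanSingleton k _ (one (plusOver A D) z.obj) ∘ₗ
      (tnil (dbl A D) z).symm.toLinearMap
  | _, _, .cons (Z := m) (Y := w) z d u =>
      TensorProduct.lift ((unbarCons A D z m w d).compl₂ (unbarTens A D u)) ∘ₗ
        (tcons (dbl A D) z d u).symm.toLinearMap

/-- The map inverse to `bars`. -/
def unbar (A : GradedQuiver k S) (D : Set S) (z w : Marked D) :
    T (dbl A D) z w →ₗ[k] T (plusOver A D) z.obj w.obj :=
  DirectSum.toModule k (Word (Marked D) z w) _ fun u => unbarTens A D u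

lemma unbar_one (z : Marked D) : unbar A D z z (one (dbl A D) z) = one (plusOver A D) z.obj := by
  rw [unbar, one, DirectSum.toModule_lof, unbarTens, LinearMap.comp_apply]
  exact one_smul k _

lemma unbar_cns {z m w : Marked D} (a : dbl A D z m d) (y : T (dbl A D) m w) :
    unbar A D z w (cns a y) = unbarCons A D z m w d a (unbar A D m w y) := by
  induction y using T.word_induction with
  | h0 => simp
  | hadd x y hx hy => simp only [map_add, hx, hy]
  | h u x => rw [cns_inT, unbar, DirectSum.toModule_lof, unbar, DirectSum.toModule_lof]; rfl

lemma unbarCons_bot {z w : Marked D} (a : dbl A D z (Marked.bot D Z) d)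
    (y : T (plusOver A D) Z w.obj) :
    unbarCons A D z (Marked.bot D Z) w d a y =
      in1 (plusOver A D) z.obj Z (overProj A D z.obj Z (cns (A := A) (X := z.obj) a (one A Z))) ⋆ y :=
  rfl

lemma unbarCons_top {z w : Marked D} (hZ : Z ∈ D) (a : dbl A D z (Marked.top hZ) d)
    (y : T (plusOver A D) Z w.obj) :
    unbarCons A D z (Marked.top hZ) w d a y = merge A D z.obj Z w.obj d a y := rfl

lemma unbar_cns_etaEps_mulL {z w : Marked D} (a : A z.obj Z d) (x : T A Z Y)
    (y : T (dbl A D) (Marked.bot D Y) w) :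
    unbar A D z w (cns (A := dbl A D) (Z := Marked.bot D Z) a
        (etaEps A (dbl A D) (Marked.bot D) Z Y x) ⋆ y) =
      in1 (plusOver A D) z.obj Y (overProj A D z.obj Y (cns a (e0 A Z Y x))) ⋆
        unbar A D (Marked.bot D Y) w y := by
  induction x using T.induction with
  | h0 => simp
  | hadd x x' hx hx' => simp only [map_add, LinearMap.add_apply, hx a y, hx' a y]
  | hsmul r x hx => simp only [map_smul, LinearMap.smul_apply, hx a y]
  | hone Z =>
    rw [etaEps_one, etaEps_one, cns_mulL, one_mulL, unbar_cns]
    exact unbarCons_bot a _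
  | hcns b x _ => rw [etaEps_cns, etaEps_cns]; simp

lemma unbar_cns_top {z w : Marked D} (hZ : Z ∈ D) (a : A z.obj Z d)
    (y : T (dbl A D) (Marked.top hZ) w) :
    unbar A D z w (cns (A := dbl A D) (Z := Marked.top hZ) a y) =
      merge A D z.obj Z w.obj d a (unbar A D (Marked.top hZ) w y) :=
  (unbar_cns _ _).trans (unbarCons_top hZ a _)

/-- The letters of a marked tensor are glued one after another at the marked inner objects, which
reassembles a single letter of `sD(C|B)`; tensors with a forbidden inner object vanish on both
sides. -/
lemma unbar_marked_mulL {c : Bool} {hc : c = true → X ∈ D} {w : Marked D} (x : T A X Z)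
    (y : T (dbl A D) (Marked.bot D Z) w) :
    unbar A D ⟨X, c, hc⟩ w (marked A D c X Z hc x ⋆ y) =
      in1 (plusOver A D) X Z (overProj A D X Z x) ⋆ unbar A D (Marked.bot D Z) w y := by
  induction x using T.induction generalizing c with
  | h0 => simp
  | hadd x x' hx hx' => simp only [map_add, LinearMap.add_apply, hx, hx']
  | hsmul r x hx => simp only [map_smul, LinearMap.smul_apply, hx]
  | hone X => rw [marked_one, overProj_one]; simp
  | @hcns X Z Y d a x ih =>
    have h1 := unbar_cns_etaEps_mulL (z := ⟨X, c, hc⟩) a x y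
    rw [marked_cns, overProj_cns, map_add, LinearMap.add_apply, map_add, h1, map_add, map_add,
      LinearMap.add_apply]
    refine congrArg₂ (· + ·) rfl ?_
    split_ifs with hZ
    · have h2 := merge_in1_mulL a (overProj A D Z Y x) (unbar A D (Marked.bot D Y) w y)
      have h3 := unbar_cns_top (z := ⟨X, c, hc⟩) (w := w) hZ a
        (marked A D true Z Y (fun _ => hZ) x ⋆ y)
      rw [cns_mulL]
      exact h3.trans ((congrArg (merge A D X Z w.obj d a) (ih y)).trans h2)
    · simp only [map_zero, LinearMap.zero_apply]

lemma unbar_bars (x : T (plusOver A D) X Y) :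
    unbar A D (Marked.bot D X) (Marked.bot D Y) (bars A D X Y x) = x := by
  induction x using T.induction with
  | h0 => simp
  | hadd x y hx hy => simp only [map_add, hx, hy]
  | hsmul r x hx => simp only [map_smul, hx]
  | hone X => rw [bars_one, unbar_one]
  | hcns u y ih =>
    rw [bars_cns]
    erw [unbar_marked_mulL]
    rw [ih, overProj_overIn, in1_inTot_mulL]

/-- The extension of `bars` to a possibly marked source. -/
def barsFrom (A : GradedQuiver k S) (D : Set S) (Y : S) : (z : Marked D) →
    T (plusOver A D) z.obj Y →ₗ[k] T (dbl A D) z (Marked.bot D Y)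
  | ⟨X, false, _⟩ => bars A D X Y
  | ⟨X, true, hc⟩ => sumCut fun Z => (mulL (dbl A D) ⟨X, true, hc⟩ (Marked.bot D Z)
      (Marked.bot D Y)).compl₁₂ (marked A D true X Z hc ∘ₗ overIn A D X Z ∘ₗ
        pr1 (plusOver A D) X Z) (bars A D Z Y)

lemma bars_mulL (x : T (plusOver A D) X Y) (y : T (plusOver A D) Y Z) :
    bars A D X Z (x ⋆ y) = bars A D X Y x ⋆ bars A D Y Z y := mext_mulL x y

lemma bars_in1 (u : Tot (plusOver A D) X Y) :
    bars A D X Y (in1 (plusOver A D) X Y u) =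
      marked A D false X Y (fun h => nomatch h) (overIn A D X Y u) := by
  induction u using Tot_induction with
  | h0 => simp
  | hadd x y hx hy => simp only [map_add, hx, hy]
  | h d u => rw [in1_inTot, bars_cns, bars_one]; exact mulL_one _

lemma barsFrom_in1_mulL (z : Marked D) (u : Tot (plusOver A D) z.obj Z)
    (y : T (plusOver A D) Z Y) :
    barsFrom A D Y z (in1 (plusOver A D) z.obj Z u ⋆ y) =
      marked A D z.mark z.obj Z z.mem (overIn A D z.obj Z u) ⋆ bars A D Z Y y := by
  rcases z with ⟨X, c | c, hc⟩
  · refine (bars_mulL _ _).trans ?_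
    rw [bars_in1]
  · exact sumCut_pr1_in1_mulL (fun Z => (mulL (dbl A D) ⟨X, true, hc⟩ (Marked.bot D Z)
      (Marked.bot D Y)).compl₁₂ (marked A D true X Z hc ∘ₗ overIn A D X Z) (bars A D Z Y)) u y

lemma barsFrom_top_one (hX : X ∈ D) :
    barsFrom A D X (Marked.top hX) (one (plusOver A D) X) = 0 := by
  change sumCut _ _ = _
  rw [sumCut_one]
  simp only [LinearMap.compl₁₂_apply, LinearMap.comp_apply, pr1_one, map_zero,
    LinearMap.zero_apply]

lemma barsFrom_merge (z : Marked D) (hX : X ∈ D) (a : A z.obj X d) (y : T (plusOver A D) X Y) :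
    barsFrom A D Y z (merge A D z.obj X Y d a y) =
      cns (A := dbl A D) (Z := Marked.top hX) a (barsFrom A D Y (Marked.top hX) y) := by
  induction y using T.induction with
  | h0 => simp
  | hadd x y hx hy => simp only [map_add, hx hX a, hy hX a]
  | hsmul r x hx => simp only [map_smul, hx hX a]
  | hone X => rw [merge_one, barsFrom_top_one, map_zero, map_zero]
  | hcns u y _ =>
    rw [← in1_inTot_mulL, merge_in1_mulL, barsFrom_in1_mulL, overIn_overProj_cns_overIn hX,
      marked_cns, dif_pos hX, etaEps_overIn, map_zero, zero_add, cns_mulL]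
    exact congrArg _ (barsFrom_in1_mulL (Marked.top hX) _ y).symm

/-- Here the target is fixed: only tensors ending at an unmarked object are in the range of `bars`.
-/
theorem T.induction_left {p : ∀ {X : S}, T A X Y → Prop} (h0 : ∀ X, p (0 : T A X Y))
    (hadd : ∀ {X} (x y : T A X Y), p x → p y → p (x + y))
    (hsmul : ∀ {X} (c : k) (x : T A X Y), p x → p (c • x)) (hone : p (one A Y))
    (hcns : ∀ {X Z d} (a : A X Z d) (y : T A Z Y), p y → p (cns a y)) {X : S}
    (x : T A X Y) : p x := by
  suffices h : ∀ {X Y'} (x : T A X Y') (e : Y' = Y), p (e ▸ x) from h x rfl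
  intro X Y' x
  induction x using T.induction with
  | h0 => rintro rfl; exact h0 _
  | hadd x y hx hy => rintro rfl; exact hadd _ _ (hx rfl) (hy rfl)
  | hsmul c x hx => rintro rfl; exact hsmul _ _ (hx rfl)
  | hone X => rintro rfl; exact hone
  | hcns a y hy => rintro rfl; exact hcns _ _ (hy rfl)

/-- Removing the first letter may leave a marked source, so the induction runs over all sources and
needs `barsFrom` in place of `bars`. -/
lemma barsFrom_unbar {z : Marked D} (y : T (dbl A D) z (Marked.bot D Y)) :
    barsFrom A D Y z (unbar A D z (Marked.bot D Y) y) = y := by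
  induction y using T.induction_left with
  | h0 => simp
  | hadd x y hx hy => simp only [map_add, hx, hy]
  | hsmul r x hx => simp only [map_smul, hx]
  | hone => rw [unbar_one]; exact bars_one Y
  | @hcns z m d a y ih =>
    rw [unbar_cns]
    rcases m with ⟨X, c | c, hc⟩
    · erw [unbarCons_bot a]
      rw [barsFrom_in1_mulL, overIn_overProj_cns_one, marked_cns_one, cns_mulL, one_mulL]
      exact congrArg _ ih
    · erw [unbarCons_top (hc rfl) a, barsFrom_merge z (hc rfl) a]
      exact congrArg _ ih

lemma bars_unbar (y : T (dbl A D) (Marked.bot D X) (Marked.bot D Y)) :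
    bars A D X Y (unbar A D (Marked.bot D X) (Marked.bot D Y) y) = y := barsFrom_unbar y

end

/-! ### Transport of homomorphisms and coderivations along the bijection. -/

section
variable {A : GradedQuiver k S} {A' : GradedQuiver k S'} {D : Set S} {E : Set S'}
  {X Y Z W : S} {d : ℤ} {P Q : Type u}
  [AddCommGroup P] [Module k P] [AddCommGroup Q] [Module k Q]

local infixl:70 " ⋆ " => mulL _ _ _ _

/-! ### Homogeneity of `bars` and `unbar` -/

lemma e0_marked {c : Bool} {hc : c = true → X ∈ D} (x : T A X Y) :
    e0 (dbl A D) _ _ (marked A D c X Y hc x) = 0 := by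
  induction x using T.induction with
  | h0 => simp
  | hadd x y hx hy => simp only [map_add, hx, hy, add_zero]
  | hsmul r x hx => simp only [map_smul, hx, smul_zero]
  | hone X => rw [marked_one, map_zero]
  | @hcns X Z Y d a x _ =>
    rw [marked_cns, map_add, etaEps_cns, zero_add]
    split_ifs
    · exact etaEps_cns _ _ _
    · exact map_zero _

lemma marked_mem_Deg {c : Bool} {hc : c = true → X ∈ D} {n : ℤ} {x : T A X Y}
    (hx : x ∈ Deg A n X Y) : marked A D c X Y hc x ∈ Deg (dbl A D) n _ _ := by
  suffices h : Deg A n X Y ≤ (Deg (dbl A D) n _ _).comap (marked A D c X Y hc) from h hx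
  refine Deg.le_of_word fun w hw x => ?_
  rw [Submodule.mem_comap]
  induction w generalizing c n with
  | nil X =>
    obtain ⟨r, rfl⟩ := (tnil A X).surjective x
    rw [inT_nil, map_smul, marked_one, smul_zero]
    exact Submodule.zero_mem _
  | @cons Z Y X d w ih =>
    induction x using Tens.cons_induction with
    | h0 => rw [map_zero, map_zero]; exact Submodule.zero_mem _
    | hadd x y hx hy =>
      rw [map_add, map_add]
      exact Submodule.add_mem _ hx hy
    | ht a x =>
      rw [← cns_inT, marked_cns]
      have hw' : d + w.degree = n := hw
      refine Submodule.add_mem _ (cns_mem_Deg _ ?_ hw') ?_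
      · have := isHomogeneous_iff.1 (IsHomogeneous.etaEps (A := A) (B := dbl A D) (Marked.bot D))
          Z Y w.degree (inT_mem_Deg w x rfl)
        rwa [add_zero] at this
      · split_ifs with hZ
        · exact cns_mem_Deg _ (ih (inT_mem_Deg w x rfl) rfl x) hw'
        · exact Submodule.zero_mem _

lemma isHomogeneous_bars : IsHomogeneous 0 (bars A D) :=
  IsHomogeneous.mext fun _ _ _ u => marked_mem_Deg (overIn_mem_Deg u)

lemma e0_bars (x : T (plusOver A D) X Y) :
    e0 (dbl A D) _ _ (bars A D X Y x) = etaEps (plusOver A D) (dbl A D) (Marked.bot D) X Y x :=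
  e0_mext (fun _ _ _ _ => e0_marked _) x

lemma in1_overProj_mem_Deg {n : ℤ} {x : T A X Y} (hx : x ∈ Deg A n X Y) :
    in1 (plusOver A D) X Y (overProj A D X Y x) ∈ Deg (plusOver A D) n X Y := by
  have : Deg A n X Y ≤ (Deg (plusOver A D) n X Y).comap
      (in1 (plusOver A D) X Y ∘ₗ overProj A D X Y) := by
    refine Deg.le_of_word fun w hw x => ?_
    rw [Submodule.mem_comap, LinearMap.comp_apply]
    by_cases h : 0 < w.length ∧ ∀ Z ∈ w.inner, Z ∈ D
    · rw [overProj_inT h.1 h.2, in1_inTot]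
      exact cns_mem_Deg _ (one_mem_Deg _) (by rw [hw, add_zero])
    · rw [overProj_inT_of_not h, map_zero]
      exact Submodule.zero_mem _
  exact this hx

lemma overIn_mem_Deg' {n : ℤ} {v : Tot (plusOver A D) X Y} (h : ∀ e, e ≠ n → v e = 0) :
    overIn A D X Y v ∈ Deg A n X Y := by
  rw [show v = inTot (plusOver A D) X Y n (v n) from DFinsupp.ext fun e => by
    rcases eq_or_ne e n with rfl | he
    · exact (DirectSum.of_eq_same (β := fun e => (plusOver A D X Y e : Type u)) e _).symm
    · rw [h e he]
      exact (DirectSum.of_eq_of_ne (β := fun e => (plusOver A D X Y e : Type u)) n e _ he).symm]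
  exact overIn_mem_Deg _

lemma merge_mem_Deg {n m : ℤ} (a : A X Z d) {x : T (plusOver A D) Z Y}
    (hx : x ∈ Deg (plusOver A D) n Z Y) (hm : d + n = m) :
    merge A D X Z Y d a x ∈ Deg (plusOver A D) m X Y := by
  suffices h : Deg (plusOver A D) n Z Y ≤ (Deg (plusOver A D) m X Y).comap (merge A D X Z Y d a)
    from h hx
  refine Deg.le_of_word fun w hw x => ?_
  rw [Submodule.mem_comap]
  refine sumCut_mem _ x fun V w₁ w₂ e x₁ x₂ => ?_
  refine mulL_mem_Deg (in1_overProj_mem_Deg (cns_mem_Deg (n := w₁.degree) a (overIn_mem_Deg'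
    fun e he => pr1_apply_of_mem_Deg (inT_mem_Deg w₁ x₁ rfl) he) rfl))
    (inT_mem_Deg w₂ x₂ rfl) ?_
  rw [← e, Word.degree_append] at hw
  omega

lemma unbar_mem_Deg {z w : Marked D} {n : ℤ} {y : T (dbl A D) z w} (hy : y ∈ Deg (dbl A D) n z w) :
    unbar A D z w y ∈ Deg (plusOver A D) n z.obj w.obj := by
  suffices h : Deg (dbl A D) n z w ≤ (Deg (plusOver A D) n _ _).comap (unbar A D z w) from h hy
  refine Deg.le_of_word fun u hu x => ?_
  rw [Submodule.mem_comap]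
  induction u generalizing n with
  | nil z =>
    obtain ⟨r, rfl⟩ := (tnil (dbl A D) z).surjective x
    rw [inT_nil, map_smul, unbar_one]
    rw [show n = 0 from hu.symm]
    exact Submodule.smul_mem _ _ (one_mem_Deg _)
  | @cons m w z d u ih =>
    induction x using Tens.cons_induction with
    | h0 => rw [map_zero, map_zero]; exact Submodule.zero_mem _
    | hadd x y hx hy =>
      rw [map_add, map_add]
      exact Submodule.add_mem _ hx hy
    | ht a x =>
      have hu' : d + u.degree = n := hu
      have ih' := ih (inT_mem_Deg u x rfl) rfl x
      rw [← cns_inT, unbar_cns, unbarCons]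
      split_ifs
      · exact merge_mem_Deg (A := A) (X := z.obj) (Z := m.obj) (Y := w.obj) a ih' hu'
      · exact mulL_mem_Deg (in1_overProj_mem_Deg (cns_mem_Deg _ (one_mem_Deg _) (add_zero d)))
          ih' hu'

lemma e0_merge (a : A X Z d) (x : T (plusOver A D) Z Y) :
    e0 (plusOver A D) X Y (merge A D X Z Y d a x) = 0 := by
  change e0 _ _ _ (sumCut _ x) = 0
  rw [map_sumCut, ← sumCut_zero x]
  refine sumCut_congr (fun V x y => ?_) x
  simp only [LinearMap.compr₂_apply, LinearMap.comp_apply]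
  rw [e0_mulL, e0_in1, map_zero]
  rfl

lemma counit_unbar {z w : Marked D} (y : T (dbl A D) z w) :
    counit (plusOver A D) z.obj w.obj (unbar A D z w y) = counit (dbl A D) z w y := by
  induction y using T.induction with
  | h0 => simp
  | hadd x y hx hy => simp only [map_add, hx, hy]
  | hsmul r x hx => simp only [map_smul, hx]
  | hone z => rw [unbar_one, counit_one, counit_one]
  | hcns a y _ =>
    rw [counit_cns, ← counit_etaEps (B := plusOver A D) (fun X => X), unbar_cns, unbarCons]
    split_ifs
    · rw [e0_merge, map_zero]
    · simp only [LinearMap.comp_apply]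
      rw [e0_mulL, e0_in1]
      simp

lemma counit_bars (x : T (plusOver A D) X Y) :
    counit (dbl A D) _ _ (bars A D X Y x) = counit (plusOver A D) X Y x := by
  rw [← counit_etaEps (B := dbl A D) (fun X => X)]
  erw [e0_bars]
  exact counit_etaEps _ x

/-! ### Transport from tensors with marked objects to tensors over `sD(C|B)` -/

section
variable {f g h : S → S'} {hf : ∀ X ∈ D, f X ∈ E} {hg : ∀ X ∈ D, g X ∈ E}
  {hh : ∀ X ∈ D, h X ∈ E}

/-- A map of tensors with marked objects as a map of tensors over `sD(C|B)`. -/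
def onBars (R : TMap (dbl A D) (dbl A' E) (Marked.map f hf) (Marked.map g hg)) :
    TMap (plusOver A D) (plusOver A' E) f g := fun X Y =>
  unbar A' E (Marked.bot E (f X)) (Marked.bot E (g Y)) ∘ₗ R (Marked.bot D X) (Marked.bot D Y) ∘ₗ
    bars A D X Y

lemma bars_onBars (R : TMap (dbl A D) (dbl A' E) (Marked.map f hf) (Marked.map g hg))
    (x : T (plusOver A D) X Y) :
    bars A' E (f X) (g Y) (onBars R X Y x) =
      R (Marked.bot D X) (Marked.bot D Y) (bars A D X Y x) := bars_unbar _

lemma IsHomogeneous.onBars {p : ℤ}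
    {R : TMap (dbl A D) (dbl A' E) (Marked.map f hf) (Marked.map g hg)} (hR : IsHomogeneous p R) :
    IsHomogeneous p (onBars R) := by
  rw [isHomogeneous_iff]
  intro X Y n x hx
  have h1 := isHomogeneous_iff.1 isHomogeneous_bars X Y n hx
  rw [add_zero] at h1
  exact unbar_mem_Deg (isHomogeneous_iff.1 hR _ _ n h1)

/-- A family of bilinear forms on tensors over `sD(C|B)` as forms on tensors with marked objects. -/
def unbarForm {X Y : S} (β : ∀ Z, T (plusOver A D) X Z →ₗ[k] T (plusOver A D) Z Y →ₗ[k] P) :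
    ∀ m, T (dbl A D) (Marked.bot D X) m →ₗ[k] T (dbl A D) m (Marked.bot D Y) →ₗ[k] P :=
  atBot fun Z => (β Z).compl₁₂ (unbar A D (Marked.bot D X) (Marked.bot D Z))
    (unbar A D (Marked.bot D Z) (Marked.bot D Y))

lemma sumCut_unbar (β : ∀ Z, T (plusOver A D) X Z →ₗ[k] T (plusOver A D) Z Y →ₗ[k] P)
    (y : T (dbl A D) (Marked.bot D X) (Marked.bot D Y)) :
    sumCut β (unbar A D _ _ y) = sumCut (unbarForm β) y := by
  conv_rhs => rw [← bars_unbar y]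
  rw [unbarForm, sumCut_atBot_bars]
  refine sumCut_congr (fun Z x y => ?_) _
  simp only [LinearMap.compl₁₂_apply]
  erw [unbar_bars, unbar_bars]

/-- The induced maps preserve marks, so a cut at a marked object goes to a cut at a marked object
and is discarded on both sides. -/
lemma atBot_map {z w : Marked D} {z' w' : Marked E} (β : ∀ Z, T (dbl A' E) z' (Marked.bot E Z) →ₗ[k]
      T (dbl A' E) (Marked.bot E Z) w' →ₗ[k] P)
    (Φ : ∀ m, T (dbl A D) z m →ₗ[k] T (dbl A' E) z' (Marked.map f hf m))
    (Ψ : ∀ m, T (dbl A D) m w →ₗ[k] T (dbl A' E) (Marked.map f hf m) w') :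
    (fun m => (atBot β (Marked.map f hf m)).compl₁₂ (Φ m) (Ψ m)) =
      atBot fun Z => (β (f Z)).compl₁₂ (Φ (Marked.bot D Z)) (Ψ (Marked.bot D Z)) := by
  funext m
  rcases m with ⟨X, c | c, hc⟩
  · rfl
  · rfl

lemma bars_sgn (p : ℤ) (x : T (plusOver A D) X Y) :
    sgn (dbl A D) p _ _ (bars A D X Y x) = bars A D X Y (sgn (plusOver A D) p X Y x) := by
  have := isHomogeneous_bars.sgn p x
  rwa [mul_zero, Int.negOnePow_zero, Units.val_one, one_smul] at this

variable {F : TMap (dbl A D) (dbl A' E) (Marked.map f hf) (Marked.map f hf)}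
  {G : TMap (dbl A D) (dbl A' E) (Marked.map g hg) (Marked.map g hg)}
  {H : TMap (dbl A D) (dbl A' E) (Marked.map h hh) (Marked.map h hh)}

lemma sumCut_onBars_aux (β : ∀ Z, T (plusOver A' E) (f X) Z →ₗ[k]
      T (plusOver A' E) Z (h Y) →ₗ[k] P) (p : ℤ)
    (Φ : TMap (dbl A D) (dbl A' E) (Marked.map f hf) (Marked.map g hg))
    (Ψ : TMap (dbl A D) (dbl A' E) (Marked.map g hg) (Marked.map h hh))
    (x : T (plusOver A D) X Y) :
    sumCut (fun m => (unbarForm β (Marked.map g hg m)).compl₁₂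
        (Φ (Marked.bot D X) m) (Ψ m (Marked.bot D Y) ∘ₗ sgn (dbl A D) p m (Marked.bot D Y)))
      (bars A D X Y x) =
    sumCut (fun Z => (β (g Z)).compl₁₂ (onBars Φ X Z)
      (onBars Ψ Z Y ∘ₗ sgn (plusOver A D) p Z Y)) x := by
  rw [unbarForm, atBot_map, sumCut_atBot_bars]
  refine sumCut_congr (fun Z x y => ?_) _
  simp only [LinearMap.compl₁₂_apply, LinearMap.comp_apply, bars_sgn]
  rfl

lemma sumCut_onBars_aux_zero (β : ∀ Z, T (plusOver A' E) (f X) Z →ₗ[k]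
      T (plusOver A' E) Z (h Y) →ₗ[k] P)
    (Φ : TMap (dbl A D) (dbl A' E) (Marked.map f hf) (Marked.map g hg))
    (Ψ : TMap (dbl A D) (dbl A' E) (Marked.map g hg) (Marked.map h hh))
    (x : T (plusOver A D) X Y) :
    sumCut (fun m => (unbarForm β (Marked.map g hg m)).compl₁₂
        (Φ (Marked.bot D X) m) (Ψ m (Marked.bot D Y))) (bars A D X Y x) =
    sumCut (fun Z => (β (g Z)).compl₁₂ (onBars Φ X Z) (onBars Ψ Z Y)) x := by
  rw [unbarForm, atBot_map, sumCut_atBot_bars]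
  rfl

/-- Cuts over `sD(C|B)` are the cuts at unmarked objects, and these are preserved. Conjugation by
`bars` and `unbar` therefore respects the comultiplication identities, here and for the two kinds of
coderivations below. -/
lemma IsCocatHom.onBars (hF : IsCocatHom F) : IsCocatHom (onBars F) := by
  refine isCocatHom_of_sumCut hF.homogeneous.onBars (fun X Y x P _ _ β => ?_)
    (fun X Y => LinearMap.ext fun x => ?_) fun X => ?_
  · refine (sumCut_unbar β (F _ _ (bars A D X Y x))).trans
      ((hF.sumCut (X := Marked.bot D X) (Y := Marked.bot D Y) (unbarForm β) (bars A D X Y x)).trans ?_)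
    exact sumCut_onBars_aux_zero β F F x
  · refine (counit_unbar (F _ _ (bars A D X Y x))).trans ?_
    rw [← LinearMap.comp_apply]
    refine (LinearMap.congr_fun (hF.counit _ _) _).trans (counit_bars x)
  · change unbar A' E _ _ (F _ _ (bars A D X X _)) = _
    rw [bars_one, hF.map_one]
    exact unbar_one _

lemma IsCoderivation.onBars {p : ℤ}
    {R : TMap (dbl A D) (dbl A' E) (Marked.map f hf) (Marked.map g hg)}
    (hR : IsCoderivation p F G R) : IsCoderivation p (onBars F) (onBars G) (onBars R) := by
  refine isCoderivation_of_sumCut hR.homogeneous.onBars (fun X Y x P _ _ β => ?_)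
  refine (sumCut_unbar β (R _ _ (bars A D X Y x))).trans
    ((hR.sumCut (X := Marked.bot D X) (Y := Marked.bot D Y) (unbarForm β) (bars A D X Y x)).trans ?_)
  exact congrArg₂ (· + ·) (sumCut_onBars_aux_zero β F R x) (sumCut_onBars_aux β p R G x)

lemma IsDoubleCoderivation.onBars {m n : ℤ}
    {R : TMap (dbl A D) (dbl A' E) (Marked.map f hf) (Marked.map g hg)}
    {P : TMap (dbl A D) (dbl A' E) (Marked.map g hg) (Marked.map h hh)}
    {Θ : TMap (dbl A D) (dbl A' E) (Marked.map f hf) (Marked.map h hh)}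
    (hΘ : IsDoubleCoderivation m n F R P H Θ) :
    IsDoubleCoderivation m n (AInf.onBars F) (AInf.onBars R) (AInf.onBars P) (AInf.onBars H)
      (AInf.onBars Θ) := by
  refine ⟨hΘ.homogeneous.onBars, fun {X Y Q} _ _ β x => ?_⟩
  refine (sumCut_unbar β (Θ _ _ (bars A D X Y x))).trans
    ((hΘ.sumCut (X := Marked.bot D X) (Y := Marked.bot D Y) (unbarForm β) (bars A D X Y x)).trans ?_)
  exact congrArg₂ (· + ·) (congrArg₂ (· + ·) (sumCut_onBars_aux_zero β F Θ x)
    (sumCut_onBars_aux β m R P x)) (sumCut_onBars_aux β (m + n) Θ H x)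

end

end

/-! ### The restrictions to `sD(C|B)` and the structure of `D(C|B)`. -/

section
variable {A : GradedQuiver k S} {A' : GradedQuiver k S'} {D : Set S} {E : Set S'}
  {X Y Z W : S} {d : ℤ} {P Q : Type u}
  [AddCommGroup P] [Module k P] [AddCommGroup Q] [Module k Q]

local infixl:70 " ⋆ " => mulL _ _ _ _

/-! ### The embedding `TsD(C|B) → T(T⁺sC)` -/

lemma lmap_tensFunctor_one {Q Q' : GradedQuiver k S} (φ : ∀ X Y d, Q X Y d →ₗ[k] Q' X Y d) (X : S) :
    DirectSum.lmap (fun w : Word S X X => tensFunctor φ w) (one Q X) = one Q' X := by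
  rw [one, DirectSum.lmap_lof]; rfl

lemma lmap_tensFunctor_cns {Q Q' : GradedQuiver k S} (φ : ∀ X Y d, Q X Y d →ₗ[k] Q' X Y d)
    (a : Q X Z d) (y : T Q Z Y) :
    DirectSum.lmap (fun w : Word S X Y => tensFunctor φ w) (cns a y) =
      cns (φ X Z d a) (DirectSum.lmap (fun w : Word S Z Y => tensFunctor φ w) y) := by
  induction y using T.word_induction with
  | h0 => simp
  | hadd x y hx hy => simp only [map_add, hx, hy]
  | h w x => rw [cns_inT, DirectSum.lmap_lof, DirectSum.lmap_lof, cns_inT]; rfl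

lemma subInclT_one (X : S) : subInclT A D X X (one (plusOver A D) X) = one (plus A) X :=
  lmap_tensFunctor_one _ X

lemma subInclT_cns (a : plusOver A D X Z d) (y : T (plusOver A D) Z Y) :
    subInclT A D X Y (cns a y) = cns (subIncl A D X Z d a) (subInclT A D Z Y y) :=
  lmap_tensFunctor_cns _ a y

lemma subProjT_one (X : S) : subProjT A D X X (one (plus A) X) = one (plusOver A D) X :=
  lmap_tensFunctor_one _ X

lemma subProjT_cns (a : plus A X Z d) (y : T (plus A) Z Y) :
    subProjT A D X Y (cns a y) = cns (subProj A D X Z d a) (subProjT A D Z Y y) :=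
  lmap_tensFunctor_cns _ a y

lemma isCocatHom_subInclT : IsCocatHom (f := fun X => X) (subInclT A D) := by
  rw [strict_eq (q := fun X => X) (φ := subIncl A D) (Φ := subInclT A D) subInclT_one subInclT_cns]
  exact isCocatHom_strict

lemma subIncl_inPlus (w : PlusWord D X Y d) (x : Tens A w.1) :
    subIncl A D X Y d (inPlus A D w x) =
      inPlus A Set.univ ⟨w.1, w.2.1, fun _ _ => Set.mem_univ _, w.2.2.2⟩ x :=
  plusLift_inPlus _ w x

lemma subProj_subIncl (x : plusOver A D X Y d) : subProj A D X Y d (subIncl A D X Y d x) = x := by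
  induction x using plusOver_induction with
  | h0 => simp
  | hadd x y hx hy => simp only [map_add, hx, hy]
  | h w x =>
    rw [subIncl_inPlus, subProj, plusLift_inPlus, dif_pos w.2.2.1]

lemma subProjT_subInclT (x : T (plusOver A D) X Y) :
    subProjT A D X Y (subInclT A D X Y x) = x := by
  induction x using T.induction with
  | h0 => simp
  | hadd x y hx hy => simp only [map_add, hx, hy]
  | hsmul r x hx => simp only [map_smul, hx]
  | hone X => rw [subInclT_one, subProjT_one]
  | hcns a y hy => rw [subInclT_cns, subProjT_cns, hy, subProj_subIncl]

lemma subIncl_univ (x : plus A X Y d) : subIncl A Set.univ X Y d x = x := by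
  induction x using plusOver_induction with
  | h0 => simp
  | hadd x y hx hy => simp only [map_add, hx, hy]
  | h w x => rw [subIncl_inPlus]

lemma subInclT_univ (x : T (plus A) X Y) : subInclT A Set.univ X Y x = x := by
  induction x using T.induction with
  | h0 => simp
  | hadd x y hx hy => simp only [map_add, hx, hy]
  | hsmul r x hx => simp only [map_smul, hx]
  | hone X => rw [subInclT_one]
  | hcns a y hy => rw [subInclT_cns, hy, subIncl_univ]

/-- For `B` the set of all objects the restriction changes nothing, so results on `overline C` are
special cases of those on `D(C|B)`. -/
lemma restrict_univ {f g : S → S'} (Φ : TMap (plus A) (plus A') f g) :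
    restrict Set.univ Set.univ Φ = Φ := by
  funext X Y
  refine LinearMap.ext fun x => ?_
  have h : ∀ y : T (plus A') (f X) (g Y), subProjT A' Set.univ (f X) (g Y) y = y := fun y => by
    conv_lhs => rw [← subInclT_univ y]
    exact subProjT_subInclT y
  change subProjT A' _ _ _ (Φ X Y (subInclT A _ X Y x)) = _
  rw [h, subInclT_univ]

lemma restricts_of_eq {f g : S → S'} {Φ : TMap (plus A) (plus A') f g}
    {Φ' : TMap (plusOver A D) (plusOver A' E) f g}
    (h : ∀ X Y x, Φ X Y (subInclT A D X Y x) = subInclT A' E (f X) (g Y) (Φ' X Y x)) :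
    Restricts D E Φ := by
  rintro X Y _ ⟨x, rfl⟩
  exact ⟨Φ' X Y x, (h X Y x).symm⟩

lemma restrict_eq_of_eq {f g : S → S'} {Φ : TMap (plus A) (plus A') f g}
    {Φ' : TMap (plusOver A D) (plusOver A' E) f g}
    (h : ∀ X Y x, Φ X Y (subInclT A D X Y x) = subInclT A' E (f X) (g Y) (Φ' X Y x)) :
    restrict D E Φ = Φ' := by
  funext X Y
  refine LinearMap.ext fun x => ?_
  change subProjT A' E (f X) (g Y) (Φ X Y (subInclT A D X Y x)) = _
  rw [h, subProjT_subInclT]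

/-- Multiplication of all factors, `TsD(C|B) → TsC`. -/
def flatOver (A : GradedQuiver k S) (D : Set S) :
    TMap (plusOver A D) A (fun X => X) (fun X => X) :=
  fun X Y => flat A X Y ∘ₗ subInclT A D X Y

lemma forget_etaEps (x : T A X Y) :
    forget A D _ _ (etaEps A (dbl A D) (Marked.bot D) X Y x) = e0 A X Y x := by
  induction x using T.induction with
  | h0 => simp
  | hadd x y hx hy => simp only [map_add, hx, hy]
  | hsmul r x hx => simp only [map_smul, hx]
  | hone X => rw [etaEps_one, etaEps_one]; exact forget_one _
  | hcns a y _ => rw [etaEps_cns, etaEps_cns, map_zero]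

lemma overIn_overProj_cns_e0 (a : A X Z d) (x : T A Z Y) :
    overIn A D X Y (overProj A D X Y (cns a (e0 A Z Y x))) = cns a (e0 A Z Y x) := by
  induction x using T.induction with
  | h0 => simp
  | hadd x y hx hy => simp only [map_add, hx a, hy a]
  | hsmul r x hx => simp only [map_smul, hx a]
  | hone X => rw [etaEps_one, overIn_overProj_cns_one]
  | hcns b y _ => rw [etaEps_cns]; simp

lemma forget_marked {c : Bool} {hc : c = true → X ∈ D} (x : T A X Y) :
    forget A D _ _ (marked A D c X Y hc x) = overIn A D X Y (overProj A D X Y x) := by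
  induction x using T.induction generalizing c with
  | h0 => simp
  | hadd x y hx hy => simp only [map_add, hx, hy]
  | hsmul r x hx => simp only [map_smul, hx]
  | hone X => rw [marked_one, overProj_one, map_zero, map_zero]
  | @hcns X Z Y d a x ih =>
    rw [marked_cns, overProj_cns, map_add, map_add, overIn_overProj_cns_e0]
    refine congrArg₂ (· + ·) ?_ ?_
    · exact (forget_cns _ _).trans (congrArg _ (forget_etaEps x))
    · split_ifs with hZ
      · rw [overIn_overProj_cns_overIn hZ]
        exact (forget_cns _ _).trans (congrArg _ ih)
      · rw [map_zero, map_zero]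

lemma forget_mulL {z m w : Marked D} (x : T (dbl A D) z m) (y : T (dbl A D) m w) :
    forget A D z w (x ⋆ y) = mulL A z.obj m.obj w.obj (forget A D z m x) (forget A D m w y) :=
  mext_mulL (q := Marked.obj) x y

lemma plusIncl_subIncl (u : plusOver A D X Y d) :
    plusIncl A X Y d (subIncl A D X Y d u) = overIn A D X Y (inTot (plusOver A D) X Y d u) := by
  induction u using plusOver_induction with
  | h0 => simp
  | hadd x y hx hy => simp only [map_add, hx, hy]
  | h w x => rw [subIncl_inPlus, plusIncl_eq, overIn_inTot_inPlus, overIn_inTot_inPlus]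

/-- Multiplying all letters and forgetting all marks both erase the bars. -/
lemma flatOver_eq (x : T (plusOver A D) X Y) :
    flatOver A D X Y x = forget A D _ _ (bars A D X Y x) := by
  rw [flatOver, LinearMap.comp_apply]
  induction x using T.induction with
  | h0 => simp
  | hadd x y hx hy => simp only [map_add, hx, hy]
  | hsmul r x hx => simp only [map_smul, hx]
  | hone X => rw [subInclT_one, bars_one, flat_one]; exact (forget_one (A := A) (Marked.bot D _)).symm
  | hcns u y ih =>
    rw [subInclT_cns, bars_cns, flat_cns, ih, plusIncl_subIncl]
    refine Eq.trans ?_ (forget_mulL (marked A D false _ _ (fun h => nomatch h)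
      (overIn A D _ _ (inTot (plusOver A D) _ _ _ u))) (bars A D _ _ y)).symm
    rw [forget_marked, overProj_overIn]

section
variable {f g h : S → S'}

theorem IsCoderivation.ext_flatOver {C : GradedQuiver k S''} {f g : S'' → S} {p : ℤ}
    {F : TMap C (plusOver A D) f f} {G : TMap C (plusOver A D) g g}
    {R R' : TMap C (plusOver A D) f g} (hF : IsCocatHom F) (hG : IsCocatHom G)
    (hR : IsCoderivation p F G R) (hR' : IsCoderivation p F G R')
    (h : ∀ X Y x, flatOver A D (f X) (g Y) (R X Y x) = flatOver A D (f X) (g Y) (R' X Y x)) :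
    R = R' := by
  have h1 := IsCoderivation.ext_flat (isCocatHom_subInclT.comp hF) (isCocatHom_subInclT.comp hG)
    (hR.hom_comp isCocatHom_subInclT) (hR'.hom_comp isCocatHom_subInclT) h
  funext X Y
  refine LinearMap.ext fun x => ?_
  have := LinearMap.congr_fun (congr_fun (congr_fun h1 X) Y) x
  rw [LinearMap.comp_apply, LinearMap.comp_apply] at this
  rw [← subProjT_subInclT (R X Y x), this, subProjT_subInclT]

variable {F : TMap A A' f f} {G : TMap A A' g g} {H : TMap A A' h h}

lemma flatOver_onBars {hf : ∀ X ∈ D, f X ∈ E} {hg : ∀ X ∈ D, g X ∈ E} {R : TMap A A' f g}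
    {R' : TMap (dbl A D) (dbl A' E) (Marked.map f hf) (Marked.map g hg)}
    (h : (fun z w => forget A' E (Marked.map f hf z) (Marked.map g hg w) ∘ₗ R' z w) =
      fun z w => R z.obj w.obj ∘ₗ forget A D z w) (x : T (plusOver A D) X Y) :
    flatOver A' E (f X) (g Y) (onBars R' X Y x) = R X Y (flatOver A D X Y x) := by
  rw [flatOver_eq, flatOver_eq, bars_onBars]
  exact LinearMap.congr_fun (congr_fun (congr_fun h (Marked.bot D X)) (Marked.bot D Y)) _

/-- Both sides are cocategory homomorphisms into `T(T⁺A')` with the same image under `flat`, hence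
equal. This shows that the overlined functor restricts and identifies its restriction, without a
formula for its components. -/
lemma overFunctor_subInclT (hf : ∀ X ∈ D, f X ∈ E) (hF : IsCocatHom F) (x : T (plusOver A D) X Y) :
    overFunctor F X Y (subInclT A D X Y x) =
      subInclT A' E (f X) (f Y) (onBars (liftHom hf F) X Y x) := by
  have h1 := IsCocatHom.ext_flat (f := f) ((isCocatHom_overFunctor hF).comp isCocatHom_subInclT)
    (isCocatHom_subInclT.comp (isCocatHom_liftHom hf hF).onBars) fun X Y x => by
      rw [LinearMap.comp_apply, flat_overFunctor hF]
      exact (flatOver_onBars (forget_liftHom hf hF) x).symm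
  exact LinearMap.congr_fun (congr_fun (congr_fun h1 X) Y) x

lemma overTransf_subInclT {p : ℤ} {R : TMap A A' f g} (hf : ∀ X ∈ D, f X ∈ E)
    (hg : ∀ X ∈ D, g X ∈ E) (hF : IsCocatHom F) (hG : IsCocatHom G) (hR : IsCoderivation p F G R)
    (x : T (plusOver A D) X Y) :
    overTransf p F R G X Y (subInclT A D X Y x) =
      subInclT A' E (f X) (g Y) (onBars (liftCoder hf hg p F R G) X Y x) := by
  have hF' := (isCocatHom_overFunctor hF).comp (isCocatHom_subInclT (A := A) (D := D))
  have hG' := (isCocatHom_overFunctor hG).comp (isCocatHom_subInclT (A := A) (D := D))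
  have h1 := (hR.overTransf hF hG).comp_hom (isCocatHom_subInclT (A := A) (D := D))
  have h2 := (isCoderivation_liftCoder hf hg hF hG hR.homogeneous).onBars.hom_comp
    (isCocatHom_subInclT (A := A') (D := E))
  -- Uniqueness compares coderivations along the same pair of homomorphisms, so the two descriptions
  -- of these must be identified beforehand.
  have eF : (fun X Y => overFunctor F X Y ∘ₗ subInclT A D X Y) =
      fun X Y => subInclT A' E (f X) (f Y) ∘ₗ onBars (liftHom hf F) X Y :=
    funext fun X => funext fun Y => LinearMap.ext fun x => overFunctor_subInclT hf hF x
  have eG : (fun X Y => overFunctor G X Y ∘ₗ subInclT A D X Y) =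
      fun X Y => subInclT A' E (g X) (g Y) ∘ₗ onBars (liftHom hg G) X Y :=
    funext fun X => funext fun Y => LinearMap.ext fun x => overFunctor_subInclT hg hG x
  rw [← eF, ← eG] at h2
  have h3 := IsCoderivation.ext_flat (f := f) (g := g) hF' hG' h1 h2 fun X Y x => by
    rw [LinearMap.comp_apply, hR.flat_overTransf hF hG]
    exact (flatOver_onBars (forget_liftCoder hf hg hF hG hR) x).symm
  exact LinearMap.congr_fun (congr_fun (congr_fun h3 X) Y) x

/-! ### The restrictions to `sD(C|B)` -/

lemma restricts_overFunctor (hf : ∀ X ∈ D, f X ∈ E) (hF : IsCocatHom F) :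
    Restricts D E (overFunctor F) := restricts_of_eq fun _ _ => overFunctor_subInclT hf hF

lemma DFunctor_eq (hf : ∀ X ∈ D, f X ∈ E) (hF : IsCocatHom F) :
    DFunctor D E F = onBars (liftHom hf F) :=
  restrict_eq_of_eq fun _ _ => overFunctor_subInclT hf hF

lemma restricts_overTransf {p : ℤ} {R : TMap A A' f g} (hf : ∀ X ∈ D, f X ∈ E)
    (hg : ∀ X ∈ D, g X ∈ E) (hF : IsCocatHom F) (hG : IsCocatHom G) (hR : IsCoderivation p F G R) :
    Restricts D E (overTransf p F R G) :=
  restricts_of_eq fun _ _ => overTransf_subInclT hf hg hF hG hR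

lemma DTransf_eq {p : ℤ} {R : TMap A A' f g} (hf : ∀ X ∈ D, f X ∈ E)
    (hg : ∀ X ∈ D, g X ∈ E) (hF : IsCocatHom F) (hG : IsCocatHom G) (hR : IsCoderivation p F G R) :
    DTransf D E p F R G = onBars (liftCoder hf hg p F R G) :=
  restrict_eq_of_eq fun _ _ => overTransf_subInclT hf hg hF hG hR

lemma IsCocatHom.DFunctor (hf : ∀ X ∈ D, f X ∈ E) (hF : IsCocatHom F) :
    IsCocatHom (DFunctor D E F) := by
  rw [DFunctor_eq hf hF]
  exact (isCocatHom_liftHom hf hF).onBars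

lemma IsCocatHom.flatOver_DFunctor (hf : ∀ X ∈ D, f X ∈ E) (hF : IsCocatHom F)
    (x : T (plusOver A D) X Y) :
    flatOver A' E (f X) (f Y) (AInf.DFunctor D E F X Y x) = F X Y (flatOver A D X Y x) := by
  rw [DFunctor_eq hf hF]
  exact flatOver_onBars (forget_liftHom hf hF) x

lemma IsCoderivation.DTransf {p : ℤ} {R : TMap A A' f g} (hf : ∀ X ∈ D, f X ∈ E)
    (hg : ∀ X ∈ D, g X ∈ E) (hF : IsCocatHom F) (hG : IsCocatHom G) (hR : IsCoderivation p F G R) :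
    IsCoderivation p (DFunctor D E F) (DFunctor D E G) (DTransf D E p F R G) := by
  rw [DTransf_eq hf hg hF hG hR, DFunctor_eq hf hF, DFunctor_eq hg hG]
  exact (isCoderivation_liftCoder hf hg hF hG hR.homogeneous).onBars

lemma IsCoderivation.flatOver_DTransf {p : ℤ} {R : TMap A A' f g} (hf : ∀ X ∈ D, f X ∈ E)
    (hg : ∀ X ∈ D, g X ∈ E) (hF : IsCocatHom F) (hG : IsCocatHom G) (hR : IsCoderivation p F G R)
    (x : T (plusOver A D) X Y) :
    flatOver A' E (f X) (g Y) (AInf.DTransf D E p F R G X Y x) = R X Y (flatOver A D X Y x) := by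
  rw [DTransf_eq hf hg hF hG hR]
  exact flatOver_onBars (forget_liftCoder hf hg hF hG hR) x

lemma IsDoubleCoderivation.exists_flatOver {m n : ℤ} {R : TMap A A' f g} {P : TMap A A' g h}
    {Θ : TMap A A' f h} (hf : ∀ X ∈ D, f X ∈ E) (hg : ∀ X ∈ D, g X ∈ E) (hh : ∀ X ∈ D, h X ∈ E)
    (hF : IsCocatHom F) (hG : IsCocatHom G) (hH : IsCocatHom H)
    (hR : IsCoderivation m F G R) (hP : IsCoderivation n G H P)
    (hΘ : IsDoubleCoderivation m n F R P H Θ) :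
    ∃ Θ' : TMap (plusOver A D) (plusOver A' E) f h,
      IsDoubleCoderivation m n (AInf.DFunctor D E F) (AInf.DTransf D E m F R G)
        (AInf.DTransf D E n G P H) (AInf.DFunctor D E H) Θ' ∧
      ∀ X Y x, flatOver A' E (f X) (h Y) (Θ' X Y x) = Θ X Y (flatOver A D X Y x) := by
  obtain ⟨Θ', h1, h2⟩ := hΘ.exists_lift hf hg hh hF hG hH hR hP
  refine ⟨AInf.onBars Θ', ?_, fun X Y x => flatOver_onBars h2 x⟩
  rw [DTransf_eq hf hg hF hG hR, DTransf_eq hg hh hG hH hP, DFunctor_eq hf hF, DFunctor_eq hh hH]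
  exact h1.onBars

lemma DFunctor_idT : DFunctor D D (idT A) = idT (plusOver A D) := by
  refine restrict_eq_of_eq fun X Y x => ?_
  rw [overFunctor_idT]; rfl

variable {b : TMap A A (fun X => X) (fun X => X)} {b' : TMap A' A' (fun X => X) (fun X => X)}

lemma DDiff_eq (b : TMap A A (fun X => X) (fun X => X)) :
    DDiff D b = DTransf D D 1 (idT A) b (idT A) := by
  rw [DDiff, overDiff_eq, DTransf]

lemma isCoderivation_DDiff (hb : IsCoderivation 1 (idT A) (idT A) b) :
    IsCoderivation 1 (idT (plusOver A D)) (idT (plusOver A D)) (DDiff D b) := by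
  have := hb.DTransf (D := D) (E := D) (fun _ h => h) (fun _ h => h) isCocatHom_idT isCocatHom_idT
  rwa [DFunctor_idT, ← DDiff_eq] at this

lemma flatOver_DDiff (hb : IsCoderivation 1 (idT A) (idT A) b) (x : T (plusOver A D) X Y) :
    flatOver A D X Y (DDiff D b X Y x) = b X Y (flatOver A D X Y x) := by
  rw [DDiff_eq]
  exact hb.flatOver_DTransf (f := fun X => X) (g := fun X => X) (fun _ h => h) (fun _ h => h)
    isCocatHom_idT isCocatHom_idT x

lemma flatOver_one (X : S) : flatOver A D X X (one (plusOver A D) X) = one A X := by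
  rw [flatOver, LinearMap.comp_apply, subInclT_one, flat_one]

lemma flatOver_in1 (v : Tot (plusOver A D) X Y) :
    flatOver A D X Y (in1 (plusOver A D) X Y v) = overIn A D X Y v := by
  induction v using Tot_induction with
  | h0 => simp
  | hadd x y hx hy => simp only [map_add, hx, hy]
  | h d u =>
    rw [in1_inTot, flatOver, LinearMap.comp_apply, subInclT_cns, flat_cns, subInclT_one, flat_one,
      mulL_one, plusIncl_subIncl]

lemma overIn_injective : Function.Injective (overIn A D X Y) := fun x y h => by
  rw [← overProj_overIn x, h, overProj_overIn]

theorem IsAInfCategory.onD (hA : IsAInfCategory A b) (D : Set S) :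
    IsAInfCategory (plusOver A D) (DDiff D b) := by
  have hb := isCoderivation_DDiff (D := D) hA.coderivation
  refine ⟨hb, fun X => ?_, fun X Y => LinearMap.ext fun x => ?_⟩
  · rw [hb.apply_one isCocatHom_idT isCocatHom_idT]
    have h1 := hb.apply_one isCocatHom_idT isCocatHom_idT X
    have h2 := congrArg (flatOver A D X X) h1
    rw [flatOver_DDiff hA.coderivation, flatOver_one, hA.map_one] at h2
    have h3 : overIn A D X X (pr1 _ X X (DDiff D b X X (one _ X))) = 0 := by
      rw [← flatOver_in1]; exact h2.symm
    rw [iota_eq_zero_iff]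
    exact overIn_injective (h3.trans (map_zero _).symm)
  · exact LinearMap.congr_fun (congr_fun (congr_fun (hb.sq.ext_flatOver isCocatHom_idT
      isCocatHom_idT isCoderivation_zero fun X Y x => by
        rw [LinearMap.comp_apply, flatOver_DDiff hA.coderivation, flatOver_DDiff hA.coderivation,
          ← LinearMap.comp_apply, hA.sq_zero]
        exact (map_zero _).symm) X) Y) x

theorem IsAInfFunctor.onD (hf : ∀ X ∈ D, f X ∈ E) (hA : IsAInfCategory A b)
    (hA' : IsAInfCategory A' b') (hF : IsAInfFunctor b b' F) :
    IsAInfFunctor (DDiff D b) (DDiff E b') (DFunctor D E F) := by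
  have hF' := hF.cocatHom.DFunctor hf
  refine ⟨hF', fun X Y => ?_⟩
  have h1 := (isCoderivation_DDiff (D := E) hA'.coderivation).comp_hom hF'
  have h2 := (isCoderivation_DDiff (D := D) hA.coderivation).hom_comp hF'
  refine congr_fun (congr_fun (IsCoderivation.ext_flatOver hF' hF' h1 h2 fun X Y x => ?_) X) Y
  rw [LinearMap.comp_apply, LinearMap.comp_apply, flatOver_DDiff hA'.coderivation,
    hF.cocatHom.flatOver_DFunctor hf, hF.cocatHom.flatOver_DFunctor hf,
    flatOver_DDiff hA.coderivation, hF.comm_apply]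

lemma flatOver_B1 (hA : IsAInfCategory A b) (hA' : IsAInfCategory A' b') {p : ℤ}
    {R : TMap A A' f g} {R' : TMap (plusOver A D) (plusOver A' E) f g}
    (h : ∀ X Y x, flatOver A' E (f X) (g Y) (R' X Y x) = R X Y (flatOver A D X Y x))
    (x : T (plusOver A D) X Y) :
    flatOver A' E (f X) (g Y) (B1 (DDiff D b) (DDiff E b') p R' X Y x) =
      B1 b b' p R X Y (flatOver A D X Y x) := by
  rw [B1_apply, B1_apply, map_sub, map_zsmul, h, flatOver_DDiff hA'.coderivation, h,
    flatOver_DDiff hA.coderivation]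

theorem IsNatural.onD (hf : ∀ X ∈ D, f X ∈ E) (hg : ∀ X ∈ D, g X ∈ E) {R : TMap A A' f g}
    (hA : IsAInfCategory A b) (hA' : IsAInfCategory A' b') (hF : IsAInfFunctor b b' F)
    (hG : IsAInfFunctor b b' G) (hR : IsNatural b b' F G R) :
    IsNatural (DDiff D b) (DDiff E b') (DFunctor D E F) (DFunctor D E G)
      (DTransf D E (-1) F R G) := by
  have hF' := hF.onD hf hA hA'
  have hG' := hG.onD hg hA hA'
  have hR' := hR.coderivation.DTransf hf hg hF.cocatHom hG.cocatHom
  refine ⟨hR', ?_⟩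
  refine IsCoderivation.ext_flatOver hF'.cocatHom hG'.cocatHom (IsCoderivation.B1
    (hA.onD D).coderivation (hA'.onD E).coderivation hF'.comm_apply hG'.comm_apply hR'
    hG'.cocatHom.homogeneous (q := 0) rfl) isCoderivation_zero fun X Y x => ?_
  rw [flatOver_B1 hA hA' (R := R) (fun X Y x => hR.coderivation.flatOver_DTransf hf hg
    hF.cocatHom hG.cocatHom x), hR.closed]
  exact (map_zero _).symm

theorem Equivalent.onD {R P : TMap A A' f g} {R' P' : TMap (plusOver A D) (plusOver A' E) f g}
    (hf : ∀ X ∈ D, f X ∈ E) (hg : ∀ X ∈ D, g X ∈ E)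
    (hA : IsAInfCategory A b) (hA' : IsAInfCategory A' b') (hF : IsAInfFunctor b b' F)
    (hG : IsAInfFunctor b b' G) (hR : IsCoderivation (-1) (DFunctor D E F) (DFunctor D E G) R')
    (hP : IsCoderivation (-1) (DFunctor D E F) (DFunctor D E G) P')
    (hR' : ∀ X Y x, flatOver A' E (f X) (g Y) (R' X Y x) = R X Y (flatOver A D X Y x))
    (hP' : ∀ X Y x, flatOver A' E (f X) (g Y) (P' X Y x) = P X Y (flatOver A D X Y x))
    (h : Equivalent b b' F G R P) :
    Equivalent (DDiff D b) (DDiff E b') (DFunctor D E F) (DFunctor D E G) R' P' := by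
  obtain ⟨V, hV, e⟩ := h
  have hF' := hF.onD hf hA hA'
  have hG' := hG.onD hg hA hA'
  have hV' := hV.DTransf hf hg hF.cocatHom hG.cocatHom
  refine ⟨_, hV', IsCoderivation.ext_flatOver hF'.cocatHom hG'.cocatHom (hR.sub hP)
    (IsCoderivation.B1 (hA.onD D).coderivation (hA'.onD E).coderivation hF'.comm_apply hG'.comm_apply
      hV' hG'.cocatHom.homogeneous (q := -1) rfl) fun X Y x => ?_⟩
  rw [flatOver_B1 hA hA' (R := V) (fun X Y x => hV.flatOver_DTransf hf hg hF.cocatHom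
    hG.cocatHom x), ← e]
  change flatOver A' E (f X) (g Y) (_ - _) = R X Y _ - P X Y _
  rw [map_sub, hR', hP']

lemma isAInfFunctor_idT : IsAInfFunctor b b (idT A) := ⟨isCocatHom_idT, fun _ _ => rfl⟩

/-- Idempotency of a unit transformation passes to `D(C|B)`. -/
theorem IsAInfCategory.onD_idempotent (hA : IsAInfCategory A b)
    {i : TMap A A (fun X => X) (fun X => X)} (hi : IsNatural b b (idT A) (idT A) i)
    (h : Equivalent b b (idT A) (idT A) (B2 b (-1) (-1) (idT A) i (idT A) i (idT A)) i) :
    IsNatural (DDiff D b) (DDiff D b) (idT (plusOver A D)) (idT (plusOver A D))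
      (DTransf D D (-1) (idT A) i (idT A)) ∧
    Equivalent (DDiff D b) (DDiff D b) (idT (plusOver A D)) (idT (plusOver A D))
      (B2 (DDiff D b) (-1) (-1) (idT (plusOver A D)) (DTransf D D (-1) (idT A) i (idT A))
        (idT (plusOver A D)) (DTransf D D (-1) (idT A) i (idT A)) (idT (plusOver A D)))
      (DTransf D D (-1) (idT A) i (idT A)) := by
  have hD : ∀ X ∈ D, (fun X => X) X ∈ D := fun _ h => h
  have hi' := hi.onD (D := D) (E := D) hD hD hA hA isAInfFunctor_idT isAInfFunctor_idT
  rw [DFunctor_idT] at hi'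
  -- Instead of the product `B2`, only a double coderivation with commutator `i` has to be
  -- transported, and the latter relation is tested by `flatOver`.
  refine ⟨hi', ((hA.onD D).equivalent_B2_iff hi').2 ?_⟩
  obtain ⟨Θ, hΘ, e⟩ := (hA.equivalent_B2_iff hi).1 h
  obtain ⟨Θ', hΘ', e'⟩ := hΘ.exists_flatOver (D := D) (E := D) hD hD hD isCocatHom_idT
    isCocatHom_idT isCocatHom_idT hi.coderivation hi.coderivation
  rw [DFunctor_idT] at hΘ'
  refine ⟨Θ', hΘ', IsCoderivation.ext_flatOver isCocatHom_idT isCocatHom_idT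
    (hΘ'.B1 (hA.onD D).coderivation (hA.onD D).coderivation (fun _ _ _ => rfl) (fun _ _ _ => rfl)
      isCocatHom_idT.homogeneous hi' hi') hi'.coderivation fun X Y x => ?_⟩
  rw [flatOver_B1 hA hA (R := Θ) e', e]
  exact (hi.coderivation.flatOver_DTransf (f := fun X => X) (g := fun X => X) hD hD
    isCocatHom_idT isCocatHom_idT x).symm

end

end

/-! ### Multiplication by letters, and coderivations that shorten words. -/

section
variable {A : GradedQuiver k S} {D : Set S}
  {X Y Z W : S} {d : ℤ} {P Q : Type u}
  [AddCommGroup P] [Module k P] [AddCommGroup Q] [Module k Q]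

local infixl:70 " ⋆ " => mulL _ _ _ _

/-! ### Multiplication with degree one tensors as a coderivation -/

/-- The map `x ↦ (-1)^(p deg x) a x`. -/
def mulLeft (p : ℤ) (a : ∀ X, Tot A X X) : TMap A A (fun X => X) (fun X => X) :=
  fun X Y => mulL A X X Y (in1 A X X (a X)) ∘ₗ sgn A p X Y

/-- The map `x ↦ x a`. -/
def mulRight (a : ∀ X, Tot A X X) : TMap A A (fun X => X) (fun X => X) :=
  fun X Y => (mulL A X Y Y).flip (in1 A Y Y (a Y))

variable {a : ∀ X, Tot A X X} {p : ℤ}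

lemma mulLeft_apply (x : T A X Y) :
    mulLeft p a X Y x = in1 A X X (a X) ⋆ sgn A p X Y x := rfl

lemma mulRight_apply (x : T A X Y) : mulRight a X Y x = x ⋆ in1 A Y Y (a Y) := rfl

/-- The cut of `a x` in front of `a` is the term with the projection to `T⁰` on the left; all other
cuts are cuts of `x` with `a` in the left part. -/
lemma isCoderivation_mulLeft (ha : ∀ X, in1 A X X (a X) ∈ Deg A p X X) :
    IsCoderivation p (etaEps A A fun X => X) (idT A) (mulLeft p a) := by
  refine isCoderivation_of_sumCut ?_ fun X Y x P _ _ β => ?_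
  · rw [isHomogeneous_iff]
    intro X Y n x hx
    rw [Submodule.mem_comap, mulLeft_apply, sgn_of_mem p hx, map_zsmul]
    exact zsmul_mem (mulL_mem_Deg (ha X) hx (add_comm p n)) _
  · rw [mulLeft_apply, sumCut_in1_mulL, sumCut_sgn]
    have := sumCut_etaEps_left (fun X => X) (fun Z => (β Z).compl₂ (mulLeft p a Z Y)) x
    exact congrArg₂ (· + ·) this.symm rfl

/-- The cut of `x a` behind `a` is the term with the projection to `T⁰` on the right; all other cuts
are cuts of `x` with `a` in the right part. -/
lemma isCoderivation_mulRight (ha : ∀ X, in1 A X X (a X) ∈ Deg A p X X) :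
    IsCoderivation p (idT A) (etaEps A A fun X => X) (mulRight a) := by
  refine isCoderivation_of_sumCut ?_ fun X Y x P _ _ β => ?_
  · rw [isHomogeneous_iff]
    intro X Y n x hx
    exact mulL_mem_Deg hx (ha Y) rfl
  · rw [mulRight_apply, sumCut_mulL, sumCut_in1]
    simp only [LinearMap.comp_apply, mulL_one]
    rw [add_comm (β Y x (in1 A Y Y (a Y))), ← add_assoc, add_sub_cancel_right]
    refine congrArg₂ (· + ·) rfl ?_
    have h1 : sumCut (fun Z => (β Z).compl₁₂ (mulRight a X Z)
        (etaEps A A (fun X => X) Z Y ∘ₗ sgn A p Z Y)) x =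
        sumCut (fun Z => ((β Z) ∘ₗ (mulRight a X Z)).compl₂ (e0 A Z Y)) x :=
      sumCut_congr (fun Z x y => by
        simp only [LinearMap.compl₁₂_apply, LinearMap.compl₂_apply, LinearMap.comp_apply, e0_sgn]) x
    refine Eq.trans ?_ h1.symm
    rw [sumCut_e0_right]
    rfl

lemma sumCut_e0 (β : ∀ Z, T A X Z →ₗ[k] T A Z Y →ₗ[k] P) (x : T A X Y) :
    sumCut β (e0 A X Y x) = β X (one A X) (e0 A X Y x) :=
  sumCut_etaEps (fun X => X) β x

lemma sumCut_e0' (β : ∀ Z, T A X Z →ₗ[k] T A Z Y →ₗ[k] P) (x : T A X Y) :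
    sumCut β (e0 A X Y x) = β Y (e0 A X Y x) (one A Y) := by
  rw [sumCut_e0]
  induction x using T.induction with
  | h0 => simp
  | hadd x y hx hy => simp only [map_add, LinearMap.add_apply, hx, hy]
  | hsmul c x hx => simp only [map_smul, LinearMap.smul_apply, hx]
  | hone X => rw [e0, etaEps_one]
  | hcns d a x => rw [e0, etaEps_cns, map_zero, map_zero]; rfl

lemma sgn_zero_apply (x : T A X Y) : sgn A 0 X Y x = x := by
  rw [sgn_zero]; rfl

/-- The projection of `TA` to `T⁺A`, as an endomorphism of `TA`. -/
def redT (A : GradedQuiver k S) : TMap A A (fun X => X) (fun X => X) :=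
  fun X Y => LinearMap.id - e0 A X Y

lemma redT_apply (x : T A X Y) : redT A X Y x = x - e0 A X Y x := rfl

lemma isHomogeneous_redT : IsHomogeneous 0 (redT A) :=
  isCocatHom_idT.homogeneous.sub (.etaEps _)

/-- This supplies the coderivation of degree `0` with first component the identity and no others,
the leading term in the perturbation argument. -/
lemma isCoderivation_redT : IsCoderivation 0 (etaEps A A fun X => X) (idT A) (redT A) := by
  refine isCoderivation_of_sumCut isHomogeneous_redT fun X Y x P _ _ β => ?_
  have h1 : sumCut (fun Z => (β Z).compl₁₂ (etaEps A A (fun X => X) X Z) (redT A Z Y)) x =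
      β X (one A X) (redT A X Y x) :=
    sumCut_etaEps_left (fun X => X) (fun Z => (β Z).compl₂ (redT A Z Y)) x
  have h2 : sumCut (fun Z => (β Z).compl₁₂ (redT A X Z) (idT A Z Y ∘ₗ sgn A 0 Z Y)) x =
      sumCut β x - β X (one A X) x := by
    rw [← sumCut_e0_left β x, ← sumCut_sub]
    refine sumCut_congr (fun Z x y => ?_) x
    rw [LinearMap.compl₁₂_apply, LinearMap.comp_apply, sgn_zero_apply, redT_apply, map_sub]
    rfl
  refine Eq.trans ?_ (congrArg₂ (· + ·) h1 h2).symm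
  rw [redT_apply, map_sub, sumCut_e0, map_sub]
  abel

lemma isCoderivation_redT' : IsCoderivation 0 (idT A) (etaEps A A fun X => X) (redT A) := by
  refine isCoderivation_of_sumCut isHomogeneous_redT fun X Y x P _ _ β => ?_
  have h1 : sumCut (fun Z => (β Z).compl₁₂ (idT A X Z) (redT A Z Y)) x =
      sumCut β x - β Y x (one A Y) := by
    rw [← sumCut_e0_right β x, ← sumCut_sub]
    refine sumCut_congr (fun Z x y => ?_) x
    rw [LinearMap.compl₁₂_apply, redT_apply, map_sub]
    rfl
  have h2 : sumCut (fun Z => (β Z).compl₁₂ (redT A X Z)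
      (etaEps A A (fun X => X) Z Y ∘ₗ sgn A 0 Z Y)) x = β Y (redT A X Y x) (one A Y) := by
    rw [← LinearMap.comp_apply (β Y),
      ← sumCut_etaEps_right (fun X => X) (fun Z => β Z ∘ₗ redT A X Z) x]
    refine sumCut_congr (fun Z x y => ?_) x
    rw [LinearMap.compl₁₂_apply, LinearMap.comp_apply, sgn_zero_apply]
    rfl
  refine Eq.trans ?_ (congrArg₂ (· + ·) h1 h2).symm
  rw [redT_apply, map_sub, sumCut_e0', map_sub, LinearMap.sub_apply]
  abel

/-! ### Diagonal maps and words -/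

/-- Maps `TA → TA` preserving all summands. -/
def IsDiagonal (F : TMap A A (fun X => X) (fun X => X)) : Prop :=
  ∀ {X Y} (w : Word S X Y) (x : Tens A w), ∃ y, F X Y (inT A w x) = inT A w y

lemma isDiagonal_idT : IsDiagonal (idT A) := fun _ x => ⟨x, rfl⟩

lemma isDiagonal_etaEps : IsDiagonal (etaEps A A fun X => X) := fun w x => by
  rcases Nat.eq_zero_or_pos w.length with hw | hw
  · cases w with
    | nil X =>
      obtain ⟨c, rfl⟩ := (tnil A _).surjective x
      exact ⟨tnil A _ c, by rw [inT_nil, map_smul]; exact congrArg _ (etaEps_one _ _)⟩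
    | cons => simp [Word.length] at hw
  · exact ⟨0, by rw [e0_inT_of_pos hw, map_zero]⟩

lemma inT_mulL_inT (w : Word S X Y) (x : Tens A w) (w' : Word S Y Z) (x' : Tens A w') :
    ∃ y, inT A w x ⋆ inT A w' x' = inT A (w.append w') y := by
  induction w with
  | nil X =>
    obtain ⟨c, rfl⟩ := (tnil A _).surjective x
    exact ⟨c • x', by
        rw [inT_nil, map_smul, LinearMap.smul_apply, one_mulL]
        exact (map_smul (inT A w') c x').symm⟩
  | cons X d w ih =>
    induction x using Tens.cons_induction with
    | h0 => exact ⟨0, by simp⟩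
    | hadd x y hx hy =>
      obtain ⟨u, hu⟩ := hx
      obtain ⟨v, hv⟩ := hy
      exact ⟨u + v, by rw [map_add, map_add, LinearMap.add_apply, hu, hv, map_add]⟩
    | ht a x =>
      obtain ⟨y, hy⟩ := ih x w' x'
      exact ⟨tcons A X d _ (a ⊗ₜ y), by rw [← cns_inT, cns_mulL, hy, cns_inT]; rfl⟩

/-- Tensors of length less than `n`. -/
def Short (A : GradedQuiver k S) (n : ℕ) (X Y : S) : Submodule k (T A X Y) where
  carrier := {x | ∀ w : Word S X Y, n ≤ w.length → x w = 0}
  add_mem' hx hy w hw := by rw [DirectSum.add_apply, hx w hw, hy w hw, add_zero]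
  zero_mem' _ _ := rfl
  smul_mem' c x hx w hw := by
    change (c • x) w = 0
    rw [DirectSum.smul_apply, hx w hw, smul_zero]

lemma inT_mem_Short {n : ℕ} (w : Word S X Y) (x : Tens A w) (h : w.length < n) :
    inT A w x ∈ Short A n X Y := fun w' hw' =>
  inT_apply_of_ne (by rintro rfl; omega) x

lemma Short_le_of_word {n : ℕ} {N : Submodule k (T A X Y)}
    (h : ∀ w : Word S X Y, w.length < n → ∀ x, inT A w x ∈ N) : Short A n X Y ≤ N := by
  intro x hx
  rw [← DirectSum.sum_support_of x]
  refine Submodule.sum_mem _ fun w _ => ?_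
  rcases lt_or_ge w.length n with hw | hw
  · exact h w hw _
  · rw [hx w hw, map_zero]
    exact Submodule.zero_mem _

lemma exists_mem_Short (x : T A X Y) : ∃ n, x ∈ Short A n X Y := by
  induction x using T.word_induction with
  | h0 => exact ⟨0, Submodule.zero_mem _⟩
  | hadd x y hx hy =>
    obtain ⟨n, hn⟩ := hx
    obtain ⟨m, hm⟩ := hy
    exact ⟨max n m, Submodule.add_mem _ (fun w hw => hn w (le_trans (le_max_left _ _) hw))
      (fun w hw => hm w (le_trans (le_max_right _ _) hw))⟩
  | h w x => exact ⟨_, inT_mem_Short w x (Nat.lt_succ_self _)⟩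

lemma eq_zero_of_mem_Short {x : T A X Y} (hx : x ∈ Short A 0 X Y) : x = 0 :=
  DFinsupp.ext fun w => hx w (Nat.zero_le _)

lemma exists_in1_eq_inT (v : Tot A X Y) {N : Submodule k (T A X Y)}
    (h : ∀ d x, inT A (.cons X d (.nil Y)) x ∈ N) : in1 A X Y v ∈ N := by
  induction v using Tot_induction with
  | h0 => rw [map_zero]; exact N.zero_mem
  | hadd x y hx hy => rw [map_add]; exact N.add_mem hx hy
  | h d x => rw [in1_inTot, one, cns_inT]; exact h d _

/-- A coderivation with diagonal `F`, `G` has values spanned by the words which arise by replacing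
a part of the given word by one letter. -/
theorem coderivation_mem {F G : TMap A A (fun X => X) (fun X => X)} (hF : IsDiagonal F)
    (hG : IsDiagonal G) {φ : Comps A A (fun X => X) (fun X => X)} {N : Submodule k (T A X Y)}
    {w : Word S X Y} (x : Tens A w)
    (h : ∀ Z V (w₁ : Word S X Z) (w₂ : Word S Z V) (w₃ : Word S V Y),
      w₁.append (w₂.append w₃) = w → (∃ x₂, φ Z V (inT A w₂ x₂) ≠ 0) → ∀ d y,
        inT A (w₁.append (.cons Z d w₃)) y ∈ N) :
    coderivation p F φ G X Y (inT A w x) ∈ N := by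
  rw [coderivation, conv_zero_apply]
  refine sumCut_mem N x fun Z w₁ w' e x₁ x' => ?_
  obtain ⟨y₁, hy₁⟩ := hF w₁ x₁
  rw [LinearMap.compl₁₂_apply, hy₁, conv_apply]
  change _ ∈ N.comap (mulL A X Z Y (inT A w₁ y₁))
  refine sumCut_mem _ x' fun V w₂ w₃ e' x₂ x₃ => ?_
  rw [LinearMap.compl₁₂_apply, LinearMap.comp_apply, sgn_inT, map_zsmul, map_zsmul]
  refine zsmul_mem ?_ _
  obtain ⟨y₃, hy₃⟩ := hG w₃ x₃
  rw [hy₃, inc, LinearMap.comp_apply]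
  by_cases h0 : φ Z V (inT A w₂ x₂) = 0
  · rw [h0, map_zero, map_zero]; exact Submodule.zero_mem _
  · refine exists_in1_eq_inT (N := (N.comap (mulL A X Z Y (inT A w₁ y₁))).comap
      ((mulL A Z V Y).flip (inT A w₃ y₃))) _ fun d y => ?_
    obtain ⟨u, hu⟩ := inT_mulL_inT (.cons Z d (.nil V)) y w₃ y₃
    obtain ⟨v, hv⟩ := inT_mulL_inT w₁ y₁ _ u
    change inT A w₁ y₁ ⋆ (inT A (.cons Z d (.nil V)) y ⋆ inT A w₃ y₃) ∈ N
    rw [hu, hv]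
    subst e'
    exact h Z V w₁ w₂ w₃ e ⟨x₂, h0⟩ d v

lemma Word.append_cons_length (w₁ : Word S X Z) (d : ℤ) (w₃ : Word S W Y) :
    (w₁.append (.cons Z d w₃)).length = w₁.length + w₃.length + 1 := by
  rw [Word.length_append]; rfl

/-- A coderivation whose components vanish on words of length at most one reduces the length. -/
theorem coderivation_mem_Short {F G : TMap A A (fun X => X) (fun X => X)} (hF : IsDiagonal F)
    (hG : IsDiagonal G) {φ : Comps A A (fun X => X) (fun X => X)}
    (hφ : ∀ {X Y} (w : Word S X Y) x, w.length ≤ 1 → φ X Y (inT A w x) = 0) {n : ℕ} {x : T A X Y}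
    (hx : x ∈ Short A (n + 1) X Y) : coderivation p F φ G X Y x ∈ Short A n X Y := by
  suffices h : Short A (n + 1) X Y ≤ (Short A n X Y).comap (coderivation p F φ G X Y) from h hx
  refine Short_le_of_word fun w hw x => ?_
  rw [Submodule.mem_comap]
  -- A subword of at least two letters is replaced by one letter, so the length drops.
  refine coderivation_mem hF hG x fun Z V w₁ w₂ w₃ e h d y => inT_mem_Short _ _ ?_
  obtain ⟨x₂, h2⟩ := h
  have h3 : ¬ w₂.length ≤ 1 := fun h => h2 (hφ w₂ x₂ h)
  rw [← e, Word.length_append, Word.length_append] at hw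
  rw [Word.append_cons_length]
  omega

lemma Word.inner_append_cons (w₁ : Word S X Z) (d e : ℤ) (w₃ : Word S W Y) :
    (w₁.append (.cons Z d w₃)).inner = (w₁.append (.cons Z e w₃)).inner := by
  induction w₁ with
  | nil => cases w₃ <;> rfl
  | cons X' d' w ih =>
    rw [Word.append, Word.append, Word.inner_cons _ _ (by rw [Word.append_cons_length]; omega),
      Word.inner_cons _ _ (by rw [Word.append_cons_length]; omega), ih]

/-- A coderivation whose components are concentrated on words of length one preserves `sD(C|B)`. -/
theorem coderivation_mem_range {F G : TMap A A (fun X => X) (fun X => X)} (hF : IsDiagonal F)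
    (hG : IsDiagonal G) {φ : Comps A A (fun X => X) (fun X => X)}
    (hφ : ∀ {X Y} (w : Word S X Y) x, w.length ≠ 1 → φ X Y (inT A w x) = 0)
    (u : Tot (plusOver A D) X Y) :
    coderivation p F φ G X Y (overIn A D X Y u) ∈ LinearMap.range (overIn A D X Y) := by
  induction u using overIn_induction with
  | h0 => rw [map_zero, map_zero]; exact Submodule.zero_mem _
  | hadd x y hx hy => rw [map_add, map_add]; exact Submodule.add_mem _ hx hy
  | h d w x =>
    rw [overIn_inTot_inPlus]
    refine coderivation_mem hF hG x fun Z V w₁ w₂ w₃ e h d y => ?_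
    obtain ⟨x₂, h2⟩ := h
    have h3 : w₂.length = 1 := not_not.1 fun h => h2 (hφ w₂ x₂ h)
    rcases w₂ with _ | ⟨_, d', _ | _⟩
    · simp [Word.length] at h3
    -- Replacing one letter by one letter changes only a degree in the word, not its inner objects.
    · refine ⟨_, overIn_overProj_inT (by rw [Word.append_cons_length]; omega) (fun V hV => ?_) y⟩
      rw [Word.inner_append_cons _ _ d'] at hV
      refine w.2.2.1 V ?_
      rw [← e]
      exact hV
    · simp [Word.length] at h3

end

/-! ### Homogeneous endomorphisms, locally nilpotent perturbations, and maps on letters. -/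

section
variable {A B : GradedQuiver k S} {D : Set S}
  {X Y Z W : S} {d p q : ℤ}

local infixl:70 " ⋆ " => mulL _ _ _ _

/-! ### Homogeneous maps of `A(X,Y)` -/

section
variable {φ ψ : Tot A X Y →ₗ[k] Tot A X Y}

lemma inTot_apply_of_ne (x : A X Y d) {e : ℤ} (h : e ≠ d) : inTot A X Y d x e = 0 :=
  DFinsupp.single_eq_of_ne h

lemma inTot_apply_self (x : A X Y d) : inTot A X Y d x d = x := DFinsupp.single_eq_same

lemma IsHomogeneousTot.apply (hφ : IsHomogeneousTot p φ) {n : ℤ} {v : Tot A X Y}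
    (hv : ∀ e, e ≠ n → v e = 0) {e : ℤ} (he : e ≠ n + p) : φ v e = 0 := by
  have : v = inTot A X Y n (v n) := by
    refine DFinsupp.ext fun e => ?_
    by_cases h : e = n
    · subst h
      exact (inTot_apply_self (v e)).symm
    · rw [hv e h]
      exact (inTot_apply_of_ne (v n) h).symm
  rw [this]
  exact hφ n _ e he

lemma IsHomogeneousTot.comp (hφ : IsHomogeneousTot p φ) (hψ : IsHomogeneousTot q ψ) {r : ℤ}
    (h : q + p = r) : IsHomogeneousTot r (φ ∘ₗ ψ) := fun d x _ he =>
  hφ.apply (n := d + q) (fun e' he' => hψ d x e' he') (by rw [add_assoc, h]; exact he)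

lemma IsHomogeneousTot.add (hφ : IsHomogeneousTot p φ) (hψ : IsHomogeneousTot p ψ) :
    IsHomogeneousTot p (φ + ψ) := fun d x e he => by
  rw [LinearMap.add_apply, DirectSum.add_apply, hφ d x e he, hψ d x e he, add_zero]

lemma IsHomogeneousTot.neg (hφ : IsHomogeneousTot p φ) : IsHomogeneousTot p (-φ) :=
  fun d x e he => by
    rw [LinearMap.neg_apply, ← neg_zero, ← hφ d x e he]; rfl

lemma IsHomogeneousTot.sub (hφ : IsHomogeneousTot p φ) (hψ : IsHomogeneousTot p ψ) :
    IsHomogeneousTot p (φ - ψ) := by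
  rw [sub_eq_add_neg]; exact hφ.add hψ.neg

lemma isHomogeneousTot_id : IsHomogeneousTot 0 (LinearMap.id : Tot A X Y →ₗ[k] Tot A X Y) :=
  fun _ x _ he => inTot_apply_of_ne x (by rwa [add_zero] at he)

lemma IsHomogeneousTot.zsmul (hφ : IsHomogeneousTot p φ) (c : ℤ) : IsHomogeneousTot p (c • φ) :=
  fun d x e he => by
    have : (c • φ) (inTot A X Y d x) e = c • (φ (inTot A X Y d x) e) := by
      rw [LinearMap.smul_apply, DFinsupp.smul_apply]
    rw [this, hφ d x e he, smul_zero]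

/-- The inverse of a homogeneous map of degree `0` is homogeneous. -/
lemma IsHomogeneousTot.inverse (hφ : IsHomogeneousTot 0 φ) (h1 : φ ∘ₗ ψ = LinearMap.id)
    (h2 : ψ ∘ₗ φ = LinearMap.id) : IsHomogeneousTot 0 ψ := by
  -- A map of degree `0` commutes with the projections to the homogeneous pieces.
  have hc : ∀ (v : Tot A X Y) e, φ (inTot A X Y e (v e)) = inTot A X Y e (φ v e) := by
    intro v e
    induction v using Tot_induction with
    | h0 => simp
    | hadd x y hx hy => simp only [map_add, DirectSum.add_apply, hx, hy]
    | h d x =>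
      by_cases h : e = d
      · subst h
        refine DFinsupp.ext fun e' => ?_
        by_cases h' : e' = e
        · subst h'
          rw [inTot_apply_self, inTot_apply_self]
        · rw [inTot_apply_of_ne _ h', hφ e _ e' (by rwa [add_zero])]
      · rw [inTot_apply_of_ne x h, hφ d x e (by rwa [add_zero]), map_zero, map_zero]
  intro d x e he
  have h3 : φ (inTot A X Y e (ψ (inTot A X Y d x) e)) = 0 := by
    rw [hc, ← LinearMap.comp_apply φ ψ, h1, LinearMap.id_apply,
      inTot_apply_of_ne x (by rwa [add_zero] at he), map_zero]
  have h4 : inTot A X Y e (ψ (inTot A X Y d x) e) = 0 := by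
    rw [← LinearMap.id_apply (R := k) (inTot A X Y e _), ← h2, LinearMap.comp_apply, h3, map_zero]
  rw [← inTot_apply_self (ψ (inTot A X Y d x) e), h4]
  rfl

end

lemma isHomogeneousTot_comps {R : TMap A A (fun X => X) (fun X => X)} (hR : IsHomogeneous p R) :
    IsHomogeneousTot p (pr1 A X Y ∘ₗ R X Y ∘ₗ in1 A X Y) := fun d x _ he =>
  pr1_apply_of_mem_Deg (isHomogeneous_iff.1 hR X Y d
    (in1_mem_Deg fun _ h => inTot_apply_of_ne x h)) he

lemma isHomogeneousTot_of_overIn {R : TMap A A (fun X => X) (fun X => X)}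
    (hR : IsHomogeneous p R) {ρ : Tot (plusOver A D) X Y →ₗ[k] Tot (plusOver A D) X Y}
    (h : ∀ u, overIn A D X Y (ρ u) = R X Y (overIn A D X Y u)) : IsHomogeneousTot p ρ := by
  intro d x e he
  have h1 := in1_overProj_mem_Deg (D := D) (isHomogeneous_iff.1 hR X Y d
    (overIn_mem_Deg' fun _ h => inTot_apply_of_ne x h))
  rw [← h, overProj_overIn] at h1
  have := pr1_apply_of_mem_Deg h1 he
  rwa [pr1_in1] at this

lemma isHomogeneous_inc_pr1 {φ : ∀ X Y, Tot A X Y →ₗ[k] Tot A X Y}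
    (hφ : ∀ X Y, IsHomogeneousTot p (φ X Y)) :
    IsHomogeneous p (inc (f := fun X => X) (g := fun X => X) fun X Y => φ X Y ∘ₗ pr1 A X Y) := by
  rw [isHomogeneous_iff]
  intro X Y n x hx
  exact in1_mem_Deg fun e he => (hφ X Y).apply (fun e he => pr1_apply_of_mem_Deg hx he) he

/-! ### Locally nilpotent perturbations -/

/-- On the kernel `ν` acts as `-ε`, which is invertible and so nilpotent only on `0`. Surjectivity
is an induction on the exponent annihilating `v`: first solve for `ν v`, then correct. -/
lemma bijective_of_locally_nilpotent {M : Type*} [AddCommGroup M] [Module k M]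
    {ν : M →ₗ[k] M} (hν : ∀ v, ∃ n, (ν ^ n) v = 0) {ε : ℤ} (hε : ε * ε = 1) :
    Function.Bijective (ε • (LinearMap.id : M →ₗ[k] M) + ν) := by
  constructor
  · rw [← LinearMap.ker_eq_bot, LinearMap.ker_eq_bot']
    intro v hv
    have h1 : ν v = (-ε) • v := by
      rw [LinearMap.add_apply, LinearMap.smul_apply, LinearMap.id_apply] at hv
      rw [neg_smul]
      exact eq_neg_of_add_eq_zero_right hv
    obtain ⟨n, hn⟩ := hν v
    have h2 : ∀ n : ℕ, (ν ^ n) v = (-ε) ^ n • v := by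
      intro n
      induction n with
      | zero => simp
      | succ n ih => rw [pow_succ', Module.End.mul_apply, ih, map_zsmul, h1, smul_smul, pow_succ]
    rw [h2] at hn
    have h3 : (-ε) ^ n * (-ε) ^ n = 1 := by rw [← mul_pow, neg_mul_neg, hε, one_pow]
    rw [← one_smul ℤ v, ← h3, mul_smul, hn, smul_zero]
  · intro v
    obtain ⟨n, hn⟩ := hν v
    induction n generalizing v with
    | zero => exact ⟨0, by simpa using hn.symm⟩
    | succ n ih =>
      obtain ⟨u, hu⟩ := ih (ν v) (by rwa [pow_succ] at hn)
      -- With `(ε + ν)u = νv`, one gets `(ε + ν)(εv - εu) = v + ενv - ενv = v`.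
      refine ⟨ε • v - ε • u, ?_⟩
      rw [map_sub, map_zsmul _ _ u, hu]
      simp [smul_smul, hε]

/-! ### Contractions on tensors of length one -/

section
variable {F G : TMap A A (fun X => X) (fun X => X)}

/-- A single letter has only the two trivial cuts. If `R` vanishes on units, what remains is a
letter, so `R` maps letters to letters. -/
lemma IsCoderivation.apply_in1 {R : TMap A A (fun X => X) (fun X => X)} (hF : IsCocatHom F)
    (hG : IsCocatHom G) (hR : IsCoderivation p F G R) (h1 : ∀ X, R X X (one A X) = 0)
    (v : Tot A X Y) : R X Y (in1 A X Y v) = in1 A X Y (pr1 A X Y (R X Y (in1 A X Y v))) := by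
  have h := hR.eq_left hF hG (in1 A X Y v)
  rw [sumCut_in1, sumCut_in1] at h
  simp only [LinearMap.compl₁₂_apply, LinearMap.comp_apply, h1, hF.map_one, hG.map_one, sgn_one,
    map_zero, LinearMap.zero_apply, add_zero, zero_add] at h
  erw [iota_one, map_zero, LinearMap.zero_apply, zero_add, mulL_one] at h
  exact h

lemma B1_neg_one_apply {b L : TMap A A (fun X => X) (fun X => X)} (x : T A X Y) :
    B1 b b (-1) L X Y x = b X Y (L X Y x) + L X Y (b X Y x) := by
  rw [B1_apply]; simp [Int.negOnePow_neg]

lemma B1_neg_two_apply {b L : TMap A A (fun X => X) (fun X => X)} (x : T A X Y) :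
    B1 b b (-2) L X Y x = b X Y (L X Y x) - L X Y (b X Y x) := by
  rw [B1_apply, Int.negOnePow_even _ (by decide), Units.val_one, one_smul]

lemma map_e0_eq_zero {R : TMap A A (fun X => X) (fun X => X)} (h1 : ∀ X, R X X (one A X) = 0)
    (x : T A X Y) : R X Y (e0 A X Y x) = 0 := by
  induction x using T.induction with
  | h0 => simp
  | hadd x y hx hy => simp only [map_add, hx, hy, add_zero]
  | hsmul c x hx => simp only [map_smul, hx, smul_zero]
  | hone X => rw [etaEps_one]; exact h1 X
  | hcns a y _ => rw [etaEps_cns, map_zero]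

lemma sumCut_eq_zero {P : Type u} [AddCommGroup P] [Module k P]
    {γ : ∀ Z, T A X Z →ₗ[k] T A Z Y →ₗ[k] P} (h : ∀ Z x y, γ Z x y = 0) (x : T A X Y) :
    sumCut γ x = 0 := by
  have : γ = fun _ => 0 := funext fun Z => LinearMap.ext₂ (h Z)
  rw [this, sumCut_zero]

/-- A coderivation of degree `0` composed with a coderivation is a coderivation, if the mixed
terms vanish. -/
lemma isCoderivation_comp {N L : TMap A A (fun X => X) (fun X => X)}
    (hN : IsCoderivation 0 F G N) (hL : IsCoderivation p F G L)
    (hF : ∀ X Y x, F X Y (F X Y x) = F X Y x) (hG : ∀ X Y x, G X Y (G X Y x) = G X Y x)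
    (hFL : (∀ X Y x, F X Y (L X Y x) = 0) ∨ ∀ X Y x, N X Y (G X Y x) = 0)
    (hGL : (∀ X Y x, N X Y (F X Y x) = 0) ∨ ∀ X Y x, G X Y (L X Y x) = 0) :
    IsCoderivation p F G fun X Y => N X Y ∘ₗ L X Y := by
  refine isCoderivation_of_sumCut (hN.homogeneous.comp hL.homogeneous (add_zero p))
    fun X Y x P _ _ β => ?_
  rw [LinearMap.comp_apply]
  have h1 := hN.sumCut β (L X Y x)
  have h2 := hL.sumCut (fun Z => (β Z).compl₁₂ (F X Z) (N Z Y)) x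
  have h3 := hL.sumCut (fun Z => (β Z).compl₁₂ (N X Z) (G Z Y ∘ₗ sgn A 0 Z Y)) x
  refine h1.trans ((congrArg₂ (· + ·) h2 h3).trans ?_)
  have h4 : sumCut (fun Z => ((β Z).compl₁₂ (F X Z) (N Z Y)).compl₁₂ (L X Z)
      (G Z Y ∘ₗ sgn A p Z Y)) x = 0 := sumCut_eq_zero (fun Z x y => by
    simp only [LinearMap.compl₁₂_apply, LinearMap.comp_apply]
    rcases hFL with h | h
    · rw [h, map_zero, LinearMap.zero_apply]
    · rw [h, map_zero]) x
  have h5 : sumCut (fun Z => ((β Z).compl₁₂ (N X Z) (G Z Y ∘ₗ sgn A 0 Z Y)).compl₁₂ (F X Z)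
      (L Z Y)) x = 0 := sumCut_eq_zero (fun Z x y => by
    simp only [LinearMap.compl₁₂_apply, LinearMap.comp_apply, sgn_zero_apply]
    rcases hGL with h | h
    · rw [h, map_zero, LinearMap.zero_apply]
    · rw [h, map_zero]) x
  refine (congrArg₂ (· + ·) (congrArg (_ + ·) h4) (congrArg (· + _) h5)).trans ?_
  rw [add_zero, zero_add]
  refine congrArg₂ (· + ·) (sumCut_congr (fun Z x y => ?_) x) (sumCut_congr (fun Z x y => ?_) x)
  · simp only [LinearMap.compl₁₂_apply, LinearMap.comp_apply, hF]
  · simp only [LinearMap.compl₁₂_apply, LinearMap.comp_apply, sgn_zero_apply, hG]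

end

end

/-! ### Homotopies to `±1` and automorphisms, for one-sided coderivations. -/

section
variable {A B : GradedQuiver k S} {D : Set S}
  {X Y Z W : S} {d p q : ℤ}
  {b F G : TMap A A (fun X => X) (fun X => X)} {ε : ℤ}

local infixl:70 " ⋆ " => mulL _ _ _ _

/-- One of `F`, `G` is the identity and the other one is the projection to `T⁰A`. -/
def IsOneSided (F G : TMap A A (fun X => X) (fun X => X)) : Prop :=
  (F = etaEps A A (fun X => X) ∧ G = idT A) ∨ (F = idT A ∧ G = etaEps A A (fun X => X))

lemma pr1_inT_of_length_ne {w : Word S X Y} (hw : w.length ≠ 1) (x : Tens A w) :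
    pr1 A X Y (inT A w x) = 0 := by
  rcases w with _ | ⟨_, d, _ | _⟩
  · simp [pr1, pr1Tens]
  · exact absurd rfl hw
  · simp [pr1, pr1Tens]

lemma exists_in1_of_length_eq {w : Word S X Y} (hw : w.length = 1) (x : Tens A w) :
    ∃ v, inT A w x = in1 A X Y v := by
  rcases w with _ | ⟨_, d, _ | _⟩
  · simp [Word.length] at hw
  · exact ⟨inTot A X _ d ((tsingle A X _ d).symm x), by simp [in1]⟩
  · simp [Word.length] at hw

lemma map_inT_of_length_eq_zero {R : TMap A A (fun X => X) (fun X => X)} (h1 : ∀ X, R X X (one A X) = 0) {w : Word S X Y}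
    (hw : w.length = 0) (x : Tens A w) : R X Y (inT A w x) = 0 := by
  cases w with
  | nil =>
    obtain ⟨c, rfl⟩ := (tnil A _).surjective x
    rw [inT_nil, map_smul, h1, smul_zero]
  | cons => simp [Word.length] at hw

lemma IsCoderivation.zsmul {R : TMap A A (fun X => X) (fun X => X)} (hR : IsCoderivation p F G R)
    (c : ℤ) : IsCoderivation p F G fun X Y => c • R X Y := by
  refine isCoderivation_of_sumCut (hR.homogeneous.zsmul c) fun X Y x P _ _ β => ?_
  rw [LinearMap.smul_apply, map_zsmul, hR.sumCut, smul_add]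
  refine congrArg₂ (· + ·) ?_ ?_
  · rw [← sumCut_zsmul]
    refine sumCut_congr (fun Z x y => ?_) x
    simp only [LinearMap.smul_apply, LinearMap.compl₁₂_apply, map_zsmul]
  · rw [← sumCut_zsmul]
    refine sumCut_congr (fun Z x y => ?_) x
    simp only [LinearMap.smul_apply, LinearMap.compl₁₂_apply, map_zsmul]

namespace IsOneSided

lemma left_hom (h : IsOneSided F G) : IsCocatHom F := by
  rcases h with ⟨rfl, rfl⟩ | ⟨rfl, rfl⟩
  exacts [isCocatHom_etaEps _, isCocatHom_idT]

lemma right_hom (h : IsOneSided F G) : IsCocatHom G := by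
  rcases h with ⟨rfl, rfl⟩ | ⟨rfl, rfl⟩
  exacts [isCocatHom_idT, isCocatHom_etaEps _]

lemma left_diagonal (h : IsOneSided F G) : IsDiagonal F := by
  rcases h with ⟨rfl, rfl⟩ | ⟨rfl, rfl⟩
  exacts [isDiagonal_etaEps, isDiagonal_idT]

lemma right_diagonal (h : IsOneSided F G) : IsDiagonal G := by
  rcases h with ⟨rfl, rfl⟩ | ⟨rfl, rfl⟩
  exacts [isDiagonal_idT, isDiagonal_etaEps]

lemma redT (h : IsOneSided F G) : IsCoderivation 0 F G (redT A) := by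
  rcases h with ⟨rfl, rfl⟩ | ⟨rfl, rfl⟩
  exacts [isCoderivation_redT, isCoderivation_redT']

lemma map_e0 (hA : IsAInfCategory A b) (x : T A X Y) :
    b X Y (e0 A X Y x) = e0 A X Y (b X Y x) := by
  rw [map_e0_eq_zero hA.map_one]
  exact (hA.coderivation.e0_apply isCocatHom_idT isCocatHom_idT x).symm

lemma left_comm (h : IsOneSided F G) (hA : IsAInfCategory A b) (X Y : S) (x : T A X Y) :
    b X Y (F X Y x) = F X Y (b X Y x) := by
  rcases h with ⟨rfl, rfl⟩ | ⟨rfl, rfl⟩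
  exacts [map_e0 hA x, rfl]

lemma right_comm (h : IsOneSided F G) (hA : IsAInfCategory A b) (X Y : S) (x : T A X Y) :
    b X Y (G X Y x) = G X Y (b X Y x) := by
  rcases h with ⟨rfl, rfl⟩ | ⟨rfl, rfl⟩
  exacts [rfl, map_e0 hA x]

lemma B1 (h : IsOneSided F G) (hA : IsAInfCategory A b) {L : TMap A A (fun X => X) (fun X => X)}
    (hL : IsCoderivation p F G L) (hq : p + 1 = q) : IsCoderivation q F G (B1 b b p L) :=
  hA.coderivation.B1 hA.coderivation (h.left_comm hA) (h.right_comm hA) hL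
    h.right_hom.homogeneous hq

/-- Coderivations do not compose in general. Here one of `F`, `G` is the projection to `T⁰`; the
mixed terms die because `L` has no part in `T⁰` and `N` vanishes on `T⁰`. -/
lemma comp (h : IsOneSided F G) {N L : TMap A A (fun X => X) (fun X => X)}
    (hN : IsCoderivation 0 F G N) (hL : IsCoderivation p F G L)
    (h1 : ∀ X, N X X (one A X) = 0) : IsCoderivation p F G fun X Y => N X Y ∘ₗ L X Y := by
  have hLe := fun X Y x => hL.e0_apply h.left_hom h.right_hom (X := X) (Y := Y) x
  rcases h with ⟨rfl, rfl⟩ | ⟨rfl, rfl⟩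
  · exact isCoderivation_comp hN hL (fun X Y x => e0_etaEps (fun X => X) x) (fun _ _ _ => rfl)
      (.inl hLe) (.inl fun X Y x => map_e0_eq_zero h1 x)
  · exact isCoderivation_comp hN hL (fun _ _ _ => rfl) (fun X Y x => e0_etaEps (fun X => X) x)
      (.inr fun X Y x => map_e0_eq_zero h1 x) (.inr hLe)

end IsOneSided

lemma IsAInfCategory.sq_apply (hA : IsAInfCategory A b) (x : T A X Y) : b X Y (b X Y x) = 0 :=
  LinearMap.congr_fun (hA.sq_zero X Y) x

lemma IsAInfCategory.apply_in1 (hA : IsAInfCategory A b) (v : Tot A X Y) :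
    b X Y (in1 A X Y v) = in1 A X Y (diff b X Y v) :=
  hA.coderivation.apply_in1 isCocatHom_idT isCocatHom_idT hA.map_one v

/-- An idempotent up to homotopy and sign, which is homotopy invertible, is homotopic to `± 1`. -/
theorem IsOneSided.exists_homotopy (h : IsOneSided F G) (hA : IsAInfCategory A b)
    {L W : TMap A A (fun X => X) (fun X => X)} (hL : IsCoderivation (-1) F G L)
    (hW : IsCoderivation (-2) F G W) (h1 : ∀ X, AInf.B1 b b (-1) L X X (one A X) = 0)
    (hQ : ∀ X, AInf.B1 b b (-1) L X X (L X X (one A X)) =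
      ε • L X X (one A X) + b X X (W X X (one A X)))
    (hI : ∀ X Y, IsHomotopyInvertible (diff b X Y)
      (pr1 A X Y ∘ₗ AInf.B1 b b (-1) L X Y ∘ₗ in1 A X Y)) :
    ∃ η : ∀ X Y, Tot A X Y →ₗ[k] Tot A X Y, (∀ X Y, IsHomogeneousTot (-1) (η X Y)) ∧
      ∀ X Y v, pr1 A X Y (AInf.B1 b b (-1) L X Y (in1 A X Y v)) =
        ε • v + (diff b X Y (η X Y v) + η X Y (diff b X Y v)) := by
  set N := AInf.B1 b b (-1) L with hN
  have hNc : IsCoderivation 0 F G N := h.B1 hA hL (by norm_num)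
  have hNL := h.comp hNc hL h1
  have hM : IsCoderivation (-1) F G (AInf.B1 b b (-2) W) := h.B1 hA hW (by norm_num)
  let L' : TMap A A (fun X => X) (fun X => X) := fun X Y => ε • L X Y
  have hL' : IsCoderivation (-1) F G L' := by
    exact hL.zsmul ε
  -- `Q` measures the failure of `N L = ε L`, corrected by the homotopy `W`. By `hQ` it vanishes on
  -- units, so it maps letters to letters.
  let Q : TMap A A (fun X => X) (fun X => X) := fun X Y =>
    N X Y ∘ₗ L X Y - L' X Y - AInf.B1 b b (-2) W X Y
  have hQc : IsCoderivation (-1) F G Q := (hNL.sub hL').sub hM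
  have hQ1 : ∀ X, Q X X (one A X) = 0 := by
    intro X
    change N X X (L X X (one A X)) - ε • L X X (one A X) - AInf.B1 b b (-2) W X X (one A X) = 0
    rw [hQ, B1_neg_two_apply, hA.map_one, map_zero]
    abel
  have hQv := fun X Y v => hQc.apply_in1 h.left_hom h.right_hom hQ1 (X := X) (Y := Y) v
  have hNv := fun X Y v => hNc.apply_in1 h.left_hom h.right_hom h1 (X := X) (Y := Y) v
  -- Since `N` commutes with `b`, taking commutators turns `N L` into `N²` and `ε L` into `ε N`,
  -- while the commutator term of `W` disappears by `b² = 0`.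
  have key : ∀ X Y (x : T A X Y), b X Y (Q X Y x) + Q X Y (b X Y x) =
      N X Y (N X Y x) - ε • N X Y x := by
    intro X Y x
    have e1 : ∀ y, Q X Y y = N X Y (L X Y y) - ε • L X Y y - (b X Y (W X Y y) - W X Y (b X Y y)) :=
      fun y => by rw [← B1_neg_two_apply]; rfl
    have e2 : ∀ y, N X Y y = b X Y (L X Y y) + L X Y (b X Y y) := fun y => B1_neg_one_apply y
    have e3 : ∀ y, b X Y (N X Y y) = N X Y (b X Y y) := fun y => by
      rw [e2, e2, map_add, hA.sq_apply, hA.sq_apply, map_zero, zero_add, add_zero]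
    rw [e1, e1, hA.sq_apply, map_zero, sub_zero]
    conv_rhs => rw [e2 x, map_add]
    simp only [map_sub, map_zsmul, e3, hA.sq_apply, smul_add]
    abel
  choose hφ hφδ ψ τ _ hψ hψδ hτ _ hψφ _ using hI
  let φ : ∀ X Y, Tot A X Y →ₗ[k] Tot A X Y := fun X Y => pr1 A X Y ∘ₗ N X Y ∘ₗ in1 A X Y
  let κ : ∀ X Y, Tot A X Y →ₗ[k] Tot A X Y := fun X Y => pr1 A X Y ∘ₗ Q X Y ∘ₗ in1 A X Y
  have hκ : ∀ X Y, IsHomogeneousTot (-1) (κ X Y) := fun X Y =>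
    isHomogeneousTot_comps hQc.homogeneous
  have e1 : ∀ X Y v, diff b X Y (κ X Y v) + κ X Y (diff b X Y v) =
      φ X Y (φ X Y v) - ε • φ X Y v := by
    intro X Y v
    apply in1_injective
    have := key X Y (in1 A X Y v)
    rw [hQv, hA.apply_in1, hA.apply_in1, hQv X Y (diff b X Y v), hNv, hNv X Y (pr1 A X Y _)] at this
    rw [map_add, map_sub, map_zsmul]
    exact this
  have e2 : ∀ X Y v, φ X Y (diff b X Y v) = diff b X Y (φ X Y v) := fun X Y v =>
    LinearMap.congr_fun (hφδ X Y) v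
  have e3 : ∀ X Y v, ψ X Y (diff b X Y v) = diff b X Y (ψ X Y v) := fun X Y v =>
    LinearMap.congr_fun (hψδ X Y) v
  have e4 : ∀ X Y v, ψ X Y (φ X Y v) =
      v + τ X Y (diff b X Y v) + diff b X Y (τ X Y v) := fun X Y v =>
    LinearMap.congr_fun (hψφ X Y) v
  -- Apply the homotopy inverse `ψ` to `φ² - εφ = dκ + κd` and insert `ψφ = 1 + τd + dτ`. Then `φ -
  -- ε` is the commutator of `d` with `ψκ - τ(φ - ε)`.
  refine ⟨fun X Y => ψ X Y ∘ₗ κ X Y - τ X Y ∘ₗ (φ X Y - ε • LinearMap.id), fun X Y => ?_,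
    fun X Y v => ?_⟩
  · exact ((hψ X Y).comp (hκ X Y) (by norm_num)).sub
      ((hτ X Y).comp ((hφ X Y).sub (isHomogeneousTot_id.zsmul ε)) (by norm_num))
  · change φ X Y v = _
    simp only [LinearMap.sub_apply, LinearMap.comp_apply, LinearMap.smul_apply, LinearMap.id_apply]
    have h2 := congrArg (ψ X Y) (e1 X Y v)
    rw [map_add, map_sub, e3, map_zsmul, e4, e4] at h2
    simp only [map_sub, map_zsmul, e2, eq_sub_of_add_eq h2, smul_add]
    abel

/-- A coderivation commuting with the codifferential, whose first component is homotopic to `± 1`,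
is homotopic to an automorphism on `sD(C|B)`. -/
theorem IsOneSided.exists_automorphism (h : IsOneSided F G) (hA : IsAInfCategory A b)
    {N : TMap A A (fun X => X) (fun X => X)} (hN : IsCoderivation 0 F G N)
    (hNb : ∀ X Y x, N X Y (b X Y x) = b X Y (N X Y x)) (h1 : ∀ X, N X X (one A X) = 0)
    (hε : ε * ε = 1) {η : ∀ X Y, Tot A X Y →ₗ[k] Tot A X Y}
    (hη : ∀ X Y, IsHomogeneousTot (-1) (η X Y))
    (hηN : ∀ X Y v, pr1 A X Y (N X Y (in1 A X Y v)) =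
        ε • v + (diff b X Y (η X Y v) + η X Y (diff b X Y v)))
    {δ φ : Tot (plusOver A D) X Y →ₗ[k] Tot (plusOver A D) X Y}
    (hδ : ∀ u, overIn A D X Y (δ u) = b X Y (overIn A D X Y u))
    (hφ : ∀ u, overIn A D X Y (φ u) = N X Y (overIn A D X Y u)) :
    ∃ υ ω χ : Tot (plusOver A D) X Y →ₗ[k] Tot (plusOver A D) X Y,
      υ ∘ₗ ω = LinearMap.id ∧ ω ∘ₗ υ = LinearMap.id ∧ IsHomogeneousTot 0 υ ∧
      IsHomogeneousTot (-1) χ ∧ υ ∘ₗ δ = δ ∘ₗ υ ∧ φ = υ + (δ ∘ₗ χ + χ ∘ₗ δ) := by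
  let ηc : Comps A A (fun X => X) (fun X => X) := fun X Y => η X Y ∘ₗ pr1 A X Y
  have hηc : IsHomogeneous (-1) (inc ηc) := isHomogeneous_inc_pr1 hη
  set H := coderivation (-1) F ηc G with hH
  have hHc : IsCoderivation (-1) F G H :=
    isCoderivation_coderivation h.left_hom h.right_hom hηc
  have hpH : ∀ X Y x, pr1 A X Y (H X Y x) = η X Y (pr1 A X Y x) :=
    fun X Y x => pr1_coderivation h.left_hom h.right_hom ηc x
  have hH1 : ∀ X, H X X (one A X) = 0 := fun X => by
    rw [hHc.apply_one h.left_hom h.right_hom]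
    exact iota_eq_zero_iff.2 (by rw [hpH, pr1_one, map_zero])
  have hHv := fun X Y v => hHc.apply_in1 h.left_hom h.right_hom hH1 (X := X) (Y := Y) v
  have hBc : IsCoderivation 0 F G (AInf.B1 b b (-1) H) := h.B1 hA hHc (by norm_num)
  -- The components of `H` act on single letters only, so no inner object is changed and `H`
  -- preserves `sD(C|B)`.
  have hrange : ∀ u, ∃ u', overIn A D X Y u' = H X Y (overIn A D X Y u) := fun u =>
    coderivation_mem_range h.left_diagonal h.right_diagonal (fun w x hw => by
      rw [LinearMap.comp_apply, pr1_inT_of_length_ne hw, map_zero]) u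
  let χ : Tot (plusOver A D) X Y →ₗ[k] Tot (plusOver A D) X Y :=
    overProj A D X Y ∘ₗ H X Y ∘ₗ overIn A D X Y
  have hχ : ∀ u, overIn A D X Y (χ u) = H X Y (overIn A D X Y u) := fun u => by
    obtain ⟨u', hu'⟩ := hrange u
    change overIn A D X Y (overProj A D X Y (H X Y (overIn A D X Y u))) = _
    rw [← hu', overProj_overIn]
  let υ := φ - (δ ∘ₗ χ + χ ∘ₗ δ)
  let U : TMap A A (fun X => X) (fun X => X) := N - AInf.B1 b b (-1) H
  have hUc : IsCoderivation 0 F G U := hN.sub hBc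
  have hU : ∀ X Y x, U X Y x = N X Y x - (b X Y (H X Y x) + H X Y (b X Y x)) := fun X Y x => by
    rw [← B1_neg_one_apply]; rfl
  have hυ : ∀ u, overIn A D X Y (υ u) = U X Y (overIn A D X Y u) := fun u => by
    rw [hU, ← hφ, ← hδ, ← hχ, ← hχ, ← hδ, ← map_add, ← map_sub]
    rfl
  -- `U` is `N` minus the commutator of `b` with `H`, so its first component is `ε`. After
  -- subtraction of `ε` times the projection to `T⁺`, the components on units and on single letters
  -- vanish.
  let U' : TMap A A (fun X => X) (fun X => X) := U - fun X Y => ε • AInf.redT A X Y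
  have hUc' : IsCoderivation 0 F G U' := hUc.sub (h.redT.zsmul ε)
  have hU' : ∀ X Y x, U' X Y x = U X Y x - ε • (x - e0 A X Y x) := fun X Y x => rfl
  have hU'1 : ∀ X, U' X X (one A X) = 0 := fun X => by
    rw [hU', hU, h1, hH1, hA.map_one, map_zero, map_zero, e0, etaEps_one, sub_self, smul_zero]
    abel
  have hU'v : ∀ X Y v, pr1 A X Y (U' X Y (in1 A X Y v)) = 0 := fun X Y v => by
    rw [hU', hU, hHv, hA.apply_in1, hA.apply_in1, e0_in1]
    simp only [map_sub, map_add, map_zsmul, pr1_in1, hpH, hηN, map_zero]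
    abel_nf
  let ν : Tot (plusOver A D) X Y →ₗ[k] Tot (plusOver A D) X Y := υ - ε • LinearMap.id
  have hν : ∀ u, overIn A D X Y (ν u) = U' X Y (overIn A D X Y u) := fun u => by
    rw [hU', e0_overIn, sub_zero, ← hυ, ← map_zsmul, ← map_sub]
    rfl
  -- Each application of `ν` lowers the length bound by one, and a nonzero tensor has length at
  -- least zero.
  have hshort : ∀ (n : ℕ) u, overIn A D X Y u ∈ Short A n X Y → (ν ^ n) u = 0 := by
    intro n
    induction n with
    | zero =>
      intro u hu
      exact overIn_injective ((eq_zero_of_mem_Short hu).trans (map_zero _).symm)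
    | succ n ih =>
      intro u hu
      rw [pow_succ, Module.End.mul_apply]
      refine ih _ ?_
      rw [hν, hUc'.eq_coderivation h.left_hom h.right_hom]
      refine coderivation_mem_Short h.left_diagonal h.right_diagonal (fun {X Y} w x hw => ?_) hu
      rcases Nat.le_one_iff_eq_zero_or_eq_one.1 hw with hw | hw
      · change pr1 A X Y (U' X Y (inT A w x)) = 0
        rw [map_inT_of_length_eq_zero hU'1 hw, map_zero]
      · obtain ⟨v, hv⟩ := exists_in1_of_length_eq hw x
        rw [hv]
        exact hU'v X Y v
  have hbij : Function.Bijective υ := by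
    have := bijective_of_locally_nilpotent (ν := ν) (fun u => by
      obtain ⟨n, hn⟩ := exists_mem_Short (overIn A D X Y u)
      exact ⟨n, hshort n u hn⟩) hε
    rwa [show ε • LinearMap.id + ν = υ from add_sub_cancel _ _] at this
  let e := LinearEquiv.ofBijective υ hbij
  have hδδ : ∀ u, δ (δ u) = 0 := fun u => overIn_injective (by
    rw [hδ, hδ, hA.sq_apply, map_zero])
  have hφδ : ∀ u, φ (δ u) = δ (φ u) := fun u => overIn_injective (by
    rw [hδ, hφ, hφ, hδ, hNb])
  refine ⟨υ, e.symm.toLinearMap, χ, LinearMap.ext e.apply_symm_apply,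
    LinearMap.ext e.symm_apply_apply, isHomogeneousTot_of_overIn hUc.homogeneous hυ,
    isHomogeneousTot_of_overIn hHc.homogeneous hχ, LinearMap.ext fun u => ?_,
    (sub_add_cancel _ _).symm⟩
  simp only [υ, LinearMap.comp_apply, LinearMap.sub_apply, LinearMap.add_apply, map_sub, map_add,
    hδδ, hφδ, map_zero]
  abel

end

/-! ### Homotopy invertibility of the unit maps of `D(C|B)`. -/

section
variable {A B : GradedQuiver k S} {D : Set S}
  {X Y Z W : S} {d p q : ℤ}
  {b i F G : TMap A A (fun X => X) (fun X => X)} {ε : ℤ}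

local infixl:70 " ⋆ " => mulL _ _ _ _

/-! ### Homotopy invertibility -/

section
variable {δ φ υ ω χ κ : Tot A X Y →ₗ[k] Tot A X Y}

/-- The inverse `ω` of the chain automorphism `υ` is a homotopy inverse of `φ`, with homotopies `ωχ`
and `χω`. -/
lemma isHomotopyInvertible_of_homotopic (hδ : IsHomogeneousTot 1 δ) (hδδ : ∀ u, δ (δ u) = 0)
    (h1 : υ ∘ₗ ω = LinearMap.id) (h2 : ω ∘ₗ υ = LinearMap.id) (hυ : IsHomogeneousTot 0 υ)
    (hχ : IsHomogeneousTot (-1) χ) (hυδ : υ ∘ₗ δ = δ ∘ₗ υ) (hφ : φ = υ + (δ ∘ₗ χ + χ ∘ₗ δ)) :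
    IsHomotopyInvertible δ φ := by
  have hω := hυ.inverse h1 h2
  have e1 : ∀ u, υ (ω u) = u := fun u => LinearMap.congr_fun h1 u
  have e2 : ∀ u, ω (υ u) = u := fun u => LinearMap.congr_fun h2 u
  have e3 : ∀ u, υ (δ u) = δ (υ u) := fun u => LinearMap.congr_fun hυδ u
  have e4 : ∀ u, ω (δ u) = δ (ω u) := fun u => by
    conv_lhs => rw [← e1 u, ← e3, e2]
  subst hφ
  refine ⟨hυ.add (((hδ.comp hχ (by norm_num))).add (hχ.comp hδ (by norm_num))), ?_, ω, ω ∘ₗ χ,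
    χ ∘ₗ ω, hω, LinearMap.ext e4, hω.comp hχ (by norm_num), hχ.comp hω (by norm_num), ?_, ?_⟩
  · refine LinearMap.ext fun u => ?_
    simp only [LinearMap.comp_apply, LinearMap.add_apply, e3, map_add, hδδ, map_zero, add_zero,
      zero_add]
  · refine LinearMap.ext fun u => ?_
    simp only [LinearMap.comp_apply, LinearMap.add_apply, e2, e4, map_add, LinearMap.id_apply]
    abel
  · refine LinearMap.ext fun u => ?_
    simp only [LinearMap.comp_apply, LinearMap.add_apply, e1, ← e4, LinearMap.id_apply]
    abel

/-- The automorphism `υ` is homotopic to the null-homotopic map `φ`. Hence `υ`, and with it the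
identity `ωυ`, is null-homotopic, so the complex is contractible. -/
lemma isHomotopyInvertible_zero_of_homotopic
    (h1 : υ ∘ₗ ω = LinearMap.id) (h2 : ω ∘ₗ υ = LinearMap.id) (hυ : IsHomogeneousTot 0 υ)
    (hχ : IsHomogeneousTot (-1) χ) (hυδ : υ ∘ₗ δ = δ ∘ₗ υ) (hφ : φ = υ + (δ ∘ₗ χ + χ ∘ₗ δ))
    (hκ : IsHomogeneousTot (-1) κ) (hφκ : φ = δ ∘ₗ κ + κ ∘ₗ δ) : IsHomotopyInvertible δ 0 := by
  have hω := hυ.inverse h1 h2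
  have e1 : ∀ u, υ (ω u) = u := fun u => LinearMap.congr_fun h1 u
  have e2 : ∀ u, ω (υ u) = u := fun u => LinearMap.congr_fun h2 u
  have e3 : ∀ u, υ (δ u) = δ (υ u) := fun u => LinearMap.congr_fun hυδ u
  have e4 : ∀ u, ω (δ u) = δ (ω u) := fun u => by
    conv_lhs => rw [← e1 u, ← e3, e2]
  have h0 : ∀ q, IsHomogeneousTot q (0 : Tot A X Y →ₗ[k] Tot A X Y) := fun _ _ _ _ _ => rfl
  -- Apply `ω` to `υ + [δ, χ] = [δ, κ]`; as `ω` commutes with `δ`, the contraction is `ω(χ - κ)`.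
  have hc : (0 : Tot A X Y →ₗ[k] Tot A X Y) =
      LinearMap.id + (ω ∘ₗ (χ - κ)) ∘ₗ δ + δ ∘ₗ (ω ∘ₗ (χ - κ)) := by
    refine LinearMap.ext fun u => ?_
    have h5 := LinearMap.congr_fun (hφ.symm.trans hφκ) u
    simp only [LinearMap.comp_apply, LinearMap.add_apply] at h5
    have h6 := congrArg ω h5
    simp only [map_add, e2, e4] at h6
    simp only [LinearMap.comp_apply, LinearMap.add_apply, LinearMap.sub_apply, LinearMap.id_apply,
      map_sub, LinearMap.zero_apply]
    rw [← sub_eq_zero] at h6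
    rw [← h6]
    abel
  have hh : IsHomogeneousTot (-1) (ω ∘ₗ (χ - κ)) := hω.comp (hχ.sub hκ) (by norm_num)
  exact ⟨h0 0, by rw [LinearMap.zero_comp, LinearMap.comp_zero], 0, _, _, h0 0,
    by rw [LinearMap.zero_comp, LinearMap.comp_zero], hh, hh,
    by rw [LinearMap.comp_zero]; exact hc, by rw [LinearMap.comp_zero]; exact hc⟩

end

/-! ### Multiplication with the unit elements -/

/-- The element `_X i₀`. -/
def unitElt (i : TMap A A (fun X => X) (fun X => X)) (X : S) : Tot A X X :=
  pr1 A X X (i X X (one A X))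

lemma IsNatural.in1_unitElt (hi : IsNatural b b (idT A) (idT A) i) (X : S) :
    in1 A X X (unitElt i X) = i X X (one A X) :=
  (hi.coderivation.apply_one isCocatHom_idT isCocatHom_idT X).symm

lemma IsNatural.in1_unitElt_mem (hi : IsNatural b b (idT A) (idT A) i) (X : S) :
    in1 A X X (unitElt i X) ∈ Deg A (-1) X X := by
  rw [hi.in1_unitElt]
  exact isHomogeneous_iff.1 hi.coderivation.homogeneous X X 0 (one_mem_Deg X)

lemma IsNatural.map_unitElt (hA : IsAInfCategory A b) (hi : IsNatural b b (idT A) (idT A) i)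
    (X : S) : b X X (in1 A X X (unitElt i X)) = 0 := by
  have : B1 b b (-1) i X X (one A X) = 0 := by rw [hi.closed]; rfl
  rwa [B1_neg_one_apply, hA.map_one, map_zero, add_zero, ← hi.in1_unitElt] at this

/-- The coderivation with first component `(_X i₀ ⊗ 1)b₂`. -/
def leftMap (b i : TMap A A (fun X => X) (fun X => X)) : TMap A A (fun X => X) (fun X => X) :=
  B1 b b (-1) (mulLeft (-1) (unitElt i))

/-- The coderivation with first component `(1 ⊗ _Y i₀)b₂`. -/
def rightMap (b i : TMap A A (fun X => X) (fun X => X)) : TMap A A (fun X => X) (fun X => X) :=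
  B1 b b (-1) (mulRight (unitElt i))

lemma isOneSided_left : IsOneSided (etaEps A A fun X => X) (idT A) := .inl ⟨rfl, rfl⟩

lemma isOneSided_right : IsOneSided (idT A) (etaEps A A fun X => X) := .inr ⟨rfl, rfl⟩

lemma leftMap_apply (x : T A X Y) : leftMap b i X Y x =
    b X Y (in1 A X X (unitElt i X) ⋆ sgn A (-1) X Y x) +
      in1 A X X (unitElt i X) ⋆ sgn A (-1) X Y (b X Y x) :=
  B1_neg_one_apply x

lemma rightMap_apply (x : T A X Y) : rightMap b i X Y x =
    b X Y (x ⋆ in1 A Y Y (unitElt i Y)) + b X Y x ⋆ in1 A Y Y (unitElt i Y) :=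
  B1_neg_one_apply x

section
variable (hA : IsAInfCategory A b) (hi : IsNatural b b (idT A) (idT A) i)
include hA hi

lemma isCoderivation_leftMap :
    IsCoderivation 0 (etaEps A A fun X => X) (idT A) (leftMap b i) :=
  isOneSided_left.B1 hA (isCoderivation_mulLeft hi.in1_unitElt_mem) (by norm_num)

lemma isCoderivation_rightMap :
    IsCoderivation 0 (idT A) (etaEps A A fun X => X) (rightMap b i) :=
  isOneSided_right.B1 hA (isCoderivation_mulRight hi.in1_unitElt_mem) (by norm_num)

lemma leftMap_one (X : S) : leftMap b i X X (one A X) = 0 := by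
  rw [leftMap_apply, hA.map_one, sgn_one, mulL_one, hi.map_unitElt hA, map_zero, map_zero, add_zero]

lemma rightMap_one (X : S) : rightMap b i X X (one A X) = 0 := by
  rw [rightMap_apply, hA.map_one, one_mulL, hi.map_unitElt hA, map_zero, LinearMap.zero_apply,
    add_zero]

end

lemma B1_neg_one_comm (hA : IsAInfCategory A b) {L : TMap A A (fun X => X) (fun X => X)}
    (x : T A X Y) : B1 b b (-1) L X Y (b X Y x) = b X Y (B1 b b (-1) L X Y x) := by
  rw [B1_neg_one_apply, B1_neg_one_apply, map_add, hA.sq_apply, hA.sq_apply, map_zero, zero_add,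
    add_zero]

lemma in1_sgnTot (v : Tot A X Y) : in1 A X Y (sgnTot A p X Y v) = sgn A p X Y (in1 A X Y v) := by
  induction v using Tot_induction with
  | h0 => simp
  | hadd x y hx hy => simp only [map_add, hx, hy]
  | h d x =>
    rw [sgn_of_mem p (in1_mem_Deg fun _ h => inTot_apply_of_ne x h), ← map_zsmul]
    congr 1
    rw [sgnTot, DirectSum.lmap_lof, LinearMap.smul_apply, LinearMap.id_apply, map_zsmul]

lemma pr1_in1_mulL_in1 (v : Tot A X Y) (v' : Tot A Y Z) :
    pr1 A X Z (in1 A X Y v ⋆ in1 A Y Z v') = 0 := by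
  rw [← iota_eq_zero_iff, iota_mulL, e0_in1, e0_in1, map_zero, map_zero, LinearMap.zero_apply,
    add_zero]

/-- On a letter, the second term of the commutator is a product of two letters and has no component.
-/
lemma pr1_leftMap (hA : IsAInfCategory A b) :
    pr1 A X Y ∘ₗ leftMap b i X Y ∘ₗ in1 A X Y = leftUnit b i X Y := by
  refine LinearMap.ext fun v => ?_
  rw [LinearMap.comp_apply, LinearMap.comp_apply, leftMap_apply, hA.apply_in1, ← in1_sgnTot,
    ← in1_sgnTot, map_add, pr1_in1_mulL_in1, add_zero]
  rfl

lemma pr1_rightMap (hA : IsAInfCategory A b) :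
    pr1 A X Y ∘ₗ rightMap b i X Y ∘ₗ in1 A X Y = rightUnit b i X Y := by
  refine LinearMap.ext fun v => ?_
  rw [LinearMap.comp_apply, LinearMap.comp_apply, rightMap_apply, hA.apply_in1, map_add,
    pr1_in1_mulL_in1, add_zero]
  rfl

/-- The homotopy between `i₀ ⊗ i₀` and `i₀`. -/
lemma IsUnitTransformation.exists_homotopy (hA : IsAInfCategory A b)
    (hi : IsUnitTransformation b i) : ∃ w : ∀ X, Tot A X X,
      (∀ X, in1 A X X (w X) ∈ Deg A (-2) X X) ∧ ∀ X,
        b X X (in1 A X X (unitElt i X) ⋆ in1 A X X (unitElt i X)) + b X X (in1 A X X (w X)) =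
          in1 A X X (unitElt i X) := by
  obtain ⟨Θ, hΘ, e⟩ := (hA.equivalent_B2_iff hi.natural).1 hi.idempotent
  refine ⟨fun X => pr1 A X X (Θ X X (one A X)), fun X => in1_mem_Deg fun e he =>
    pr1_apply_of_mem_Deg (isHomogeneous_iff.1 hΘ.homogeneous X X 0 (one_mem_Deg X)) he,
    fun X => ?_⟩
  -- The unit has only the trivial cut, so the relation for `Θ` makes its value on the unit the
  -- product of two unit elements plus a single letter, which is the required `w`.
  have h1 : Θ X X (one A X) = in1 A X X (unitElt i X) ⋆ in1 A X X (unitElt i X) +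
      in1 A X X (pr1 A X X (Θ X X (one A X))) := by
    have h2 := split_left (Θ X X (one A X))
    rw [hΘ.e0_apply isCocatHom_idT isCocatHom_idT isCocatHom_idT hi.natural.coderivation
      hi.natural.coderivation, hΘ.sumCut, sumCut_one, sumCut_one, sumCut_one] at h2
    simp only [LinearMap.compl₁₂_apply, LinearMap.comp_apply, sgn_one,
      ← hi.natural.in1_unitElt] at h2
    have h3 : idT A X X (one A X) = one A X := rfl
    rw [h3, iota_one, map_zero, LinearMap.zero_apply, zero_add, zero_add, mulL_one, iota_in1] at h2
    exact h2
  rw [← map_add, ← h1]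
  have h3 : B1 b b (-2) Θ X X (one A X) = i X X (one A X) := by rw [e]
  rwa [B1_neg_two_apply, hA.map_one, map_zero, sub_zero, ← hi.natural.in1_unitElt] at h3

/-- The sign is `-1` since left multiplication carries the Koszul sign of its argument: for `i₀`, of
odd degree, `N(i₀)` is `-b(i₀ ⊗ i₀) = -i₀ + b(w)`. -/
theorem IsUnitTransformation.exists_homotopy_left (hA : IsAInfCategory A b)
    (hi : IsUnitTransformation b i) :
    ∃ η : ∀ X Y, Tot A X Y →ₗ[k] Tot A X Y, (∀ X Y, IsHomogeneousTot (-1) (η X Y)) ∧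
      ∀ X Y v, pr1 A X Y (leftMap b i X Y (in1 A X Y v)) =
        (-1 : ℤ) • v + (diff b X Y (η X Y v) + η X Y (diff b X Y v)) := by
  obtain ⟨w, hw, e⟩ := hi.exists_homotopy hA
  refine isOneSided_left.exists_homotopy hA (isCoderivation_mulLeft hi.natural.in1_unitElt_mem)
    (isCoderivation_mulLeft hw) (leftMap_one hA hi.natural) (fun X => ?_) fun X Y => ?_
  · rw [mulLeft_apply, mulLeft_apply, sgn_one, sgn_one, mulL_one, mulL_one]
    change leftMap b i X X _ = _
    rw [leftMap_apply, hi.natural.map_unitElt hA, sgn_of_mem _ (hi.natural.in1_unitElt_mem X)]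
    conv_rhs => rw [← e X]
    simp
  · have := hi.left X Y
    rwa [← pr1_leftMap hA] at this

theorem IsUnitTransformation.exists_homotopy_right (hA : IsAInfCategory A b)
    (hi : IsUnitTransformation b i) :
    ∃ η : ∀ X Y, Tot A X Y →ₗ[k] Tot A X Y, (∀ X Y, IsHomogeneousTot (-1) (η X Y)) ∧
      ∀ X Y v, pr1 A X Y (rightMap b i X Y (in1 A X Y v)) =
        (1 : ℤ) • v + (diff b X Y (η X Y v) + η X Y (diff b X Y v)) := by
  obtain ⟨w, hw, e⟩ := hi.exists_homotopy hA
  refine isOneSided_right.exists_homotopy hA (isCoderivation_mulRight hi.natural.in1_unitElt_mem)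
    -- No sign occurs on the right: `N(i₀) = b(i₀ ⊗ i₀) = i₀ - b(w)`, whence `ε = 1` and the
    -- correcting element is `-w`.
    (isCoderivation_mulRight (a := fun X => - w X) (p := -2) fun X => ?_)
    (rightMap_one hA hi.natural) (fun X => ?_) fun X Y => ?_
  · rw [map_neg]; exact neg_mem (hw X)
  · rw [mulRight_apply, mulRight_apply, one_mulL, one_mulL]
    change rightMap b i X X _ = _
    rw [rightMap_apply, hi.natural.map_unitElt hA]
    conv_rhs => rw [← e X]
    simp
  · have := hi.right X Y
    rwa [← pr1_rightMap hA] at this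

/-! ### Homotopy invertibility on `sD(C|B)` -/

lemma isHomogeneous_flatOver : IsHomogeneous 0 (flatOver A D) := by
  have h : IsHomogeneous 0 (flat A) := by rw [flat_eq_flatS]; exact isHomogeneous_flatS
  exact h.comp isCocatHom_subInclT.homogeneous (add_zero 0)

lemma flatOver_sgn (x : T (plusOver A D) X Y) :
    flatOver A D X Y (sgn (plusOver A D) p X Y x) = sgn A p X Y (flatOver A D X Y x) := by
  rw [isHomogeneous_flatOver.sgn]; simp

lemma flatOver_mulL (x : T (plusOver A D) X Y) (y : T (plusOver A D) Y Z) :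
    flatOver A D X Z (x ⋆ y) = flatOver A D X Y x ⋆ flatOver A D Y Z y := by
  induction x using T.induction with
  | h0 => simp
  | hadd x y hx hy => simp only [map_add, LinearMap.add_apply, hx, hy]
  | hsmul c x hx => simp only [map_smul, LinearMap.smul_apply, hx]
  | hone X => rw [flatOver_one, one_mulL, one_mulL]
  | hcns a x ih =>
    rw [cns_mulL]
    have h : ∀ {V} (y : T (plusOver A D) _ V), flatOver A D _ V (cns a y) =
        plusIncl A _ _ _ (subIncl A D _ _ _ a) ⋆ flatOver A D _ V y := fun y => by
      rw [flatOver, LinearMap.comp_apply, subInclT_cns, flat_cns]; rfl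
    rw [h, h, ih, mulL_assoc]

section
variable (hA : IsAInfCategory A b) (hi : IsUnitTransformation b i)
include hA

lemma overIn_diff (u : Tot (plusOver A D) X Y) :
    overIn A D X Y (diff (DDiff D b) X Y u) = b X Y (overIn A D X Y u) := by
  rw [← flatOver_in1, ← (hA.onD D).apply_in1, flatOver_DDiff hA.coderivation, flatOver_in1]

lemma isHomogeneousTot_diff : IsHomogeneousTot 1 (diff b X Y) :=
  isHomogeneousTot_comps hA.coderivation.homogeneous

include hi

lemma IsUnitTransformation.natural_onD : IsNatural (DDiff D b) (DDiff D b) (idT (plusOver A D))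
    (idT (plusOver A D)) (DTransf D D (-1) (idT A) i (idT A)) :=
  (hA.onD_idempotent hi.natural hi.idempotent).1

lemma flatOver_unitElt (X : S) :
    flatOver A D X X (in1 _ X X (unitElt (DTransf D D (-1) (idT A) i (idT A)) X)) =
      in1 A X X (unitElt i X) := by
  rw [(hi.natural_onD hA).in1_unitElt, hi.natural.in1_unitElt]
  have := hi.natural.coderivation.flatOver_DTransf (D := D) (E := D) (f := fun X => X)
    (g := fun X => X) (fun _ h => h) (fun _ h => h) isCocatHom_idT isCocatHom_idT
    (one (plusOver A D) X)
  rw [flatOver_one] at this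
  exact this

/-- Multiplication of all factors carries the unit element of `D(C|B)` to that of `C` and commutes
with products, signs and codifferentials. So the unit map becomes the commutator of `b` with
multiplication by `i₀`. -/
lemma overIn_leftUnit (u : Tot (plusOver A D) X Y) :
    overIn A D X Y (leftUnit (DDiff D b) (DTransf D D (-1) (idT A) i (idT A)) X Y u) =
      leftMap b i X Y (overIn A D X Y u) := by
  rw [← pr1_leftMap (hA.onD D), LinearMap.comp_apply, LinearMap.comp_apply, ← flatOver_in1,
    ← flatOver_in1, ← (isCoderivation_leftMap (hA.onD D) (hi.natural_onD hA)).apply_in1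
      (isCocatHom_etaEps _) isCocatHom_idT (leftMap_one (hA.onD D) (hi.natural_onD hA)),
    leftMap_apply, leftMap_apply, map_add, flatOver_DDiff hA.coderivation, flatOver_mulL,
    flatOver_mulL, flatOver_sgn, flatOver_sgn, flatOver_DDiff hA.coderivation,
    flatOver_unitElt hA hi]

lemma overIn_rightUnit (u : Tot (plusOver A D) X Y) :
    overIn A D X Y (rightUnit (DDiff D b) (DTransf D D (-1) (idT A) i (idT A)) X Y u) =
      rightMap b i X Y (overIn A D X Y u) := by
  rw [← pr1_rightMap (hA.onD D), LinearMap.comp_apply, LinearMap.comp_apply, ← flatOver_in1,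
    ← flatOver_in1, ← (isCoderivation_rightMap (hA.onD D) (hi.natural_onD hA)).apply_in1
      isCocatHom_idT (isCocatHom_etaEps _) (rightMap_one (hA.onD D) (hi.natural_onD hA)),
    rightMap_apply, rightMap_apply, map_add, flatOver_DDiff hA.coderivation, flatOver_mulL,
    flatOver_mulL, flatOver_DDiff hA.coderivation, flatOver_unitElt hA hi]

/-- The commutator with multiplication by `i₀` has first component homotopic to `∓1`. On all of
`sD(C|B)` it is then homotopic to an automorphism, hence homotopy invertible. -/
theorem IsUnitTransformation.onD (D : Set S) :
    IsUnitTransformation (DDiff D b) (DTransf D D (-1) (idT A) i (idT A)) where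
  natural := hi.natural_onD hA
  idempotent := (hA.onD_idempotent hi.natural hi.idempotent).2
  left X Y := by
    obtain ⟨η, hη, e⟩ := hi.exists_homotopy_left hA
    obtain ⟨υ, ω, χ, h1, h2, h3, h4, h5, h6⟩ := isOneSided_left.exists_automorphism hA
      (isCoderivation_leftMap hA hi.natural) (fun X Y x => B1_neg_one_comm hA x)
      (leftMap_one hA hi.natural) (by norm_num) hη e
      (overIn_diff hA (D := D) (X := X) (Y := Y)) (overIn_leftUnit hA hi)
    exact isHomotopyInvertible_of_homotopic (isHomogeneousTot_diff (hA.onD D))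
      (fun u => overIn_injective (by
        rw [overIn_diff hA, overIn_diff hA, hA.sq_apply, map_zero])) h1 h2 h3 h4 h5 h6
  right X Y := by
    obtain ⟨η, hη, e⟩ := hi.exists_homotopy_right hA
    obtain ⟨υ, ω, χ, h1, h2, h3, h4, h5, h6⟩ := isOneSided_right.exists_automorphism hA
      (isCoderivation_rightMap hA hi.natural) (fun X Y x => B1_neg_one_comm hA x)
      (rightMap_one hA hi.natural) (by norm_num) hη e
      (overIn_diff hA (D := D) (X := X) (Y := Y)) (overIn_rightUnit hA hi)
    exact isHomotopyInvertible_of_homotopic (isHomogeneousTot_diff (hA.onD D))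
      (fun u => overIn_injective (by
        rw [overIn_diff hA, overIn_diff hA, hA.sq_apply, map_zero])) h1 h2 h3 h4 h5 h6

/-- The complex `T⁺sC(X,Y)` is contractible. -/
theorem IsUnitTransformation.isHomotopyInvertible_zero
    {δ : Tot (plus A) X Y →ₗ[k] Tot (plus A) X Y}
    (hδ : ∀ u, overIn A Set.univ X Y (δ u) = b X Y (overIn A Set.univ X Y u)) :
    IsHomotopyInvertible δ 0 := by
  obtain ⟨η, hη, e⟩ := hi.exists_homotopy_right hA
  have hL := isCoderivation_mulRight hi.natural.in1_unitElt_mem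
  -- Right multiplication by `i₀` preserves `T⁺`, so there `rightMap` is null-homotopic. On a
  -- general `sD(C|B)` this would fail, as the product acquires `Y` as an inner object.
  let κ : Tot (plus A) X Y →ₗ[k] Tot (plus A) X Y :=
    plusProj A X Y ∘ₗ mulRight (unitElt i) X Y ∘ₗ overIn A Set.univ X Y
  have hκ : ∀ u, overIn A Set.univ X Y (κ u) =
      mulRight (unitElt i) X Y (overIn A Set.univ X Y u) := fun u => by
    change overIn A Set.univ X Y (plusProj A X Y _) = _
    rw [overIn_plusProj]
    exact (congrArg (_ - ·) (hL.e0_apply isCocatHom_idT (isCocatHom_etaEps _) _)).trans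
      (sub_zero _)
  obtain ⟨υ, ω, χ, h1, h2, h3, h4, h5, h6⟩ := isOneSided_right.exists_automorphism hA
    (isCoderivation_rightMap hA hi.natural) (fun X Y x => B1_neg_one_comm hA x)
    (rightMap_one hA hi.natural) (by norm_num) hη e hδ (φ := δ ∘ₗ κ + κ ∘ₗ δ) fun u => by
      have e1 : overIn A Set.univ X Y ((δ ∘ₗ κ) u) =
          b X Y (mulRight (unitElt i) X Y (overIn A Set.univ X Y u)) :=
        (hδ _).trans (congrArg _ (hκ u))
      have e2 : overIn A Set.univ X Y ((κ ∘ₗ δ) u) =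
          mulRight (unitElt i) X Y (b X Y (overIn A Set.univ X Y u)) :=
        (hκ _).trans (congrArg _ (hδ u))
      rw [LinearMap.add_apply, map_add, e1, e2]
      exact (B1_neg_one_apply _).symm
  exact isHomotopyInvertible_zero_of_homotopic h1 h2 h3 h4 h5 h6
    (isHomogeneousTot_of_overIn hL.homogeneous hκ) rfl

end

end

/-! ### Units of `underline C`, and unital functors. -/

section
variable {A : GradedQuiver k S} {A' : GradedQuiver k S'} {D : Set S}
  {X Y Z W : S} {d p q : ℤ} {f : S → S'} {F : TMap A A' f f}
  {b i : TMap A A (fun X => X) (fun X => X)} {b' : TMap A' A' (fun X => X) (fun X => X)}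

local infixl:70 " ⋆ " => mulL _ _ _ _

/-! ### The unit transformation of `underline C` -/

lemma low_eq_zero {y : T (plus A) X Y} (h0 : e0 _ X Y y = 0) (h1 : pr1 _ X Y y = 0) :
    low A X Y y = 0 := by
  rw [low_apply, ← etaEps_e0, h0, h1, map_zero, map_zero, add_zero]

lemma pr1_underDiff (hA : IsAInfCategory A b) (y : T (plus A) X Y) :
    pr1 _ X Y (underDiff b X Y y) = plusProj A X Y (b X Y (low A X Y y)) := by
  rw [← plusProj_low, low_underDiff hA.coderivation]

lemma overIn_diff_underDiff (hA : IsAInfCategory A b) (u : Tot (plus A) X Y) :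
    overIn A Set.univ X Y (diff (underDiff b) X Y u) = b X Y (overIn A Set.univ X Y u) := by
  have h : ∀ v : Tot (plus A) X Y, low A X Y (in1 _ X Y v) = overIn A Set.univ X Y v := fun v => by
    rw [low_apply, ← etaEps_e0, e0_in1, map_zero, zero_add, pr1_in1]
  rw [← h, ← hA.under.apply_in1, low_underDiff hA.coderivation, h]

lemma coderivation_zero {F G : TMap A A (fun X => X) (fun X => X)} (hF : IsCocatHom F)
    (hG : IsCocatHom G) : coderivation p F (fun _ _ => 0) G = 0 := by
  have h : IsHomogeneous p (inc (A := A) (B := A) (f := fun X => X) (g := fun X => X)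
      fun _ _ => 0) := fun X Y w x w' _ => by
    rw [inc, LinearMap.comp_zero]; rfl
  refine (isCoderivation_coderivation hF hG h).eq_zero hF hG fun X Y x => ?_
  rw [pr1_coderivation hF hG]
  rfl

/-- The underlined codifferential has only a first component, while `theta` has no part in `T⁰` or
`T¹`. -/
lemma B2_underDiff (hA : IsAInfCategory A b) {R P : TMap (plus A) (plus A) (fun X => X) (fun X => X)}
    (hR : IsCoderivation (-1) (idT _) (idT _) R) (hP : IsCoderivation (-1) (idT _) (idT _) P) :
    B2 (underDiff b) (-1) (-1) (idT (plus A)) R (idT (plus A)) P (idT (plus A)) = 0 := by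
  have h := isDoubleCoderivation_theta isCocatHom_idT isCocatHom_idT isCocatHom_idT hR hP
  have : (fun X Y => pr1 (plus A) X Y ∘ₗ underDiff b X Y ∘ₗ
      theta (-1) (-1) (idT (plus A)) R (idT (plus A)) P (idT (plus A)) X Y) = fun _ _ => 0 := by
    refine funext fun X => funext fun Y => LinearMap.ext fun x => ?_
    rw [LinearMap.comp_apply, LinearMap.comp_apply, pr1_underDiff hA,
      low_eq_zero (h.e0_apply isCocatHom_idT isCocatHom_idT isCocatHom_idT hR hP x)
        (pr1_theta (h := fun X => X) isCocatHom_idT x), map_zero, map_zero]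
    rfl
  rw [B2, this]
  exact coderivation_zero isCocatHom_idT isCocatHom_idT

lemma leftUnit_underDiff (hA : IsAInfCategory A b)
    (j : TMap (plus A) (plus A) (fun X => X) (fun X => X)) :
    leftUnit (underDiff b) j X Y = 0 := by
  refine LinearMap.ext fun v => ?_
  refine (pr1_underDiff hA (in1 _ X X (pr1 _ X X (j X X (one _ X))) ⋆
    in1 _ X Y (sgnTot _ (-1) X Y v))).trans ?_
  rw [low_eq_zero (by rw [e0_mulL, e0_in1, map_zero, LinearMap.zero_apply]) (pr1_in1_mulL_in1 _ _),
    map_zero, map_zero]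
  rfl

lemma rightUnit_underDiff (hA : IsAInfCategory A b)
    (j : TMap (plus A) (plus A) (fun X => X) (fun X => X)) :
    rightUnit (underDiff b) j X Y = 0 := by
  refine LinearMap.ext fun v => ?_
  refine (pr1_underDiff hA (in1 _ X Y v ⋆ in1 _ Y Y (pr1 _ Y Y (j Y Y (one _ Y))))).trans ?_
  rw [low_eq_zero (by rw [e0_mulL, e0_in1, map_zero, LinearMap.zero_apply]) (pr1_in1_mulL_in1 _ _),
    map_zero, map_zero]
  rfl

/-- The unit maps are zero, so their homotopy invertibility is contractibility of `T⁺sC(X,Y)`. The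
product in the idempotency condition is zero too, so `underline i` must be equivalent to `0`; this
follows from `i` being the commutator of some `Θ` with `b`. -/
theorem IsUnitTransformation.under (hA : IsAInfCategory A b) (hi : IsUnitTransformation b i) :
    IsUnitTransformation (underDiff b) (underTransf (-1) (idT A) i (idT A)) := by
  have hid : IsAInfFunctor b b (idT A) := isAInfFunctor_idT
  have hn := hi.natural.under hA hA hid hid
  rw [underFunctor_idT] at hn
  refine ⟨hn, ?_, fun X Y => ?_, fun X Y => ?_⟩
  · obtain ⟨Θ, hΘ, e⟩ := (hA.equivalent_B2_iff hi.natural).1 hi.idempotent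
    have hΘh : IsHomogeneous (-2) Θ := hΘ.homogeneous
    -- `Θ` itself is only a double coderivation, but its restriction to `T⁺` and its values on units
    -- are legitimate components of an ordinary coderivation.
    have hV : IsCoderivation (-2) (underFunctor (idT A)) (underFunctor (idT A))
        (underTransf (-2) (idT A) Θ (idT A)) :=
      isCoderivation_underTransf isCocatHom_idT isCocatHom_idT hΘh
    rw [underFunctor_idT] at hV
    have hlow := fun X Y x => low_underTransf (X := X) (Y := Y) (p := -2) isCocatHom_idT
      isCocatHom_idT hΘh (fun X Y x => hΘ.e0_apply isCocatHom_idT isCocatHom_idT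
        isCocatHom_idT hi.natural.coderivation hi.natural.coderivation x) x
    have hB := hA.under.coderivation
    have hBV : B1 (underDiff b) (underDiff b) (-2) (underTransf (-2) (idT A) Θ (idT A)) =
        underTransf (-1) (idT A) i (idT A) := by
      refine IsCoderivation.ext_low isCocatHom_idT isCocatHom_idT
        (hB.B1 hB (fun _ _ _ => rfl) (fun _ _ _ => rfl) hV isCocatHom_idT.homogeneous
          (by norm_num)) hn.coderivation fun X Y x => ?_
      rw [low_B1 hA hA hlow, e]
      exact (hi.natural.coderivation.low_underTransf isCocatHom_idT isCocatHom_idT x).symm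
    -- The difference to be written as a commutator is `0 - underline i`, hence the factor `-1`.
    refine ⟨_, hV.zsmul (-1), ?_⟩
    rw [B2_underDiff hA hn.coderivation hn.coderivation, ← hBV]
    refine funext fun X => funext fun Y => LinearMap.ext fun x => ?_
    refine Eq.trans ?_ (B1_neg_two_apply x).symm
    set V := underTransf (-2) (idT A) Θ (idT A)
    have h0 : (0 - B1 (underDiff b) (underDiff b) (-2) V) X Y x =
        -(underDiff b X Y (V X Y x) - V X Y (underDiff b X Y x)) := by
      rw [← B1_neg_two_apply, zero_sub]
      rfl
    rw [h0, LinearMap.smul_apply, LinearMap.smul_apply, map_zsmul]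
    simp only [neg_smul, one_smul]
    abel
  · rw [leftUnit_underDiff hA]
    exact hi.isHomotopyInvertible_zero hA (overIn_diff_underDiff hA)
  · rw [rightUnit_underDiff hA]
    exact hi.isHomotopyInvertible_zero hA (overIn_diff_underDiff hA)

/-! ### Unital functors -/

/-- The two composites of the functor with the units are intertwined by `low` with those for `F`, so
the equivalence witnessing unitality is transported by `Equivalent.under`. -/
theorem IsUnitalFunctor.under (h : IsUnitalFunctor b b' F) :
    IsUnitalFunctor (underDiff b) (underDiff b') (underFunctor F) := by
  obtain ⟨hA, hA', hF, i, i', hi, hi', e⟩ := h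
  refine ⟨hA.under, hA'.under, hF.under hA hA', _, _, hi.under hA, hi'.under hA', ?_⟩
  have hU := isCocatHom_underFunctor hF.cocatHom
  refine e.under hA hA' hF hF ((hi.under hA).natural.coderivation.hom_comp hU)
    ((hi'.under hA').natural.coderivation.comp_hom hU) (fun X Y x => ?_) fun X Y x => ?_
  · rw [LinearMap.comp_apply, low_underFunctor hF.cocatHom]
    exact congrArg _ (hi.natural.coderivation.low_underTransf isCocatHom_idT isCocatHom_idT x)
  · rw [LinearMap.comp_apply, LinearMap.comp_apply, ← low_underFunctor hF.cocatHom]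
    exact hi'.natural.coderivation.low_underTransf isCocatHom_idT isCocatHom_idT _

theorem IsUnitalFunctor.onD {E : Set S'} (hf : ∀ X ∈ D, f X ∈ E) (h : IsUnitalFunctor b b' F) :
    IsUnitalFunctor (DDiff D b) (DDiff E b') (DFunctor D E F) := by
  obtain ⟨hA, hA', hF, i, i', hi, hi', e⟩ := h
  refine ⟨hA.onD D, hA'.onD E, hF.onD hf hA hA', _, _, hi.onD hA D, hi'.onD hA' E, ?_⟩
  have hU := hF.cocatHom.DFunctor hf
  refine e.onD hf hf hA hA' hF hF ((hi.onD hA D).natural.coderivation.hom_comp hU)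
    ((hi'.onD hA' E).natural.coderivation.comp_hom hU) (fun X Y x => ?_) fun X Y x => ?_
  · rw [LinearMap.comp_apply, hF.cocatHom.flatOver_DFunctor hf]
    exact congrArg _ (hi.natural.coderivation.flatOver_DTransf (f := fun X => X) (g := fun X => X)
      (fun _ h => h) (fun _ h => h) isCocatHom_idT isCocatHom_idT x)
  · rw [LinearMap.comp_apply, LinearMap.comp_apply, ← hF.cocatHom.flatOver_DFunctor hf]
    exact hi'.natural.coderivation.flatOver_DTransf (f := fun X => X) (g := fun X => X)
      (fun _ h => h) (fun _ h => h) isCocatHom_idT isCocatHom_idT _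

lemma DDiff_univ : DDiff Set.univ b = overDiff b := restrict_univ _

lemma DTransf_univ : DTransf Set.univ Set.univ p (idT A) i (idT A) =
    overTransf p (idT A) i (idT A) := restrict_univ _

lemma DFunctor_univ : DFunctor Set.univ Set.univ F = overFunctor F := restrict_univ _

end

end AInf

end

/-! ### Assembly of the four statements. -/

theorem mainTheorem6 {k : Type u} [CommRing k] {S : Type u} (C : AInf.GradedQuiver k S)
    (b : AInf.TMap C C (fun X => X) (fun X => X)) (hC : AInf.IsUnital C b) :
    -- the category `D(C|B)`
    (∀ B : Set S,
      AInf.Restricts B B (AInf.overDiff b) ∧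
      AInf.IsUnital (AInf.plusOver C B) (AInf.DDiff B b) ∧
      ∀ i : AInf.TMap C C (fun X => X) (fun X => X), AInf.IsUnitTransformation b i →
        AInf.Restricts B B (AInf.overTransf (-1) (AInf.idT C) i (AInf.idT C)) ∧
        AInf.IsUnitTransformation (AInf.DDiff B b)
          (AInf.DTransf B B (-1) (AInf.idT C) i (AInf.idT C))) ∧
    -- the category `overline C`
    (AInf.IsUnital (AInf.plus C) (AInf.overDiff b) ∧
      ∀ i : AInf.TMap C C (fun X => X) (fun X => X), AInf.IsUnitTransformation b i →
        AInf.IsUnitTransformation (AInf.overDiff b)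
          (AInf.overTransf (-1) (AInf.idT C) i (AInf.idT C))) ∧
    -- the category `underline C`
    (AInf.IsUnital (AInf.plus C) (AInf.underDiff b) ∧
      ∀ i : AInf.TMap C C (fun X => X) (fun X => X), AInf.IsUnitTransformation b i →
        AInf.IsUnitTransformation (AInf.underDiff b)
          (AInf.underTransf (-1) (AInf.idT C) i (AInf.idT C))) ∧
    -- functors
    (∀ (S' : Type u) (I : AInf.GradedQuiver k S')
      (b' : AInf.TMap I I (fun X => X) (fun X => X)) (f : S → S') (F : AInf.TMap C I f f),
      AInf.IsUnitalFunctor b b' F →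
        AInf.IsUnitalFunctor (AInf.overDiff b) (AInf.overDiff b') (AInf.overFunctor F) ∧
        AInf.IsUnitalFunctor (AInf.underDiff b) (AInf.underDiff b') (AInf.underFunctor F) ∧
        ∀ (B : Set S) (J : Set S'), (∀ X ∈ B, f X ∈ J) →
          AInf.Restricts B J (AInf.overFunctor F) ∧
          AInf.IsUnitalFunctor (AInf.DDiff B b) (AInf.DDiff J b') (AInf.DFunctor B J F)) := by
  obtain ⟨hA, i₀, hi₀⟩ := hC
  refine ⟨fun B => ⟨?_, ⟨hA.onD B, _, hi₀.onD hA B⟩, fun i hi => ⟨?_, hi.onD hA B⟩⟩, ?_, ?_, ?_⟩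
  · have := AInf.restricts_overTransf (D := B) (E := B) (f := fun X => X) (g := fun X => X)
      (fun _ h => h) (fun _ h => h) AInf.isCocatHom_idT AInf.isCocatHom_idT hA.coderivation
    rwa [AInf.overDiff_eq]
  · exact AInf.restricts_overTransf (f := fun X => X) (g := fun X => X)
      (fun _ h => h) (fun _ h => h) AInf.isCocatHom_idT AInf.isCocatHom_idT hi.natural.coderivation
  -- `overline C` is `D(C|C)`, so the first part with all objects allowed applies; the same
  -- reduction serves for functors.
  · rw [← AInf.DDiff_univ]
    have h := fun i (hi : AInf.IsUnitTransformation b i) => hi.onD hA Set.univ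
    simp only [AInf.DTransf_univ] at h
    exact ⟨⟨hA.onD _, _, h i₀ hi₀⟩, h⟩
  · exact ⟨⟨hA.under, _, hi₀.under hA⟩, fun i hi => hi.under hA⟩
  · intro S' I b' f F hF
    refine ⟨?_, hF.under, fun B J hf =>
      ⟨AInf.restricts_overFunctor hf hF.2.2.1.cocatHom, hF.onD hf⟩⟩
    have := hF.onD (D := Set.univ) (E := Set.univ) fun _ _ => Set.mem_univ _
    rwa [AInf.DDiff_univ, AInf.DDiff_univ, AInf.DFunctor_univ] at this
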